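/- **Proposition (time-independent higher integrability of the density).** Let $\mu>0$, $\gamma>1$, $1\le\beta\le\gamma$, $R>0$, let $k\ge 1$ be real, and let $\Omega=B_R\subset\mathbb R^2$ be the disk of radius $R$ centred at the origin. Consider the compressible Navier–Stokes equations $$\rho_t+\operatorname{div}(\rho\mathbf u)=0,\qquad (\rho\mathbf u)_t+\operatorname{div}(\rho\mathbf u\otimes\mathbf u)+\nabla\rho^\gamma=\mu\Delta\mathbf u+\nabla\big((\mu+\rho^\beta)\operatorname{div}\mathbf u\big)\quad\text{in }\Omega\times(0,T),$$ for radially symmetric fields with swirl $\rho(x,t)=\rho(r,t)\ge0$, $\mathbf u(x,t)=u_r(r,t)\mathbf e_r+u_\theta(r,t)\mathbf e_\theta$, where $r=|x|$, $\mathbf e_r=(x_1,x_2)/r$, $\mathbf e_\theta=(x_2,-x_1)/r$, with the Dirichlet condition $u_r(0,t)=u_r(R,t)=u_\theta(0,t)=u_\theta(R,t)=0$ and initial data $\rho(r,0)=\rho_0(r)$, $u_r(r,0)=u_{r_0}(r)$, $u_\theta(r,0)=u_{\theta_0}(r)$. A radially symmetric strong solution on $\Omega\times(0,T)$ is such a pair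 $(\rho,\mathbf u)$ with $\rho\in C([0,T];W^{1,q}(\Omega))$ for some $q\in(2,\infty)$, $\mathbf u\in C([0,T];H^1(\Omega))$ (with $u_r,u_\theta$ the versions that are continuous on $[0,R]$ in $r$), weak time derivative $\mathbf u_t\in L^1_{loc}(\Omega\times(0,T))$ and $\sqrt\rho\,(\mathbf u_t+\mathbf u\cdot\nabla\mathbf u)\in L^2(\Omega\times(0,T))$, such that all derivatives in the equations are regular distributions and the equations hold almost everywhere in $\Omega\times(0,T)$. Then there is a constant $C>0$ depending only on $\mu,\beta,\gamma,k,R$ and the initial data $(\rho_0,u_{r_0},u_{\theta_0})$, but not on $T$ (nor on $q$), such that for every $T>0$ and every radially symmetric strong solution $(\rho,\mathbf u)$ on $\Omega\times(0,T)$ with these initial data, $$\sup_{0\le t\le T}\int_\Omega\rho(x,t)^{k\beta\gamma+1}\,dx\le C .$$ -/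

import Mathlib

open MeasureTheory Set Filter Topology
open scoped ContDiff

noncomputable section

namespace RadialNS

/-- The Euclidean plane. -/
abbrev Plane : Type := EuclideanSpace ℝ (Fin 2)

/-- The disk `Ω = B_R` centred at the origin. -/
def disk (R : ℝ) : Set Plane := Metric.ball 0 R

/-- The open space-time cylinder `(0,T) × Ω`; a point is a pair (time, position). -/
def cylinder (R T : ℝ) : Set (ℝ × Plane) := Ioo 0 T ×ˢ disk R

/-- The coordinate directions of the plane. -/
def dirX (i : Fin 2) : Plane := EuclideanSpace.single i 1

/-- The time direction in space-time. -/
def dirT : ℝ × Plane := (1, 0)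

/-- The coordinate directions of the plane, seen in space-time. -/
def dirTX (i : Fin 2) : ℝ × Plane := (0, dirX i)

/-- `g` is the weak (distributional) derivative of `f` in the direction `v` on the open set `U`;
both are locally integrable there, so the derivative is a regular distribution. -/
def HasWeakDeriv {X F : Type*} [NormedAddCommGroup X] [NormedSpace ℝ X] [MeasureSpace X]
    [NormedAddCommGroup F] [NormedSpace ℝ F] (U : Set X) (v : X) (f g : X → F) : Prop :=
  LocallyIntegrableOn f U ∧ LocallyIntegrableOn g U ∧
    ∀ φ : X → ℝ, ContDiff ℝ ∞ φ → HasCompactSupport φ → tsupport φ ⊆ U →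
      ∫ x in U, (fderiv ℝ φ x v) • f x = -∫ x in U, φ x • g x

/-- `f ∈ C([0,T]; W^{1,p}(Ω))`, where `Df i t` is the weak derivative `∂_i f(t)`. -/
def ContinuousInSobolev {F : Type*} [NormedAddCommGroup F] [NormedSpace ℝ F]
    (Ω : Set Plane) (p : ENNReal) (T : ℝ)
    (f : ℝ → Plane → F) (Df : Fin 2 → ℝ → Plane → F) : Prop :=
  (∀ t ∈ Icc 0 T, MemLp (f t) p (volume.restrict Ω) ∧
    ∀ i, HasWeakDeriv Ω (dirX i) (f t) (Df i t) ∧ MemLp (Df i t) p (volume.restrict Ω)) ∧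
  ∀ s ∈ Icc 0 T, Tendsto
    (fun t => eLpNorm (f t - f s) p (volume.restrict Ω)
      + ∑ i, eLpNorm (Df i t - Df i s) p (volume.restrict Ω))
    (𝓝[Icc 0 T] s) (𝓝 0)

/-- The radial unit vector `e_r = (x₁/r, x₂/r)`, `r = |x|`. -/
def eR (x : Plane) : Plane := !₂[x 0 / ‖x‖, x 1 / ‖x‖]

/-- The angular unit vector `e_θ = (x₂/r, -x₁/r)`, `r = |x|`. -/
def eTheta (x : Plane) : Plane := !₂[x 1 / ‖x‖, -(x 0 / ‖x‖)]

/-- The radially symmetric scalar field `x ↦ a(t,|x|)` with profile `a`. -/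
def scalarField (a : ℝ → ℝ → ℝ) (t : ℝ) (x : Plane) : ℝ := a t ‖x‖

/-- The radially symmetric vector field with swirl `a(t,|x|) e_r + b(t,|x|) e_θ`. -/
def vectorField (a b : ℝ → ℝ → ℝ) (t : ℝ) (x : Plane) : Plane :=
  a t ‖x‖ • eR x + b t ‖x‖ • eTheta x

/-- The continuity equation `ρ_t + div(ρ u) = 0`: all derivatives are regular distributions and
the equation holds almost everywhere in `(0,T) × Ω`. -/
def ContinuityEq (R T : ℝ) (ρ : ℝ → Plane → ℝ) (u : ℝ → Plane → Plane) : Prop :=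
  ∃ (ρt : ℝ × Plane → ℝ) (c : Fin 2 → ℝ × Plane → ℝ),
    HasWeakDeriv (cylinder R T) dirT (fun z => ρ z.1 z.2) ρt ∧
    (∀ i, HasWeakDeriv (cylinder R T) (dirTX i) (fun z => ρ z.1 z.2 * u z.1 z.2 i) (c i)) ∧
    ∀ᵐ z ∂(volume.restrict (cylinder R T)), ρt z + ∑ i, c i z = 0

/-- The momentum equation
`(ρ u)_t + div(ρ u ⊗ u) + ∇ρ^γ = μ Δu + ∇((μ + ρ^β) div u)`, component by component:
all derivatives are regular distributions and the equation holds almost everywhere in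
`(0,T) × Ω`. Here `Du i` is the (weak) derivative `∂_i u`. -/
def MomentumEq (μ β γ R T : ℝ) (ρ : ℝ → Plane → ℝ) (u : ℝ → Plane → Plane)
    (Du : Fin 2 → ℝ → Plane → Plane) : Prop :=
  ∀ j : Fin 2, ∃ (m p d : ℝ × Plane → ℝ) (n l : Fin 2 → ℝ × Plane → ℝ),
    HasWeakDeriv (cylinder R T) dirT (fun z => ρ z.1 z.2 * u z.1 z.2 j) m ∧
    (∀ i, HasWeakDeriv (cylinder R T) (dirTX i)
      (fun z => ρ z.1 z.2 * u z.1 z.2 i * u z.1 z.2 j) (n i)) ∧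
    HasWeakDeriv (cylinder R T) (dirTX j) (fun z => ρ z.1 z.2 ^ γ) p ∧
    (∀ i, HasWeakDeriv (cylinder R T) (dirTX i) (fun z => Du i z.1 z.2 j) (l i)) ∧
    HasWeakDeriv (cylinder R T) (dirTX j)
      (fun z => (μ + ρ z.1 z.2 ^ β) * ∑ i, Du i z.1 z.2 i) d ∧
    ∀ᵐ z ∂(volume.restrict (cylinder R T)),
      m z + ∑ i, n i z + p z = μ * ∑ i, l i z + d z

/-- The material derivative `u_t + (u · ∇) u`. -/
def materialDeriv (u : ℝ → Plane → Plane) (ut : ℝ → Plane → Plane)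
    (Du : Fin 2 → ℝ → Plane → Plane) (t : ℝ) (x : Plane) : Plane :=
  ut t x + ∑ i, u t x i • Du i t x

/-- The defining properties of a radially symmetric strong solution on `[0,T] × B_R`, for the
profiles `ρ, ur, uθ` (functions of `t` and `r`) and given versions `Dρ`, `Du`, `ut` of the weak
derivatives `∂_i ρ`, `∂_i u`, `∂_t u`. -/
structure IsStrongSolutionWith (μ β γ R T q : ℝ) (ρ ur uθ : ℝ → ℝ → ℝ)
    (Dρ : Fin 2 → ℝ → Plane → ℝ) (Du : Fin 2 → ℝ → Plane → Plane)
    (ut : ℝ → Plane → Plane) : Prop where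
  /-- The density is nonnegative (vacuum is allowed). -/
  density_nonneg : ∀ t ∈ Icc 0 T, ∀ᵐ r ∂(volume.restrict (Ioo 0 R)), 0 ≤ ρ t r
  /-- `ρ ∈ C([0,T]; W^{1,q}(Ω))`. -/
  density_sobolev : ContinuousInSobolev (disk R) (ENNReal.ofReal q) T (scalarField ρ) Dρ
  /-- `u ∈ C([0,T]; H¹(Ω))`. -/
  velocity_sobolev : ContinuousInSobolev (disk R) 2 T (vectorField ur uθ) Du
  /-- The velocity profiles are the versions that are continuous on `[0,R]` in `r`. -/
  profile_continuous : ∀ t ∈ Icc 0 T,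
    ContinuousOn (ur t) (Icc 0 R) ∧ ContinuousOn (uθ t) (Icc 0 R)
  /-- The boundary condition `u_r(0,t) = u_r(R,t) = u_θ(0,t) = u_θ(R,t) = 0`. -/
  boundary : ∀ t ∈ Icc 0 T, ur t 0 = 0 ∧ ur t R = 0 ∧ uθ t 0 = 0 ∧ uθ t R = 0
  /-- `Dρ` and `Du` are the spatial weak derivatives also as functions on the cylinder. -/
  density_gradient : ∀ i, HasWeakDeriv (cylinder R T) (dirTX i)
    (fun z => scalarField ρ z.1 z.2) (fun z => Dρ i z.1 z.2)
  velocity_gradient : ∀ i, HasWeakDeriv (cylinder R T) (dirTX i)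
    (fun z => vectorField ur uθ z.1 z.2) (fun z => Du i z.1 z.2)
  /-- `u_t` is a regular distribution. -/
  velocity_time : HasWeakDeriv (cylinder R T) dirT
    (fun z => vectorField ur uθ z.1 z.2) (fun z => ut z.1 z.2)
  /-- `√ρ (u_t + (u · ∇) u) ∈ L²((0,T) × Ω)`. -/
  acceleration : MemLp
    (fun z : ℝ × Plane => √(scalarField ρ z.1 z.2) •
      materialDeriv (vectorField ur uθ) ut Du z.1 z.2) 2 (volume.restrict (cylinder R T))
  continuity : ContinuityEq R T (scalarField ρ) (vectorField ur uθ)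
  momentum : MomentumEq μ β γ R T (scalarField ρ) (vectorField ur uθ) Du

/-- `(ρ, u)`, with `ρ(x,t) = ρ(|x|,t)` and `u = u_r e_r + u_θ e_θ`, is a radially symmetric strong
solution on `[0,T] × B_R` of the compressible Navier–Stokes equations with pressure `ρ^γ`, shear
viscosity `μ`, bulk viscosity coefficient `ρ^β` and Dirichlet boundary condition, with
`ρ ∈ C([0,T]; W^{1,q})`. -/
def IsStrongSolution (μ β γ R T q : ℝ) (ρ ur uθ : ℝ → ℝ → ℝ) : Prop :=
  ∃ Dρ Du ut, IsStrongSolutionWith μ β γ R T q ρ ur uθ Dρ Du ut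

/-- The solution has initial data `ρ₀`, `u₀ = u_{r0} e_r + u_{θ0} e_θ`. -/
def HasInitialData (R : ℝ) (ρ ur uθ : ℝ → ℝ → ℝ) (ρ₀ ur₀ uθ₀ : ℝ → ℝ) : Prop :=
  ∀ᵐ r ∂(volume.restrict (Ioo 0 R)), ρ 0 r = ρ₀ r ∧ ur 0 r = ur₀ r ∧ uθ 0 r = uθ₀ r

end RadialNS

end

/-! Put s = |x|². In this variable the planar measure is π ds and the flow lives on (0, S), S = R².
Let P be the density, v and w the radial and angular velocity, d and c the s-derivatives of √s v and
√s w, so that div u = 2d. Up to the factor π, the energy ½∫P(v² + w²) + (γ-1)⁻¹∫P^γ decreases at a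
rate of at least 4D, D = ∫(2μ + P^β)d² (`RadialFlow.hasDerivAt_energy`). Hence the time integral of
D is bounded by the initial energy, and an inequality Y' ≤ C D (1 + Y) bounds Y independently of T.

A suitable Y comes from the cancellation of Vaigant and Kazhikhov. Let ξ be a potential of the
radial momentum, ∂_r ξ = ρ u_r, and θ(ρ) = 2μ log ρ + ρ^β/β. Along particle paths the momentum
equation makes ξ grow by the effective viscous flux plus a nonlocal term, up to a function of time
m(t); the continuity equation makes θ decrease by the flux plus the pressure. The flux drops out of
the sum, whose material derivative is -ρ^γ + ∫_r^R ρ(u_r² - u_θ²)/r' dr' - m(t). Take Y = ∫ P (θ(P)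
+ ξ - K)₊^n (`RadialFlow.hasDerivAt_functional`). The truncation vanishes near vacuum, where θ tends
to -∞, so Y is differentiable although vacuum is allowed.

Y controls ∫P^(1+βn) because ξ is of lower order: the energy bounds ξ² by a multiple of 1 + ∫_r^R
ρ/r' dr', Hardy's inequality bounds the (n+1)-st power of the latter by that of P, and n + 1 ≤ 1 +
βn (`Slice.exists_mass_le`).

For the growth of Y (`Slice.exists_growth_le`), the nonlocal term carries a factor sup u_r² ≤ ∫d² ≤
D/(2μ). The potential is normalised by its mean over (S/2, S), away from the axis, and this gives -m
≤ C₀ + (2/S) D. Only C₀ fails to be integrable in time. Where ρ^γ ≥ C₀ the pressure absorbs it.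
Elsewhere K = θ(C₀^(1/γ)) + 1 forces ξ ≥ 1 on the support of the truncation; then powers of ξ may be
raised until two factors can be estimated by sup |u_r|, which again produces D. With the energy as
integrating factor, `RadialFlow.exists_bound` follows.

The remaining work derives the radial equations from the weak formulation
(`IsStrongSolutionWith.exists_radialFlow`): means over circles, and test fields χ(|x|²)(a x + b x^⊥)
with x^⊥ = |x| e_θ. Time derivatives are taken of P and of the momentum potentials only, as
functions with values in L²; the velocity itself is never differentiated in time. -/

noncomputable section

namespace RadialNS

section

/-! ### Absolutely continuous functions on `(0,S]` -/

lemma absolutelyContinuousOnInterval_congr {f g : ℝ → ℝ} {a b : ℝ}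
    (hf : AbsolutelyContinuousOnInterval f a b) (h : EqOn f g (uIcc a b)) :
    AbsolutelyContinuousOnInterval g a b := by
  rw [absolutelyContinuousOnInterval_iff] at hf ⊢
  intro ε hε
  obtain ⟨δ, hδ, H⟩ := hf ε hε
  refine ⟨δ, hδ, fun E hE hlt => ?_⟩
  have := H E hE hlt
  rwa [Finset.sum_congr rfl fun i hi => by
    rw [h (hE.1 i hi).1, h (hE.1 i hi).2]] at this

/-- A C¹ function is Lipschitz on the compact box that contains the values of f and g. -/
lemma absolutelyContinuousOnInterval_comp₂ {Θ : ℝ × ℝ → ℝ} (hΘ : ContDiff ℝ 1 Θ) {f g : ℝ → ℝ}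
    {a b : ℝ} (hf : AbsolutelyContinuousOnInterval f a b)
    (hg : AbsolutelyContinuousOnInterval g a b) :
    AbsolutelyContinuousOnInterval (fun x => Θ (f x, g x)) a b := by
  obtain ⟨Mf, hMf⟩ := hf.exists_bound
  obtain ⟨Mg, hMg⟩ := hg.exists_bound
  obtain ⟨K, hK⟩ := hΘ.contDiffOn.exists_lipschitzOnWith (n := 1) (by norm_num)
    ((convex_Icc (-Mf) Mf).prod (convex_Icc (-Mg) Mg)) (isCompact_Icc.prod isCompact_Icc)
  have hmem : ∀ x ∈ uIcc a b, (f x, g x) ∈ Icc (-Mf) Mf ×ˢ Icc (-Mg) Mg := fun x hx =>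
    ⟨abs_le.1 (hMf x hx), abs_le.1 (hMg x hx)⟩
  have hlim : Tendsto (fun E : ℕ × (ℕ → ℝ × ℝ) =>
      K * (∑ i ∈ Finset.range E.1, dist (f (E.2 i).1) (f (E.2 i).2)
        + ∑ i ∈ Finset.range E.1, dist (g (E.2 i).1) (g (E.2 i).2)))
      (AbsolutelyContinuousOnInterval.totalLengthFilter ⊓
        𝓟 (AbsolutelyContinuousOnInterval.disjWithin a b)) (𝓝 0) := by
    simpa using (Tendsto.add hf hg).const_mul (K : ℝ)
  refine squeeze_zero' (Eventually.of_forall fun E => by positivity) ?_ hlim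
  have hev : ∀ᶠ E in AbsolutelyContinuousOnInterval.totalLengthFilter ⊓
      𝓟 (AbsolutelyContinuousOnInterval.disjWithin a b),
      E ∈ AbsolutelyContinuousOnInterval.disjWithin a b :=
    mem_inf_of_right (mem_principal_self _)
  filter_upwards [hev] with E hE
  rw [← Finset.sum_add_distrib, Finset.mul_sum]
  refine Finset.sum_le_sum fun i hi => ?_
  refine (hK.dist_le_mul _ (hmem _ (hE.1 i hi).1) _ (hmem _ (hE.1 i hi).2)).trans ?_
  gcongr
  rw [Prod.dist_eq]
  exact max_le (le_add_of_nonneg_right dist_nonneg) (le_add_of_nonneg_left dist_nonneg)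

/-- `f` is absolutely continuous on every `[a,S]`, `a > 0`, with almost everywhere derivative `g`. -/
def PrimLoc (S : ℝ) (f g : ℝ → ℝ) : Prop :=
  (∀ a, 0 < a → a ≤ S → AbsolutelyContinuousOnInterval f a S) ∧
    ∀ᵐ x, x ∈ Ioo 0 S → HasDerivAt f (g x) x

namespace PrimLoc

variable {S : ℝ} {f g f₁ g₁ f₂ g₂ : ℝ → ℝ}

lemma congr_deriv (h : PrimLoc S f g) (h' : ∀ x ∈ Ioo 0 S, g x = g₁ x) : PrimLoc S f g₁ := by
  refine ⟨h.1, ?_⟩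
  filter_upwards [h.2] with x hx hxS
  rw [← h' x hxS]; exact hx hxS

lemma congr (h : PrimLoc S f g) (h' : EqOn f f₁ (Ioc 0 S)) : PrimLoc S f₁ g := by
  refine ⟨fun a ha haS => absolutelyContinuousOnInterval_congr (h.1 a ha haS) fun x hx => ?_, ?_⟩
  · rw [uIcc_of_le haS] at hx
    exact h' ⟨ha.trans_le hx.1, hx.2⟩
  · filter_upwards [h.2] with x hx hxS
    refine (hx hxS).congr_of_eventuallyEq ?_
    filter_upwards [Ioo_mem_nhds hxS.1 hxS.2] with y hy
    exact (h' ⟨hy.1, hy.2.le⟩).symm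

lemma comp₂ {Θ : ℝ × ℝ → ℝ} (hΘ : ContDiff ℝ 1 Θ) (h₁ : PrimLoc S f₁ g₁) (h₂ : PrimLoc S f₂ g₂) :
    PrimLoc S (fun x => Θ (f₁ x, f₂ x)) (fun x => fderiv ℝ Θ (f₁ x, f₂ x) (g₁ x, g₂ x)) := by
  refine ⟨fun a ha haS => absolutelyContinuousOnInterval_comp₂ hΘ (h₁.1 a ha haS) (h₂.1 a ha haS), ?_⟩
  filter_upwards [h₁.2, h₂.2] with x hx₁ hx₂ hxS
  exact ((hΘ.differentiable (by norm_num)) _).hasFDerivAt.comp_hasDerivAt x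
    ((hx₁ hxS).prodMk (hx₂ hxS))

lemma add (h₁ : PrimLoc S f₁ g₁) (h₂ : PrimLoc S f₂ g₂) :
    PrimLoc S (fun x => f₁ x + f₂ x) (fun x => g₁ x + g₂ x) := by
  refine ⟨fun a ha haS => (h₁.1 a ha haS).add (h₂.1 a ha haS), ?_⟩
  filter_upwards [h₁.2, h₂.2] with x hx₁ hx₂ hxS
  exact (hx₁ hxS).add (hx₂ hxS)

lemma mul (h₁ : PrimLoc S f₁ g₁) (h₂ : PrimLoc S f₂ g₂) :
    PrimLoc S (fun x => f₁ x * f₂ x) (fun x => g₁ x * f₂ x + f₁ x * g₂ x) := by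
  refine ⟨fun a ha haS => (h₁.1 a ha haS).mul (h₂.1 a ha haS), ?_⟩
  filter_upwards [h₁.2, h₂.2] with x hx₁ hx₂ hxS
  exact (hx₁ hxS).mul (hx₂ hxS)

lemma const_mul (c : ℝ) (h : PrimLoc S f g) :
    PrimLoc S (fun x => c * f x) (fun x => c * g x) := by
  refine ⟨fun a ha haS => (h.1 a ha haS).const_mul c, ?_⟩
  filter_upwards [h.2] with x hx hxS
  exact (hx hxS).const_mul c

lemma add_const (h : PrimLoc S f g) (c : ℝ) : PrimLoc S (fun x => f x + c) g := by
  refine ⟨fun a ha haS => ?_, ?_⟩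
  · have := h.1 a ha haS
    rw [absolutelyContinuousOnInterval_iff] at this ⊢
    simpa using this
  · filter_upwards [h.2] with x hx hxS
    exact (hx hxS).add_const c

lemma of_hasDerivAt (h : ∀ x, 0 < x → HasDerivAt f (g x) x) (hg : ContinuousOn g (Ioi 0)) :
    PrimLoc S f g := by
  refine ⟨fun a ha haS => ?_, Eventually.of_forall fun x hx => h x hx.1⟩
  have hsub : Icc a S ⊆ Ioi 0 := fun x hx => ha.trans_le hx.1
  obtain ⟨C, hC⟩ := isCompact_Icc.exists_bound_of_continuousOn (hg.mono hsub)
  refine LipschitzOnWith.absolutelyContinuousOnInterval (K := C.toNNReal) ?_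
  rw [uIcc_of_le haS]
  refine (convex_Icc a S).lipschitzOnWith_of_nnnorm_hasDerivWithin_le
    (fun x hx => (h x (hsub hx)).hasDerivWithinAt) fun x hx => ?_
  rw [← NNReal.coe_le_coe, coe_nnnorm]
  exact (hC x hx).trans (Real.le_coe_toNNReal C)

lemma continuousOn (h : PrimLoc S f g) : ContinuousOn f (Ioc 0 S) := by
  intro x hx
  have h1 := (h.1 (x / 2) (by linarith [hx.1]) (by linarith [hx.1, hx.2])).continuousOn
  rw [uIcc_of_le (by linarith [hx.1, hx.2])] at h1
  refine (h1 x ⟨by linarith [hx.1], hx.2⟩).mono_of_mem_nhdsWithin ?_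
  filter_upwards [self_mem_nhdsWithin,
    mem_nhdsWithin_of_mem_nhds (Ioi_mem_nhds (show x / 2 < x by linarith [hx.1]))] with y hy hy'
  exact ⟨le_of_lt hy', hy.2⟩

lemma ae_deriv_eq (h : PrimLoc S f g) {a b : ℝ} (ha : 0 < a) (hab : a ≤ b) (hb : b ≤ S) :
    ∀ᵐ x, x ∈ uIoc a b → deriv f x = g x := by
  have hne : ∀ᵐ x : ℝ, x ≠ S := by simp [ae_iff]
  filter_upwards [h.2, hne] with x hx hxS hxab
  rw [uIoc_of_le hab] at hxab
  exact (hx ⟨ha.trans hxab.1, lt_of_le_of_ne (hxab.2.trans hb) hxS⟩).deriv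

lemma ac (h : PrimLoc S f g) {a b : ℝ} (ha : 0 < a) (hab : a ≤ b) (hb : b ≤ S) :
    AbsolutelyContinuousOnInterval f a b :=
  (h.1 a ha (hab.trans hb)).mono (by
    rw [uIcc_of_le hab, uIcc_of_le (hab.trans hb)]; exact Icc_subset_Icc_right hb)

lemma intervalIntegrable (h : PrimLoc S f g) {a b : ℝ} (ha : 0 < a) (hab : a ≤ b) (hb : b ≤ S) :
    IntervalIntegrable g volume a b :=
  (h.ac ha hab hb).intervalIntegrable_deriv.congr_ae
    ((ae_restrict_iff' measurableSet_uIoc).2 (h.ae_deriv_eq ha hab hb))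

lemma integral_eq (h : PrimLoc S f g) {a b : ℝ} (ha : 0 < a) (hab : a ≤ b) (hb : b ≤ S) :
    ∫ x in a..b, g x = f b - f a := by
  rw [← (h.ac ha hab hb).integral_deriv_eq_sub]
  refine intervalIntegral.integral_congr_ae ?_
  filter_upwards [h.ae_deriv_eq ha hab hb] with x hx hxab
  exact (hx hxab).symm

/-- The singular endpoint 0 enters only through the limit l, while g is integrable up to 0. Boundary
terms at the axis r = 0 are handled in this way throughout. -/
lemma integral_eq_of_tendsto (h : PrimLoc S f g) (hS : 0 < S) (hg : IntegrableOn g (Ioo 0 S))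
    {l : ℝ} (hl : Tendsto f (𝓝[>] 0) (𝓝 l)) : ∫ x in Ioo 0 S, g x = f S - l := by
  have hi : IntervalIntegrable g volume 0 S := by
    rw [intervalIntegrable_iff_integrableOn_Ioo_of_le hS.le]; exact hg
  have h1 : Tendsto (fun a => ∫ x in a..S, g x) (𝓝[>] 0) (𝓝 (∫ x in 0..S, g x)) := by
    have hc := intervalIntegral.continuousOn_primitive_interval_left
      (f := g) (μ := volume) (a := 0) (b := S) (by
        rw [uIcc_of_le hS.le, integrableOn_Icc_iff_integrableOn_Ioo]; exact hg)
    rw [uIcc_of_le hS.le] at hc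
    refine (hc 0 ⟨le_rfl, hS.le⟩).mono_left ?_
    refine nhdsWithin_le_of_mem ?_
    filter_upwards [Ioo_mem_nhdsGT hS] with y hy
    exact ⟨hy.1.le, hy.2.le⟩
  have h2 : Tendsto (fun a => ∫ x in a..S, g x) (𝓝[>] 0) (𝓝 (f S - l)) := by
    refine (tendsto_const_nhds.sub hl).congr' ?_
    filter_upwards [Ioo_mem_nhdsGT hS] with y hy
    exact (h.integral_eq hy.1 hy.2.le le_rfl).symm
  rw [← integral_Ioc_eq_integral_Ioo, ← intervalIntegral.integral_of_le hS.le]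
  exact tendsto_nhds_unique h1 h2

lemma of_integral (hg : ∀ a, 0 < a → a ≤ S → IntervalIntegrable g volume a S)
    (h : ∀ a, 0 < a → a ≤ S → f a = f S - ∫ x in a..S, g x) : PrimLoc S f g := by
  have hac : ∀ a, 0 < a → a ≤ S → AbsolutelyContinuousOnInterval f a S := fun a ha haS => by
    have h1 := (hg a ha haS).absolutelyContinuousOnInterval_intervalIntegral (c := S)
      (right_mem_uIcc)
    rw [absolutelyContinuousOnInterval_iff] at h1
    refine absolutelyContinuousOnInterval_congr (f := fun x => (∫ y in S..x, g y) + f S) ?_ ?_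
    · rw [absolutelyContinuousOnInterval_iff]; simpa using h1
    · intro x hx
      rw [uIcc_of_le haS] at hx
      simp only
      rw [h x (ha.trans_le hx.1) hx.2, intervalIntegral.integral_symm]; ring
  refine ⟨hac, ?_⟩
  rcases le_or_gt S 0 with hS | hS
  · exact Eventually.of_forall fun x hx => absurd (hx.1.trans hx.2) (not_lt.2 hS)
  -- Lebesgue differentiation on each interval away from 0; countably many of them exhaust (0, S).
  have key : ∀ n : ℕ, ∀ᵐ x, x ∈ Ioo (S / (n + 2)) S → HasDerivAt f (g x) x := fun n => by
    have hpos : 0 < S / (n + 2 : ℝ) := by positivity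
    have hle : S / (n + 2 : ℝ) ≤ S := div_le_self hS.le (by linarith [n.cast_nonneg (α := ℝ)])
    filter_upwards [(hg _ hpos hle).ae_hasDerivAt_integral] with x hx hxS
    have h1 := hx (by rw [uIcc_of_le hle]; exact ⟨hxS.1.le, hxS.2.le⟩) S right_mem_uIcc
    refine (h1.add_const (f S)).congr_of_eventuallyEq ?_
    filter_upwards [Ioo_mem_nhds hxS.1 hxS.2] with y hy
    rw [h y (hpos.trans hy.1) hy.2.le, intervalIntegral.integral_symm y S]; ring
  filter_upwards [ae_all_iff.2 key] with x hx hxS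
  obtain ⟨n, hn⟩ := exists_nat_gt (S / x)
  refine hx n ⟨?_, hxS.2⟩
  rw [div_lt_iff₀ (by positivity)]
  rw [div_lt_iff₀ hxS.1] at hn
  nlinarith [hxS.1]

end PrimLoc

/-! ### The lemma of du Bois-Reymond -/

/-- The test functions on an open interval. -/
def IsTest (a b : ℝ) (χ : ℝ → ℝ) : Prop :=
  ContDiff ℝ ∞ χ ∧ HasCompactSupport χ ∧ tsupport χ ⊆ Ioo a b

lemma IsTest.deriv {a b : ℝ} {χ : ℝ → ℝ} (h : IsTest a b χ) : IsTest a b (deriv χ) := by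
  have h1 : ContDiff ℝ (∞ + 1) χ := by simpa using h.1
  exact ⟨(contDiff_succ_iff_deriv.1 h1).2.2, h.2.1.deriv, (tsupport_deriv_subset).trans h.2.2⟩

lemma IsTest.eq_zero {a b : ℝ} {χ : ℝ → ℝ} (h : IsTest a b χ) {x : ℝ} (hx : x ∉ Ioo a b) :
    χ x = 0 := image_eq_zero_of_notMem_tsupport fun h' => hx (h.2.2 h')

lemma IsTest.hasDerivAt {a b : ℝ} {χ : ℝ → ℝ} (h : IsTest a b χ) (x : ℝ) :
    HasDerivAt χ (_root_.deriv χ x) x :=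
  ((h.1.differentiable (by norm_num)) x).hasDerivAt

lemma IsTest.exists_bound {a b : ℝ} {χ : ℝ → ℝ} (h : IsTest a b χ) : ∃ M, ∀ x, |χ x| ≤ M :=
  h.2.1.exists_bound_of_continuous h.1.continuous

lemma IsTest.exists_Icc {a b : ℝ} {χ : ℝ → ℝ} (h : IsTest a b χ) (hab : a < b) :
    ∃ a' b', a < a' ∧ a' < b' ∧ b' < b ∧ ∀ x, x ∉ Icc a' b' → χ x = 0 := by
  -- If χ vanishes identically its support has no endpoints, and any nondegenerate subinterval
  -- serves.
  rcases (tsupport χ).eq_empty_or_nonempty with he | hne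
  · refine ⟨(2 * a + b) / 3, (a + 2 * b) / 3, by linarith, by linarith, by linarith, fun x _ => ?_⟩
    exact image_eq_zero_of_notMem_tsupport (by simp [he])
  · obtain ⟨x₁, hx₁, h₁⟩ := h.2.1.isCompact.exists_isLeast hne
    obtain ⟨x₂, hx₂, h₂⟩ := h.2.1.isCompact.exists_isGreatest hne
    refine ⟨(a + x₁) / 2, (b + x₂) / 2, by linarith [(h.2.2 hx₁).1], ?_, by linarith [(h.2.2 hx₂).2],
      fun x hx => image_eq_zero_of_notMem_tsupport fun hx' => hx ?_⟩
    · linarith [(h.2.2 hx₁).1, (h.2.2 hx₂).2, h₁ hx₂]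
    · have := h₁ hx'; have := h₂ hx'
      exact ⟨by linarith [(h.2.2 hx₁).1], by linarith [(h.2.2 hx₂).2]⟩

lemma exists_isTest_integral_one {a b : ℝ} (hab : a < b) :
    ∃ χ, IsTest a b χ ∧ ∫ x in Ioo a b, χ x = 1 := by
  obtain ⟨f, hf⟩ : ∃ f : ContDiffBump ((a + b) / 2), f.rOut = (b - a) / 4 :=
    ⟨⟨(b - a) / 8, (b - a) / 4, by linarith, by linarith⟩, rfl⟩
  have ht : tsupport f ⊆ Ioo a b := by
    rw [f.tsupport_eq, hf, Real.closedBall_eq_Icc]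
    exact fun x hx => ⟨by linarith [hx.1], by linarith [hx.2]⟩
  have hn : tsupport (f.normed volume) ⊆ Ioo a b := by
    rw [f.tsupport_normed_eq, ← f.tsupport_eq]; exact ht
  refine ⟨f.normed volume, ⟨f.contDiff_normed, f.hasCompactSupport_normed, hn⟩, ?_⟩
  rw [setIntegral_eq_integral_of_forall_compl_eq_zero, f.integral_normed]
  exact fun x hx => image_eq_zero_of_notMem_tsupport fun h' => hx (hn h')

/-- The vanishing mean is what makes the primitive zero to the right of the support, hence again a
test function. -/
lemma IsTest.primitive {a b : ℝ} {χ : ℝ → ℝ} (h : IsTest a b χ) (hab : a < b)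
    (h0 : ∫ x in Ioo a b, χ x = 0) :
    IsTest a b (fun x => ∫ y in a..x, χ y) ∧
      ∀ x, _root_.deriv (fun x => ∫ y in a..x, χ y) x = χ x := by
  have hd : ∀ x, HasDerivAt (fun x => ∫ y in a..x, χ y) (χ x) x := fun x =>
    intervalIntegral.integral_hasDerivAt_right (h.1.continuous.intervalIntegrable _ _)
      h.1.continuous.aestronglyMeasurable.stronglyMeasurableAtFilter h.1.continuous.continuousAt
  obtain ⟨a', b', ha, hab', hb, hz⟩ := h.exists_Icc hab
  have hsupp : Function.support (fun x => ∫ y in a..x, χ y) ⊆ Icc a' b' := by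
    intro x hx
    by_contra hx'
    apply hx
    simp only [mem_Icc, not_and_or, not_le] at hx'
    rcases hx' with hx' | hx'
    · have : ∫ y in a..x, χ y = ∫ y in a..x, (0 : ℝ) :=
        intervalIntegral.integral_congr fun y hy => hz y fun hy' => by
          have := hy.2
          have : y ≤ max a x := this
          rcases le_max_iff.1 this with h | h <;> linarith [hy'.1]
      simpa using this
    · have hxa : a ≤ x := by linarith
      have h1 : ∫ y in a..b, χ y = 0 := by
        rw [intervalIntegral.integral_of_le hab.le, integral_Ioc_eq_integral_Ioo, h0]
      have h2 : ∫ y in x..b, χ y = ∫ y in x..b, (0 : ℝ) :=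
        intervalIntegral.integral_congr fun y hy => hz y fun hy' => by
          have : min x b ≤ y := hy.1
          rcases min_le_iff.1 this with h | h <;> linarith [hy'.2]
      have h3 := intervalIntegral.integral_add_adjacent_intervals
        (h.1.continuous.intervalIntegrable (μ := volume) a x)
        (h.1.continuous.intervalIntegrable (μ := volume) x b)
      rw [h1, h2] at h3
      simpa using h3
  have hts : tsupport (fun x => ∫ y in a..x, χ y) ⊆ Icc a' b' :=
    closure_minimal hsupp isClosed_Icc
  refine ⟨⟨?_, ?_, hts.trans fun x hx => ⟨ha.trans_le hx.1, hx.2.trans_lt hb⟩⟩,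
    fun x => (hd x).deriv⟩
  · have : ContDiff ℝ (∞ + 1) (fun x => ∫ y in a..x, χ y) := by
      refine contDiff_succ_iff_deriv.2 ⟨fun x => (hd x).differentiableAt, by simp, ?_⟩
      rw [show _root_.deriv (fun x => ∫ y in a..x, χ y) = χ from funext fun x => (hd x).deriv]
      exact h.1
    simpa using this
  · exact isCompact_Icc.of_isClosed_subset (isClosed_tsupport _) hts

lemma IsTest.integrableOn_mul {a b : ℝ} {χ g : ℝ → ℝ} (h : IsTest a b χ)
    (hg : IntegrableOn g (Ioo a b)) : IntegrableOn (fun x => g x * χ x) (Ioo a b) := by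
  obtain ⟨M, hM⟩ := h.exists_bound
  exact Integrable.mul_bdd hg h.1.continuous.aestronglyMeasurable (Eventually.of_forall hM)

/-- The lemma of du Bois-Reymond. -/
theorem ae_eq_const_of_integral_deriv_eq_zero {a b : ℝ} (hab : a < b) {g : ℝ → ℝ}
    (hg : IntegrableOn g (Ioo a b))
    (h : ∀ ζ, IsTest a b ζ → ∫ x in Ioo a b, g x * deriv ζ x = 0) :
    ∃ c, ∀ᵐ x, x ∈ Ioo a b → g x = c := by
  obtain ⟨χ₀, h₀, h₁⟩ := exists_isTest_integral_one hab
  set c := ∫ x in Ioo a b, g x * χ₀ x with hc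
  refine ⟨c, ?_⟩
  have hgc : IntegrableOn (fun x => g x - c) (Ioo a b) := hg.sub (integrable_const c)
  have := isOpen_Ioo.ae_eq_zero_of_integral_contDiff_smul_eq_zero (μ := volume)
    (hgc.locallyIntegrableOn) ?_
  · filter_upwards [this] with x hx hxab
    linarith [hx hxab]
  intro χ hχ hχc hχs
  have hT : IsTest a b χ := ⟨hχ, hχc, hχs⟩
  have hχi : IntegrableOn χ (Ioo a b) := (hχ.continuous.integrable_of_hasCompactSupport hχc).integrableOn
  have hχ₀i : IntegrableOn χ₀ (Ioo a b) :=
    (h₀.1.continuous.integrable_of_hasCompactSupport h₀.2.1).integrableOn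
  set m := ∫ x in Ioo a b, χ x with hm
  -- Subtracting m χ₀ makes the mean zero, so the difference is the derivative of a test function.
  -- Therefore g - c is orthogonal to χ itself.
  have hT' : IsTest a b (fun x => χ x - m * χ₀ x) := by
    refine ⟨hχ.sub (contDiff_const.mul h₀.1), hχc.sub (h₀.2.1.mul_left), ?_⟩
    refine (tsupport_sub _ _).trans (union_subset hχs ?_)
    exact (tsupport_mul_subset_right).trans h₀.2.2
  have hp := hT'.primitive hab (by
    rw [integral_sub hχi (hχ₀i.const_mul m), integral_const_mul, h₁, ← hm]; ring)
  have hz := h _ hp.1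
  simp only [hp.2] at hz
  have e1 : ∫ x in Ioo a b, g x * (χ x - m * χ₀ x)
      = (∫ x in Ioo a b, g x * χ x) - m * c := by
    have : ∀ x, g x * (χ x - m * χ₀ x) = g x * χ x - m * (g x * χ₀ x) := fun x => by ring
    simp only [this]
    rw [integral_sub (hT.integrableOn_mul hg) ((h₀.integrableOn_mul hg).const_mul m),
      integral_const_mul]
  have e2 : ∫ x, χ x • (g x - c) = ∫ x in Ioo a b, (g x * χ x - c * χ x) := by
    rw [← setIntegral_eq_integral_of_forall_compl_eq_zero (s := Ioo a b)]
    · refine integral_congr_ae (Eventually.of_forall fun x => ?_)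
      simp only [smul_eq_mul]; ring
    · intro x hx
      simp [hT.eq_zero hx]
  rw [e2, integral_sub (hT.integrableOn_mul hg) (hχi.const_mul c), integral_const_mul, ← hm]
  linarith

/-- If `f' = g` in the sense of distributions on `(a,b)`, then `f` is a primitive of `g`. -/
theorem ae_eq_const_add_integral {a b : ℝ} (hab : a < b) {f g : ℝ → ℝ}
    (hf : IntegrableOn f (Ioo a b)) (hg : IntegrableOn g (Ioo a b))
    (h : ∀ ζ, IsTest a b ζ → ∫ x in Ioo a b, f x * deriv ζ x = -∫ x in Ioo a b, g x * ζ x) :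
    ∃ c, ∀ᵐ x, x ∈ Ioo a b → f x = c + ∫ y in a..x, g y := by
  have hgi : IntervalIntegrable g volume a b := by
    rw [intervalIntegrable_iff_integrableOn_Ioo_of_le hab.le]; exact hg
  have hac := hgi.absolutelyContinuousOnInterval_intervalIntegral (c := a) left_mem_uIcc
  have hpi : IntegrableOn (fun x => ∫ y in a..x, g y) (Ioo a b) := by
    have := hac.continuousOn
    rw [uIcc_of_le hab.le] at this
    exact (this.integrableOn_Icc).mono_set Ioo_subset_Icc_self
  -- The difference of f and the absolutely continuous primitive of g has zero weak derivative.
  obtain ⟨c, hc⟩ := ae_eq_const_of_integral_deriv_eq_zero hab (hf.sub hpi) fun ζ hζ => by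
    have hζac : AbsolutelyContinuousOnInterval ζ a b :=
      (hζ.1.of_le (by norm_cast)).contDiffOn.absolutelyContinuousOnInterval
    have h1 := hac.integral_mul_deriv_eq_deriv_mul hζac
    rw [hζ.eq_zero (x := a) (by simp), hζ.eq_zero (x := b) (by simp)] at h1
    have h2 : ∫ x in a..b, deriv (fun x => ∫ y in a..x, g y) x * ζ x = ∫ x in a..b, g x * ζ x := by
      refine intervalIntegral.integral_congr_ae ?_
      filter_upwards [hgi.ae_hasDerivAt_integral] with x hx hxab
      rw [(hx (uIoc_subset_uIcc hxab) a left_mem_uIcc).deriv]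
    simp only [h2, intervalIntegral.integral_of_le hab.le, integral_Ioc_eq_integral_Ioo,
      mul_zero, sub_zero] at h1
    have h3 := h ζ hζ
    simp only [Pi.sub_apply, sub_mul]
    rw [integral_sub (hζ.deriv.integrableOn_mul hf) (hζ.deriv.integrableOn_mul hpi), h1, h3]
    ring
  exact ⟨c, by filter_upwards [hc] with x hx hxab; have := hx hxab; simp only [Pi.sub_apply] at this; linarith⟩

end

section

/-! ### Functions as elements of `L²` -/

/-- The class of `f` in `L²(μ)`; zero if `f` is not square integrable. -/
def toL2 {α : Type*} [MeasurableSpace α] (μ : Measure α) (f : α → ℝ) : Lp ℝ 2 μ :=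
  open Classical in if h : MemLp f 2 μ then h.toLp f else 0

section toL2

variable {α : Type*} [MeasurableSpace α] {μ : Measure α} {f g : α → ℝ}

lemma toL2_coe (h : MemLp f 2 μ) : toL2 μ f =ᵐ[μ] f := by
  rw [toL2, dif_pos h]; exact h.coeFn_toLp

lemma toL2_congr (h : MemLp f 2 μ) (hfg : f =ᵐ[μ] g) : toL2 μ f = toL2 μ g := by
  have hg := (memLp_congr_ae hfg).1 h
  exact Lp.ext ((toL2_coe h).trans (hfg.trans (toL2_coe hg).symm))

lemma toL2_add (hf : MemLp f 2 μ) (hg : MemLp g 2 μ) :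
    toL2 μ (fun x => f x + g x) = toL2 μ f + toL2 μ g := by
  refine Lp.ext ?_
  filter_upwards [toL2_coe (hf.add hg), toL2_coe hf, toL2_coe hg,
    Lp.coeFn_add (toL2 μ f) (toL2 μ g)] with x h1 h2 h3 h4
  rw [h4, Pi.add_apply, h2, h3]; exact h1

lemma toL2_const_mul (c : ℝ) (hf : MemLp f 2 μ) :
    toL2 μ (fun x => c * f x) = c • toL2 μ f := by
  refine Lp.ext ?_
  filter_upwards [toL2_coe (hf.const_mul c), toL2_coe hf,
    Lp.coeFn_smul c (toL2 μ f)] with x h1 h2 h3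
  rw [h3, Pi.smul_apply, h2, smul_eq_mul]; exact h1

lemma toL2_sub (hf : MemLp f 2 μ) (hg : MemLp g 2 μ) :
    toL2 μ (fun x => f x - g x) = toL2 μ f - toL2 μ g := by
  refine Lp.ext ?_
  filter_upwards [toL2_coe (hf.sub hg), toL2_coe hf, toL2_coe hg,
    Lp.coeFn_sub (toL2 μ f) (toL2 μ g)] with x h1 h2 h3 h4
  rw [h4, Pi.sub_apply, h2, h3]; exact h1

lemma toL2_coeFn (F : Lp ℝ 2 μ) : toL2 μ F = F :=
  Lp.ext (toL2_coe (Lp.memLp F))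

lemma inner_toL2 (hf : MemLp f 2 μ) (hg : MemLp g 2 μ) :
    inner ℝ (toL2 μ f) (toL2 μ g) = ∫ x, f x * g x ∂μ := by
  rw [L2.inner_def]
  refine integral_congr_ae ?_
  filter_upwards [toL2_coe hf, toL2_coe hg] with x h1 h2
  rw [h1, h2]; simp [mul_comm]

lemma norm_toL2_sq (hf : MemLp f 2 μ) : ‖toL2 μ f‖ ^ 2 = ∫ x, f x ^ 2 ∂μ := by
  rw [← real_inner_self_eq_norm_sq, inner_toL2 hf hf]; simp only [sq]

lemma norm_toL2_le_mul {M : ℝ} (hf : MemLp f 2 μ) (hg : MemLp g 2 μ)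
    (h : ∀ᵐ x ∂μ, |f x| ≤ M * |g x|) : ‖toL2 μ f‖ ≤ M * ‖toL2 μ g‖ := by
  refine Lp.norm_le_mul_norm_of_ae_le_mul ?_
  filter_upwards [toL2_coe hf, toL2_coe hg, h] with x h1 h2 h3
  rw [h1, h2]; exact h3

lemma norm_toL2_eq_eLpNorm (hf : MemLp f 2 μ) : ‖toL2 μ f‖ = (eLpNorm f 2 μ).toReal := by
  rw [toL2, dif_pos hf, Lp.norm_toLp]

lemma abs_integral_mul_le (hf : MemLp f 2 μ) (hg : MemLp g 2 μ) :
    |∫ x, f x * g x ∂μ| ≤ ‖toL2 μ f‖ * ‖toL2 μ g‖ := by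
  rw [← inner_toL2 hf hg]; exact abs_real_inner_le_norm _ _

attribute [irreducible] toL2

end toL2

/-- Lebesgue measure on `(0,S)`. -/
abbrev nu (S : ℝ) : Measure ℝ := volume.restrict (Ioo 0 S)

lemma ae_nu {S : ℝ} {p : ℝ → Prop} (h : ∀ x ∈ Ioo 0 S, p x) : ∀ᵐ x ∂(nu S), p x :=
  (ae_restrict_iff' measurableSet_Ioo).2 (Eventually.of_forall h)

/-- Families of functions on `(0,S]`, each continuous and bounded, that depend continuously on
`t ∈ I` with respect to uniform convergence. -/
structure SupCont (S : ℝ) (I : Set ℝ) (g : ℝ → ℝ → ℝ) : Prop where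
  cont : ∀ t ∈ I, ContinuousOn (g t) (Ioc 0 S)
  bdd : ∀ t ∈ I, ∃ M, ∀ s ∈ Ioc 0 S, |g t s| ≤ M
  unif : ∀ t ∈ I, TendstoUniformlyOn g (g t) (𝓝[I] t) (Ioc 0 S)

/-- Families of square integrable functions that depend continuously on `t ∈ I` in `L²(0,S)`. -/
structure L2Cont (S : ℝ) (I : Set ℝ) (f : ℝ → ℝ → ℝ) : Prop where
  memLp : ∀ t ∈ I, MemLp (f t) 2 (nu S)
  cont : ContinuousOn (fun t => toL2 (nu S) (f t)) I

variable {S : ℝ} {I : Set ℝ}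

lemma memLp_nu_of_bound {f : ℝ → ℝ} {M : ℝ} (hc : ContinuousOn f (Ioo 0 S))
    (hM : ∀ s ∈ Ioo 0 S, |f s| ≤ M) (p : ENNReal) : MemLp f p (nu S) :=
  MemLp.of_bound (hc.aestronglyMeasurable measurableSet_Ioo) M (ae_nu hM)

lemma SupCont.exists_pos_bound {g : ℝ → ℝ → ℝ} (hg : SupCont S I g) {t : ℝ} (ht : t ∈ I) :
    ∃ M > 0, ∀ s ∈ Ioc 0 S, |g t s| ≤ M := by
  obtain ⟨M, hM⟩ := hg.bdd t ht
  exact ⟨max M 1, by positivity, fun s hs => (hM s hs).trans (le_max_left _ _)⟩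

lemma SupCont.memLp {g : ℝ → ℝ → ℝ} (hg : SupCont S I g) {t : ℝ} (ht : t ∈ I) (p : ENNReal) :
    MemLp (g t) p (nu S) := by
  obtain ⟨M, hM⟩ := hg.bdd t ht
  exact memLp_nu_of_bound ((hg.cont t ht).mono Ioo_subset_Ioc_self)
    (fun s hs => hM s (Ioo_subset_Ioc_self hs)) p

lemma SupCont.const {f : ℝ → ℝ} (hf : ContinuousOn f (Ioc 0 S))
    (hb : ∃ M, ∀ s ∈ Ioc 0 S, |f s| ≤ M) : SupCont S I (fun _ => f) where
  cont _ _ := hf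
  bdd _ _ := hb
  unif t _ := by
    rw [Metric.tendstoUniformlyOn_iff]
    exact fun ε hε => Eventually.of_forall fun _ x _ => by simpa using hε

lemma SupCont.comp₂ {Ψ : ℝ × ℝ → ℝ} (hΨ : Continuous Ψ) {f g : ℝ → ℝ → ℝ} (hf : SupCont S I f)
    (hg : SupCont S I g) : SupCont S I (fun t s => Ψ (f t s, g t s)) where
  cont t ht := hΨ.comp_continuousOn ((hf.cont t ht).prodMk (hg.cont t ht))
  bdd t ht := by
    obtain ⟨Mf, hMf⟩ := hf.bdd t ht
    obtain ⟨Mg, hMg⟩ := hg.bdd t ht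
    obtain ⟨C, hC⟩ := ((isCompact_Icc (a := -Mf) (b := Mf)).prod
      (isCompact_Icc (a := -Mg) (b := Mg))).exists_bound_of_continuousOn hΨ.continuousOn
    exact ⟨C, fun s hs => hC _ ⟨abs_le.1 (hMf s hs), abs_le.1 (hMg s hs)⟩⟩
  unif t ht := by
    obtain ⟨Mf, hMf⟩ := hf.bdd t ht
    obtain ⟨Mg, hMg⟩ := hg.bdd t ht
    -- Near t the values exceed the bounds at t by less than 1, so uniform continuity of Ψ on the
    -- box enlarged by 1 is enough.
    have hK := ((isCompact_Icc (a := -(Mf + 1)) (b := Mf + 1)).prod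
      (isCompact_Icc (a := -(Mg + 1)) (b := Mg + 1)))
    have huc := hK.uniformContinuousOn_of_continuous hΨ.continuousOn
    rw [Metric.uniformContinuousOn_iff] at huc
    have h1 := Metric.tendstoUniformlyOn_iff.1 (hf.unif t ht)
    have h2 := Metric.tendstoUniformlyOn_iff.1 (hg.unif t ht)
    rw [Metric.tendstoUniformlyOn_iff]
    intro ε hε
    obtain ⟨δ, hδ, H⟩ := huc ε hε
    filter_upwards [h1 (min δ 1) (by positivity), h2 (min δ 1) (by positivity)] with τ h1 h2 s hs
    have a1 := abs_le.1 (hMf s hs)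
    have a2 := abs_le.1 (hMg s hs)
    have b1 := h1 s hs
    have b2 := h2 s hs
    have c1 := abs_lt.1 (lt_of_lt_of_le (by simpa [Real.dist_eq] using b1) (min_le_right δ 1))
    have c2 := abs_lt.1 (lt_of_lt_of_le (by simpa [Real.dist_eq] using b2) (min_le_right δ 1))
    refine H _ ⟨⟨by linarith [a1.1], by linarith [a1.2]⟩, by linarith [a2.1], by linarith [a2.2]⟩ _
      ⟨⟨by linarith [a1.1, c1.2], by linarith [a1.2, c1.1]⟩,
        by linarith [a2.1, c2.2], by linarith [a2.2, c2.1]⟩ ?_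
    rw [Prod.dist_eq]
    exact max_lt (b1.trans_le (min_le_left _ _)) (b2.trans_le (min_le_left _ _))

lemma SupCont.comp {Ψ : ℝ → ℝ} (hΨ : Continuous Ψ) {f : ℝ → ℝ → ℝ} (hf : SupCont S I f) :
    SupCont S I (fun t s => Ψ (f t s)) :=
  SupCont.comp₂ (Ψ := fun p => Ψ p.1) (hΨ.comp continuous_fst) hf hf

lemma SupCont.mul {f g : ℝ → ℝ → ℝ} (hf : SupCont S I f) (hg : SupCont S I g) :
    SupCont S I (fun t s => f t s * g t s) :=
  SupCont.comp₂ (Ψ := fun p => p.1 * p.2) (by fun_prop) hf hg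

lemma SupCont.add {f g : ℝ → ℝ → ℝ} (hf : SupCont S I f) (hg : SupCont S I g) :
    SupCont S I (fun t s => f t s + g t s) :=
  SupCont.comp₂ (Ψ := fun p => p.1 + p.2) (by fun_prop) hf hg

lemma SupCont.sub {f g : ℝ → ℝ → ℝ} (hf : SupCont S I f) (hg : SupCont S I g) :
    SupCont S I (fun t s => f t s - g t s) :=
  SupCont.comp₂ (Ψ := fun p => p.1 - p.2) (by fun_prop) hf hg

lemma SupCont.const_mul (c : ℝ) {f : ℝ → ℝ → ℝ} (hf : SupCont S I f) :
    SupCont S I (fun t s => c * f t s) :=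
  SupCont.comp (Ψ := fun x => c * x) (by fun_prop) hf

/-- A family is continuous for uniform convergence if its increments are bounded by a quantity that
tends to zero. -/
lemma SupCont.of_bound {f : ℝ → ℝ → ℝ} (hc : ∀ t ∈ I, ContinuousOn (f t) (Ioc 0 S))
    (hb : ∀ t ∈ I, ∃ M, ∀ s ∈ Ioc 0 S, |f t s| ≤ M) (B : ℝ → ℝ → ℝ)
    (hB : ∀ t ∈ I, Tendsto (B t) (𝓝[I] t) (𝓝 0))
    (h : ∀ t ∈ I, ∀ τ ∈ I, ∀ s ∈ Ioc 0 S, |f τ s - f t s| ≤ B t τ) : SupCont S I f where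
  cont := hc
  bdd := hb
  unif t ht := by
    rw [Metric.tendstoUniformlyOn_iff]
    intro ε hε
    filter_upwards [(hB t ht).eventually (gt_mem_nhds hε), self_mem_nhdsWithin] with τ h1 h2 s hs
    rw [dist_comm, Real.dist_eq]
    exact (h t ht τ h2 s hs).trans_lt h1

lemma SupCont.tendsto_sup {f : ℝ → ℝ → ℝ} (hf : SupCont S I f) {t : ℝ} (ht : t ∈ I) {ε : ℝ}
    (hε : 0 < ε) : ∀ᶠ τ in 𝓝[I] t, ∀ s ∈ Ioc 0 S, |f τ s - f t s| < ε := by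
  filter_upwards [Metric.tendstoUniformlyOn_iff.1 (hf.unif t ht) ε hε] with τ h s hs
  have := h s hs
  rwa [dist_comm, Real.dist_eq] at this

lemma L2Cont.add {f g : ℝ → ℝ → ℝ} (hf : L2Cont S I f) (hg : L2Cont S I g) :
    L2Cont S I (fun t s => f t s + g t s) where
  memLp t ht := (hf.memLp t ht).add (hg.memLp t ht)
  cont := (hf.cont.add hg.cont).congr fun t ht => toL2_add (hf.memLp t ht) (hg.memLp t ht)

lemma L2Cont.sub {f g : ℝ → ℝ → ℝ} (hf : L2Cont S I f) (hg : L2Cont S I g) :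
    L2Cont S I (fun t s => f t s - g t s) where
  memLp t ht := (hf.memLp t ht).sub (hg.memLp t ht)
  cont := (hf.cont.sub hg.cont).congr fun t ht => toL2_sub (hf.memLp t ht) (hg.memLp t ht)

lemma L2Cont.const_mul (c : ℝ) {f : ℝ → ℝ → ℝ} (hf : L2Cont S I f) :
    L2Cont S I (fun t s => c * f t s) where
  memLp t ht := (hf.memLp t ht).const_mul c
  cont := (hf.cont.const_smul c).congr fun t ht => toL2_const_mul c (hf.memLp t ht)

lemma memLp_mul_bdd {f g : ℝ → ℝ} {M : ℝ} (hf : MemLp f 2 (nu S)) (hg : ContinuousOn g (Ioc 0 S))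
    (hM : ∀ s ∈ Ioc 0 S, |g s| ≤ M) : MemLp (fun s => f s * g s) 2 (nu S) := by
  refine hf.of_le_mul (c := M) (hf.1.mul ((hg.mono Ioo_subset_Ioc_self).aestronglyMeasurable
    measurableSet_Ioo)) (ae_nu fun s hs => ?_)
  rw [norm_mul, mul_comm]
  exact mul_le_mul_of_nonneg_right (hM s (Ioo_subset_Ioc_self hs)) (norm_nonneg _)

/-- In the telescoped increment (f_τ - f_t) g_τ + f_t (g_τ - g_t) each product has one small factor:
the first is small in L², the second uniformly. -/
lemma L2Cont.mul {f g : ℝ → ℝ → ℝ} (hf : L2Cont S I f) (hg : SupCont S I g) :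
    L2Cont S I (fun t s => f t s * g t s) where
  memLp t ht := by
    obtain ⟨M, hM⟩ := hg.bdd t ht
    exact memLp_mul_bdd (hf.memLp t ht) (hg.cont t ht) hM
  cont t ht := by
    have hm : ∀ τ ∈ I, MemLp (fun s => f τ s * g τ s) 2 (nu S) := fun τ hτ => by
      obtain ⟨M, hM⟩ := hg.bdd τ hτ
      exact memLp_mul_bdd (hf.memLp τ hτ) (hg.cont τ hτ) hM
    obtain ⟨M, hM0, hM⟩ := hg.exists_pos_bound ht
    rw [ContinuousWithinAt, tendsto_iff_norm_sub_tendsto_zero]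
    have hbound : ∀ ε : ℝ, 0 < ε → ε ≤ 1 → ∀ᶠ τ in 𝓝[I] t,
        ‖toL2 (nu S) (fun s => f τ s * g τ s) - toL2 (nu S) (fun s => f t s * g t s)‖
          ≤ (M + 1) * ‖toL2 (nu S) (f τ) - toL2 (nu S) (f t)‖ + ε * ‖toL2 (nu S) (f t)‖ := by
      intro ε hε hε1
      filter_upwards [hg.tendsto_sup ht hε, self_mem_nhdsWithin] with τ hτ hτI
      have m1 := (hf.memLp τ hτI).sub (hf.memLp t ht)
      obtain ⟨M', hM'⟩ := hg.bdd τ hτI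
      have m2 : MemLp (fun s => (f τ s - f t s) * g τ s) 2 (nu S) :=
        memLp_mul_bdd m1 (hg.cont τ hτI) hM'
      have m3 : MemLp (fun s => f t s * (g τ s - g t s)) 2 (nu S) :=
        memLp_mul_bdd (hf.memLp t ht) ((hg.cont τ hτI).sub (hg.cont t ht)) fun s hs => (hτ s hs).le
      rw [← toL2_sub (hm τ hτI) (hm t ht)]
      have e : (fun s => f τ s * g τ s - f t s * g t s)
          = fun s => (f τ s - f t s) * g τ s + f t s * (g τ s - g t s) := by
        funext s; ring
      rw [e, toL2_add m2 m3]
      refine (norm_add_le _ _).trans (add_le_add ?_ ?_)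
      · rw [← toL2_sub (hf.memLp τ hτI) (hf.memLp t ht)]
        refine norm_toL2_le_mul m2 m1 (ae_nu fun s hs => ?_)
        have hs' := Ioo_subset_Ioc_self hs
        rw [abs_mul, mul_comm]
        refine mul_le_mul_of_nonneg_right ?_ (abs_nonneg _)
        have := abs_sub_abs_le_abs_sub (g τ s) (g t s)
        linarith [hM s hs', hτ s hs']
      · refine norm_toL2_le_mul m3 (hf.memLp t ht) (ae_nu fun s hs => ?_)
        rw [abs_mul, mul_comm]
        exact mul_le_mul_of_nonneg_right (hτ s (Ioo_subset_Ioc_self hs)).le (abs_nonneg _)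
    rw [Metric.tendsto_nhds]
    intro ε hε
    set N := ‖toL2 (nu S) (f t)‖
    set η := min 1 (ε / (2 * (N + 1))) with hη
    have hN : 0 ≤ N := norm_nonneg _
    have hη0 : 0 < η := lt_min one_pos (by positivity)
    have hlim := (tendsto_iff_norm_sub_tendsto_zero.1 (hf.cont t ht)).eventually
      (gt_mem_nhds (show 0 < ε / (2 * (M + 1)) by positivity))
    filter_upwards [hbound η hη0 (min_le_left _ _), hlim] with τ h1 h2
    rw [dist_zero_right, Real.norm_of_nonneg (norm_nonneg _)]
    have h3 : (M + 1) * ‖toL2 (nu S) (f τ) - toL2 (nu S) (f t)‖ < ε / 2 := by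
      rw [lt_div_iff₀ (by positivity)] at h2; linarith
    have h4 : η * N ≤ ε / 2 := by
      have : η * (2 * (N + 1)) ≤ ε := by
        rw [← le_div_iff₀ (by positivity)]; exact min_le_right _ _
      nlinarith
    linarith

lemma SupCont.l2Cont {g : ℝ → ℝ → ℝ} (hg : SupCont S I g) : L2Cont S I g := by
  have h1 : L2Cont S I (fun _ _ => (1 : ℝ)) := ⟨fun t _ => memLp_const 1, continuousOn_const⟩
  simpa using h1.mul hg

lemma L2Cont.integrableOn {f : ℝ → ℝ → ℝ} (hf : L2Cont S I f) {t : ℝ} (ht : t ∈ I) :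
    IntegrableOn (f t) (Ioo 0 S) := (hf.memLp t ht).integrable (by norm_num)

lemma L2Cont.continuousOn_integral_mul {f g : ℝ → ℝ → ℝ} (hf : L2Cont S I f) (hg : L2Cont S I g) :
    ContinuousOn (fun t => ∫ s in Ioo 0 S, f t s * g t s) I :=
  (hf.cont.inner hg.cont).congr fun t ht => (inner_toL2 (hf.memLp t ht) (hg.memLp t ht)).symm

lemma L2Cont.continuousOn_integral {f : ℝ → ℝ → ℝ} (hf : L2Cont S I f) :
    ContinuousOn (fun t => ∫ s in Ioo 0 S, f t s) I := by
  have h1 : L2Cont S I (fun _ _ => (1 : ℝ)) := ⟨fun t _ => memLp_const 1, continuousOn_const⟩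
  simpa using hf.continuousOn_integral_mul h1

/-! ### Differentiation in `L²` -/

/-- Since the first factor vanishes at τ = t, mere continuity of B suffices. This is what makes
energy computations possible without a time derivative of the velocity. -/
lemma hasDerivAt_inner_sub {H : Type*} [NormedAddCommGroup H] [InnerProductSpace ℝ H]
    {A B : ℝ → H} {A' : H} {t : ℝ} (hA : HasDerivAt A A' t) (hB : ContinuousAt B t) :
    HasDerivAt (fun τ => inner ℝ (A τ - A t) (B τ)) (inner ℝ A' (B t)) t := by
  rw [hasDerivAt_iff_tendsto_slope] at hA ⊢
  refine (hA.inner (hB.tendsto.mono_left nhdsWithin_le_nhds)).congr fun τ => ?_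
  simp [slope, inner_smul_left]

/-- The derivative is uniformly continuous on the ball of radius M + 1; the extra 1 leaves room for
the increment y - x. -/
lemma taylor_uniform {Θ : ℝ × ℝ → ℝ} (hΘ : ContDiff ℝ 1 Θ) (M : ℝ) {ε : ℝ} (hε : 0 < ε) :
    ∃ δ > 0, ∀ x : ℝ × ℝ, ‖x‖ ≤ M → ∀ y, ‖y - x‖ < δ →
      |Θ y - Θ x - fderiv ℝ Θ x (y - x)| ≤ ε * ‖y - x‖ := by
  have huc := (isCompact_closedBall (0 : ℝ × ℝ) (M + 1)).uniformContinuousOn_of_continuous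
    (hΘ.continuous_fderiv (by norm_num)).continuousOn
  rw [Metric.uniformContinuousOn_iff] at huc
  obtain ⟨δ, hδ, H⟩ := huc ε hε
  refine ⟨min δ 1, by positivity, fun x hx y hy => ?_⟩
  refine Convex.norm_image_sub_le_of_norm_fderiv_le' (𝕜 := ℝ) (s := Metric.ball x (min δ 1))
    (fun z _ => (hΘ.differentiable (by norm_num)) z) (fun z hz => ?_) (convex_ball _ _)
    (Metric.mem_ball_self (by positivity)) (by rwa [Metric.mem_ball, dist_eq_norm])
  rw [Metric.mem_ball] at hz
  rw [← dist_eq_norm]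
  refine (H z ?_ x ?_ (hz.trans_le (min_le_left _ _))).le
  · rw [mem_closedBall_zero_iff]
    have := norm_le_norm_add_norm_sub' z x
    rw [dist_eq_norm] at hz
    linarith [hz.trans_le (min_le_right _ _)]
  · rw [mem_closedBall_zero_iff]; linarith

lemma norm_toL2_one (hS : 0 < S) : ‖toL2 (nu S) (fun _ => (1 : ℝ))‖ = √S := by
  rw [← Real.sqrt_sq (norm_nonneg _), norm_toL2_sq (memLp_const 1)]
  simp [hS.le]

lemma integral_abs_le (hS : 0 < S) {f : ℝ → ℝ} (hf : MemLp f 2 (nu S)) :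
    ∫ s in Ioo 0 S, |f s| ≤ √S * ‖toL2 (nu S) f‖ := by
  have h1 := abs_integral_mul_le (μ := nu S) (f := fun _ => (1 : ℝ)) (memLp_const 1) hf.abs
  have h2 : ‖toL2 (nu S) (fun s => |f s|)‖ ≤ 1 * ‖toL2 (nu S) f‖ :=
    norm_toL2_le_mul hf.abs hf (Eventually.of_forall fun s => by simp)
  rw [norm_toL2_one hS] at h1
  simp only [one_mul] at h1 h2
  exact (le_abs_self _).trans (h1.trans (mul_le_mul_of_nonneg_left h2 (Real.sqrt_nonneg _)))

/-- The chain rule for `t ↦ ∫ Θ(a(t,s), b(t,s)) ds`. -/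
theorem hasDerivAt_integral_comp {Θ : ℝ × ℝ → ℝ} (hΘ : ContDiff ℝ 1 Θ) (hS : 0 < S)
    {a b : ℝ → ℝ → ℝ} (ha : SupCont S I a) (hb : SupCont S I b) {a' b' : ℝ → ℝ} {t : ℝ}
    (hI : I ∈ 𝓝 t) (ha' : MemLp a' 2 (nu S)) (hb' : MemLp b' 2 (nu S))
    (hda : HasDerivAt (fun τ => toL2 (nu S) (a τ)) (toL2 (nu S) a') t)
    (hdb : HasDerivAt (fun τ => toL2 (nu S) (b τ)) (toL2 (nu S) b') t) :
    HasDerivAt (fun τ => ∫ s in Ioo 0 S, Θ (a τ s, b τ s))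
      (∫ s in Ioo 0 S, fderiv ℝ Θ (a t s, b t s) (a' s, b' s)) t := by
  have htI : t ∈ I := mem_of_mem_nhds hI
  have hnI : 𝓝[I] t = 𝓝 t := nhdsWithin_eq_nhds.2 hI
  have hΘ' : Continuous (fderiv ℝ Θ) := hΘ.continuous_fderiv (by norm_num)
  have hlin : ∀ x h k, fderiv ℝ Θ x (h, k)
      = fderiv ℝ Θ x (1, 0) * h + fderiv ℝ Θ x (0, 1) * k := fun x h k => by
    have : ((h, k) : ℝ × ℝ) = h • (1, 0) + k • (0, 1) := by simp
    rw [this, map_add, map_smul, map_smul]; simp [mul_comm]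
  have hα : SupCont S I (fun τ s => fderiv ℝ Θ (a τ s, b τ s) (1, 0)) :=
    SupCont.comp₂ (Ψ := fun x => fderiv ℝ Θ x (1, 0)) (by fun_prop) ha hb
  have hβ : SupCont S I (fun τ s => fderiv ℝ Θ (a τ s, b τ s) (0, 1)) :=
    SupCont.comp₂ (Ψ := fun x => fderiv ℝ Θ x (0, 1)) (by fun_prop) ha hb
  have hθ : SupCont S I (fun τ s => Θ (a τ s, b τ s)) := SupCont.comp₂ hΘ.continuous ha hb
  have mα := hα.memLp htI 2
  have mβ := hβ.memLp htI 2
  set α := fun s => fderiv ℝ Θ (a t s, b t s) (1, 0) with hαd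
  set β := fun s => fderiv ℝ Θ (a t s, b t s) (0, 1) with hβd
  -- The linearisation at time t, with coefficients frozen at t, is differentiated by pairing in L².
  have hL : HasDerivAt (fun τ => inner ℝ (toL2 (nu S) α) (toL2 (nu S) (a τ))
      + inner ℝ (toL2 (nu S) β) (toL2 (nu S) (b τ)))
      (∫ s in Ioo 0 S, fderiv ℝ Θ (a t s, b t s) (a' s, b' s)) t := by
    have h1 := ((hasDerivAt_const t (toL2 (nu S) α)).inner ℝ hda).add
      ((hasDerivAt_const t (toL2 (nu S) β)).inner ℝ hdb)
    have e : ∫ s in Ioo 0 S, fderiv ℝ Θ (a t s, b t s) (a' s, b' s)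
        = (∫ s in Ioo 0 S, α s * a' s) + ∫ s in Ioo 0 S, β s * b' s := by
      have j1 : IntegrableOn (fun s => α s * a' s) (Ioo 0 S) := mα.integrable_mul ha'
      have j2 : IntegrableOn (fun s => β s * b' s) (Ioo 0 S) := mβ.integrable_mul hb'
      rw [← integral_add j1 j2]
      exact integral_congr_ae (Eventually.of_forall fun s => hlin _ _ _)
    rw [inner_zero_left, inner_zero_left, add_zero, add_zero, inner_toL2 mα ha',
      inner_toL2 mβ hb', ← e] at h1
    exact h1
  set L := fun τ => inner ℝ (toL2 (nu S) α) (toL2 (nu S) (a τ))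
      + inner ℝ (toL2 (nu S) β) (toL2 (nu S) (b τ)) with hLdef
  -- The Taylor remainder is at most ε times the increments of a and b. Their L¹ norms are at most
  -- √S times their L² norms, and these are O(τ - t) by differentiability in L².
  have hR : HasDerivAt (fun τ => (∫ s in Ioo 0 S, Θ (a τ s, b τ s)) - L τ) 0 t := by
    rw [hasDerivAt_iff_isLittleO]
    simp only [smul_zero, sub_zero]
    obtain ⟨Ma, hMa⟩ := ha.bdd t htI
    obtain ⟨Mb, hMb⟩ := hb.bdd t htI
    have key : ∀ ε : ℝ, 0 < ε → ∀ᶠ τ in 𝓝 t,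
        |(∫ s in Ioo 0 S, Θ (a τ s, b τ s)) - L τ - ((∫ s in Ioo 0 S, Θ (a t s, b t s)) - L t)|
          ≤ ε * √S * (‖toL2 (nu S) (a τ) - toL2 (nu S) (a t)‖
            + ‖toL2 (nu S) (b τ) - toL2 (nu S) (b t)‖) := by
      intro ε hε
      obtain ⟨δ, hδ, H⟩ := taylor_uniform hΘ (max Ma Mb) hε
      have e1 := ha.tendsto_sup htI hδ
      have e2 := hb.tendsto_sup htI hδ
      rw [hnI] at e1 e2
      filter_upwards [hI, e1, e2] with τ hτ h1 h2
      have m1 : MemLp (fun s => a τ s - a t s) 2 (nu S) := (ha.memLp hτ 2).sub (ha.memLp htI 2)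
      have m2 : MemLp (fun s => b τ s - b t s) 2 (nu S) := (hb.memLp hτ 2).sub (hb.memLp htI 2)
      rw [← toL2_sub (ha.memLp hτ 2) (ha.memLp htI 2), ← toL2_sub (hb.memLp hτ 2) (hb.memLp htI 2)]
      have i1 : IntegrableOn (fun s => Θ (a τ s, b τ s)) (Ioo 0 S) :=
        (hθ.memLp hτ 1).integrable le_rfl
      have i2 : IntegrableOn (fun s => Θ (a t s, b t s)) (Ioo 0 S) :=
        (hθ.memLp htI 1).integrable le_rfl
      have i3 : IntegrableOn (fun s => α s * (a τ s - a t s)) (Ioo 0 S) := mα.integrable_mul m1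
      have i4 : IntegrableOn (fun s => β s * (b τ s - b t s)) (Ioo 0 S) := mβ.integrable_mul m2
      have i12 : IntegrableOn (fun s => Θ (a τ s, b τ s) - Θ (a t s, b t s)) (Ioo 0 S) := i1.sub i2
      have i34 : IntegrableOn (fun s => α s * (a τ s - a t s) + β s * (b τ s - b t s)) (Ioo 0 S) :=
        i3.add i4
      have e : (∫ s in Ioo 0 S, Θ (a τ s, b τ s)) - L τ - ((∫ s in Ioo 0 S, Θ (a t s, b t s)) - L t)
          = ∫ s in Ioo 0 S, (Θ (a τ s, b τ s) - Θ (a t s, b t s)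
            - (α s * (a τ s - a t s) + β s * (b τ s - b t s))) := by
        have d1 : L τ - L t = (∫ s in Ioo 0 S, α s * (a τ s - a t s))
            + ∫ s in Ioo 0 S, β s * (b τ s - b t s) := by
          rw [hLdef]
          simp only
          rw [← inner_toL2 mα m1, ← inner_toL2 mβ m2,
            toL2_sub (ha.memLp hτ 2) (ha.memLp htI 2),
            toL2_sub (hb.memLp hτ 2) (hb.memLp htI 2), inner_sub_right, inner_sub_right]
          ring
        rw [integral_sub i12 i34, integral_sub i1 i2, integral_add i3 i4]
        linarith
      rw [e]
      have b1 : ∀ s ∈ Ioo 0 S, |Θ (a τ s, b τ s) - Θ (a t s, b t s)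
            - (α s * (a τ s - a t s) + β s * (b τ s - b t s))|
          ≤ ε * (|a τ s - a t s| + |b τ s - b t s|) := by
        intro s hs
        have hs' := Ioo_subset_Ioc_self hs
        have := H (a t s, b t s) (by
          rw [Prod.norm_def]
          exact max_le_max (hMa s hs') (hMb s hs')) (a τ s, b τ s) (by
          rw [Prod.mk_sub_mk, Prod.norm_def]; exact max_lt (h1 s hs') (h2 s hs'))
        rw [Prod.mk_sub_mk, hlin] at this
        refine this.trans (mul_le_mul_of_nonneg_left ?_ hε.le)
        rw [Prod.norm_def]
        exact max_le (le_add_of_nonneg_right (abs_nonneg _)) (le_add_of_nonneg_left (abs_nonneg _))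
      refine (abs_integral_le_integral_abs).trans ?_
      have ia : IntegrableOn (fun s => |a τ s - a t s|) (Ioo 0 S) :=
        (m1.abs).integrable (q := 2) (by norm_num)
      have ib : IntegrableOn (fun s => |b τ s - b t s|) (Ioo 0 S) :=
        (m2.abs).integrable (q := 2) (by norm_num)
      refine (integral_mono_ae ((i12.sub i34).abs) ((ia.add ib).const_mul ε)
        (ae_nu b1)).trans ?_
      rw [integral_const_mul]
      simp only [Pi.add_apply]
      rw [integral_add ia ib, mul_assoc]
      have := integral_abs_le hS m1
      have := integral_abs_le hS m2
      refine mul_le_mul_of_nonneg_left ?_ hε.le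
      linarith
    have hO : (fun τ => ‖toL2 (nu S) (a τ) - toL2 (nu S) (a t)‖
            + ‖toL2 (nu S) (b τ) - toL2 (nu S) (b t)‖) =O[𝓝 t] fun τ => τ - t :=
      (hda.isBigO_sub.norm_left).add (hdb.isBigO_sub.norm_left)
    obtain ⟨C, hC, hCb⟩ := hO.exists_pos
    rw [Asymptotics.IsBigOWith] at hCb
    rw [Asymptotics.isLittleO_iff]
    intro c hc
    have hp : 0 < √S := Real.sqrt_pos.2 hS
    filter_upwards [key (c / (√S * C)) (by positivity), hCb] with τ h1 h2
    refine h1.trans ?_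
    rw [Real.norm_of_nonneg (by positivity)] at h2
    calc c / (√S * C) * √S * (‖toL2 (nu S) (a τ) - toL2 (nu S) (a t)‖
            + ‖toL2 (nu S) (b τ) - toL2 (nu S) (b t)‖)
        ≤ c / (√S * C) * √S * (C * ‖τ - t‖) := by gcongr
      _ = c * ‖τ - t‖ := by field_simp
  have := hR.add hL
  rw [zero_add] at this
  refine this.congr_of_eventuallyEq (Eventually.of_forall fun τ => ?_)
  simp

/-- A weak derivative in time that is continuous is a derivative. -/
theorem hasDerivAt_of_weak {H : Type*} [NormedAddCommGroup H] [InnerProductSpace ℝ H]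
    [CompleteSpace H] {T : ℝ} {A Ξ : ℝ → H} (Pr : H →L[ℝ] H) (𝒯 : Set H)
    (hPr : ∀ g : H, (∀ χ ∈ 𝒯, inner ℝ χ g = 0) → Pr g = 0) (hΞ : ContinuousOn Ξ (Ioo 0 T))
    (h : ∀ χ ∈ 𝒯, ∀ t ∈ Ioo 0 T, HasDerivAt (fun τ => inner ℝ χ (A τ)) (inner ℝ χ (Ξ t)) t)
    {t : ℝ} (ht : t ∈ Ioo 0 T) : HasDerivAt (fun τ => Pr (A τ)) (Pr (Ξ t)) t := by
  have hsub : ∀ τ ∈ Ioo 0 T, uIcc t τ ⊆ Ioo 0 T := fun τ hτ =>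
    (convex_Ioo 0 T).ordConnected.uIcc_subset ht hτ
  have hint : ∀ τ ∈ Ioo 0 T, IntervalIntegrable Ξ volume t τ := fun τ hτ =>
    (hΞ.mono (hsub τ hτ)).intervalIntegrable
  -- `Pr` annihilates whatever the tests in 𝒯 cannot detect: it will be the identity for tests ζ,
  -- and the removal of a mean for tests ζ'.
  have key : ∀ τ ∈ Ioo 0 T, Pr (A τ) = Pr (∫ x in t..τ, Ξ x) + Pr (A t) := by
    intro τ hτ
    have := hPr (A τ - A t - ∫ x in t..τ, Ξ x) fun χ hχ => by
      have h1 : ∫ x in t..τ, inner ℝ χ (Ξ x) = inner ℝ χ (A τ) - inner ℝ χ (A t) := by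
        refine intervalIntegral.integral_eq_sub_of_hasDerivAt
          (fun x hx => h χ hχ x (hsub τ hτ hx)) ?_
        exact ContinuousOn.intervalIntegrable (continuousOn_const.inner (hΞ.mono (hsub τ hτ)))
      have h2 := (innerSL ℝ χ).intervalIntegral_comp_comm (hint τ hτ)
      simp only [innerSL_apply_apply] at h2
      rw [inner_sub_right, inner_sub_right, ← h2, h1, sub_self]
    rw [map_sub, map_sub, sub_eq_zero, sub_eq_iff_eq_add] at this
    exact this
  have hd : HasDerivAt (fun τ => ∫ x in t..τ, Ξ x) (Ξ t) t := by
    have hn : Ioo 0 T ∈ 𝓝 t := Ioo_mem_nhds ht.1 ht.2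
    exact intervalIntegral.integral_hasDerivAt_right (by simp)
      (hΞ.stronglyMeasurableAtFilter isOpen_Ioo t ht) (hΞ.continuousAt hn)
  refine ((Pr.hasFDerivAt.comp_hasDerivAt t hd).add_const (Pr (A t))).congr_of_eventuallyEq ?_
  filter_upwards [Ioo_mem_nhds ht.1 ht.2] with τ hτ
  exact key τ hτ

end

section

/-! ### Angular means -/

/-- The disk of radius √a has area πa, which is linear in a; comparing on half-lines determines the
image measure. This is the reason for the variable s = |x|². -/
lemma map_normSq {R : ℝ} (hR : 0 < R) :
    Measure.map (fun x : Plane => ‖x‖ ^ 2) (volume.restrict (disk R))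
      = ENNReal.ofReal Real.pi • nu (R ^ 2) := by
  have hm : Measurable (fun x : Plane => ‖x‖ ^ 2) := by fun_prop
  have : IsFiniteMeasure (volume.restrict (disk R)) :=
    ⟨by rw [Measure.restrict_apply_univ]; exact measure_ball_lt_top⟩
  have : IsFiniteMeasure (Measure.map (fun x : Plane => ‖x‖ ^ 2) (volume.restrict (disk R))) :=
    Measure.isFiniteMeasure_map _ _
  have : IsFiniteMeasure (ENNReal.ofReal Real.pi • nu (R ^ 2)) :=
    Measure.smul_finite _ ENNReal.ofReal_ne_top
  have hpi := Real.pi_pos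
  refine Measure.ext_of_Iic _ _ fun a => ?_
  rw [Measure.map_apply hm measurableSet_Iic, Measure.restrict_apply (hm measurableSet_Iic),
    Measure.smul_apply, Measure.restrict_apply measurableSet_Iic, smul_eq_mul]
  rcases lt_or_ge a 0 with ha | ha
  · have h1 : (fun x : Plane => ‖x‖ ^ 2) ⁻¹' Iic a ∩ disk R = ∅ := by
      ext x; simp only [mem_inter_iff, mem_preimage, mem_Iic, mem_empty_iff_false, iff_false]
      exact fun h => absurd h.1 (by nlinarith [sq_nonneg ‖x‖])
    have h2 : Iic a ∩ Ioo 0 (R ^ 2) = ∅ := by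
      ext x; simp only [mem_inter_iff, mem_Iic, mem_Ioo, mem_empty_iff_false, iff_false]
      exact fun h => absurd h.1 (by linarith [h.2.1])
    rw [h1, h2]; simp
  rcases lt_or_ge a (R ^ 2) with haR | haR
  · have h1 : (fun x : Plane => ‖x‖ ^ 2) ⁻¹' Iic a ∩ disk R = Metric.closedBall 0 (√a) := by
      ext x
      simp only [mem_inter_iff, mem_preimage, mem_Iic, disk, mem_ball_zero_iff,
        mem_closedBall_zero_iff]
      rw [Real.le_sqrt (norm_nonneg _) ha]
      exact ⟨fun h => h.1, fun h => ⟨h, by nlinarith [norm_nonneg x]⟩⟩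
    have h2 : Iic a ∩ Ioo 0 (R ^ 2) = Ioc 0 a := by
      ext x; simp only [mem_inter_iff, mem_Iic, mem_Ioo, mem_Ioc]
      exact ⟨fun h => ⟨h.2.1, h.1⟩, fun h => ⟨h.2, h.1, h.2.trans_lt haR⟩⟩
    rw [h1, h2, EuclideanSpace.volume_closedBall_fin_two, Real.volume_Ioc, sub_zero,
      ← ENNReal.ofReal_pow (Real.sqrt_nonneg _), Real.sq_sqrt ha, mul_comm]
  · have h1 : (fun x : Plane => ‖x‖ ^ 2) ⁻¹' Iic a ∩ disk R = Metric.ball 0 R := by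
      ext x
      simp only [mem_inter_iff, mem_preimage, mem_Iic, disk, mem_ball_zero_iff]
      exact ⟨fun h => h.2, fun h => ⟨by nlinarith [norm_nonneg x], h⟩⟩
    have h2 : Iic a ∩ Ioo 0 (R ^ 2) = Ioo 0 (R ^ 2) :=
      inter_eq_right.2 fun x hx => hx.2.le.trans haR
    rw [h1, h2, EuclideanSpace.volume_ball_fin_two, Real.volume_Ioo, sub_zero,
      ← ENNReal.ofReal_pow hR.le, mul_comm]

/-- Lebesgue measure on the disk, divided by `π`. -/
def muD (R : ℝ) : Measure Plane := (ENNReal.ofReal Real.pi)⁻¹ • volume.restrict (disk R)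

lemma ofReal_pi_ne_zero : ENNReal.ofReal Real.pi ≠ 0 := by simp [Real.pi_pos]

instance (R : ℝ) : IsFiniteMeasure (volume.restrict (disk R)) :=
  ⟨by rw [Measure.restrict_apply_univ]; exact measure_ball_lt_top⟩

lemma measurePreserving_normSq {R : ℝ} (hR : 0 < R) :
    MeasurePreserving (fun x : Plane => ‖x‖ ^ 2) (muD R) (nu (R ^ 2)) := by
  refine ⟨by fun_prop, ?_⟩
  rw [muD, Measure.map_smul, map_normSq hR, smul_smul,
    ENNReal.inv_mul_cancel ofReal_pi_ne_zero ENNReal.ofReal_ne_top, one_smul]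

lemma quasiMeasurePreserving_normSq {R : ℝ} (hR : 0 < R) :
    Measure.QuasiMeasurePreserving (fun x : Plane => ‖x‖ ^ 2) (volume.restrict (disk R))
      (nu (R ^ 2)) :=
  ⟨by fun_prop, by
    rw [map_normSq hR]; exact Measure.smul_absolutelyContinuous⟩

lemma integral_radial {R : ℝ} (hR : 0 < R) {g : ℝ → ℝ} (hg : AEStronglyMeasurable g (nu (R ^ 2))) :
    ∫ x in disk R, g (‖x‖ ^ 2) = Real.pi * ∫ s in Ioo 0 (R ^ 2), g s := by
  have h1 : AEStronglyMeasurable g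
      (Measure.map (fun x : Plane => ‖x‖ ^ 2) (volume.restrict (disk R))) := by
    rw [map_normSq hR]; exact hg.smul_measure _
  rw [← integral_map (by fun_prop) h1, map_normSq hR, integral_smul_measure,
    ENNReal.toReal_ofReal Real.pi_pos.le, smul_eq_mul]

lemma integrable_radial {R : ℝ} (hR : 0 < R) {g : ℝ → ℝ} (hg : IntegrableOn g (Ioo 0 (R ^ 2))) :
    IntegrableOn (fun x : Plane => g (‖x‖ ^ 2)) (disk R) := by
  have h1 : Integrable g
      (Measure.map (fun x : Plane => ‖x‖ ^ 2) (volume.restrict (disk R))) := by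
    rw [map_normSq hR]; exact hg.integrable.smul_measure ENNReal.ofReal_ne_top
  exact h1.comp_measurable (by fun_prop)

lemma integrable_radial_iff {R : ℝ} (hR : 0 < R) {g : ℝ → ℝ}
    (hg : AEStronglyMeasurable g (nu (R ^ 2))) :
    IntegrableOn (fun x : Plane => g (‖x‖ ^ 2)) (disk R) ↔ IntegrableOn g (Ioo 0 (R ^ 2)) := by
  refine ⟨fun h => ?_, integrable_radial hR⟩
  have h1 : AEStronglyMeasurable g
      (Measure.map (fun x : Plane => ‖x‖ ^ 2) (volume.restrict (disk R))) := by
    rw [map_normSq hR]; exact hg.smul_measure _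
  have h2 := (integrable_map_measure h1 (by fun_prop)).2 h
  rw [map_normSq hR] at h2
  exact (integrable_smul_measure ofReal_pi_ne_zero ENNReal.ofReal_ne_top).1 h2

lemma memLp_muD {R : ℝ} {g : Plane → ℝ} (hg : MemLp g 2 (volume.restrict (disk R))) :
    MemLp g 2 (muD R) :=
  hg.smul_measure (ENNReal.inv_ne_top.2 ofReal_pi_ne_zero)

lemma memLp_radial {R : ℝ} (hR : 0 < R) {g : ℝ → ℝ} {p : ENNReal} (hg : MemLp g p (nu (R ^ 2))) :
    MemLp (fun x : Plane => g (‖x‖ ^ 2)) p (volume.restrict (disk R)) := by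
  have h1 : MemLp g p
      (Measure.map (fun x : Plane => ‖x‖ ^ 2) (volume.restrict (disk R))) := by
    rw [map_normSq hR]; exact hg.smul_measure ENNReal.ofReal_ne_top
  exact h1.comp_of_map (by fun_prop)

/-- The composition with `x ↦ ‖x‖²` as an isometry of `L²` spaces. -/
def radialLift {R : ℝ} (hR : 0 < R) : Lp ℝ 2 (nu (R ^ 2)) →L[ℝ] Lp ℝ 2 (muD R) :=
  (Lp.compMeasurePreservingₗᵢ ℝ (fun x : Plane => ‖x‖ ^ 2)
    (measurePreserving_normSq hR)).toContinuousLinearMap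

/-- The mean of a square integrable function over circles, as a function of `s = ‖x‖²`. -/
def avg {R : ℝ} (hR : 0 < R) (g : Plane → ℝ) : ℝ → ℝ :=
  ContinuousLinearMap.adjoint (radialLift hR) (toL2 (muD R) g)

lemma memLp_avg {R : ℝ} (hR : 0 < R) (g : Plane → ℝ) : MemLp (avg hR g) 2 (nu (R ^ 2)) :=
  Lp.memLp _

lemma toL2_avg {R : ℝ} (hR : 0 < R) (g : Plane → ℝ) :
    toL2 (nu (R ^ 2)) (avg hR g)
      = ContinuousLinearMap.adjoint (radialLift hR) (toL2 (muD R) g) := toL2_coeFn _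

/-- The defining property of the adjoint; the factor π undoes the normalisation of `muD`. -/
lemma integral_mul_avg {R : ℝ} (hR : 0 < R) {f : ℝ → ℝ} {g : Plane → ℝ}
    (hf : MemLp f 2 (nu (R ^ 2))) (hg : MemLp g 2 (volume.restrict (disk R))) :
    ∫ x in disk R, f (‖x‖ ^ 2) * g x
      = Real.pi * ∫ s in Ioo 0 (R ^ 2), f s * avg hR g s := by
  have hmp := measurePreserving_normSq hR
  have h1 : inner ℝ (toL2 (nu (R ^ 2)) f) (toL2 (nu (R ^ 2)) (avg hR g))
      = inner ℝ (radialLift hR (toL2 (nu (R ^ 2)) f)) (toL2 (muD R) g) := by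
    rw [toL2_avg, ContinuousLinearMap.adjoint_inner_right]
  have h2 : radialLift hR (toL2 (nu (R ^ 2)) f)
      = toL2 (muD R) (fun x => f (‖x‖ ^ 2)) := by
    have hc := hf.comp_measurePreserving hmp
    refine Lp.ext ?_
    refine (Lp.coeFn_compMeasurePreserving _ hmp).trans ?_
    refine (hmp.quasiMeasurePreserving.ae_eq_comp (toL2_coe hf)).trans ?_
    exact (toL2_coe hc).symm
  have hc : MemLp (fun x : Plane => f (‖x‖ ^ 2)) 2 (muD R) := hf.comp_measurePreserving hmp
  rw [inner_toL2 hf (memLp_avg hR g), h2, inner_toL2 hc (memLp_muD hg), muD,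
    integral_smul_measure, ENNReal.toReal_inv, ENNReal.toReal_ofReal Real.pi_pos.le,
    smul_eq_mul] at h1
  rw [h1, ← mul_assoc, mul_inv_cancel₀ Real.pi_ne_zero, one_mul]

lemma l2Cont_avg {R : ℝ} (hR : 0 < R) {I : Set ℝ} {g : ℝ → Plane → ℝ}
    (hg : ∀ t ∈ I, MemLp (g t) 2 (volume.restrict (disk R)))
    (hc : ∀ s ∈ I, Tendsto (fun t => eLpNorm (g t - g s) 2 (volume.restrict (disk R)))
      (𝓝[I] s) (𝓝 0)) : L2Cont (R ^ 2) I (fun t => avg hR (g t)) where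
  memLp t _ := memLp_avg hR _
  cont := by
    simp only [toL2_avg]
    refine (ContinuousLinearMap.continuous _).comp_continuousOn fun s hs => ?_
    rw [ContinuousWithinAt, tendsto_iff_norm_sub_tendsto_zero]
    have h1 : Tendsto (fun t => ((ENNReal.ofReal Real.pi)⁻¹ ^ (1 / (2 : ENNReal)).toReal
        * eLpNorm (g t - g s) 2 (volume.restrict (disk R))).toReal) (𝓝[I] s) (𝓝 0) := by
      rw [← ENNReal.toReal_zero]
      refine (ENNReal.tendsto_toReal (by simp)).comp ?_
      have := ENNReal.Tendsto.const_mul (a := (ENNReal.ofReal Real.pi)⁻¹ ^ (1 / (2 : ENNReal)).toReal)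
        (hc s hs) (Or.inr (ENNReal.rpow_ne_top_of_nonneg (by positivity)
          (ENNReal.inv_ne_top.2 ofReal_pi_ne_zero)))
      simpa using this
    refine h1.congr' ?_
    filter_upwards [self_mem_nhdsWithin] with t ht
    have hm : MemLp (fun x => g t x - g s x) 2 (muD R) := memLp_muD ((hg t ht).sub (hg s hs))
    rw [← toL2_sub (memLp_muD (hg t ht)) (memLp_muD (hg s hs)), norm_toL2_eq_eLpNorm hm, muD,
      eLpNorm_smul_measure_of_ne_top (by norm_num)]
    rfl

/-- Averaging over circles does not increase weighted L¹ norms, even for an unbounded weight. The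
weight cut off at n, times the sign of the average, is an admissible test function; monotone
convergence removes the cut-off. It is needed for the weight 1/√s in the derivative of the density.
-/
lemma integrable_abs_avg_mul {R : ℝ} (hR : 0 < R) {g : Plane → ℝ} {h : ℝ → ℝ}
    (hg : MemLp g 2 (volume.restrict (disk R))) (hh : Measurable h) (h0 : ∀ s, 0 ≤ h s)
    (hi : IntegrableOn (fun x : Plane => h (‖x‖ ^ 2) * |g x|) (disk R)) :
    IntegrableOn (fun s => h s * |avg hR g s|) (Ioo 0 (R ^ 2)) ∧
      Real.pi * ∫ s in Ioo 0 (R ^ 2), h s * |avg hR g s|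
        ≤ ∫ x in disk R, h (‖x‖ ^ 2) * |g x| := by
  set Q := avg hR g with hQ
  have hQm : Measurable Q := (Lp.stronglyMeasurable _).measurable
  set B := ∫ x in disk R, h (‖x‖ ^ 2) * |g x| with hB
  have hpi := Real.pi_pos
  have hQ2 : MemLp Q 2 (nu (R ^ 2)) := memLp_avg hR g
  have key : ∀ n : ℕ, IntegrableOn (fun s => min (h s) n * |Q s|) (Ioo 0 (R ^ 2)) ∧
      Real.pi * ∫ s in Ioo 0 (R ^ 2), min (h s) n * |Q s| ≤ B := by
    intro n
    set f : ℝ → ℝ := fun s => (if 0 ≤ Q s then 1 else -1) * min (h s) n with hf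
    have hfm : Measurable f := (Measurable.ite (measurableSet_le measurable_const hQm)
      measurable_const measurable_const).mul (hh.min measurable_const)
    have hfb : ∀ s, |f s| ≤ min (h s) n := fun s => by
      have : 0 ≤ min (h s) n := le_min (h0 s) n.cast_nonneg
      rw [hf]; simp only; split_ifs <;> simp [abs_of_nonneg this]
    have hf2 : MemLp f 2 (nu (R ^ 2)) := MemLp.of_bound hfm.aestronglyMeasurable n
      (Eventually.of_forall fun s => (hfb s).trans (min_le_right _ _))
    have e : ∀ s, f s * Q s = min (h s) n * |Q s| := fun s => by
      rw [hf]; simp only; split_ifs with hs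
      · rw [abs_of_nonneg hs]; ring
      · rw [abs_of_neg (not_le.1 hs)]; ring
    refine ⟨?_, ?_⟩
    · have := hf2.integrable_mul hQ2
      refine (integrable_congr (Eventually.of_forall fun s => ?_)).1 this
      exact e s
    · have h1 := integral_mul_avg hR hf2 hg
      simp only [← hQ, e] at h1
      rw [← h1, hB]
      refine integral_mono_ae ?_ hi ?_
      · exact Integrable.bdd_mul (c := n) (hg.integrable (by norm_num))
          (hfm.comp (by fun_prop)).aestronglyMeasurable
          (Eventually.of_forall fun x => (hfb _).trans (min_le_right _ _))
      · refine Eventually.of_forall fun x => ?_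
        refine (le_abs_self _).trans ?_
        rw [abs_mul]
        exact mul_le_mul_of_nonneg_right ((hfb _).trans (min_le_left _ _)) (abs_nonneg _)
  have hlim : ∀ s, Tendsto (fun n : ℕ => ENNReal.ofReal (min (h s) n * |Q s|)) atTop
      (𝓝 (ENNReal.ofReal (h s * |Q s|))) := fun s => by
    refine tendsto_const_nhds.congr' ?_
    obtain ⟨N, hN⟩ := exists_nat_ge (h s)
    filter_upwards [eventually_ge_atTop N] with n hn
    rw [min_eq_left (hN.trans (by exact_mod_cast hn))]
  have hl : ∫⁻ s in Ioo 0 (R ^ 2), ENNReal.ofReal (h s * |Q s|) ≤ ENNReal.ofReal (B / Real.pi) := by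
    have ht := lintegral_tendsto_of_tendsto_of_monotone (μ := nu (R ^ 2))
      (f := fun (n : ℕ) s => ENNReal.ofReal (min (h s) n * |Q s|))
      (F := fun s => ENNReal.ofReal (h s * |Q s|))
      (fun n => ((hh.min measurable_const).mul hQm.abs).ennreal_ofReal.aemeasurable)
      (Eventually.of_forall fun s n m hnm => ENNReal.ofReal_le_ofReal
        (mul_le_mul_of_nonneg_right (min_le_min_left _ (by exact_mod_cast hnm)) (abs_nonneg _)))
      (Eventually.of_forall hlim)
    refine le_of_tendsto' ht fun n => ?_
    rw [← ofReal_integral_eq_lintegral_ofReal (key n).1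
      (Eventually.of_forall fun s => mul_nonneg (le_min (h0 s) n.cast_nonneg) (abs_nonneg _))]
    refine ENNReal.ofReal_le_ofReal ?_
    rw [le_div_iff₀ hpi, mul_comm]; exact (key n).2
  have hnn : ∀ s, 0 ≤ h s * |Q s| := fun s => mul_nonneg (h0 s) (abs_nonneg _)
  have hint : IntegrableOn (fun s => h s * |Q s|) (Ioo 0 (R ^ 2)) := by
    refine ⟨(hh.mul hQm.abs).aestronglyMeasurable, ?_⟩
    rw [hasFiniteIntegral_iff_ofReal (Eventually.of_forall hnn)]
    exact hl.trans_lt ENNReal.ofReal_lt_top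
  refine ⟨hint, ?_⟩
  rw [← ofReal_integral_eq_lintegral_ofReal hint (Eventually.of_forall hnn)] at hl
  have hB0 : 0 ≤ B := integral_nonneg fun x => mul_nonneg (h0 _) (abs_nonneg _)
  rw [ENNReal.ofReal_le_ofReal_iff (by positivity), le_div_iff₀ hpi] at hl
  linarith

end

section

variable {S : ℝ}

/-! ### Integration by parts on `(0,S)` -/

lemma PrimLoc.sqrt : PrimLoc S (fun s => √s) (fun s => 1 / (2 * √s)) := by
  refine PrimLoc.of_hasDerivAt (fun x hx => Real.hasDerivAt_sqrt hx.ne') ?_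
  refine continuousOn_const.div (by fun_prop) fun x hx => ?_
  have : 0 < √x := Real.sqrt_pos.2 hx
  positivity

lemma PrimLoc.inv : PrimLoc S (fun s => s⁻¹) (fun s => -(s ^ 2)⁻¹) := by
  refine PrimLoc.of_hasDerivAt (fun x hx => hasDerivAt_inv hx.ne') ?_
  exact ((continuousOn_id.pow 2).inv₀ fun x hx => pow_ne_zero 2 (ne_of_gt hx)).neg

lemma IsTest.primLoc {χ : ℝ → ℝ} (h : IsTest 0 S χ) : PrimLoc S χ (_root_.deriv χ) :=
  PrimLoc.of_hasDerivAt (fun x _ => h.hasDerivAt x) h.deriv.1.continuous.continuousOn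

lemma IsTest.integrableOn_mul_left {f χ : ℝ → ℝ} (h : IsTest 0 S χ) (hS : 0 < S)
    (hf : ∀ a b, 0 < a → a ≤ b → b ≤ S → IntegrableOn f (Icc a b)) :
    IntegrableOn (fun s => f s * χ s) (Ioo 0 S) := by
  obtain ⟨a, b, ha, hab, hb, hz⟩ := h.exists_Icc hS
  obtain ⟨M, hM⟩ := h.exists_bound
  have h1 : IntegrableOn (fun s => f s * χ s) (Icc a b) :=
    Integrable.mul_bdd (hf a b ha hab.le hb.le) h.1.continuous.aestronglyMeasurable
      (Eventually.of_forall hM)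
  refine (IntegrableOn.of_forall_sdiff_eq_zero h1 measurableSet_Ioo fun x hx => ?_)
  rw [hz x hx.2, mul_zero]

lemma PrimLoc.integrableOn_Icc_deriv {f g : ℝ → ℝ} (h : PrimLoc S f g) {a b : ℝ} (ha : 0 < a)
    (hab : a ≤ b) (hb : b ≤ S) : IntegrableOn g (Icc a b) := by
  rw [integrableOn_Icc_iff_integrableOn_Ioc]
  exact (intervalIntegrable_iff_integrableOn_Ioc_of_le hab).1 (h.intervalIntegrable ha hab hb)

lemma PrimLoc.integrableOn_Icc {f g : ℝ → ℝ} (h : PrimLoc S f g) {a b : ℝ} (ha : 0 < a)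
    (hb : b ≤ S) : IntegrableOn f (Icc a b) :=
  (h.continuousOn.mono fun _ hx => ⟨ha.trans_le hx.1, hx.2.trans hb⟩).integrableOn_Icc

lemma PrimLoc.integral_mul_deriv_test {f g χ : ℝ → ℝ} (h : PrimLoc S f g) (hS : 0 < S)
    (hχ : IsTest 0 S χ) :
    ∫ s in Ioo 0 S, f s * deriv χ s = -∫ s in Ioo 0 S, g s * χ s := by
  have i1 := hχ.integrableOn_mul_left hS fun a b ha hab hb => h.integrableOn_Icc_deriv ha hab hb
  have i2 := hχ.deriv.integrableOn_mul_left hS fun a b ha _ hb => h.integrableOn_Icc ha hb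
  have hp := h.mul hχ.primLoc
  obtain ⟨a, b, ha, hab, hb, hz⟩ := hχ.exists_Icc hS
  have := hp.integral_eq_of_tendsto hS (i1.add i2) (l := 0) (by
    refine tendsto_const_nhds.congr' ?_
    filter_upwards [Ioo_mem_nhdsGT ha] with x hx
    rw [hz x fun h' => not_lt.2 h'.1 hx.2, mul_zero])
  rw [integral_add i1 i2, hχ.eq_zero (x := S) (by simp)] at this
  linarith

lemma tendsto_sqrt_mul_zero {f : ℝ → ℝ} {M : ℝ} (hS : 0 < S) (hM : ∀ s ∈ Ioc 0 S, |f s| ≤ M) :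
    Tendsto (fun s => √s * f s) (𝓝[>] 0) (𝓝 0) := by
  have h0 : Tendsto (fun s => √s * M) (𝓝[>] 0) (𝓝 0) := by
    have : Tendsto (fun s => √s * M) (𝓝 0) (𝓝 (√0 * M)) :=
      (Continuous.tendsto (by fun_prop) 0)
    simp only [Real.sqrt_zero, zero_mul] at this
    exact this.mono_left nhdsWithin_le_nhds
  refine squeeze_zero_norm' ?_ h0
  filter_upwards [Ioc_mem_nhdsGT hS] with s hs
  rw [norm_mul, Real.norm_of_nonneg (Real.sqrt_nonneg s)]
  exact mul_le_mul_of_nonneg_left (hM s hs) (Real.sqrt_nonneg s)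

lemma integrableOn_inv_sqrt (hS : 0 < S) : IntegrableOn (fun s => 1 / √s) (Ioo 0 S) := by
  have h := intervalIntegral.intervalIntegrable_rpow' (a := 0) (b := S) (r := -(1 / 2))
    (by norm_num)
  rw [intervalIntegrable_iff_integrableOn_Ioo_of_le hS.le] at h
  refine h.congr_fun (fun s hs => ?_) measurableSet_Ioo
  simp only
  rw [Real.rpow_neg hs.1.le, ← Real.sqrt_eq_rpow, one_div]

lemma integrableOn_bdd_div_sqrt {f : ℝ → ℝ} {M : ℝ} (hS : 0 < S) (hf : ContinuousOn f (Ioc 0 S))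
    (hM : ∀ s ∈ Ioc 0 S, |f s| ≤ M) : IntegrableOn (fun s => f s / √s) (Ioo 0 S) := by
  have h := Integrable.bdd_mul (c := M) (integrableOn_inv_sqrt hS)
    ((hf.mono Ioo_subset_Ioc_self).aestronglyMeasurable measurableSet_Ioo)
    (ae_nu fun s hs => hM s (Ioo_subset_Ioc_self hs))
  exact h.congr (Eventually.of_forall fun s => by simp [div_eq_mul_inv])

/-! ### Weighted primitives -/

/-- The primitive of `g(s) / (2√s)` that vanishes at `S`. -/
def sqrtPrim (S : ℝ) (g : ℝ → ℝ) (s : ℝ) : ℝ := -∫ σ in s..S, g σ / (2 * √σ)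

/-- The primitive of `-g(s) / (2s)` that vanishes at `S`. -/
def logPrim (S : ℝ) (g : ℝ → ℝ) (s : ℝ) : ℝ := ∫ σ in s..S, g σ / (2 * σ)

lemma intervalIntegrable_div_sqrt {g : ℝ → ℝ} (hg : ContinuousOn g (Ioc 0 S)) {a : ℝ} (ha : 0 < a)
    (haS : a ≤ S) : IntervalIntegrable (fun σ => g σ / (2 * √σ)) volume a S := by
  refine ContinuousOn.intervalIntegrable ?_
  rw [uIcc_of_le haS]
  refine (hg.mono fun x hx => ⟨ha.trans_le hx.1, hx.2⟩).div (by fun_prop) fun x hx => ?_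
  have : 0 < √x := Real.sqrt_pos.2 (ha.trans_le hx.1)
  positivity

lemma intervalIntegrable_div_id {g : ℝ → ℝ} (hg : ContinuousOn g (Ioc 0 S)) {a : ℝ} (ha : 0 < a)
    (haS : a ≤ S) : IntervalIntegrable (fun σ => g σ / (2 * σ)) volume a S := by
  refine ContinuousOn.intervalIntegrable ?_
  rw [uIcc_of_le haS]
  refine (hg.mono fun x hx => ⟨ha.trans_le hx.1, hx.2⟩).div (by fun_prop) fun x hx => ?_
  have : 0 < x := ha.trans_le hx.1
  positivity

lemma sqrtPrim_end (g : ℝ → ℝ) : sqrtPrim S g S = 0 := by simp [sqrtPrim]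

lemma logPrim_end (g : ℝ → ℝ) : logPrim S g S = 0 := by simp [logPrim]

lemma primLoc_sqrtPrim {g : ℝ → ℝ} (hg : ContinuousOn g (Ioc 0 S)) :
    PrimLoc S (sqrtPrim S g) (fun s => g s / (2 * √s)) :=
  PrimLoc.of_integral (fun _ ha haS => intervalIntegrable_div_sqrt hg ha haS)
    fun a _ _ => by rw [sqrtPrim_end]; simp [sqrtPrim]

lemma primLoc_logPrim {g : ℝ → ℝ} (hg : ContinuousOn g (Ioc 0 S)) :
    PrimLoc S (logPrim S g) (fun s => -(g s / (2 * s))) :=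
  PrimLoc.of_integral (fun _ ha haS => (intervalIntegrable_div_id hg ha haS).neg)
    fun a _ _ => by rw [logPrim_end]; simp [logPrim]

lemma sqrtPrim_sub {g h : ℝ → ℝ} (hg : ContinuousOn g (Ioc 0 S)) (hh : ContinuousOn h (Ioc 0 S))
    {s : ℝ} (hs : s ∈ Ioc 0 S) :
    sqrtPrim S g s - sqrtPrim S h s = sqrtPrim S (fun σ => g σ - h σ) s := by
  simp only [sqrtPrim, sub_div]
  rw [intervalIntegral.integral_sub (intervalIntegrable_div_sqrt hg hs.1 hs.2)
    (intervalIntegrable_div_sqrt hh hs.1 hs.2)]; ring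

lemma logPrim_sub {g h : ℝ → ℝ} (hg : ContinuousOn g (Ioc 0 S)) (hh : ContinuousOn h (Ioc 0 S))
    {s : ℝ} (hs : s ∈ Ioc 0 S) :
    logPrim S g s - logPrim S h s = logPrim S (fun σ => g σ - h σ) s := by
  simp only [logPrim, sub_div]
  rw [intervalIntegral.integral_sub (intervalIntegrable_div_id hg hs.1 hs.2)
    (intervalIntegrable_div_id hh hs.1 hs.2)]

lemma logPrim_mono {g h : ℝ → ℝ} (hg : ContinuousOn g (Ioc 0 S)) (hh : ContinuousOn h (Ioc 0 S))
    (hgh : ∀ s ∈ Ioc 0 S, g s ≤ h s) {s : ℝ} (hs : s ∈ Ioc 0 S) :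
    logPrim S g s ≤ logPrim S h s := by
  refine intervalIntegral.integral_mono_on hs.2 (intervalIntegrable_div_id hg hs.1 hs.2)
    (intervalIntegrable_div_id hh hs.1 hs.2) fun σ hσ => ?_
  have : 0 < σ := hs.1.trans_le hσ.1
  exact div_le_div_of_nonneg_right (hgh σ ⟨this, hσ.2⟩) (by positivity)

lemma logPrim_const_mul (c : ℝ) (g : ℝ → ℝ) (s : ℝ) :
    logPrim S (fun σ => c * g σ) s = c * logPrim S g s := by
  simp only [logPrim, mul_div_assoc]
  rw [intervalIntegral.integral_const_mul]

lemma logPrim_nonneg {g : ℝ → ℝ} (h0 : ∀ s ∈ Ioc 0 S, 0 ≤ g s) {s : ℝ} (hs : s ∈ Ioc 0 S) :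
    0 ≤ logPrim S g s :=
  intervalIntegral.integral_nonneg hs.2 fun σ hσ => by
    have : 0 < σ := hs.1.trans_le hσ.1
    have := h0 σ ⟨this, hσ.2⟩
    positivity

lemma abs_logPrim_le {g h : ℝ → ℝ} (hg : ContinuousOn g (Ioc 0 S))
    (hh : ContinuousOn h (Ioc 0 S)) (hgh : ∀ s ∈ Ioc 0 S, |g s| ≤ h s) {s : ℝ}
    (hs : s ∈ Ioc 0 S) : |logPrim S g s| ≤ logPrim S h s := by
  refine abs_le.2 ⟨?_, logPrim_mono hg hh (fun σ hσ => (le_abs_self _).trans (hgh σ hσ)) hs⟩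
  have h1 := logPrim_mono (S := S) (g := fun σ => (-1) * h σ) (h := g) (by fun_prop) hg
    (fun σ hσ => by linarith [abs_le.1 (hgh σ hσ)]) hs
  rw [logPrim_const_mul] at h1
  linarith

lemma logPrim_one {s : ℝ} (hs : s ∈ Ioc 0 S) : logPrim S (fun _ => 1) s = Real.log (S / s) / 2 := by
  have h : ∀ σ : ℝ, 1 / (2 * σ) = (1 / 2) * σ⁻¹ := fun σ => by
    rw [one_div, mul_inv]; norm_num
  simp only [logPrim, h]
  rw [intervalIntegral.integral_const_mul, integral_inv_of_pos hs.1 (hs.1.trans_le hs.2)]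
  ring

/-- A bounded g gives at most logarithmic growth at the axis. The bound log x ≤ 4x^(1/4) replaces
the logarithm by a power that is still square integrable. -/
lemma abs_logPrim_le_rpow {g : ℝ → ℝ} {M : ℝ} (hg : ContinuousOn g (Ioc 0 S))
    (hM : ∀ s ∈ Ioc 0 S, |g s| ≤ M) {s : ℝ} (hs : s ∈ Ioc 0 S) :
    |logPrim S g s| ≤ M * (2 * (S / s) ^ (1 / 4 : ℝ)) := by
  have h1 := abs_logPrim_le (h := fun _ => M * 1) hg (by fun_prop) (by simpa using hM) hs
  rw [logPrim_const_mul, logPrim_one hs] at h1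
  have hM0 : 0 ≤ M := (abs_nonneg _).trans (hM s hs)
  have h2 := Real.log_le_rpow_div (x := S / s) (ε := 1 / 4)
    (div_nonneg (hs.1.le.trans hs.2) hs.1.le) (by norm_num)
  refine h1.trans (mul_le_mul_of_nonneg_left ?_ hM0)
  linarith

lemma memLp_rpow_quarter (hS : 0 < S) : MemLp (fun s => (S / s) ^ (1 / 4 : ℝ)) 2 (nu S) := by
  have hc : ContinuousOn (fun s : ℝ => (S / s) ^ (1 / 4 : ℝ)) (Ioo 0 S) := by
    refine ContinuousOn.rpow_const ?_ fun s hs => Or.inl (div_pos hS hs.1).ne'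
    exact continuousOn_const.div continuousOn_id fun s hs => hs.1.ne'
  rw [memLp_two_iff_integrable_sq (hc.aestronglyMeasurable measurableSet_Ioo)]
  refine ((integrableOn_inv_sqrt hS).const_mul (√S)).congr (ae_nu fun s hs => ?_)
  simp only
  rw [← Real.rpow_natCast, ← Real.rpow_mul (div_pos hS hs.1).le]
  norm_num
  rw [← Real.sqrt_eq_rpow, Real.sqrt_div hS.le]
  ring

lemma memLp_logPrim {g : ℝ → ℝ} {M : ℝ} (hS : 0 < S) (hg : ContinuousOn g (Ioc 0 S))
    (hM : ∀ s ∈ Ioc 0 S, |g s| ≤ M) : MemLp (logPrim S g) 2 (nu S) := by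
  refine (memLp_rpow_quarter hS).of_le_mul (c := M * 2)
    (((primLoc_logPrim hg).continuousOn.mono Ioo_subset_Ioc_self).aestronglyMeasurable
      measurableSet_Ioo) (ae_nu fun s hs => ?_)
  have h := abs_logPrim_le_rpow hg hM (Ioo_subset_Ioc_self hs)
  rw [← mul_assoc] at h
  exact h.trans (mul_le_mul_of_nonneg_left (le_abs_self _)
    (by linarith [(abs_nonneg _).trans (hM s (Ioo_subset_Ioc_self hs))]))

/-- Of √s = s^(1/4) s^(1/4), one factor compensates the growth of `logPrim` and the other tends to
zero. -/
lemma tendsto_logPrim_mul_sqrt {g f : ℝ → ℝ} {M N : ℝ} (hS : 0 < S) (hg : ContinuousOn g (Ioc 0 S))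
    (hM : ∀ s ∈ Ioc 0 S, |g s| ≤ M) (hN : ∀ s ∈ Ioc 0 S, |f s| ≤ N) :
    Tendsto (fun s => logPrim S g s * (√s * f s)) (𝓝[>] 0) (𝓝 0) := by
  have hlim : Tendsto (fun s : ℝ => M * 2 * S ^ (1 / 4 : ℝ) * N * s ^ (1 / 4 : ℝ)) (𝓝[>] 0)
      (𝓝 0) := by
    have h1 : ContinuousAt (fun s : ℝ => M * 2 * S ^ (1 / 4 : ℝ) * N * s ^ (1 / 4 : ℝ)) 0 :=
      continuousAt_const.mul (Real.continuousAt_rpow_const _ _ (Or.inr (by norm_num)))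
    have h2 := h1.tendsto
    rw [Real.zero_rpow (by norm_num), mul_zero] at h2
    exact h2.mono_left nhdsWithin_le_nhds
  refine squeeze_zero_norm' ?_ hlim
  filter_upwards [Ioc_mem_nhdsGT hS] with s hs
  have h1 := abs_logPrim_le_rpow hg hM hs
  rw [Real.norm_eq_abs, abs_mul, abs_mul, abs_of_nonneg (Real.sqrt_nonneg s)]
  have hM0 : 0 ≤ M := (abs_nonneg _).trans (hM s hs)
  have hsq : √s = s ^ (1 / 4 : ℝ) * s ^ (1 / 4 : ℝ) := by
    rw [← Real.rpow_add hs.1, Real.sqrt_eq_rpow]; norm_num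
  calc |logPrim S g s| * (√s * |f s|)
      ≤ M * (2 * (S / s) ^ (1 / 4 : ℝ)) * (√s * N) := by
        have : 0 ≤ M * (2 * (S / s) ^ (1 / 4 : ℝ)) := (abs_nonneg _).trans h1
        exact mul_le_mul h1 (mul_le_mul_of_nonneg_left (hN s hs) (Real.sqrt_nonneg s))
          (by positivity) this
    _ = M * 2 * S ^ (1 / 4 : ℝ) * N * s ^ (1 / 4 : ℝ) := by
        rw [Real.div_rpow hS.le hs.1.le, hsq]
        have : s ^ (1 / 4 : ℝ) ≠ 0 := (Real.rpow_pos_of_pos hs.1 _).ne'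
        field_simp

lemma integral_inv_two_sqrt {s : ℝ} (hs : s ∈ Ioc 0 S) :
    ∫ σ in s..S, 1 / (2 * √σ) = √S - √s :=
  PrimLoc.sqrt.integral_eq hs.1 hs.2 le_rfl

lemma abs_sqrtPrim_le {g : ℝ → ℝ} {M : ℝ} (hM : ∀ s ∈ Ioc 0 S, |g s| ≤ M) {s : ℝ} (hs : s ∈ Ioc 0 S) : |sqrtPrim S g s| ≤ M * √S := by
  have hM0 : 0 ≤ M := (abs_nonneg _).trans (hM s hs)
  have h1 : |sqrtPrim S g s| ≤ ∫ σ in s..S, M * (1 / (2 * √σ)) := by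
    rw [sqrtPrim, abs_neg, ← Real.norm_eq_abs]
    refine intervalIntegral.norm_integral_le_of_norm_le hs.2
      (Eventually.of_forall fun σ hσ => ?_) ((PrimLoc.sqrt.intervalIntegrable hs.1 hs.2
        le_rfl).const_mul M)
    rw [norm_div, Real.norm_of_nonneg (by positivity : 0 ≤ 2 * √σ), mul_one_div]
    exact div_le_div_of_nonneg_right (hM σ ⟨hs.1.trans hσ.1, hσ.2⟩) (by positivity)
  rw [intervalIntegral.integral_const_mul, integral_inv_two_sqrt hs] at h1
  exact h1.trans (mul_le_mul_of_nonneg_left (by linarith [Real.sqrt_nonneg s]) hM0)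

variable {I : Set ℝ}

lemma SupCont.sqrtPrim {g : ℝ → ℝ → ℝ} (hg : SupCont S I g) :
    SupCont S I (fun t => sqrtPrim S (g t)) := by
  have hsub : ∀ t ∈ I, ∀ ε : ℝ, 0 < ε → ∀ᶠ τ in 𝓝[I] t, ∀ s ∈ Ioc 0 S,
      |RadialNS.sqrtPrim S (g τ) s - RadialNS.sqrtPrim S (g t) s| ≤ ε * √S := by
    intro t ht ε hε
    filter_upwards [hg.tendsto_sup ht hε, self_mem_nhdsWithin] with τ h1 hτ s hs
    rw [sqrtPrim_sub (hg.cont τ hτ) (hg.cont t ht) hs]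
    exact abs_sqrtPrim_le (fun σ hσ => (h1 σ hσ).le) hs
  refine ⟨fun t ht => (primLoc_sqrtPrim (hg.cont t ht)).continuousOn, fun t ht => ?_, fun t ht => ?_⟩
  · obtain ⟨M, hM⟩ := hg.bdd t ht
    exact ⟨M * √S, fun s hs => abs_sqrtPrim_le hM hs⟩
  · rw [Metric.tendstoUniformlyOn_iff]
    intro ε hε
    filter_upwards [hsub t ht (ε / (√S + 1)) (by positivity)] with τ h1 s hs
    rw [dist_comm, Real.dist_eq]
    refine (h1 s hs).trans_lt ?_
    rw [div_mul_eq_mul_div, div_lt_iff₀ (by positivity)]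
    nlinarith

/-- Unlike 1/(2√σ), the weight 1/(2σ) is not integrable at 0, so uniform continuity in time is
weakened to continuity in L². -/
lemma SupCont.logPrim {g : ℝ → ℝ → ℝ} (hS : 0 < S) (hg : SupCont S I g) :
    L2Cont S I (fun t => logPrim S (g t)) where
  memLp t ht := by
    obtain ⟨M, hM⟩ := hg.bdd t ht
    exact memLp_logPrim hS (hg.cont t ht) hM
  cont t ht := by
    rw [ContinuousWithinAt, tendsto_iff_norm_sub_tendsto_zero, Metric.tendsto_nhds]
    intro ε hε
    set N := ‖toL2 (nu S) (fun s => (S / s) ^ (1 / 4 : ℝ))‖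
    have hN : 0 ≤ N := norm_nonneg _
    filter_upwards [hg.tendsto_sup ht (show 0 < ε / (2 * (N + 1)) by positivity),
      self_mem_nhdsWithin] with τ h1 hτ
    have m : ∀ τ ∈ I, MemLp (RadialNS.logPrim S (g τ)) 2 (nu S) := fun τ hτ => by
      obtain ⟨M, hM⟩ := hg.bdd τ hτ
      exact memLp_logPrim hS (hg.cont τ hτ) hM
    rw [dist_zero_right, norm_norm, ← toL2_sub (m τ hτ) (m t ht)]
    refine (norm_toL2_le_mul (M := ε / (2 * (N + 1)) * 2) ((m τ hτ).sub (m t ht))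
      (memLp_rpow_quarter hS) (ae_nu fun s hs => ?_)).trans_lt ?_
    · have hs' := Ioo_subset_Ioc_self hs
      rw [Pi.sub_apply, logPrim_sub (hg.cont τ hτ) (hg.cont t ht) hs', mul_assoc]
      refine (abs_logPrim_le_rpow ((hg.cont τ hτ).sub (hg.cont t ht))
        (fun σ hσ => (h1 σ hσ).le) hs').trans ?_
      gcongr
      exact le_abs_self _
    · calc ε / (2 * (N + 1)) * 2 * N = ε * (N / (N + 1)) := by field_simp
        _ < ε * 1 := by
          refine mul_lt_mul_of_pos_left ?_ hε
          rw [div_lt_one (by positivity)]; linarith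
        _ = ε := mul_one ε

/-! ### The mean over `(S/2, S)` -/

/-- The mean over `(S/2, S)`. -/
def tailMean (S : ℝ) (f : ℝ → ℝ) : ℝ :=
  ∫ s in Ioo 0 S, (Ioo (S / 2) S).indicator (fun _ => 2 / S) s * f s

lemma memLp_tail (S : ℝ) : MemLp ((Ioo (S / 2) S).indicator (fun _ => 2 / S)) 2 (nu S) :=
  (memLp_const (2 / S)).indicator measurableSet_Ioo

/-- The orthogonal-type projection `f ↦ f - ⟨f⟩` that annihilates the constants. -/
def removeMean (S : ℝ) : Lp ℝ 2 (nu S) →L[ℝ] Lp ℝ 2 (nu S) :=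
  ContinuousLinearMap.id ℝ _ -
    (innerSL ℝ (toL2 (nu S) ((Ioo (S / 2) S).indicator (fun _ => 2 / S)))).smulRight
      (toL2 (nu S) (fun _ => 1))

lemma removeMean_toL2 {f : ℝ → ℝ} (hf : MemLp f 2 (nu S)) :
    removeMean S (toL2 (nu S) f) = toL2 (nu S) (fun s => f s - tailMean S f) := by
  have h1 : (fun s => f s - tailMean S f) = fun s => f s - tailMean S f * (fun _ => (1 : ℝ)) s := by
    simp
  rw [h1, toL2_sub hf (memLp_const _), toL2_const_mul _ (memLp_const 1)]
  simp only [removeMean, sub_apply, ContinuousLinearMap.id_apply,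
    ContinuousLinearMap.smulRight_apply, innerSL_apply_apply, inner_toL2 (memLp_tail S) hf]
  rfl

lemma tailMean_const (hS : 0 < S) (c : ℝ) : tailMean S (fun _ => c) = c := by
  have h1 : ∀ s : ℝ, (Ioo (S / 2) S).indicator (fun _ => 2 / S) s * c
      = (Ioo (S / 2) S).indicator (fun _ => 2 / S * c) s := fun s => by
    by_cases hs : s ∈ Ioo (S / 2) S <;> simp [hs]
  simp only [tailMean, h1]
  rw [setIntegral_indicator measurableSet_Ioo,
    inter_eq_right.2 (Ioo_subset_Ioo_left (by linarith)), setIntegral_const]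
  rw [Measure.real, Real.volume_Ioo, ENNReal.toReal_ofReal (by linarith), smul_eq_mul]
  field_simp; ring

lemma tailMean_eq (hS : 0 < S) (f : ℝ → ℝ) : tailMean S f = 2 / S * ∫ s in Ioo (S / 2) S, f s := by
  have h1 : ∀ s : ℝ, (Ioo (S / 2) S).indicator (fun _ => 2 / S) s * f s
      = (Ioo (S / 2) S).indicator (fun s => 2 / S * f s) s := fun s => by
    by_cases hs : s ∈ Ioo (S / 2) S <;> simp [hs]
  simp only [tailMean, h1]
  rw [setIntegral_indicator measurableSet_Ioo,
    inter_eq_right.2 (Ioo_subset_Ioo_left (by linarith)), integral_const_mul]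

/-- By du Bois-Reymond, orthogonality to all ζ' leaves only constants, and constants equal their own
mean. This is the condition on the projection in `hasDerivAt_of_weak`. -/
lemma removeMean_eq_zero (hS : 0 < S) (g : Lp ℝ 2 (nu S))
    (h : ∀ χ ∈ {χ | ∃ ζ, IsTest 0 S ζ ∧ χ = toL2 (nu S) (deriv ζ)}, inner ℝ χ g = 0) :
    removeMean S g = 0 := by
  have hg2 : MemLp g 2 (nu S) := Lp.memLp g
  obtain ⟨c, hc⟩ := ae_eq_const_of_integral_deriv_eq_zero hS (g := g) (hg2.integrable (by norm_num))
    fun ζ hζ => by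
      have h1 := h _ ⟨ζ, hζ, rfl⟩
      obtain ⟨M, hM⟩ := hζ.deriv.exists_bound
      rw [← toL2_coeFn g, inner_toL2 (memLp_nu_of_bound hζ.deriv.1.continuous.continuousOn
        (fun s _ => hM s) 2) hg2] at h1
      refine Eq.trans ?_ h1
      exact integral_congr_ae (Eventually.of_forall fun s => mul_comm (g s) (_root_.deriv ζ s))
  have hgc : g = toL2 (nu S) (fun _ => c) := by
    rw [← toL2_coeFn g]
    exact toL2_congr hg2 ((ae_restrict_iff' measurableSet_Ioo).2 hc)
  rw [hgc, removeMean_toL2 (memLp_const c), tailMean_const hS]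
  simp only [sub_self]
  have := toL2_const_mul (μ := nu S) (f := fun _ => (1 : ℝ)) 0 (memLp_const 1)
  simpa using this

lemma eq_zero_of_inner_test {g : Lp ℝ 2 (nu S)}
    (h : ∀ χ ∈ {χ | ∃ ζ, IsTest 0 S ζ ∧ χ = toL2 (nu S) ζ}, inner ℝ χ g = 0) : g = 0 := by
  have hg2 : MemLp g 2 (nu S) := Lp.memLp g
  have h1 := isOpen_Ioo.ae_eq_zero_of_integral_contDiff_smul_eq_zero (μ := volume) (U := Ioo 0 S)
    (f := g) (IntegrableOn.locallyIntegrableOn (hg2.integrable (by norm_num)))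
    fun χ hχ hχc hχs => by
      have hT : IsTest 0 S χ := ⟨hχ, hχc, hχs⟩
      have h1 := h _ ⟨χ, hT, rfl⟩
      obtain ⟨M, hM⟩ := hT.exists_bound
      rw [← toL2_coeFn g, inner_toL2 (memLp_nu_of_bound hχ.continuous.continuousOn
        (fun s _ => hM s) 2) hg2] at h1
      rw [← h1, ← setIntegral_eq_integral_of_forall_compl_eq_zero (s := Ioo 0 S)]
      · rfl
      · intro x hx; simp [hT.eq_zero hx]
  rw [Lp.eq_zero_iff_ae_eq_zero]
  exact (ae_restrict_iff' measurableSet_Ioo).2 h1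

end

/-! ### Radial flows and the differentiation of kinetic energies -/

section

/-- The radial form of the equations in the variable `s = |x|²`: `P` is the density, `v`, `w` are
the radial and the angular velocity, `d`, `c` the derivatives of `√s v`, `√s w`, and `Q / (2√s)` is
the derivative of `P`. The equations hold weakly in `s` and classically in time. -/
structure RadialFlow (μ β γ S T : ℝ) (P v w Q d c : ℝ → ℝ → ℝ) : Prop where
  supP : SupCont S (Icc 0 T) P
  supv : SupCont S (Icc 0 T) v
  supw : SupCont S (Icc 0 T) w
  l2Q : L2Cont S (Icc 0 T) Q
  l2d : L2Cont S (Icc 0 T) d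
  l2c : L2Cont S (Icc 0 T) c
  nonneg : ∀ t ∈ Icc 0 T, ∀ s ∈ Ioc 0 S, 0 ≤ P t s
  primP : ∀ t ∈ Icc 0 T, PrimLoc S (P t) (fun s => Q t s / (2 * √s))
  primV : ∀ t ∈ Icc 0 T, PrimLoc S (fun s => √s * v t s) (d t)
  primW : ∀ t ∈ Icc 0 T, PrimLoc S (fun s => √s * w t s) (c t)
  v_end : ∀ t ∈ Icc 0 T, v t S = 0
  w_end : ∀ t ∈ Icc 0 T, w t S = 0
  continuity : ∀ χ, IsTest 0 S χ → ∀ t ∈ Ioo 0 T,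
    HasDerivAt (fun τ => ∫ s in Ioo 0 S, P τ s * χ s)
      (2 * ∫ s in Ioo 0 S, P t s * (√s * v t s) * deriv χ s) t
  radial : ∀ ζ, IsTest 0 S ζ → ∀ t ∈ Ioo 0 T,
    HasDerivAt (fun τ => ∫ s in Ioo 0 S, P τ s * v τ s / √s * ζ s)
      (∫ s in Ioo 0 S, (2 * (P t s * v t s ^ 2) * deriv ζ s
        - P t s * (v t s ^ 2 - w t s ^ 2) / s * ζ s
        - 2 * (2 * (2 * μ + P t s ^ β) * d t s - P t s ^ γ) * deriv ζ s)) t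
  angular : ∀ ζ, IsTest 0 S ζ → ∀ t ∈ Ioo 0 T,
    HasDerivAt (fun τ => ∫ s in Ioo 0 S, P τ s * w τ s / √s * ζ s)
      (∫ s in Ioo 0 S, (2 * (P t s * v t s * w t s) * deriv ζ s
        - 2 * (P t s * v t s * w t s) / s * ζ s - 4 * μ * c t s * deriv ζ s)) t

lemma IsTest.memLp {a b : ℝ} {S : ℝ} {χ : ℝ → ℝ} (h : IsTest a b χ) : MemLp χ 2 (nu S) := by
  obtain ⟨M, hM⟩ := h.exists_bound
  exact memLp_nu_of_bound h.1.continuous.continuousOn (fun s _ => hM s) 2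

variable {S : ℝ} {I : Set ℝ}

/-- Integration by parts against (√s y)' = e. The potential vanishes at S and √s y vanishes at the
axis. Kinetic energies thus become pairings of the momentum potential with e. -/
lemma integral_sqrtPrim_mul {f y e : ℝ → ℝ} {M N : ℝ} (hS : 0 < S) (hf : ContinuousOn f (Ioc 0 S))
    (hM : ∀ s ∈ Ioc 0 S, |f s| ≤ M) (hy : PrimLoc S (fun s => √s * y s) e)
    (hyc : ContinuousOn y (Ioc 0 S)) (hN : ∀ s ∈ Ioc 0 S, |y s| ≤ N) (he : MemLp e 2 (nu S)) :
    ∫ s in Ioo 0 S, f s * y s = -2 * ∫ s in Ioo 0 S, sqrtPrim S f s * e s := by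
  have hξb : ∀ s ∈ Ioc 0 S, |sqrtPrim S f s| ≤ M * √S := fun s hs => abs_sqrtPrim_le hM hs
  have hξc := (primLoc_sqrtPrim hf).continuousOn
  have hξ : MemLp (sqrtPrim S f) 2 (nu S) :=
    memLp_nu_of_bound (hξc.mono Ioo_subset_Ioc_self) (fun s hs => hξb s (Ioo_subset_Ioc_self hs)) 2
  have hp : PrimLoc S (fun s => sqrtPrim S f s * (√s * y s))
      (fun s => 1 / 2 * (f s * y s) + sqrtPrim S f s * e s) :=
    ((primLoc_sqrtPrim hf).mul hy).congr_deriv fun s hs => by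
      have : 0 < √s := Real.sqrt_pos.2 hs.1
      field_simp
  have i1 : IntegrableOn (fun s => 1 / 2 * (f s * y s)) (Ioo 0 S) := by
    refine (((memLp_nu_of_bound (hf.mono Ioo_subset_Ioc_self)
      (fun s hs => hM s (Ioo_subset_Ioc_self hs)) 2)).integrable_mul
      (memLp_nu_of_bound (hyc.mono Ioo_subset_Ioc_self)
        (fun s hs => hN s (Ioo_subset_Ioc_self hs)) 2)).const_mul (1 / 2)
  have i2 : IntegrableOn (fun s => sqrtPrim S f s * e s) (Ioo 0 S) := hξ.integrable_mul he
  have := hp.integral_eq_of_tendsto hS (i1.add i2) (l := 0) (by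
    have := tendsto_sqrt_mul_zero (f := fun s => sqrtPrim S f s * y s) (M := M * √S * N) hS
      fun s hs => by
        rw [abs_mul]
        exact mul_le_mul (hξb s hs) (hN s hs) (abs_nonneg _) ((abs_nonneg _).trans (hξb s hs))
    exact this.congr fun s => by ring)
  rw [integral_add i1 i2, integral_const_mul, sqrtPrim_end, zero_mul, sub_zero] at this
  linarith

/-- Integration by parts again: `logPrim` vanishes at S, and its growth at the axis is beaten by √s.
The result has the form of the inertial terms f y / r. -/
lemma integral_logPrim_mul {f y e : ℝ → ℝ} {M N : ℝ} (hS : 0 < S) (hf : ContinuousOn f (Ioc 0 S))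
    (hM : ∀ s ∈ Ioc 0 S, |f s| ≤ M) (hy : PrimLoc S (fun s => √s * y s) e)
    (hyc : ContinuousOn y (Ioc 0 S)) (hN : ∀ s ∈ Ioc 0 S, |y s| ≤ N) (he : MemLp e 2 (nu S)) :
    ∫ s in Ioo 0 S, logPrim S f s * e s = 1 / 2 * ∫ s in Ioo 0 S, f s * y s / √s := by
  have hp : PrimLoc S (fun s => logPrim S f s * (√s * y s))
      (fun s => (-(1 / 2)) * (f s * y s / √s) + logPrim S f s * e s) :=
    ((primLoc_logPrim hf).mul hy).congr_deriv fun s hs => by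
      have h0 : 0 < √s := Real.sqrt_pos.2 hs.1
      have : s = √s * √s := (Real.mul_self_sqrt hs.1.le).symm
      have h1 : f s / (2 * s) * (√s * y s) = 1 / 2 * (f s * y s / √s) := by
        rw [this, Real.sqrt_mul_self (Real.sqrt_nonneg s)]; field_simp
      linarith
  have i1 : IntegrableOn (fun s => (-(1 / 2)) * (f s * y s / √s)) (Ioo 0 S) :=
    (integrableOn_bdd_div_sqrt (f := fun s => f s * y s) (M := M * N) hS (hf.mul hyc)
      fun s hs => by
        rw [abs_mul]
        exact mul_le_mul (hM s hs) (hN s hs) (abs_nonneg _)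
          ((abs_nonneg _).trans (hM s hs))).const_mul _
  have i2 : IntegrableOn (fun s => logPrim S f s * e s) (Ioo 0 S) :=
    (memLp_logPrim hS hf hM).integrable_mul he
  have := hp.integral_eq_of_tendsto hS (i1.add i2) (tendsto_logPrim_mul_sqrt hS hf hM hN)
  rw [integral_add i1 i2, integral_const_mul, logPrim_end, zero_mul, sub_zero] at this
  linarith

/-- There is no flux through the axis or the wall. Hence a potential may be shifted by any constant
before it is paired with e, and the unknown function of time in the momentum potential plays no role
in the energy. -/
lemma integral_deriv_eq_zero {y e : ℝ → ℝ} {N : ℝ} (hS : 0 < S)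
    (hy : PrimLoc S (fun s => √s * y s) e) (hN : ∀ s ∈ Ioc 0 S, |y s| ≤ N) (hyS : y S = 0)
    (he : MemLp e 2 (nu S)) : ∫ s in Ioo 0 S, e s = 0 := by
  have := hy.integral_eq_of_tendsto hS (he.integrable (by norm_num)) (tendsto_sqrt_mul_zero hS hN)
  rw [this, hyS, mul_zero, sub_zero]

lemma integral_sub_const_mul {f e : ℝ → ℝ} (m : ℝ) (hf : MemLp f 2 (nu S)) (he : MemLp e 2 (nu S))
    (h0 : ∫ s in Ioo 0 S, e s = 0) :
    ∫ s in Ioo 0 S, (f s - m) * e s = ∫ s in Ioo 0 S, f s * e s := by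
  have i1 : IntegrableOn (fun s => f s * e s) (Ioo 0 S) := hf.integrable_mul he
  have i2 : IntegrableOn (fun s => m * e s) (Ioo 0 S) := (he.integrable (by norm_num)).const_mul m
  simp only [sub_mul]
  rw [integral_sub i1 i2, integral_const_mul, h0, mul_zero, sub_zero]

lemma memLp_sub_const {f : ℝ → ℝ} (m : ℝ) (hf : MemLp f 2 (nu S)) :
    MemLp (fun s => f s - m) 2 (nu S) := hf.sub (memLp_const m)

/-- The time derivative of `∫ P y²`, in terms of the time derivatives of `P` and of the potential
of the momentum `P y`. -/
theorem hasDerivAt_kinetic {P y e : ℝ → ℝ → ℝ} (hS : 0 < S) {T : ℝ}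
    (hP : SupCont S (Icc 0 T) P) (hy : SupCont S (Icc 0 T) y) (he : L2Cont S (Icc 0 T) e)
    (hprim : ∀ t ∈ Icc 0 T, PrimLoc S (fun s => √s * y t s) (e t))
    (hend : ∀ t ∈ Icc 0 T, y t S = 0) {P' Ξ : ℝ → ℝ} {t m : ℝ} (ht : t ∈ Ioo 0 T)
    (hP' : MemLp P' 2 (nu S)) (hΞ : MemLp Ξ 2 (nu S))
    (hdP : HasDerivAt (fun τ => toL2 (nu S) (P τ)) (toL2 (nu S) P') t)
    (hdξ : HasDerivAt (fun τ => toL2 (nu S) (fun s => sqrtPrim S (fun σ => P τ σ * y τ σ) s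
        - tailMean S (sqrtPrim S (fun σ => P τ σ * y τ σ))))
      (toL2 (nu S) (fun s => Ξ s - m)) t) :
    HasDerivAt (fun τ => ∫ s in Ioo 0 S, P τ s * y τ s ^ 2)
      (-4 * (∫ s in Ioo 0 S, Ξ s * e t s) - ∫ s in Ioo 0 S, P' s * y t s ^ 2) t := by
  have htI : t ∈ Icc 0 T := Ioo_subset_Icc_self ht
  have hn : Icc 0 T ∈ 𝓝 t := Icc_mem_nhds ht.1 ht.2
  have hPy := hP.mul hy
  have hξ := hPy.sqrtPrim
  have h0 : ∀ τ ∈ Icc 0 T, ∫ s in Ioo 0 S, e τ s = 0 := fun τ hτ => by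
    obtain ⟨N, hN⟩ := hy.bdd τ hτ
    exact integral_deriv_eq_zero hS (hprim τ hτ) hN (hend τ hτ) (he.memLp τ hτ)
  -- The momentum at one time paired with the velocity at another, expressed through the potential.
  have cross : ∀ a ∈ Icc 0 T, ∀ b ∈ Icc 0 T, ∫ s in Ioo 0 S, P a s * y a s * y b s
      = -2 * inner ℝ (toL2 (nu S) (fun s => sqrtPrim S (fun σ => P a σ * y a σ) s
        - tailMean S (sqrtPrim S (fun σ => P a σ * y a σ)))) (toL2 (nu S) (e b)) := by
    intro a ha b hb
    obtain ⟨M, hM⟩ := hPy.bdd a ha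
    obtain ⟨N, hN⟩ := hy.bdd b hb
    rw [integral_sqrtPrim_mul hS (hPy.cont a ha) hM (hprim b hb) (hy.cont b hb) hN
      (he.memLp b hb), inner_toL2 (memLp_sub_const _ (hξ.memLp ha 2)) (he.memLp b hb),
      integral_sub_const_mul _ (hξ.memLp ha 2) (he.memLp b hb) (h0 b hb)]
  set A := fun τ => toL2 (nu S) (fun s => sqrtPrim S (fun σ => P τ σ * y τ σ) s
        - tailMean S (sqrtPrim S (fun σ => P τ σ * y τ σ))) with hA
  have hyc := hy.l2Cont
  have hsq : L2Cont S (Icc 0 T) (fun τ s => y τ s * y t s) :=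
    (hy.mul (SupCont.const (hy.cont t htI) (hy.bdd t htI))).l2Cont
  have hD : ContinuousAt (fun τ => toL2 (nu S) (e τ) + toL2 (nu S) (e t)) t :=
    (he.cont.continuousAt hn).add continuousAt_const
  -- The increment is split as P_τ y_τ² - P_t y_t² = (P_τ y_τ - P_t y_t)(y_τ + y_t) - (P_τ - P_t)
  -- y_τ y_t. After `cross`, each term pairs the increment of something differentiable in L² with
  -- something that is only continuous, so y needs no time derivative.
  have d1 := (hasDerivAt_inner_sub hdξ hD).const_mul (-2)
  have d2 := hasDerivAt_inner_sub hdP (hsq.cont.continuousAt hn)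
  have d3 := ((d1.sub d2).const_add (∫ s in Ioo 0 S, P t s * y t s ^ 2))
  have e1 : inner ℝ (toL2 (nu S) (fun s => Ξ s - m)) (toL2 (nu S) (e t) + toL2 (nu S) (e t))
      = 2 * ∫ s in Ioo 0 S, Ξ s * e t s := by
    rw [inner_add_right, inner_toL2 (memLp_sub_const _ hΞ) (he.memLp t htI),
      integral_sub_const_mul _ hΞ (he.memLp t htI) (h0 t htI)]
    ring
  have e2 : inner ℝ (toL2 (nu S) P') (toL2 (nu S) (fun s => y t s * y t s))
      = ∫ s in Ioo 0 S, P' s * y t s ^ 2 := by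
    rw [inner_toL2 hP' (hsq.memLp t htI)]
    simp only [sq]
  rw [e1, e2] at d3
  have d4 : HasDerivAt (fun τ => (∫ s in Ioo 0 S, P t s * y t s ^ 2)
      + (-2 * inner ℝ (A τ - A t) (toL2 (nu S) (e τ) + toL2 (nu S) (e t))
        - inner ℝ (toL2 (nu S) (P τ) - toL2 (nu S) (P t))
            (toL2 (nu S) (fun s => y τ s * y t s))))
      (-4 * (∫ s in Ioo 0 S, Ξ s * e t s) - ∫ s in Ioo 0 S, P' s * y t s ^ 2) t := by
    exact d3.congr_deriv (by ring)
  refine d4.congr_of_eventuallyEq ?_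
  filter_upwards [hn] with τ hτ
  have c1 := cross τ hτ τ hτ
  have c2 := cross τ hτ t htI
  have c3 := cross t htI τ hτ
  have c4 := cross t htI t htI
  have hP2 := hP.l2Cont
  have q : inner ℝ (toL2 (nu S) (P τ) - toL2 (nu S) (P t)) (toL2 (nu S) (fun s => y τ s * y t s))
      = (∫ s in Ioo 0 S, P τ s * y τ s * y t s) - ∫ s in Ioo 0 S, P t s * y t s * y τ s := by
    rw [inner_sub_left, inner_toL2 (hP2.memLp τ hτ) (hsq.memLp τ hτ),
      inner_toL2 (hP2.memLp t htI) (hsq.memLp τ hτ)]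
    congr 1
    · exact integral_congr_ae (Eventually.of_forall fun s => by simp only; ring)
    · exact integral_congr_ae (Eventually.of_forall fun s => by simp only; ring)
  have r1 : ∫ s in Ioo 0 S, P τ s * y τ s ^ 2 = ∫ s in Ioo 0 S, P τ s * y τ s * y τ s :=
    integral_congr_ae (Eventually.of_forall fun s => by simp only; ring)
  have r2 : ∫ s in Ioo 0 S, P t s * y t s ^ 2 = ∫ s in Ioo 0 S, P t s * y t s * y t s :=
    integral_congr_ae (Eventually.of_forall fun s => by simp only; ring)
  rw [q, r1, r2, inner_add_right, inner_sub_left, inner_sub_left]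
  linarith

lemma integral_deriv_mul_sqrtPrim {f ζ : ℝ → ℝ} (hS : 0 < S) (hf : ContinuousOn f (Ioc 0 S))
    (hζ : IsTest 0 S ζ) :
    ∫ s in Ioo 0 S, deriv ζ s * sqrtPrim S f s = -(1 / 2) * ∫ s in Ioo 0 S, f s / √s * ζ s := by
  have := (primLoc_sqrtPrim hf).integral_mul_deriv_test hS hζ
  rw [← integral_const_mul]
  rw [show (∫ s in Ioo 0 S, deriv ζ s * sqrtPrim S f s) = ∫ s in Ioo 0 S, sqrtPrim S f s * deriv ζ s
    from integral_congr_ae (Eventually.of_forall fun s => mul_comm _ _), this, ← integral_neg]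
  exact setIntegral_congr_fun measurableSet_Ioo fun s hs => by ring


namespace RadialFlow

variable {μ β γ T : ℝ} {P v w Q d c : ℝ → ℝ → ℝ}

/-- The time derivative of the density. -/
def dP (P v Q d : ℝ → ℝ → ℝ) (t s : ℝ) : ℝ := (-1) * (Q t s * v t s + 2 * (d t s * P t s))

/-- The effective viscous flux. -/
def flux (μ β γ : ℝ) (P d : ℝ → ℝ → ℝ) (t s : ℝ) : ℝ :=
  2 * (d t s * (2 * μ + P t s ^ β)) - P t s ^ γ

/-- The time derivative of the potential of the radial momentum, up to a constant. -/
def dXi (μ β γ S : ℝ) (P v w d : ℝ → ℝ → ℝ) (t s : ℝ) : ℝ :=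
  flux μ β γ P d t s - P t s * v t s ^ 2
    + logPrim S (fun σ => P t σ * (v t σ ^ 2 - w t σ ^ 2)) s

/-- The time derivative of the potential of the angular momentum, up to a constant. -/
def dOm (μ S : ℝ) (P v w c : ℝ → ℝ → ℝ) (t s : ℝ) : ℝ :=
  2 * μ * c t s - P t s * v t s * w t s + 2 * logPrim S (fun σ => P t σ * v t σ * w t σ) s

section

variable (h : RadialFlow μ β γ S T P v w Q d c) (hS : 0 < S) (hβ : 1 ≤ β) (hγ : 1 < γ)

include h

lemma supV2 : SupCont S (Icc 0 T) (fun t s => P t s * v t s ^ 2) :=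
  h.supP.mul (h.supv.comp (Ψ := fun x => x ^ 2) (by fun_prop))

lemma supVW2 : SupCont S (Icc 0 T) (fun t s => P t s * (v t s ^ 2 - w t s ^ 2)) :=
  h.supP.mul ((h.supv.comp (Ψ := fun x => x ^ 2) (by fun_prop)).sub
    (h.supw.comp (Ψ := fun x => x ^ 2) (by fun_prop)))

lemma supVW : SupCont S (Icc 0 T) (fun t s => P t s * v t s * w t s) :=
  (h.supP.mul h.supv).mul h.supw

lemma l2dP : L2Cont S (Icc 0 T) (dP P v Q d) :=
  ((h.l2Q.mul h.supv).add ((h.l2d.mul h.supP).const_mul 2)).const_mul (-1)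

include hβ hγ in
lemma l2flux : L2Cont S (Icc 0 T) (flux μ β γ P d) :=
  ((h.l2d.mul (h.supP.comp (Ψ := fun x => 2 * μ + x ^ β)
    (continuous_const.add (Real.continuous_rpow_const (by linarith))))).const_mul 2).sub
    (h.supP.comp (Ψ := fun x => x ^ γ) (Real.continuous_rpow_const (by linarith))).l2Cont

include hS hβ hγ in
lemma l2dXi : L2Cont S (Icc 0 T) (dXi μ β γ S P v w d) :=
  ((h.l2flux hβ hγ).sub h.supV2.l2Cont).add (SupCont.logPrim hS h.supVW2)

include hS in
lemma l2dOm : L2Cont S (Icc 0 T) (dOm μ S P v w c) :=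
  ((h.l2c.const_mul (2 * μ)).sub h.supVW.l2Cont).add ((SupCont.logPrim hS h.supVW).const_mul 2)

/-- By the product rule, `dP` is -2 times the s-derivative of the mass flux P √s v: the strong form
of the continuity equation. -/
lemma primPV {t : ℝ} (ht : t ∈ Icc 0 T) :
    PrimLoc S (fun s => P t s * (√s * v t s)) (fun s => -(1 / 2) * dP P v Q d t s) :=
  ((h.primP t ht).mul (h.primV t ht)).congr_deriv fun s hs => by
    have : 0 < √s := Real.sqrt_pos.2 hs.1
    rw [dP]; field_simp

include hS in
-- The weak time derivative `dP` is continuous in time with values in L², so it is a genuine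
-- derivative in L².
theorem hasDerivAt_density {t : ℝ} (ht : t ∈ Ioo 0 T) :
    HasDerivAt (fun τ => toL2 (nu S) (P τ)) (toL2 (nu S) (dP P v Q d t)) t := by
  refine hasDerivAt_of_weak (ContinuousLinearMap.id ℝ _)
    {χ | ∃ ζ, IsTest 0 S ζ ∧ χ = toL2 (nu S) ζ} (fun g hg => eq_zero_of_inner_test hg)
    (h.l2dP.cont.mono Ioo_subset_Icc_self) ?_ ht
  rintro _ ⟨χ, hχ, rfl⟩ t ht
  have htI := Ioo_subset_Icc_self ht
  have e : inner ℝ (toL2 (nu S) χ) (toL2 (nu S) (dP P v Q d t))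
      = 2 * ∫ s in Ioo 0 S, P t s * (√s * v t s) * deriv χ s := by
    rw [inner_toL2 hχ.memLp (h.l2dP.memLp t htI), (h.primPV htI).integral_mul_deriv_test hS hχ,
      ← integral_neg, ← integral_const_mul]
    exact integral_congr_ae (Eventually.of_forall fun s => by simp only; ring)
  rw [e]
  refine (h.continuity χ hχ t ht).congr_of_eventuallyEq ?_
  filter_upwards [Ioo_mem_nhds ht.1 ht.2] with τ hτ
  rw [inner_toL2 hχ.memLp (h.supP.memLp (Ioo_subset_Icc_self hτ) 2)]
  exact integral_congr_ae (Eventually.of_forall fun s => mul_comm _ _)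

end

end RadialFlow

end

/-! ### Time derivatives of the momentum potentials, and the energy identity -/

section

variable {S : ℝ} {I : Set ℝ}

lemma integral_sub_add' {f g k : ℝ → ℝ} {A : Set ℝ} (hf : IntegrableOn f A) (hg : IntegrableOn g A)
    (hk : IntegrableOn k A) :
    ∫ s in A, (f s - g s + k s) = (∫ s in A, f s) - (∫ s in A, g s) + ∫ s in A, k s := by
  rw [← integral_sub hf hg]; exact integral_add (hf.sub hg) hk

lemma integral_sub_sub' {f g k : ℝ → ℝ} {A : Set ℝ} (hf : IntegrableOn f A) (hg : IntegrableOn g A)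
    (hk : IntegrableOn k A) :
    ∫ s in A, (f s - g s - k s) = (∫ s in A, f s) - (∫ s in A, g s) - ∫ s in A, k s := by
  rw [← integral_sub hf hg]; exact integral_sub (hf.sub hg) hk

lemma integral_add_sub' {f g k : ℝ → ℝ} {A : Set ℝ} (hf : IntegrableOn f A) (hg : IntegrableOn g A)
    (hk : IntegrableOn k A) :
    ∫ s in A, (f s + g s - k s) = (∫ s in A, f s) + (∫ s in A, g s) - ∫ s in A, k s := by
  rw [← integral_add hf hg]; exact integral_sub (hf.add hg) hk

lemma integral_deriv_mul_logPrim {f ζ : ℝ → ℝ} (hS : 0 < S) (hf : ContinuousOn f (Ioc 0 S))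
    (hζ : IsTest 0 S ζ) :
    ∫ s in Ioo 0 S, deriv ζ s * logPrim S f s = 1 / 2 * ∫ s in Ioo 0 S, f s / s * ζ s := by
  have := (primLoc_logPrim hf).integral_mul_deriv_test hS hζ
  rw [← integral_const_mul]
  rw [show (∫ s in Ioo 0 S, deriv ζ s * logPrim S f s) = ∫ s in Ioo 0 S, logPrim S f s * deriv ζ s
    from integral_congr_ae (Eventually.of_forall fun s => mul_comm _ _), this, ← integral_neg]
  exact setIntegral_congr_fun measurableSet_Ioo fun s hs => by ring

lemma IsTest.integrableOn_div_mul {f ζ : ℝ → ℝ} (hS : 0 < S) (hf : ContinuousOn f (Ioc 0 S))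
    (hζ : IsTest 0 S ζ) : IntegrableOn (fun s => f s / s * ζ s) (Ioo 0 S) := by
  refine hζ.integrableOn_mul_left hS fun a b ha hab hb => ContinuousOn.integrableOn_Icc ?_
  exact (hf.mono fun s hs => ⟨ha.trans_le hs.1, hs.2.trans hb⟩).div continuousOn_id
    fun s hs => (ha.trans_le hs.1).ne'

/-- A weak formulation of `∂ₜ ∫ f / (2√s) = Ξ`, tested with derivatives, determines the time
derivative of the primitive up to a constant. -/
theorem hasDerivAt_sqrtPrim {f Ξ : ℝ → ℝ → ℝ} (hS : 0 < S) {T : ℝ}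
    (hf : SupCont S (Icc 0 T) f) (hΞ : L2Cont S (Icc 0 T) Ξ)
    (hw : ∀ ζ, IsTest 0 S ζ → ∀ t ∈ Ioo 0 T,
      HasDerivAt (fun τ => ∫ s in Ioo 0 S, f τ s / √s * ζ s)
        (-2 * ∫ s in Ioo 0 S, deriv ζ s * Ξ t s) t) {t : ℝ} (ht : t ∈ Ioo 0 T) :
    HasDerivAt (fun τ => toL2 (nu S) (fun s => sqrtPrim S (f τ) s - tailMean S (sqrtPrim S (f τ))))
      (toL2 (nu S) (fun s => Ξ t s - tailMean S (Ξ t))) t := by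
  -- Tests of the form ζ' determine the potential only up to a function of time, and subtracting the
  -- mean over (S/2, S) fixes it.
  have h1 := hasDerivAt_of_weak (A := fun τ => toL2 (nu S) (sqrtPrim S (f τ)))
    (Ξ := fun τ => toL2 (nu S) (Ξ τ)) (removeMean S)
    {χ | ∃ ζ, IsTest 0 S ζ ∧ χ = toL2 (nu S) (deriv ζ)} (removeMean_eq_zero hS)
    (hΞ.cont.mono Ioo_subset_Icc_self) (by
      rintro _ ⟨ζ, hζ, rfl⟩ t ht
      rw [inner_toL2 hζ.deriv.memLp (hΞ.memLp t (Ioo_subset_Icc_self ht))]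
      have h2 := (hw ζ hζ t ht).const_mul (-(1 / 2))
      refine (h2.congr_deriv (by ring)).congr_of_eventuallyEq ?_
      filter_upwards [Ioo_mem_nhds ht.1 ht.2] with τ hτ
      have hτI := Ioo_subset_Icc_self hτ
      rw [inner_toL2 hζ.deriv.memLp (hf.sqrtPrim.memLp hτI 2),
        integral_deriv_mul_sqrtPrim hS (hf.cont τ hτI) hζ]) ht
  rw [removeMean_toL2 (hΞ.memLp t (Ioo_subset_Icc_self ht))] at h1
  refine h1.congr_of_eventuallyEq ?_
  filter_upwards [Ioo_mem_nhds ht.1 ht.2] with τ hτ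
  rw [removeMean_toL2 (hf.sqrtPrim.memLp (Ioo_subset_Icc_self hτ) 2)]

namespace RadialFlow

variable {μ β γ T : ℝ} {P v w Q d c : ℝ → ℝ → ℝ}

section

variable (h : RadialFlow μ β γ S T P v w Q d c) (hS : 0 < S) (hβ : 1 ≤ β) (hγ : 1 < γ)

include h hS

include hβ hγ in
-- This is the radial momentum equation integrated once in r. The geometric source P(v² - w²)/s
-- tested with ζ turns into the nonlocal `logPrim` term tested with ζ'.
theorem hasDerivAt_xi {t : ℝ} (ht : t ∈ Ioo 0 T) :
    HasDerivAt (fun τ => toL2 (nu S) (fun s => sqrtPrim S (fun σ => P τ σ * v τ σ) s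
        - tailMean S (sqrtPrim S (fun σ => P τ σ * v τ σ))))
      (toL2 (nu S) (fun s => dXi μ β γ S P v w d t s - tailMean S (dXi μ β γ S P v w d t))) t := by
  refine hasDerivAt_sqrtPrim hS (h.supP.mul h.supv) (h.l2dXi hS hβ hγ) (fun ζ hζ t ht => ?_) ht
  refine (h.radial ζ hζ t ht).congr_deriv ?_
  have htI := Ioo_subset_Icc_self ht
  have hF := (h.l2flux hβ hγ).memLp t htI
  have hV := h.supV2.memLp htI 2
  obtain ⟨M, hM⟩ := h.supVW2.bdd t htI
  have hL := memLp_logPrim hS (h.supVW2.cont t htI) hM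
  have hζ' := hζ.deriv.memLp (S := S)
  have i1 : IntegrableOn (fun s => deriv ζ s * flux μ β γ P d t s) (Ioo 0 S) :=
    hζ'.integrable_mul hF
  have i2 : IntegrableOn (fun s => deriv ζ s * (P t s * v t s ^ 2)) (Ioo 0 S) :=
    hζ'.integrable_mul hV
  have i3 : IntegrableOn (fun s => deriv ζ s
      * logPrim S (fun σ => P t σ * (v t σ ^ 2 - w t σ ^ 2)) s) (Ioo 0 S) := hζ'.integrable_mul hL
  have i4 := hζ.integrableOn_div_mul hS (h.supVW2.cont t htI)
  have e1 : ∫ s in Ioo 0 S, deriv ζ s * dXi μ β γ S P v w d t s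
      = (∫ s in Ioo 0 S, deriv ζ s * flux μ β γ P d t s)
        - (∫ s in Ioo 0 S, deriv ζ s * (P t s * v t s ^ 2))
        + 1 / 2 * ∫ s in Ioo 0 S, P t s * (v t s ^ 2 - w t s ^ 2) / s * ζ s := by
    rw [← integral_deriv_mul_logPrim hS (h.supVW2.cont t htI) hζ,
      ← integral_sub_add' i1 i2 i3]
    exact integral_congr_ae (Eventually.of_forall fun s => by simp only [dXi]; ring)
  rw [e1]
  have e2 : ∀ s, 2 * (P t s * v t s ^ 2) * deriv ζ s
        - P t s * (v t s ^ 2 - w t s ^ 2) / s * ζ s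
        - 2 * (2 * (2 * μ + P t s ^ β) * d t s - P t s ^ γ) * deriv ζ s
      = 2 * (deriv ζ s * (P t s * v t s ^ 2)) - P t s * (v t s ^ 2 - w t s ^ 2) / s * ζ s
        - 2 * (deriv ζ s * flux μ β γ P d t s) := fun s => by rw [flux]; ring
  simp only [e2]
  rw [integral_sub_sub' (i2.const_mul 2) i4 (i1.const_mul 2),
    integral_const_mul, integral_const_mul]
  ring

theorem hasDerivAt_om {t : ℝ} (ht : t ∈ Ioo 0 T) :
    HasDerivAt (fun τ => toL2 (nu S) (fun s => sqrtPrim S (fun σ => P τ σ * w τ σ) s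
        - tailMean S (sqrtPrim S (fun σ => P τ σ * w τ σ))))
      (toL2 (nu S) (fun s => dOm μ S P v w c t s - tailMean S (dOm μ S P v w c t))) t := by
  refine hasDerivAt_sqrtPrim hS (h.supP.mul h.supw) (h.l2dOm hS) (fun ζ hζ t ht => ?_) ht
  refine (h.angular ζ hζ t ht).congr_deriv ?_
  have htI := Ioo_subset_Icc_self ht
  have hc := h.l2c.memLp t htI
  have hV := h.supVW.memLp htI 2
  obtain ⟨M, hM⟩ := h.supVW.bdd t htI
  have hL := memLp_logPrim hS (h.supVW.cont t htI) hM
  have hζ' := hζ.deriv.memLp (S := S)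
  have i1 : IntegrableOn (fun s => 2 * μ * (deriv ζ s * c t s)) (Ioo 0 S) :=
    (hζ'.integrable_mul hc).const_mul _
  have i2 : IntegrableOn (fun s => deriv ζ s * (P t s * v t s * w t s)) (Ioo 0 S) :=
    hζ'.integrable_mul hV
  have i3 : IntegrableOn (fun s => 2 * (deriv ζ s
      * logPrim S (fun σ => P t σ * v t σ * w t σ) s)) (Ioo 0 S) :=
    (hζ'.integrable_mul hL).const_mul _
  have i4 := hζ.integrableOn_div_mul hS (h.supVW.cont t htI)
  have e1 : ∫ s in Ioo 0 S, deriv ζ s * dOm μ S P v w c t s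
      = (∫ s in Ioo 0 S, 2 * μ * (deriv ζ s * c t s))
        - (∫ s in Ioo 0 S, deriv ζ s * (P t s * v t s * w t s))
        + 2 * (1 / 2 * ∫ s in Ioo 0 S, P t s * v t s * w t s / s * ζ s) := by
    rw [← integral_deriv_mul_logPrim hS (h.supVW.cont t htI) hζ,
      ← integral_const_mul, ← integral_sub_add' i1 i2 i3]
    exact integral_congr_ae (Eventually.of_forall fun s => by simp only [dOm]; ring)
  rw [e1]
  have e2 : ∀ s, 2 * (P t s * v t s * w t s) * deriv ζ s
        - 2 * (P t s * v t s * w t s) / s * ζ s - 4 * μ * c t s * deriv ζ s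
      = 2 * (deriv ζ s * (P t s * v t s * w t s)) - 2 * (P t s * v t s * w t s / s * ζ s)
        - 2 * (2 * μ * (deriv ζ s * c t s)) := fun s => by ring
  simp only [e2]
  rw [integral_sub_sub' (i2.const_mul 2) (i4.const_mul 2) (i1.const_mul 2),
    integral_const_mul, integral_const_mul, integral_const_mul]
  ring

/-- Integration by parts in the mass flux P √s v. Writing y² = (√s y)²/s lets only e appear, and the
derivative of 1/s contributes the term with 1/√s. -/
lemma integral_dP_mul_sq {y e : ℝ → ℝ → ℝ} (hy : SupCont S (Icc 0 T) y)
    (he : L2Cont S (Icc 0 T) e) (hprim : ∀ t ∈ Icc 0 T, PrimLoc S (fun s => √s * y t s) (e t))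
    {t : ℝ} (ht : t ∈ Icc 0 T) :
    ∫ s in Ioo 0 S, dP P v Q d t s * y t s ^ 2
      = 4 * (∫ s in Ioo 0 S, P t s * v t s * y t s * e t s)
        - 2 * ∫ s in Ioo 0 S, P t s * v t s * y t s ^ 2 / √s := by
  have hy2 := hy.comp (Ψ := fun x => x ^ 2) (by fun_prop)
  have hp : PrimLoc S (fun s => P t s * (√s * v t s) * (√s * y t s * (√s * y t s) * s⁻¹))
      (fun s => -(1 / 2) * (dP P v Q d t s * y t s ^ 2) + 2 * (P t s * v t s * y t s * e t s)
        - P t s * v t s * y t s ^ 2 / √s) :=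
    ((h.primPV ht).mul (((hprim t ht).mul (hprim t ht)).mul PrimLoc.inv)).congr_deriv fun s hs => by
      have h0 : 0 < √s := Real.sqrt_pos.2 hs.1
      obtain ⟨r, hr, hs'⟩ : ∃ r, 0 < r ∧ s = r ^ 2 := ⟨√s, h0, (Real.sq_sqrt hs.1.le).symm⟩
      have hq : √s = r := by rw [hs', Real.sqrt_sq hr.le]
      rw [hq]
      generalize dP P v Q d t s = D
      generalize P t s = p
      generalize v t s = a
      generalize y t s = b
      generalize e t s = k
      subst hs'
      field_simp
      ring
  have hPvy := ((h.supP.mul h.supv).mul hy)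
  have hPvy2 := ((h.supP.mul h.supv).mul hy2)
  have i1 : IntegrableOn (fun s => -(1 / 2) * (dP P v Q d t s * y t s ^ 2)) (Ioo 0 S) :=
    ((h.l2dP.memLp t ht).integrable_mul (hy2.memLp ht 2)).const_mul _
  have i2 : IntegrableOn (fun s => 2 * (P t s * v t s * y t s * e t s)) (Ioo 0 S) :=
    ((hPvy.memLp ht 2).integrable_mul (he.memLp t ht)).const_mul _
  obtain ⟨M, hM⟩ := hPvy2.bdd t ht
  have i3 : IntegrableOn (fun s => P t s * v t s * y t s ^ 2 / √s) (Ioo 0 S) :=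
    integrableOn_bdd_div_sqrt hS (hPvy2.cont t ht) hM
  have hlim : Tendsto (fun s => P t s * (√s * v t s) * (√s * y t s * (√s * y t s) * s⁻¹))
      (𝓝[>] 0) (𝓝 0) := by
    refine (tendsto_sqrt_mul_zero hS hM).congr' ?_
    filter_upwards [self_mem_nhdsWithin] with s hs
    have hs' : (0 : ℝ) < s := hs
    have : √s * √s = s := Real.mul_self_sqrt hs'.le
    have h2 : √s * y t s * (√s * y t s) * s⁻¹ = y t s ^ 2 := by
      calc √s * y t s * (√s * y t s) * s⁻¹ = (√s * √s) * s⁻¹ * y t s ^ 2 := by ring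
        _ = y t s ^ 2 := by rw [this, mul_inv_cancel₀ hs'.ne', one_mul]
    rw [h2]; ring
  have := hp.integral_eq_of_tendsto hS ((i1.add i2).sub i3) hlim
  have e0 : P t S * (√S * v t S) = 0 := by rw [h.v_end t ht]; ring
  rw [integral_add_sub' i1 i2 i3, integral_const_mul, integral_const_mul,
    e0] at this
  linarith

/-- The time derivative of twice the kinetic energy. -/
theorem hasDerivAt_kineticEnergy (hβ : 1 ≤ β) (hγ : 1 < γ) {t : ℝ} (ht : t ∈ Ioo 0 T) :
    HasDerivAt (fun τ => (∫ s in Ioo 0 S, P τ s * v τ s ^ 2) + ∫ s in Ioo 0 S, P τ s * w τ s ^ 2)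
      (-4 * (∫ s in Ioo 0 S, flux μ β γ P d t s * d t s)
        - 8 * μ * ∫ s in Ioo 0 S, c t s ^ 2) t := by
  have htI := Ioo_subset_Icc_self ht
  have k1 := hasDerivAt_kinetic hS h.supP h.supv h.l2d h.primV h.v_end ht (h.l2dP.memLp t htI)
    ((h.l2dXi hS hβ hγ).memLp t htI) (h.hasDerivAt_density hS ht) (h.hasDerivAt_xi hS hβ hγ ht)
  have k2 := hasDerivAt_kinetic hS h.supP h.supw h.l2c h.primW h.w_end ht (h.l2dP.memLp t htI)
    ((h.l2dOm hS).memLp t htI) (h.hasDerivAt_density hS ht) (h.hasDerivAt_om hS ht)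
  refine (k1.add k2).congr_deriv ?_
  rw [h.integral_dP_mul_sq hS h.supv h.l2d h.primV htI,
    h.integral_dP_mul_sq hS h.supw h.l2c h.primW htI]
  have hd := h.l2d.memLp t htI
  have hc := h.l2c.memLp t htI
  have hF := (h.l2flux hβ hγ).memLp t htI
  have hV := h.supV2.memLp htI 2
  have hVW := h.supVW.memLp htI 2
  obtain ⟨M, hM⟩ := h.supVW2.bdd t htI
  have hL := memLp_logPrim hS (h.supVW2.cont t htI) hM
  obtain ⟨M', hM'⟩ := h.supVW.bdd t htI
  have hL' := memLp_logPrim hS (h.supVW.cont t htI) hM'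
  obtain ⟨N, hN⟩ := h.supv.bdd t htI
  obtain ⟨N', hN'⟩ := h.supw.bdd t htI
  have i1 : IntegrableOn (fun s => flux μ β γ P d t s * d t s) (Ioo 0 S) := hF.integrable_mul hd
  have i2 : IntegrableOn (fun s => P t s * v t s ^ 2 * d t s) (Ioo 0 S) := hV.integrable_mul hd
  have i3 : IntegrableOn (fun s => logPrim S (fun σ => P t σ * (v t σ ^ 2 - w t σ ^ 2)) s * d t s)
    (Ioo 0 S) := hL.integrable_mul hd
  have j1 : IntegrableOn (fun s => 2 * μ * c t s ^ 2) (Ioo 0 S) := hc.integrable_sq.const_mul _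
  have j2 : IntegrableOn (fun s => P t s * v t s * w t s * c t s) (Ioo 0 S) :=
    hVW.integrable_mul hc
  have j3 : IntegrableOn (fun s => 2 * (logPrim S (fun σ => P t σ * v t σ * w t σ) s * c t s))
    (Ioo 0 S) := (hL'.integrable_mul hc).const_mul 2
  have e1 : ∫ s in Ioo 0 S, dXi μ β γ S P v w d t s * d t s
      = (∫ s in Ioo 0 S, flux μ β γ P d t s * d t s)
        - (∫ s in Ioo 0 S, P t s * v t s ^ 2 * d t s)
        + 1 / 2 * ∫ s in Ioo 0 S, P t s * (v t s ^ 2 - w t s ^ 2) * v t s / √s := by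
    rw [← integral_logPrim_mul hS (h.supVW2.cont t htI) hM (h.primV t htI) (h.supv.cont t htI) hN
      hd, ← integral_sub_add' i1 i2 i3]
    exact integral_congr_ae (Eventually.of_forall fun s => by simp only [dXi]; ring)
  have e2 : ∫ s in Ioo 0 S, dOm μ S P v w c t s * c t s
      = 2 * μ * (∫ s in Ioo 0 S, c t s ^ 2)
        - (∫ s in Ioo 0 S, P t s * v t s * w t s * c t s)
        + 2 * (1 / 2 * ∫ s in Ioo 0 S, P t s * v t s * w t s * w t s / √s) := by
    rw [← integral_logPrim_mul hS (h.supVW.cont t htI) hM' (h.primW t htI) (h.supw.cont t htI) hN'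
      hc, ← integral_const_mul (2 * μ), ← integral_const_mul 2,
      ← integral_sub_add' j1 j2 j3]
    exact integral_congr_ae (Eventually.of_forall fun s => by simp only [dOm]; ring)
  have hPv3 := ((h.supP.mul h.supv).mul (h.supv.comp (Ψ := fun x => x ^ 2) (by fun_prop)))
  have hPvw2 := ((h.supP.mul h.supv).mul (h.supw.comp (Ψ := fun x => x ^ 2) (by fun_prop)))
  obtain ⟨A, hA⟩ := hPv3.bdd t htI
  obtain ⟨B, hB⟩ := hPvw2.bdd t htI
  have i5 := integrableOn_bdd_div_sqrt hS (hPv3.cont t htI) hA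
  have i6 := integrableOn_bdd_div_sqrt hS (hPvw2.cont t htI) hB
  have e3 : ∫ s in Ioo 0 S, P t s * (v t s ^ 2 - w t s ^ 2) * v t s / √s
      = (∫ s in Ioo 0 S, P t s * v t s * v t s ^ 2 / √s)
        - ∫ s in Ioo 0 S, P t s * v t s * w t s ^ 2 / √s := by
    rw [← integral_sub i5 i6]
    exact integral_congr_ae (Eventually.of_forall fun s => by simp only; ring)
  have e4 : ∫ s in Ioo 0 S, P t s * v t s * w t s * w t s / √s
      = ∫ s in Ioo 0 S, P t s * v t s * w t s ^ 2 / √s :=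
    integral_congr_ae (Eventually.of_forall fun s => by simp only; ring)
  have e5 : ∫ s in Ioo 0 S, P t s * v t s * v t s * d t s
      = ∫ s in Ioo 0 S, P t s * v t s ^ 2 * d t s :=
    integral_congr_ae (Eventually.of_forall fun s => by simp only; ring)
  -- In each component the terms with P v² d, P v w c and P v³/√s cancel. What is left besides
  -- viscosity and pressure is 2∫P v w²/√s in the radial part and its negative in the angular part:
  -- the centrifugal and Coriolis forces do no net work.
  rw [e1, e2, e3, e4, e5]
  ring

/-- The time derivative of the integral of the pressure. -/
theorem hasDerivAt_pressure (hγ : 1 < γ) {t : ℝ} (ht : t ∈ Ioo 0 T) :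
    HasDerivAt (fun τ => ∫ s in Ioo 0 S, P τ s ^ γ)
      (-2 * (γ - 1) * ∫ s in Ioo 0 S, P t s ^ γ * d t s) t := by
  have htI := Ioo_subset_Icc_self ht
  have hΘ : ContDiff ℝ 1 (fun x : ℝ × ℝ => x.1 ^ γ) :=
    (Real.contDiff_rpow_const_of_le (n := 1) (by norm_num; linarith)).comp contDiff_fst
  have hf : ∀ x k : ℝ × ℝ, fderiv ℝ (fun x : ℝ × ℝ => x.1 ^ γ) x k = γ * x.1 ^ (γ - 1) * k.1 := by
    intro x k
    have h1 := (Real.hasDerivAt_rpow_const (x := x.1) (p := γ) (Or.inr hγ.le)).comp_hasFDerivAt x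
      (hasFDerivAt_fst (𝕜 := ℝ) (E := ℝ) (F := ℝ) (p := x))
    erw [h1.fderiv]
    simp
  -- The function x.1 ^ γ ignores its second argument, which is filled with P again.
  have hd := hasDerivAt_integral_comp hΘ hS h.supP h.supP (Icc_mem_nhds ht.1 ht.2)
    (h.l2dP.memLp t htI) (h.l2dP.memLp t htI) (h.hasDerivAt_density hS ht)
    (h.hasDerivAt_density hS ht)
  simp only [hf] at hd
  refine hd.congr_deriv ?_
  have hp : PrimLoc S (fun s => P t s ^ γ * (√s * v t s))
      (fun s => 1 / 2 * (γ * P t s ^ (γ - 1) * (Q t s * v t s)) + P t s ^ γ * d t s) :=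
    ((((h.primP t htI).comp₂ hΘ (h.primP t htI)).mul (h.primV t htI))).congr_deriv fun s hs => by
      have h0 : 0 < √s := Real.sqrt_pos.2 hs.1
      rw [hf]
      field_simp
  have hPg := h.supP.comp (Ψ := fun x => x ^ γ) (Real.continuous_rpow_const (by linarith))
  have hPg1 := (h.supP.comp (Ψ := fun x => x ^ (γ - 1))
    (Real.continuous_rpow_const (by linarith))).const_mul γ
  have i1 : IntegrableOn (fun s => 1 / 2 * (γ * P t s ^ (γ - 1) * (Q t s * v t s))) (Ioo 0 S) :=
    ((hPg1.memLp htI 2).integrable_mul ((h.l2Q.mul h.supv).memLp t htI)).const_mul _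
  have i2 : IntegrableOn (fun s => P t s ^ γ * d t s) (Ioo 0 S) :=
    (hPg.memLp htI 2).integrable_mul (h.l2d.memLp t htI)
  obtain ⟨M, hM⟩ := (hPg.mul h.supv).bdd t htI
  -- The convective part of `dP` is eliminated by means of the exact derivative of P^γ √s v, which
  -- vanishes at both ends.
  have := hp.integral_eq_of_tendsto hS (i1.add i2) (l := 0)
    ((tendsto_sqrt_mul_zero hS hM).congr fun s => by ring)
  rw [integral_add i1 i2, h.v_end t htI, mul_zero, mul_zero, sub_zero] at this
  have e : ∫ s in Ioo 0 S, γ * P t s ^ (γ - 1) * dP P v Q d t s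
      = -2 * (∫ s in Ioo 0 S, 1 / 2 * (γ * P t s ^ (γ - 1) * (Q t s * v t s)))
        - 2 * γ * ∫ s in Ioo 0 S, P t s ^ γ * d t s := by
    rw [← integral_const_mul, ← integral_const_mul, ← integral_sub (i1.const_mul _)
      (i2.const_mul _)]
    refine setIntegral_congr_fun measurableSet_Ioo fun s hs => ?_
    have hP0 := h.nonneg t htI s (Ioo_subset_Ioc_self hs)
    have : P t s ^ γ = P t s ^ (γ - 1) * P t s := by
      rcases hP0.eq_or_lt with h0 | h0
      · rw [← h0, Real.zero_rpow (by linarith), mul_zero]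
      · rw [← Real.rpow_add_one h0.ne']; ring_nf
    simp only [this, dP]; ring
  rw [e]
  linarith

/-- The total energy. -/
def energy (γ S : ℝ) (P v w : ℝ → ℝ → ℝ) (t : ℝ) : ℝ :=
  1 / 2 * ((∫ s in Ioo 0 S, P t s * v t s ^ 2) + ∫ s in Ioo 0 S, P t s * w t s ^ 2)
    + 1 / (γ - 1) * ∫ s in Ioo 0 S, P t s ^ γ

/-- The rate of dissipation. -/
def dissipation (μ β S : ℝ) (P d c : ℝ → ℝ → ℝ) (t : ℝ) : ℝ :=
  4 * (∫ s in Ioo 0 S, (2 * μ + P t s ^ β) * d t s ^ 2) + 4 * μ * ∫ s in Ioo 0 S, c t s ^ 2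

/-- The work 2∫P^γ d of the pressure is gained by the kinetic energy and lost by the internal
energy. -/
theorem hasDerivAt_energy (hβ : 1 ≤ β) (hγ : 1 < γ) {t : ℝ} (ht : t ∈ Ioo 0 T) :
    HasDerivAt (energy γ S P v w) (-dissipation μ β S P d c t) t := by
  have htI := Ioo_subset_Icc_self ht
  refine (((h.hasDerivAt_kineticEnergy hS hβ hγ ht).const_mul (1 / 2)).add
    ((h.hasDerivAt_pressure hS hγ ht).const_mul (1 / (γ - 1)))).congr_deriv ?_
  have hPg := h.supP.comp (Ψ := fun x => x ^ γ) (Real.continuous_rpow_const (by linarith))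
  have i2 : IntegrableOn (fun s => P t s ^ γ * d t s) (Ioo 0 S) :=
    (hPg.memLp htI 2).integrable_mul (h.l2d.memLp t htI)
  have i1 : IntegrableOn (fun s => (2 * μ + P t s ^ β) * d t s ^ 2) (Ioo 0 S) := by
    have hs := h.supP.comp (Ψ := fun x => 2 * μ + x ^ β)
      (continuous_const.add (Real.continuous_rpow_const (by linarith)))
    have := ((h.l2d.mul hs).memLp t htI).integrable_mul (h.l2d.memLp t htI)
    refine this.congr (Eventually.of_forall fun s => ?_)
    simp only [Pi.mul_apply]; ring
  have e : ∫ s in Ioo 0 S, flux μ β γ P d t s * d t s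
      = 2 * (∫ s in Ioo 0 S, (2 * μ + P t s ^ β) * d t s ^ 2)
        - ∫ s in Ioo 0 S, P t s ^ γ * d t s := by
    rw [← integral_const_mul, ← integral_sub (i1.const_mul 2) i2]
    exact integral_congr_ae (Eventually.of_forall fun s => by simp only [flux]; ring)
  rw [e, dissipation]
  have : γ - 1 ≠ 0 := by linarith
  field_simp
  ring

end

end RadialFlow

end

section

/-! ### The truncated potential -/

lemma hasDerivAt_max_zero_pow {n : ℕ} (hn : 2 ≤ n) (x : ℝ) :
    HasDerivAt (fun y : ℝ => max 0 y ^ n) (n * max 0 x ^ (n - 1)) x := by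
  have hne : ∀ y : ℝ, y ≠ 0 → HasDerivAt (fun y : ℝ => max 0 y ^ n) (n * max 0 y ^ (n - 1)) y := by
    intro y hy
    rcases lt_or_gt_of_ne hy with h | h
    · rw [max_eq_left h.le, zero_pow (by omega), mul_zero]
      refine (hasDerivAt_const y (0 : ℝ)).congr_of_eventuallyEq ?_
      filter_upwards [Iio_mem_nhds h] with z hz
      rw [max_eq_left (le_of_lt hz), zero_pow (by omega)]
    · rw [max_eq_right h.le]
      refine (hasDerivAt_pow n y).congr_of_eventuallyEq ?_
      filter_upwards [Ioi_mem_nhds h] with z hz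
      rw [max_eq_right (le_of_lt hz)]
  by_cases hx : x = 0
  · subst hx
    -- Both the function and the candidate derivative are continuous, so the formula extends to the
    -- corner; n ≥ 2 is used here through n - 1 ≥ 1.
    exact hasDerivAt_of_hasDerivAt_of_ne (f := fun y : ℝ => max 0 y ^ n)
      (g := fun x : ℝ => n * max 0 x ^ (n - 1)) hne
      (by fun_prop) (by fun_prop)
  · exact hne x hx

lemma contDiff_max_zero_pow {n : ℕ} (hn : 2 ≤ n) : ContDiff ℝ 1 (fun y : ℝ => max 0 y ^ n) := by
  refine contDiff_one_iff_deriv.2 ⟨fun x => (hasDerivAt_max_zero_pow hn x).differentiableAt, ?_⟩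
  have : deriv (fun y : ℝ => max 0 y ^ n) = fun x : ℝ => n * max 0 x ^ (n - 1) :=
    funext fun x => (hasDerivAt_max_zero_pow hn x).deriv
  rw [this]
  fun_prop

/-- The potential `2μ log ρ + ρ^β / β`, whose derivative along particle paths is minus the sum of
the effective viscous flux and the pressure. -/
def theta (μ β ρ : ℝ) : ℝ := 2 * μ * Real.log ρ + ρ ^ β / β

/-- The positive part of `θ(ρ) + ξ - K`, set to zero in vacuum. -/
def cut (μ β K ρ ξ : ℝ) : ℝ := if 0 < ρ then max 0 (theta μ β ρ + ξ - K) else 0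

variable {μ β K : ℝ}

lemma cut_nonneg (ρ ξ : ℝ) : 0 ≤ cut μ β K ρ ξ := by
  unfold cut; split_ifs
  · exact le_max_left _ _
  · exact le_rfl

lemma theta_mono (hμ : 0 < μ) (hβ : 1 ≤ β) {a b : ℝ} (ha : 0 < a) (hab : a ≤ b) :
    theta μ β a ≤ theta μ β b := by
  have h1 := Real.log_le_log ha hab
  have h2 := Real.rpow_le_rpow ha.le hab (by linarith : 0 ≤ β)
  unfold theta
  have : 0 < β := by linarith
  gcongr

lemma tendsto_theta (hμ : 0 < μ) (hβ : 1 ≤ β) : Tendsto (theta μ β) (𝓝[>] 0) atBot := by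
  have h1 : Tendsto (fun x : ℝ => 2 * μ * Real.log x) (𝓝[>] 0) atBot :=
    Real.tendsto_log_nhdsGT_zero.const_mul_atBot (by positivity)
  have h2 : Tendsto (fun x : ℝ => x ^ β / β) (𝓝[>] 0) (𝓝 (0 ^ β / β)) :=
    (((Real.continuous_rpow_const (by linarith : 0 ≤ β)).div_const β).tendsto 0).mono_left
      nhdsWithin_le_nhds
  exact h1.atBot_add h2

/-- As ρ decreases to 0, θ(ρ) tends to -∞, so the truncation is zero in a full neighbourhood of
every vacuum state. For this reason the functional is smooth enough although θ is singular at
vacuum. -/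
lemma eventually_cut_eq_zero (hμ : 0 < μ) (hβ : 1 ≤ β) {ρ : ℝ} (ξ : ℝ) (hρ : ρ ≤ 0) :
    ∀ᶠ x : ℝ × ℝ in 𝓝 (ρ, ξ), cut μ β K x.1 x.2 = 0 := by
  obtain ⟨δ, hδ, h0⟩ : ∃ δ, theta μ β δ ≤ K - ξ - 1 ∧ 0 < δ :=
    (((tendsto_theta hμ hβ).eventually_le_atBot (K - ξ - 1)).and self_mem_nhdsWithin).exists
  have h1 : ∀ᶠ x : ℝ × ℝ in 𝓝 (ρ, ξ), x.1 < δ :=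
    (continuous_fst.tendsto (ρ, ξ)).eventually (Iio_mem_nhds (by simpa using hρ.trans_lt h0))
  have h2 : ∀ᶠ x : ℝ × ℝ in 𝓝 (ρ, ξ), x.2 < ξ + 1 :=
    (continuous_snd.tendsto (ρ, ξ)).eventually (Iio_mem_nhds (by simp))
  filter_upwards [h1, h2] with x hx1 hx2
  unfold cut
  split_ifs with h
  · have := theta_mono hμ hβ h hx1.le
    exact max_eq_left (by linarith)
  · rfl

lemma eventually_cut_eq {ρ : ℝ} (ξ : ℝ) (hρ : 0 < ρ) :
    ∀ᶠ x : ℝ × ℝ in 𝓝 (ρ, ξ), cut μ β K x.1 x.2 = max 0 (theta μ β x.1 + x.2 - K) := by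
  have h1 : ∀ᶠ x : ℝ × ℝ in 𝓝 (ρ, ξ), 0 < x.1 :=
    (continuous_fst.tendsto (ρ, ξ)).eventually (Ioi_mem_nhds hρ)
  filter_upwards [h1] with x hx
  rw [cut, if_pos hx]

lemma hasDerivAt_theta (hβ : 1 ≤ β) {ρ : ℝ} (hρ : 0 < ρ) :
    HasDerivAt (theta μ β) (2 * μ / ρ + ρ ^ (β - 1)) ρ := by
  have h1 := (Real.hasDerivAt_log hρ.ne').const_mul (2 * μ)
  have h2 := (Real.hasDerivAt_rpow_const (x := ρ) (p := β) (Or.inl hρ.ne')).div_const β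
  refine (h1.add h2).congr_deriv ?_
  have : β ≠ 0 := by linarith
  field_simp

lemma contDiffAt_theta {ρ : ℝ} (hρ : 0 < ρ) : ContDiffAt ℝ 1 (theta μ β) ρ :=
  (contDiffAt_const.mul (Real.contDiffAt_log.2 hρ.ne')).add
    ((Real.contDiffAt_rpow_const_of_ne hρ.ne').div_const β)

lemma contDiffAt_cut_arg {ρ ξ : ℝ} (hρ : 0 < ρ) :
    ContDiffAt ℝ 1 (fun x : ℝ × ℝ => theta μ β x.1 + x.2 - K) (ρ, ξ) :=
  ((ContDiffAt.comp (ρ, ξ) (contDiffAt_theta hρ) contDiffAt_fst).add contDiffAt_snd).sub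
    contDiffAt_const

lemma continuous_cut (hμ : 0 < μ) (hβ : 1 ≤ β) :
    Continuous (fun x : ℝ × ℝ => cut μ β K x.1 x.2) := by
  refine continuous_iff_continuousAt.2 fun ⟨ρ, ξ⟩ => ?_
  rcases le_or_gt ρ 0 with h | h
  · exact continuousAt_const.congr ((eventually_cut_eq_zero hμ hβ ξ h).mono fun x hx => hx.symm)
  · have : ContinuousAt (fun x : ℝ × ℝ => max 0 (theta μ β x.1 + x.2 - K)) (ρ, ξ) :=
      Filter.Tendsto.max tendsto_const_nhds (contDiffAt_cut_arg h).continuousAt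
    exact this.congr ((eventually_cut_eq ξ h).mono fun x hx => hx.symm)

lemma contDiff_cut_pow (hμ : 0 < μ) (hβ : 1 ≤ β) {n : ℕ} (hn : 2 ≤ n) :
    ContDiff ℝ 1 (fun x : ℝ × ℝ => cut μ β K x.1 x.2 ^ n) := by
  refine contDiff_iff_contDiffAt.2 fun ⟨ρ, ξ⟩ => ?_
  rcases le_or_gt ρ 0 with h | h
  · refine contDiffAt_const (c := (0 : ℝ)) |>.congr_of_eventuallyEq ?_
    filter_upwards [eventually_cut_eq_zero hμ hβ ξ h] with x hx
    rw [hx, zero_pow (by omega)]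
  · refine (ContDiffAt.comp (ρ, ξ) ((contDiff_max_zero_pow hn).contDiffAt)
      (contDiffAt_cut_arg (μ := μ) (β := β) (K := K) h)).congr_of_eventuallyEq ?_
    filter_upwards [eventually_cut_eq ξ h] with x hx
    rw [hx]; rfl

lemma contDiff_mul_cut_pow (hμ : 0 < μ) (hβ : 1 ≤ β) {n : ℕ} (hn : 2 ≤ n) :
    ContDiff ℝ 1 (fun x : ℝ × ℝ => x.1 * cut μ β K x.1 x.2 ^ n) :=
  contDiff_fst.mul (contDiff_cut_pow hμ hβ hn)

/-- The derivative of `ρ (θ(ρ) + ξ - K)₊ ^ n` along a particle path. -/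
lemma fderiv_mul_cut_pow (hμ : 0 < μ) (hβ : 1 ≤ β) {n : ℕ} (hn : 2 ≤ n) {ρ : ℝ} (ξ a b : ℝ)
    (hρ : 0 ≤ ρ) :
    fderiv ℝ (fun x : ℝ × ℝ => x.1 * cut μ β K x.1 x.2 ^ n) (ρ, ξ) (-2 * a * ρ, b)
        + 2 * a * (ρ * cut μ β K ρ ξ ^ n)
      = ρ * (n * cut μ β K ρ ξ ^ (n - 1)) * (b - 2 * (a * (2 * μ + ρ ^ β))) := by
  rcases hρ.eq_or_lt with h | h
  · subst h
    have : (fun x : ℝ × ℝ => x.1 * cut μ β K x.1 x.2 ^ n) =ᶠ[𝓝 ((0 : ℝ), ξ)] fun _ => 0 := by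
      filter_upwards [eventually_cut_eq_zero hμ hβ ξ le_rfl] with x hx
      rw [hx, zero_pow (by omega), mul_zero]
    rw [this.fderiv_eq]
    simp
  · have h0 : HasFDerivAt (theta μ β ∘ Prod.fst) _ (ρ, ξ) :=
      (hasDerivAt_theta (μ := μ) hβ h).comp_hasFDerivAt (ρ, ξ)
        (hasFDerivAt_fst (𝕜 := ℝ) (E := ℝ) (F := ℝ))
    have h1 := ((h0.fun_add (hasFDerivAt_snd (𝕜 := ℝ) (E := ℝ) (F := ℝ))).sub_const K)
    have h2 := (hasDerivAt_max_zero_pow hn (theta μ β ρ + ξ - K)).comp_hasFDerivAt (ρ, ξ) h1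
    have h3 := (hasFDerivAt_fst (𝕜 := ℝ) (E := ℝ) (F := ℝ) (p := (ρ, ξ))).mul h2
    have h4 : (fun x : ℝ × ℝ => x.1 * cut μ β K x.1 x.2 ^ n) =ᶠ[𝓝 (ρ, ξ)]
        fun x => x.1 * max 0 (theta μ β x.1 + x.2 - K) ^ n := by
      filter_upwards [eventually_cut_eq ξ h] with x hx
      rw [hx]
    have h5 := h3.fderiv
    have h6 : fderiv ℝ (fun x : ℝ × ℝ => x.1 * cut μ β K x.1 x.2 ^ n) (ρ, ξ) = _ :=
      h4.fderiv_eq.trans h5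
    rw [h6]
    have hc : cut μ β K ρ ξ = max 0 (theta μ β ρ + ξ - K) := by rw [cut, if_pos h]
    rw [hc]
    -- This expresses ρ θ'(ρ) = 2μ + ρ^β, the identity for which θ is chosen: the density equation
    -- then reproduces the viscous part of the flux.
    have hp : ρ ^ β = ρ ^ (β - 1) * ρ := by rw [← Real.rpow_add_one h.ne']; ring_nf
    simp only [add_apply, smul_apply,
      ContinuousLinearMap.coe_fst', ContinuousLinearMap.coe_snd', smul_eq_mul, Function.comp]
    rw [hp]
    field_simp
    ring

end

/-! ### Evolution of the main functional -/

section

variable {S : ℝ} {I : Set ℝ}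

lemma SupCont.of_time {m : ℝ → ℝ} (hm : ContinuousOn m I) : SupCont S I (fun t _ => m t) := by
  refine SupCont.of_bound (fun t _ => continuousOn_const) (fun t _ => ⟨|m t|, fun _ _ => le_rfl⟩)
    (fun t τ => |m τ - m t|) (fun t ht => ?_) (fun t _ τ _ s _ => le_rfl)
  have := ((hm t ht).sub (continuousWithinAt_const (b := m t))).abs
  simpa [ContinuousWithinAt] using this

lemma L2Cont.continuousOn_tailMean {f : ℝ → ℝ → ℝ} (hf : L2Cont S I f) :
    ContinuousOn (fun t => tailMean S (f t)) I :=
  L2Cont.continuousOn_integral_mul (f := fun _ => (Ioo (S / 2) S).indicator (fun _ => 2 / S))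
    ⟨fun _ _ => memLp_tail S, continuousOn_const⟩ hf

/-- The potential `-∫ₛ^S f / (2√σ)`, normalised by its mean over `(S/2, S)`. -/
def normPrim (S : ℝ) (f : ℝ → ℝ) (s : ℝ) : ℝ := sqrtPrim S f s - tailMean S (sqrtPrim S f)

lemma SupCont.normPrim {g : ℝ → ℝ → ℝ} (hg : SupCont S I g) :
    SupCont S I (fun t => normPrim S (g t)) :=
  hg.sqrtPrim.sub (SupCont.of_time hg.sqrtPrim.l2Cont.continuousOn_tailMean)

lemma primLoc_normPrim {g : ℝ → ℝ} (hg : ContinuousOn g (Ioc 0 S)) :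
    PrimLoc S (normPrim S g) (fun s => g s / (2 * √s)) :=
  (primLoc_sqrtPrim hg).add_const _

lemma memLp_fderiv {Θ : ℝ × ℝ → ℝ} (hΘ : ContDiff ℝ 1 Θ) {I : Set ℝ} {a b : ℝ → ℝ → ℝ}
    (ha : SupCont S I a) (hb : SupCont S I b) {t : ℝ} (ht : t ∈ I) {f g : ℝ → ℝ}
    (hf : MemLp f 2 (nu S)) (hg : MemLp g 2 (nu S)) :
    MemLp (fun s => fderiv ℝ Θ (a t s, b t s) (f s, g s)) 2 (nu S) := by
  have hc := hΘ.continuous_fderiv (by norm_num)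
  have h1 := SupCont.comp₂ (Ψ := fun x => fderiv ℝ Θ x (1, 0)) (by fun_prop) ha hb
  have h2 := SupCont.comp₂ (Ψ := fun x => fderiv ℝ Θ x (0, 1)) (by fun_prop) ha hb
  obtain ⟨M, hM⟩ := h1.bdd t ht
  obtain ⟨N, hN⟩ := h2.bdd t ht
  refine ((memLp_mul_bdd hf (h1.cont t ht) hM).add (memLp_mul_bdd hg (h2.cont t ht) hN)).ae_eq
    (Eventually.of_forall fun s => ?_)
  have : (f s, g s) = f s • ((1, 0) : ℝ × ℝ) + g s • ((0, 1) : ℝ × ℝ) := by simp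
  simp only [Pi.add_apply]
  rw [this, map_add, map_smul, map_smul]
  rfl

namespace RadialFlow

variable {μ β γ T K : ℝ} {P v w Q d c : ℝ → ℝ → ℝ}

/-- The integral of `ρ (θ(ρ) + ξ - K)₊ ^ n`. -/
def functional (μ β K : ℝ) (n : ℕ) (S : ℝ) (P v : ℝ → ℝ → ℝ) (t : ℝ) : ℝ :=
  ∫ s in Ioo 0 S, P t s * cut μ β K (P t s) (normPrim S (fun σ => P t σ * v t σ) s) ^ n

/-- Convection integrates to zero, so derivatives along particle paths may be used. Along them θ
changes by -(2μ + P^β) 2d, and ξ changes by the viscous flux, which contains the same expression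
with the opposite sign. Only the pressure, the nonlocal term and the mean remain. -/
theorem hasDerivAt_functional (h : RadialFlow μ β γ S T P v w Q d c) (hS : 0 < S) (hμ : 0 < μ)
    (hβ : 1 ≤ β) (hγ : 1 < γ) {n : ℕ} (hn : 2 ≤ n) {t : ℝ} (ht : t ∈ Ioo 0 T) :
    HasDerivAt (functional μ β K n S P v)
      (∫ s in Ioo 0 S,
        P t s * (n * cut μ β K (P t s) (normPrim S (fun σ => P t σ * v t σ) s) ^ (n - 1))
          * (-P t s ^ γ + logPrim S (fun σ => P t σ * (v t σ ^ 2 - w t σ ^ 2)) s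
            - tailMean S (dXi μ β γ S P v w d t))) t := by
  have htI := Ioo_subset_Icc_self ht
  have hΘ := contDiff_mul_cut_pow (K := K) hμ hβ hn
  set Θ : ℝ × ℝ → ℝ := fun x => x.1 * cut μ β K x.1 x.2 ^ n with hΘd
  have hξ := (h.supP.mul h.supv).normPrim
  set ξ := fun (t : ℝ) => normPrim S (fun σ => P t σ * v t σ) with hξd
  have hdx := h.l2dXi hS hβ hγ
  set m := tailMean S (dXi μ β γ S P v w d t) with hm
  have hd := hasDerivAt_integral_comp hΘ hS h.supP hξ (Icc_mem_nhds ht.1 ht.2)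
    (h.l2dP.memLp t htI) (memLp_sub_const m (hdx.memLp t htI)) (h.hasDerivAt_density hS ht)
    (h.hasDerivAt_xi hS hβ hγ ht)
  refine hd.congr_deriv ?_
  have hp : PrimLoc S (fun s => Θ (P t s, ξ t s) * (√s * v t s))
      (fun s => 1 / 2 * fderiv ℝ Θ (P t s, ξ t s) (Q t s * v t s, P t s * v t s * v t s)
        + Θ (P t s, ξ t s) * d t s) :=
    (((h.primP t htI).comp₂ hΘ (primLoc_normPrim ((h.supP.mul h.supv).cont t htI))).mul
      (h.primV t htI)).congr_deriv fun s hs => by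
      have h0 : 0 < √s := Real.sqrt_pos.2 hs.1
      have e : ((Q t s * v t s, P t s * v t s * v t s) : ℝ × ℝ)
          = (2 * (√s * v t s)) • ((Q t s / (2 * √s), P t s * v t s / (2 * √s)) : ℝ × ℝ) := by
        ext <;> simp <;> field_simp
      rw [e, map_smul, smul_eq_mul]
      ring
  have hΘs := SupCont.comp₂ hΘ.continuous h.supP hξ
  have mQ := (h.l2Q.mul h.supv).memLp t htI
  have mV := ((h.supP.mul h.supv).mul h.supv).memLp htI 2
  have m1 := memLp_fderiv hΘ h.supP hξ htI mQ mV
  have i1 : IntegrableOn (fun s => 1 / 2 * fderiv ℝ Θ (P t s, ξ t s)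
      (Q t s * v t s, P t s * v t s * v t s)) (Ioo 0 S) :=
    (m1.integrable (by norm_num)).const_mul _
  have i2 : IntegrableOn (fun s => Θ (P t s, ξ t s) * d t s) (Ioo 0 S) :=
    (hΘs.memLp htI 2).integrable_mul (h.l2d.memLp t htI)
  have i3 : IntegrableOn (fun s => fderiv ℝ Θ (P t s, ξ t s)
      (dP P v Q d t s, dXi μ β γ S P v w d t s - m)) (Ioo 0 S) :=
    (memLp_fderiv hΘ h.supP hξ htI (h.l2dP.memLp t htI)
      (memLp_sub_const m (hdx.memLp t htI))).integrable (by norm_num)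
  obtain ⟨M, hM⟩ := (hΘs.mul h.supv).bdd t htI
  have h0 := hp.integral_eq_of_tendsto hS (i1.add i2) (l := 0)
    ((tendsto_sqrt_mul_zero hS hM).congr fun s => by ring)
  rw [h.v_end t htI, mul_zero, mul_zero, sub_zero] at h0
  -- Adding twice the exact derivative of Θ √s v, whose integral is zero, completes the time
  -- derivatives to material derivatives.
  have h1 : ∫ s in Ioo 0 S, (fderiv ℝ Θ (P t s, ξ t s)
        (dP P v Q d t s, dXi μ β γ S P v w d t s - m)
      + 2 * (1 / 2 * fderiv ℝ Θ (P t s, ξ t s) (Q t s * v t s, P t s * v t s * v t s)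
        + Θ (P t s, ξ t s) * d t s))
      = ∫ s in Ioo 0 S, fderiv ℝ Θ (P t s, ξ t s)
        (dP P v Q d t s, dXi μ β γ S P v w d t s - m) := by
    have i4 : IntegrableOn (fun s => 1 / 2 * fderiv ℝ Θ (P t s, ξ t s)
        (Q t s * v t s, P t s * v t s * v t s) + Θ (P t s, ξ t s) * d t s) (Ioo 0 S) := i1.add i2
    rw [integral_add i3 (i4.const_mul 2), integral_const_mul, h0, mul_zero, add_zero]
  rw [← h1]
  refine setIntegral_congr_fun measurableSet_Ioo fun s hs => ?_
  have hP0 := h.nonneg t htI s (Ioo_subset_Ioc_self hs)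
  have h2 := fderiv_mul_cut_pow (K := K) hμ hβ hn (ξ t s) (d t s)
    (flux μ β γ P d t s + logPrim S (fun σ => P t σ * (v t σ ^ 2 - w t σ ^ 2)) s - m) hP0
  -- The sum of the time derivatives and the convection: in it Q and the term P v² disappear.
  have e : ((-2 * d t s * P t s,
      flux μ β γ P d t s + logPrim S (fun σ => P t σ * (v t σ ^ 2 - w t σ ^ 2)) s - m) : ℝ × ℝ)
      = (dP P v Q d t s, dXi μ β γ S P v w d t s - m)
        + (Q t s * v t s, P t s * v t s * v t s) := by
    ext
    · simp only [dP, Prod.mk_add_mk]; ring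
    · simp only [dXi, Prod.mk_add_mk]; ring
  rw [e, map_add] at h2
  simp only [hΘd] at h2 ⊢
  have e2 : flux μ β γ P d t s = 2 * (d t s * (2 * μ + P t s ^ β)) - P t s ^ γ := rfl
  rw [e2] at h2
  linear_combination h2

end RadialFlow

end

section

variable {S : ℝ}

/-! ### One-dimensional inequalities -/

lemma PrimLoc.mono {f g : ℝ → ℝ} (h : PrimLoc S f g) {s : ℝ} (hs : s ≤ S) : PrimLoc s f g :=
  ⟨fun _ ha has => h.ac ha has hs, h.2.mono fun _ hx hxs => hx ⟨hxs.1, hxs.2.trans_le hs⟩⟩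

/-- √s y(s) is the integral of e over (0, s), and Cauchy-Schwarz yields exactly the factor √s.
Applied to the velocity, it is a pointwise bound up to the axis by the dissipation. -/
lemma sq_le_integral_sq_deriv {y e : ℝ → ℝ} {N : ℝ} (hy : PrimLoc S (fun s => √s * y s) e)
    (hN : ∀ s ∈ Ioc 0 S, |y s| ≤ N) (he : MemLp e 2 (nu S)) {s : ℝ} (hs : s ∈ Ioc 0 S) :
    y s ^ 2 ≤ ∫ σ in Ioo 0 S, e σ ^ 2 := by
  have hsub : Ioo 0 s ⊆ Ioo 0 S := Ioo_subset_Ioo_right hs.2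
  have he' : MemLp e 2 (nu s) := he.mono_measure (Measure.restrict_mono hsub le_rfl)
  have h1 := (hy.mono hs.2).integral_eq_of_tendsto hs.1 (he'.integrable (by norm_num))
    (tendsto_sqrt_mul_zero hs.1 fun x hx => hN x ⟨hx.1, hx.2.trans hs.2⟩)
  have h2 := abs_integral_mul_le (memLp_const (μ := nu s) (p := 2) (1 : ℝ)) he'
  rw [norm_toL2_one hs.1] at h2
  simp only [one_mul] at h2
  have h3 := norm_toL2_sq he'
  have h4 : ∫ σ in Ioo 0 s, e σ ^ 2 ≤ ∫ σ in Ioo 0 S, e σ ^ 2 :=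
    setIntegral_mono_set he.integrable_sq (Eventually.of_forall fun _ => sq_nonneg _)
      hsub.eventuallyLE
  rw [sub_zero] at h1
  rw [show (∫ x, e x ∂nu s) = √s * y s from h1, abs_mul, abs_of_nonneg (Real.sqrt_nonneg s)] at h2
  have h5 : |y s| ≤ ‖toL2 (nu s) e‖ := le_of_mul_le_mul_left h2 (Real.sqrt_pos.2 hs.1)
  calc y s ^ 2 = |y s| ^ 2 := (sq_abs _).symm
    _ ≤ ‖toL2 (nu s) e‖ ^ 2 := by gcongr
    _ = ∫ σ in Ioo 0 s, e σ ^ 2 := h3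
    _ ≤ _ := h4

/-- An elementary substitute for Young's inequality: compare a with N b. -/
lemma pow_pred_mul_le {a b : ℝ} (ha : 0 ≤ a) (hb : 0 ≤ b) {N : ℕ} (hN : 1 ≤ N) :
    N * (a ^ (N - 1) * b) ≤ a ^ N + N ^ N * b ^ N := by
  have hN0 : (0 : ℝ) ≤ N := by positivity
  obtain ⟨m, rfl⟩ : ∃ m, N = m + 1 := ⟨N - 1, by omega⟩
  simp only [Nat.add_sub_cancel]
  set c : ℝ := ((m + 1 : ℕ) : ℝ) * b with hc
  have hc0 : 0 ≤ c := by positivity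
  have e1 : ((m + 1 : ℕ) : ℝ) * (a ^ m * b) = a ^ m * c := by rw [hc]; ring
  have e2 : ((m + 1 : ℕ) : ℝ) ^ (m + 1) * b ^ (m + 1) = c ^ (m + 1) := by rw [hc, mul_pow]
  rw [e1, e2]
  rcases le_total c a with h | h
  · calc a ^ m * c ≤ a ^ m * a := by gcongr
      _ = a ^ (m + 1) := by ring
      _ ≤ _ := le_add_of_nonneg_right (by positivity)
  · calc a ^ m * c ≤ c ^ m * c := by gcongr
      _ = c ^ (m + 1) := by ring
      _ ≤ _ := le_add_of_nonneg_left (by positivity)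

lemma integrableOn_pow_of_bdd {f : ℝ → ℝ} (hf : ContinuousOn f (Ioc 0 S)) {M : ℝ}
    (hM : ∀ s ∈ Ioc 0 S, |f s| ≤ M) (N : ℕ) : IntegrableOn (fun s => f s ^ N) (Ioo 0 S) := by
  have := memLp_nu_of_bound (S := S) (M := M ^ N) ((hf.pow N).mono Ioo_subset_Ioc_self)
    (fun s hs => by
      rw [Pi.pow_apply, abs_pow]; exact pow_le_pow_left₀ (abs_nonneg _) (hM s (Ioo_subset_Ioc_self hs)) N) 1
  exact memLp_one_iff_integrable.1 this

/-- With G = `logPrim S f`, (s G^N)' = G^N - (N/2) G^(N-1) f. Integrated over (δ, S), the boundary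
term at δ has a favourable sign, and N G^(N-1) f ≤ G^N + N^N f^N allows half of ∫G^N to be absorbed.
-/
lemma intervalIntegral_logPrim_pow_le {f : ℝ → ℝ} {M : ℝ} (hf : ContinuousOn f (Ioc 0 S))
    (hM : ∀ s ∈ Ioc 0 S, |f s| ≤ M) (h0 : ∀ s ∈ Ioc 0 S, 0 ≤ f s) {N : ℕ} (hN : 1 ≤ N) {δ : ℝ}
    (hδ : 0 < δ) (hδS : δ ≤ S) :
    ∫ s in δ..S, logPrim S f s ^ N ≤ N ^ N * ∫ s in Ioo 0 S, f s ^ N := by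
  have hG := primLoc_logPrim hf
  have hp : PrimLoc S (fun s => s * logPrim S f s ^ N)
      (fun s => logPrim S f s ^ N - 1 / 2 * (N * (logPrim S f s ^ (N - 1) * f s))) := by
    have h1 := PrimLoc.of_hasDerivAt (S := S) (f := id) (g := fun _ => (1 : ℝ))
      (fun x _ => hasDerivAt_id x) continuousOn_const
    have hΘ : ContDiff ℝ 1 (fun x : ℝ × ℝ => x.1 ^ N) := contDiff_fst.pow N
    refine (h1.mul (hG.comp₂ hΘ hG)).congr_deriv fun s hs => ?_
    have h2 : HasFDerivAt (fun x : ℝ × ℝ => x.1 ^ N) _ (logPrim S f s, logPrim S f s) :=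
      (hasFDerivAt_fst (𝕜 := ℝ) (E := ℝ) (F := ℝ)).pow N
    rw [h2.fderiv]
    have : s ≠ 0 := hs.1.ne'
    simp
    field_simp
    ring
  have h1 := hp.integral_eq hδ hδS le_rfl
  have hGc := hG.continuousOn
  have hsub : uIcc δ S ⊆ Ioc 0 S := by
    rw [uIcc_of_le hδS]; exact fun x hx => ⟨hδ.trans_le hx.1, hx.2⟩
  have i1 : IntervalIntegrable (fun s => logPrim S f s ^ N) volume δ S :=
    ((hGc.pow N).mono hsub).intervalIntegrable
  have i2 : IntervalIntegrable (fun s => (N : ℝ) * (logPrim S f s ^ (N - 1) * f s)) volume δ S :=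
    (continuousOn_const.mul (((hGc.pow (N - 1)).mul hf).mono hsub)).intervalIntegrable
  have i3 : IntervalIntegrable (fun s => (N : ℝ) ^ N * f s ^ N) volume δ S :=
    (continuousOn_const.mul ((hf.pow N).mono hsub)).intervalIntegrable
  rw [intervalIntegral.integral_sub i1 (i2.const_mul _), intervalIntegral.integral_const_mul,
    logPrim_end, zero_pow (by omega), mul_zero] at h1
  have h2 : 0 ≤ δ * logPrim S f δ ^ N :=
    mul_nonneg hδ.le (pow_nonneg (logPrim_nonneg h0 ⟨hδ, hδS⟩) N)
  have h3 : ∫ s in δ..S, (N : ℝ) * (logPrim S f s ^ (N - 1) * f s)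
      ≤ (∫ s in δ..S, logPrim S f s ^ N) + ∫ s in δ..S, (N : ℝ) ^ N * f s ^ N := by
    rw [← intervalIntegral.integral_add i1 i3]
    refine intervalIntegral.integral_mono_on hδS i2 (i1.add i3) fun s hs => ?_
    have hs' : s ∈ Ioc 0 S := ⟨hδ.trans_le hs.1, hs.2⟩
    exact pow_pred_mul_le (logPrim_nonneg h0 hs') (h0 s hs') hN
  have h4 : ∫ s in δ..S, (N : ℝ) ^ N * f s ^ N ≤ N ^ N * ∫ s in Ioo 0 S, f s ^ N := by
    rw [intervalIntegral.integral_const_mul, intervalIntegral.integral_of_le hδS,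
      integral_Ioc_eq_integral_Ioo]
    refine mul_le_mul_of_nonneg_left (setIntegral_mono_set (integrableOn_pow_of_bdd hf hM N) ?_
      (Ioo_subset_Ioo_left hδ.le).eventuallyLE) (by positivity)
    exact ae_restrict_of_forall_mem measurableSet_Ioo fun s hs =>
      pow_nonneg (h0 s (Ioo_subset_Ioc_self hs)) N
  linarith

/-- A Hardy inequality for `½ ∫ₛ^S f / σ`. -/
theorem integral_logPrim_pow_le {f : ℝ → ℝ} {M : ℝ} (hS : 0 < S) (hf : ContinuousOn f (Ioc 0 S))
    (hM : ∀ s ∈ Ioc 0 S, |f s| ≤ M) (h0 : ∀ s ∈ Ioc 0 S, 0 ≤ f s) {N : ℕ} (hN : 1 ≤ N) :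
    IntegrableOn (fun s => logPrim S f s ^ N) (Ioo 0 S) ∧
      ∫ s in Ioo 0 S, logPrim S f s ^ N ≤ N ^ N * ∫ s in Ioo 0 S, f s ^ N := by
  have hGc := (primLoc_logPrim hf).continuousOn
  have ha : ∀ i : ℕ, 0 < S / (i + 1) ∧ S / (i + 1) ≤ S := fun i =>
    ⟨by positivity, div_le_self hS.le (by linarith [(Nat.cast_nonneg i : (0 : ℝ) ≤ i)])⟩
  have ht : Tendsto (fun i : ℕ => S / ((i : ℝ) + 1)) atTop (𝓝 0) :=
    tendsto_const_div_atTop_nhds_zero_nat S |>.comp (tendsto_add_atTop_nat 1) |>.congr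
      fun i => by simp
  have hB := fun i : ℕ => intervalIntegral_logPrim_pow_le hf hM h0 hN (ha i).1 (ha i).2
  have hi : ∀ i : ℕ, IntegrableOn (fun s => logPrim S f s ^ N) (Ioc (S / (i + 1)) S) := fun i =>
    (((hGc.pow N).mono fun x hx => ⟨(ha i).1.trans_le hx.1, hx.2⟩).integrableOn_Icc).mono_set
      Ioc_subset_Icc_self
  -- The bounds on (S/(i+1), S) do not depend on i; they give integrability up to 0 first, and the
  -- inequality in the limit.
  have hint : IntegrableOn (fun s => logPrim S f s ^ N) (Ioc 0 S) := by
    refine integrableOn_Ioc_of_intervalIntegral_norm_bounded_left (l := atTop)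
      (I := N ^ N * ∫ s in Ioo 0 S, f s ^ N) hi ht (Eventually.of_forall fun i => ?_)
    refine le_trans (le_of_eq ?_) (hB i)
    rw [intervalIntegral.integral_of_le (ha i).2]
    refine setIntegral_congr_fun measurableSet_Ioc fun s hs => ?_
    exact Real.norm_of_nonneg (pow_nonneg (logPrim_nonneg h0 ⟨(ha i).1.trans hs.1, hs.2⟩) N)
  refine ⟨hint.mono_set Ioo_subset_Ioc_self, ?_⟩
  rw [← integral_Ioc_eq_integral_Ioo, ← intervalIntegral.integral_of_le hS.le]
  have hc := intervalIntegral.continuousOn_primitive_interval_left (μ := volume) (a := 0) (b := S)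
    (f := fun s => logPrim S f s ^ N)
    (by rw [uIcc_of_le hS.le, integrableOn_Icc_iff_integrableOn_Ioc]; exact hint)
  rw [uIcc_of_le hS.le] at hc
  have ht' : Tendsto (fun i : ℕ => S / ((i : ℝ) + 1)) atTop (𝓝[Icc 0 S] 0) :=
    tendsto_nhdsWithin_iff.2 ⟨ht, Eventually.of_forall fun i => ⟨(ha i).1.le, (ha i).2⟩⟩
  exact le_of_tendsto ((hc 0 ⟨le_rfl, hS.le⟩).tendsto.comp ht') (Eventually.of_forall hB)

/-- On (S/2, S) the weight 1/(2σ) is at most 1/S. This is why the potentials are normalised by their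
mean there. -/
lemma logPrim_le_of_half_le {f : ℝ → ℝ} {M : ℝ} (hS : 0 < S) (hf : ContinuousOn f (Ioc 0 S))
    (hM : ∀ s ∈ Ioc 0 S, |f s| ≤ M) (h0 : ∀ s ∈ Ioc 0 S, 0 ≤ f s) {s : ℝ} (hs : s ∈ Ico (S / 2) S) :
    logPrim S f s ≤ 1 / S * ∫ σ in Ioo 0 S, f σ := by
  have hs0 : 0 < s := by linarith [hs.1]
  have hsub : uIcc s S ⊆ Ioc 0 S := by
    rw [uIcc_of_le hs.2.le]; exact fun x hx => ⟨hs0.trans_le hx.1, hx.2⟩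
  have h1 : logPrim S f s ≤ ∫ σ in s..S, 1 / S * f σ := by
    refine intervalIntegral.integral_mono_on hs.2.le (intervalIntegrable_div_id hf hs0 hs.2.le)
      (continuousOn_const.mul (hf.mono hsub)).intervalIntegrable fun σ hσ => ?_
    have hσ0 : 0 < σ := hs0.trans_le hσ.1
    have : 0 ≤ f σ := h0 σ ⟨hσ0, hσ.2⟩
    rw [div_mul_eq_mul_div, one_mul]
    exact div_le_div_of_nonneg_left this hS (by linarith [hs.1, hσ.1])
  refine h1.trans ?_
  rw [intervalIntegral.integral_const_mul, intervalIntegral.integral_of_le hs.2.le,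
    integral_Ioc_eq_integral_Ioo]
  refine mul_le_mul_of_nonneg_left (setIntegral_mono_set ?_ ?_
      (Ioo_subset_Ioo_left hs0.le).eventuallyLE) (by positivity)
  · simpa using integrableOn_pow_of_bdd hf hM 1
  · exact ae_restrict_of_forall_mem measurableSet_Ioo fun s hs => h0 s (Ioo_subset_Ioc_self hs)

/-- The bound is optimal at l = √(b/a), where its right-hand side equals √(ab). -/
lemma sq_le_mul_of_forall {x a b : ℝ} (ha : 0 < a) (hb : 0 < b) (hx : 0 ≤ x)
    (h : ∀ l, 0 < l → x ≤ l / 2 * a + b / (2 * l)) : x ^ 2 ≤ a * b := by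
  have h1 := h (√(b / a)) (by positivity)
  have h2 : √(b / a) / 2 * a + b / (2 * √(b / a)) = √(a * b) := by
    obtain ⟨r, hr, rfl⟩ : ∃ r, 0 < r ∧ a = r ^ 2 := ⟨√a, Real.sqrt_pos.2 ha, (Real.sq_sqrt ha.le).symm⟩
    obtain ⟨q, hq, rfl⟩ : ∃ q, 0 < q ∧ b = q ^ 2 := ⟨√b, Real.sqrt_pos.2 hb, (Real.sq_sqrt hb.le).symm⟩
    rw [← div_pow, ← mul_pow, Real.sqrt_sq (by positivity), Real.sqrt_sq (by positivity)]
    field_simp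
    ring
  rw [h2] at h1
  calc x ^ 2 ≤ √(a * b) ^ 2 := by gcongr
    _ = a * b := Real.sq_sqrt (by positivity)

section

variable {P v : ℝ → ℝ} {M N : ℝ} (hP : ContinuousOn P (Ioc 0 S)) (hP0 : ∀ s ∈ Ioc 0 S, 0 ≤ P s)
  (hv : ContinuousOn v (Ioc 0 S))

include hP hP0 hv

/-- Because 1/√σ ≤ √S/σ, the weight can be replaced by that of `logPrim`. The gain is the factor U,
a bound for the velocity, and hence dissipation. -/
lemma abs_sqrtPrim_mul_le {U : ℝ} (hU : ∀ s ∈ Ioc 0 S, |v s| ≤ U) {s : ℝ} (hs : s ∈ Ioc 0 S) :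
    |sqrtPrim S (fun σ => P σ * v σ) s| ≤ √S * U * logPrim S P s := by
  have hsub : uIcc s S ⊆ Ioc 0 S := by
    rw [uIcc_of_le hs.2]; exact fun x hx => ⟨hs.1.trans_le hx.1, hx.2⟩
  rw [sqrtPrim, abs_neg, logPrim, ← intervalIntegral.integral_const_mul]
  refine (intervalIntegral.abs_integral_le_integral_abs hs.2).trans ?_
  refine intervalIntegral.integral_mono_on hs.2
    (intervalIntegrable_div_sqrt (hP.mul hv) hs.1 hs.2).abs
    ((intervalIntegrable_div_id hP hs.1 hs.2).const_mul _) fun σ hσ => ?_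
  have hσ0 : 0 < σ := hs.1.trans_le hσ.1
  have hσ' : σ ∈ Ioc 0 S := ⟨hσ0, hσ.2⟩
  have h1 : 0 < √σ := Real.sqrt_pos.2 hσ0
  have h2 : √σ ≤ √S := Real.sqrt_le_sqrt hσ.2
  have h3 := hP0 σ hσ'
  have h4 := hU σ hσ'
  rw [abs_div, abs_mul, abs_of_nonneg h3, abs_of_pos (by positivity : 0 < 2 * √σ)]
  have e : P σ * |v σ| / (2 * √σ) = √σ * |v σ| * (P σ / (2 * σ)) := by
    obtain ⟨r, hr⟩ : ∃ r, √σ = r := ⟨_, rfl⟩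
    have hq : σ = r ^ 2 := by rw [← hr, Real.sq_sqrt hσ0.le]
    rw [hr] at h1 ⊢
    generalize P σ = p, |v σ| = y
    rw [hq]
    field_simp
  rw [e]
  have : 0 ≤ P σ / (2 * σ) := by positivity
  gcongr

/-- Cauchy-Schwarz with density P: the integrand is split into P v², controlled by the energy, and
P/σ, controlled by `logPrim`. The parameter l is optimised by `sq_le_mul_of_forall`. -/
lemma sqrtPrim_mul_sq_le (hPM : ∀ s ∈ Ioc 0 S, |P s| ≤ M) (hvN : ∀ s ∈ Ioc 0 S, |v s| ≤ N) {E b : ℝ}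
    (hE : 0 < E) (hEv : ∫ s in Ioo 0 S, P s * v s ^ 2 ≤ E) {s : ℝ} (hs : s ∈ Ioc 0 S) (hb : 0 < b)
    (hGb : logPrim S P s ≤ b) :
    sqrtPrim S (fun σ => P σ * v σ) s ^ 2 ≤ E * b := by
  rw [← sq_abs]
  refine sq_le_mul_of_forall hE hb (abs_nonneg _) fun l hl => ?_
  have hsub : uIcc s S ⊆ Ioc 0 S := by
    rw [uIcc_of_le hs.2]; exact fun x hx => ⟨hs.1.trans_le hx.1, hx.2⟩
  have i1 : IntervalIntegrable (fun σ => P σ * v σ ^ 2) volume s S :=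
    ((hP.mul (hv.pow 2)).mono hsub).intervalIntegrable
  have i2 := intervalIntegrable_div_id hP hs.1 hs.2
  have h1 : |sqrtPrim S (fun σ => P σ * v σ) s|
      ≤ ∫ σ in s..S, (l / 2 * (P σ * v σ ^ 2) + 1 / (2 * l) * (P σ / (2 * σ))) := by
    rw [sqrtPrim, abs_neg]
    refine (intervalIntegral.abs_integral_le_integral_abs hs.2).trans ?_
    refine intervalIntegral.integral_mono_on hs.2
      (intervalIntegrable_div_sqrt (hP.mul hv) hs.1 hs.2).abs
      ((i1.const_mul _).add (i2.const_mul _)) fun σ hσ => ?_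
    have hσ0 : 0 < σ := hs.1.trans_le hσ.1
    have h1 : 0 < √σ := Real.sqrt_pos.2 hσ0
    have h3 := hP0 σ ⟨hσ0, hσ.2⟩
    rw [abs_div, abs_mul, abs_of_nonneg h3, abs_of_pos (by positivity : 0 < 2 * √σ)]
    have e : l / 2 * (P σ * v σ ^ 2) + 1 / (2 * l) * (P σ / (2 * σ)) - P σ * |v σ| / (2 * √σ)
        = P σ / (2 * l) * ((l * |v σ| - 1 / (2 * √σ)) ^ 2 + 1 / (4 * √σ ^ 2)) := by
      rw [← sq_abs (v σ)]
      obtain ⟨r, hr⟩ : ∃ r, √σ = r := ⟨_, rfl⟩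
      have hq : σ = r ^ 2 := by rw [← hr, Real.sq_sqrt hσ0.le]
      rw [hr] at h1 ⊢
      generalize P σ = p, |v σ| = y
      rw [hq]
      field_simp
      ring
    have : 0 ≤ P σ / (2 * l) * ((l * |v σ| - 1 / (2 * √σ)) ^ 2 + 1 / (4 * √σ ^ 2)) := by positivity
    linarith
  rw [intervalIntegral.integral_add (i1.const_mul _) (i2.const_mul _),
    intervalIntegral.integral_const_mul, intervalIntegral.integral_const_mul] at h1
  have h2 : ∫ σ in s..S, P σ * v σ ^ 2 ≤ E := by
    refine le_trans ?_ hEv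
    rw [intervalIntegral.integral_of_le hs.2, integral_Ioc_eq_integral_Ioo]
    refine setIntegral_mono_set ?_ ?_ (Ioo_subset_Ioo_left hs.1.le).eventuallyLE
    · have := integrableOn_pow_of_bdd (S := S) (M := M * N ^ 2) (hP.mul (hv.pow 2)) (fun σ hσ => by
        rw [Pi.mul_apply, Pi.pow_apply, abs_mul, abs_pow]
        have := hPM σ hσ
        have := hvN σ hσ
        have := (abs_nonneg _).trans (hPM σ hσ)
        gcongr) 1
      simpa using this
    · exact ae_restrict_of_forall_mem measurableSet_Ioo fun s hs =>
        mul_nonneg (hP0 s (Ioo_subset_Ioc_self hs)) (sq_nonneg _)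
  have h3 : 1 / (2 * l) * (∫ σ in s..S, P σ / (2 * σ)) ≤ b / (2 * l) := by
    rw [div_mul_eq_mul_div, one_mul]
    gcongr
    exact hGb
  have h4 : l / 2 * (∫ σ in s..S, P σ * v σ ^ 2) ≤ l / 2 * E := by gcongr
  linarith

end

lemma abs_tailMean_le {f : ℝ → ℝ} {B : ℝ} (hS : 0 < S) (h : ∀ s ∈ Ioo (S / 2) S, |f s| ≤ B) :
    |tailMean S f| ≤ B := by
  rw [tailMean_eq hS, abs_mul, abs_of_pos (by positivity)]
  have := norm_setIntegral_le_of_norm_le_const (μ := volume) (s := Ioo (S / 2) S) (f := f) (C := B)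
    measure_Ioo_lt_top (fun x hx => h x hx)
  rw [Real.norm_eq_abs, Real.volume_real_Ioo_of_le (by linarith)] at this
  calc 2 / S * |∫ s in Ioo (S / 2) S, f s| ≤ 2 / S * (B * (S - S / 2)) := by gcongr
    _ = B := by field_simp; ring

end

section

variable {S : ℝ}

/-! ### Estimates at a fixed time -/

lemma integral_add_add_add {f g k l : ℝ → ℝ} {A : Set ℝ} (hf : IntegrableOn f A)
    (hg : IntegrableOn g A) (hk : IntegrableOn k A) (hl : IntegrableOn l A) :
    ∫ s in A, (f s + g s + k s + l s)
      = (∫ s in A, f s) + (∫ s in A, g s) + (∫ s in A, k s) + ∫ s in A, l s := by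
  rw [← integral_add hf hg]
  exact (integral_add ((hf.add hg).add hk) hl).trans
    (congrArg (· + _) (integral_add (hf.add hg) hk))

lemma SupCont.integrableOn {I : Set ℝ} {g : ℝ → ℝ → ℝ} (hg : SupCont S I g) {t : ℝ} (ht : t ∈ I) :
    IntegrableOn (g t) (Ioo 0 S) := hg.l2Cont.integrableOn ht

lemma SupCont.memLp_const {f : ℝ → ℝ} (hf : SupCont S univ fun _ => f) : MemLp f 2 (nu S) :=
  hf.memLp (mem_univ (0 : ℝ)) 2

lemma SupCont.integrableOn_const {f : ℝ → ℝ} (hf : SupCont S univ fun _ => f) :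
    IntegrableOn f (Ioo 0 S) := hf.integrableOn (mem_univ (0 : ℝ))

lemma rpow_le_one_add_rpow {x a b : ℝ} (hx : 0 ≤ x) (ha : 0 ≤ a) (hab : a ≤ b) :
    x ^ a ≤ 1 + x ^ b := by
  have := Real.rpow_nonneg hx b
  rcases le_total x 1 with h | h
  · linarith [Real.rpow_le_one hx h ha]
  · linarith [Real.rpow_le_rpow_of_exponent_le h hab]

lemma mul_pow_le_add {a b : ℝ} (ha : 0 ≤ a) (hb : 0 ≤ b) (n : ℕ) :
    a * b ^ n ≤ a ^ (n + 1) + b ^ (n + 1) := by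
  rcases le_total a b with h | h
  · calc a * b ^ n ≤ b * b ^ n := by gcongr
      _ = b ^ (n + 1) := by ring
      _ ≤ _ := le_add_of_nonneg_left (by positivity)
  · calc a * b ^ n ≤ a * a ^ n := by gcongr
      _ = a ^ (n + 1) := by ring
      _ ≤ _ := le_add_of_nonneg_right (by positivity)

/-- Density, velocity and derivative of the radial velocity at a fixed time, with bounds for the
energy. -/
structure Slice (γ S E : ℝ) (P v w d : ℝ → ℝ) : Prop where
  supP : SupCont S univ (fun _ => P)
  supv : SupCont S univ (fun _ => v)
  supw : SupCont S univ (fun _ => w)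
  nonneg : ∀ s ∈ Ioc 0 S, 0 ≤ P s
  primV : PrimLoc S (fun s => √s * v s) d
  memLp_d : MemLp d 2 (nu S)
  pressure_le : ∫ s in Ioo 0 S, P s ^ γ ≤ E
  radial_le : ∫ s in Ioo 0 S, P s * v s ^ 2 ≤ E
  angular_le : ∫ s in Ioo 0 S, P s * w s ^ 2 ≤ E

namespace Slice

variable {μ β γ E : ℝ} {P v w d : ℝ → ℝ}

/-- The power of the density that controls the solution. -/
def mass (β : ℝ) (n : ℕ) (S : ℝ) (P : ℝ → ℝ) : ℝ := ∫ s in Ioo 0 S, P s ^ (1 + β * n)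

/-- The main functional at a fixed time. -/
def psi (μ β K : ℝ) (n : ℕ) (S : ℝ) (P v : ℝ → ℝ) : ℝ :=
  ∫ s in Ioo 0 S, P s * cut μ β K (P s) (normPrim S (fun σ => P σ * v σ) s) ^ n

/-- The radial dissipation at a fixed time. -/
def diss (μ β S : ℝ) (P d : ℝ → ℝ) : ℝ := ∫ s in Ioo 0 S, (2 * μ + P s ^ β) * d s ^ 2

/-- An upper bound for the potentials. -/
def pot (S E : ℝ) (P : ℝ → ℝ) (s : ℝ) : ℝ := logPrim S P s + (1 + E / S)

lemma contP (h : Slice γ S E P v w d) : ContinuousOn P (Ioc 0 S) := h.supP.cont 0 (mem_univ _)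

lemma contv (h : Slice γ S E P v w d) : ContinuousOn v (Ioc 0 S) := h.supv.cont 0 (mem_univ _)

lemma bddP (h : Slice γ S E P v w d) : ∃ M, ∀ s ∈ Ioc 0 S, |P s| ≤ M := h.supP.bdd 0 (mem_univ _)

lemma bddv (h : Slice γ S E P v w d) : ∃ M, ∀ s ∈ Ioc 0 S, |v s| ≤ M := h.supv.bdd 0 (mem_univ _)

lemma supRpow (h : Slice γ S E P v w d) {a : ℝ} (ha : 0 ≤ a) :
    SupCont S univ (fun _ s => P s ^ a) :=
  h.supP.comp (Ψ := fun x => x ^ a) (Real.continuous_rpow_const ha)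

lemma supPow (h : Slice γ S E P v w d) (n : ℕ) : SupCont S univ (fun _ s => P s ^ n) :=
  h.supP.comp (Ψ := fun x => x ^ n) (by fun_prop)

lemma supNormPrim (h : Slice γ S E P v w d) :
    SupCont S univ (fun _ => normPrim S (fun σ => P σ * v σ)) := (h.supP.mul h.supv).normPrim

lemma supCut (h : Slice γ S E P v w d) (hμ : 0 < μ) (hβ : 1 ≤ β) (K : ℝ) (n : ℕ) :
    SupCont S univ
      (fun _ s => cut μ β K (P s) (normPrim S (fun σ => P σ * v σ) s) ^ n) :=
  SupCont.comp₂ (Ψ := fun x => cut μ β K x.1 x.2 ^ n) ((continuous_cut hμ hβ).pow n) h.supP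
    h.supNormPrim

section

variable (h : Slice γ S E P v w d) (hS : 0 < S) (hγ : 1 < γ) (hE : 0 < E)

include h

include hS hγ in
lemma integral_density_le : ∫ s in Ioo 0 S, P s ≤ S + E := by
  have h1 : ∫ s in Ioo 0 S, P s ≤ ∫ s in Ioo 0 S, (1 + P s ^ γ) := by
    refine setIntegral_mono_on h.supP.integrableOn_const
      ((integrable_const _).add (h.supRpow (by linarith : 0 ≤ γ)).integrableOn_const)
      measurableSet_Ioo fun s hs => ?_
    simpa using rpow_le_one_add_rpow (h.nonneg s (Ioo_subset_Ioc_self hs)) zero_le_one hγ.le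
  rw [integral_add (integrable_const _) (h.supRpow (by linarith : 0 ≤ γ)).integrableOn_const] at h1
  have h2 : ∫ _ in Ioo 0 S, (1 : ℝ) = S := by simp [hS.le]
  linarith [h.pressure_le]

include hS hE in
lemma one_le_pot {s : ℝ} (hs : s ∈ Ioc 0 S) : 1 ≤ pot S E P s := by
  have := logPrim_nonneg h.nonneg hs
  have : 0 < E / S := by positivity
  unfold pot; linarith

include hS hγ in
lemma logPrim_le {s : ℝ} (hs : s ∈ Ioo (S / 2) S) : logPrim S P s ≤ 1 + E / S := by
  obtain ⟨M, hM⟩ := h.bddP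
  refine (logPrim_le_of_half_le hS h.contP hM h.nonneg (Ioo_subset_Ico_self hs)).trans ?_
  calc 1 / S * ∫ σ in Ioo 0 S, P σ ≤ 1 / S * (S + E) := by
        gcongr; exact h.integral_density_le hS hγ
    _ = 1 + E / S := by field_simp

include hS hE hγ in
-- The primitive and its mean are each at most √(E · pot) in absolute value, and 6 leaves room for
-- the square of their difference. This bound costs one power of `pot` for two of the potential.
lemma normPrim_sq_le {s : ℝ} (hs : s ∈ Ioc 0 S) :
    normPrim S (fun σ => P σ * v σ) s ^ 2 ≤ 6 * E * pot S E P s := by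
  obtain ⟨M, hM⟩ := h.bddP
  obtain ⟨N, hN⟩ := h.bddv
  have hb : 0 < 1 + E / S := by positivity
  have key := fun {s} (hs : s ∈ Ioc 0 S) {b : ℝ} hb hle => sqrtPrim_mul_sq_le h.contP h.nonneg h.contv hM hN hE
    h.radial_le hs (b := b) hb hle
  have h1 := key hs (b := pot S E P s) (by linarith [h.one_le_pot hS hE hs])
    (by unfold pot; linarith)
  have h2 : |tailMean S (sqrtPrim S (fun σ => P σ * v σ))| ≤ √(E * (1 + E / S)) :=
    abs_tailMean_le hS fun s hs => Real.abs_le_sqrt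
      (key ⟨by linarith [hs.1], hs.2.le⟩ hb (h.logPrim_le hS hγ hs))
  have h3 : tailMean S (sqrtPrim S (fun σ => P σ * v σ)) ^ 2 ≤ E * (1 + E / S) := by
    rw [← sq_abs, ← Real.sq_sqrt (by positivity : 0 ≤ E * (1 + E / S))]
    gcongr
  have h4 : 1 + E / S ≤ pot S E P s := by
    unfold pot; linarith [logPrim_nonneg h.nonneg hs]
  have h5 : E * (1 + E / S) ≤ E * pot S E P s := by gcongr
  have h6 : 0 < E * pot S E P s := by
    have := h.one_le_pot hS hE hs
    positivity
  unfold normPrim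
  nlinarith [sq_nonneg (sqrtPrim S (fun σ => P σ * v σ) s
    + tailMean S (sqrtPrim S (fun σ => P σ * v σ)))]

include hS hγ in
lemma abs_normPrim_le {U : ℝ} (hU : ∀ s ∈ Ioc 0 S, |v s| ≤ U) {s : ℝ} (hs : s ∈ Ioc 0 S) :
    |normPrim S (fun σ => P σ * v σ) s| ≤ √S * U * pot S E P s := by
  have hU0 : 0 ≤ U := (abs_nonneg _).trans (hU s hs)
  have h1 := abs_sqrtPrim_mul_le h.contP h.nonneg h.contv hU hs
  have h2 : |tailMean S (sqrtPrim S (fun σ => P σ * v σ))| ≤ √S * U * (1 + E / S) :=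
    abs_tailMean_le hS fun s hs =>
      (abs_sqrtPrim_mul_le h.contP h.nonneg h.contv hU ⟨by linarith [hs.1], hs.2.le⟩).trans
        (mul_le_mul_of_nonneg_left (h.logPrim_le hS hγ hs) (by positivity))
  refine (abs_sub _ _).trans ?_
  unfold pot
  linarith

include hS hE hγ in
-- One factor ξ² is estimated through U and costs two powers of `pot`; the n others are estimated
-- through the energy and cost one each. So the total exponent is only n + 2, with a factor U² to be
-- turned into dissipation.
lemma normPrim_pow_le {U : ℝ} (hU : ∀ s ∈ Ioc 0 S, |v s| ≤ U) {n : ℕ} {s : ℝ}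
    (hs : s ∈ Ioc 0 S) :
    normPrim S (fun σ => P σ * v σ) s ^ (2 * (n + 1))
      ≤ S * (6 * E) ^ n * U ^ 2 * pot S E P s ^ (n + 2) := by
  have h0 := h.one_le_pot hS hE hs
  have h1 := h.normPrim_sq_le hS hγ hE hs
  have h2 := pow_le_pow_left₀ (abs_nonneg _) (h.abs_normPrim_le hS hγ hU hs) 2
  rw [sq_abs, mul_pow, mul_pow, Real.sq_sqrt hS.le] at h2
  calc normPrim S (fun σ => P σ * v σ) s ^ (2 * (n + 1))
      = normPrim S (fun σ => P σ * v σ) s ^ 2 * (normPrim S (fun σ => P σ * v σ) s ^ 2) ^ n := by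
        ring
    _ ≤ S * U ^ 2 * pot S E P s ^ 2 * (6 * E * pot S E P s) ^ n := by gcongr
    _ = _ := by rw [mul_pow]; ring

lemma integrableOn_rpow {β : ℝ} (hβ : 1 ≤ β) (n : ℕ) :
    IntegrableOn (fun s => P s ^ (1 + β * n)) (Ioo 0 S) :=
  (h.supRpow (by positivity : 0 ≤ 1 + β * n)).integrableOn_const

lemma mass_nonneg (β : ℝ) (n : ℕ) : 0 ≤ mass β n S P :=
  setIntegral_nonneg measurableSet_Ioo fun s hs =>
    Real.rpow_nonneg (h.nonneg s (Ioo_subset_Ioc_self hs)) _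

lemma psi_nonneg (K : ℝ) (n : ℕ) : 0 ≤ psi μ β K n S P v :=
  setIntegral_nonneg measurableSet_Ioo fun s hs =>
    mul_nonneg (h.nonneg s (Ioo_subset_Ioc_self hs)) (pow_nonneg (cut_nonneg _ _) _)

include hS in
-- Because β ≥ 1, n + 1 ≤ 1 + β n: the power of the density that Hardy's inequality asks for is
-- dominated by `mass`.
lemma integral_pow_succ_le (hβ : 1 ≤ β) (n : ℕ) :
    ∫ s in Ioo 0 S, P s ^ (n + 1) ≤ S + mass β n S P := by
  have h2 : ∫ _ in Ioo 0 S, (1 : ℝ) = S := by simp [hS.le]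
  have h3 : S + mass β n S P = ∫ s in Ioo 0 S, (1 + P s ^ (1 + β * n)) := by
    rw [integral_add (integrable_const _) (h.integrableOn_rpow hβ n), h2, mass]
  rw [h3]
  refine setIntegral_mono_on (h.supPow _).integrableOn_const
    ((integrable_const _).add (h.integrableOn_rpow hβ n)) measurableSet_Ioo fun s hs => ?_
  have := rpow_le_one_add_rpow (a := ((n + 1 : ℕ) : ℝ)) (b := 1 + β * n)
    (h.nonneg s (Ioo_subset_Ioc_self hs)) (by positivity) (by
      push_cast; nlinarith [(Nat.cast_nonneg n : (0 : ℝ) ≤ n)])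
  rwa [Real.rpow_natCast] at this

include hS in
lemma integrableOn_pot_pow (hE : 0 < E) {N : ℕ} (hN : 1 ≤ N) :
    IntegrableOn (fun s => pot S E P s ^ N) (Ioo 0 S) ∧
      ∫ s in Ioo 0 S, pot S E P s ^ N
        ≤ 2 ^ (N - 1) * (N ^ N * (∫ s in Ioo 0 S, P s ^ N) + S * (1 + E / S) ^ N) := by
  obtain ⟨M, hM⟩ := h.bddP
  obtain ⟨h1, h2⟩ := integral_logPrim_pow_le hS h.contP hM h.nonneg hN
  have hb : 0 < 1 + E / S := by positivity
  have hi : IntegrableOn (fun s => (2 : ℝ) ^ (N - 1) * (logPrim S P s ^ N + (1 + E / S) ^ N))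
      (Ioo 0 S) := (h1.add (integrable_const _)).const_mul _
  have hle : ∀ s ∈ Ioo 0 S, pot S E P s ^ N
      ≤ 2 ^ (N - 1) * (logPrim S P s ^ N + (1 + E / S) ^ N) := fun s hs =>
    add_pow_le (logPrim_nonneg h.nonneg (Ioo_subset_Ioc_self hs)) hb.le N
  have hint : IntegrableOn (fun s => pot S E P s ^ N) (Ioo 0 S) := by
    refine hi.mono' ?_ (ae_restrict_of_forall_mem measurableSet_Ioo fun s hs => ?_)
    · refine ContinuousOn.aestronglyMeasurable ?_ measurableSet_Ioo
      exact (((primLoc_logPrim h.contP).continuousOn.mono Ioo_subset_Ioc_self).add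
        continuousOn_const).pow N
    · have := h.one_le_pot hS hE (Ioo_subset_Ioc_self hs)
      rw [Real.norm_of_nonneg (by positivity)]
      exact hle s hs
  refine ⟨hint, (setIntegral_mono_on hint hi measurableSet_Ioo hle).trans ?_⟩
  rw [integral_const_mul, integral_add h1 (integrable_const _)]
  have h3 : ∫ _ in Ioo 0 S, (1 + E / S) ^ N = S * (1 + E / S) ^ N := by simp [hS.le]
  rw [h3]
  gcongr

end

/-- Hardy's inequality returns the potential to the density, with a constant that is the same for
all slices. -/
lemma exists_integral_pot_pow_le (hS : 0 < S) (hE : 0 < E) (hβ : 1 ≤ β) (n : ℕ) :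
    ∃ C : ℝ, 0 < C ∧ ∀ P v w d, Slice γ S E P v w d →
      ∫ s in Ioo 0 S, pot S E P s ^ (n + 1) ≤ C * (1 + mass β n S P) := by
  refine ⟨2 ^ n * (((n + 1 : ℕ) : ℝ) ^ (n + 1) * (S + 1) + S * (1 + E / S) ^ (n + 1)), by positivity,
    fun P v w d h => ?_⟩
  have h1 := (h.integrableOn_pot_pow hS hE (N := n + 1) (by omega)).2
  have h2 := h.integral_pow_succ_le hS hβ n
  have hA := h.mass_nonneg β n
  refine h1.trans ?_
  rw [Nat.add_sub_cancel, mul_assoc (2 ^ n)]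
  have h3 : ∫ s in Ioo 0 S, P s ^ (n + 1) ≤ (S + 1) * (1 + mass β n S P) := by nlinarith
  have h4 : S * (1 + E / S) ^ (n + 1) ≤ S * (1 + E / S) ^ (n + 1) * (1 + mass β n S P) :=
    le_mul_of_one_le_right (by positivity) (by linarith)
  have h5 : ((n + 1 : ℕ) : ℝ) ^ (n + 1) * (∫ s in Ioo 0 S, P s ^ (n + 1))
      ≤ ((n + 1 : ℕ) : ℝ) ^ (n + 1) * ((S + 1) * (1 + mass β n S P)) := by gcongr
  have : (0 : ℝ) ≤ 2 ^ n := by positivity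
  refine mul_le_mul_of_nonneg_left ?_ this
  linarith

/-- The mean of the potential part of the effective viscous flux is bounded by the energy and the
dissipation. -/
lemma neg_tailMean_le (h : Slice γ S E P v w d) (hS : 0 < S) (hμ : 0 < μ) (hβ : 1 ≤ β)
    (hβγ : β ≤ γ) (hE : 0 < E) :
    -tailMean S (fun s => 2 * (d s * (2 * μ + P s ^ β)) - P s ^ γ - P s * v s ^ 2
        + logPrim S (fun σ => P σ * (v σ ^ 2 - w σ ^ 2)) s)
      ≤ 2 / S * ((2 * μ + 1) * S + 4 * E) + 2 / S * diss μ β S P d := by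
  have hγ0 : 0 ≤ γ := by linarith
  have sβ := h.supRpow (by linarith : 0 ≤ β)
  have sγ := h.supRpow hγ0
  have sv2 := h.supP.mul (h.supv.comp (Ψ := fun x => x ^ 2) (by fun_prop))
  have sw2 := h.supP.mul (h.supw.comp (Ψ := fun x => x ^ 2) (by fun_prop))
  have sμ := h.supP.comp (Ψ := fun x => 2 * μ + x ^ β)
    (continuous_const.add (Real.continuous_rpow_const (by linarith)))
  have svw := h.supP.mul ((h.supv.comp (Ψ := fun x => x ^ 2) (by fun_prop)).sub
    (h.supw.comp (Ψ := fun x => x ^ 2) (by fun_prop)))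
  have cvw := svw.cont 0 (mem_univ _)
  have cw := sw2.cont 0 (mem_univ _)
  obtain ⟨B, hB⟩ := svw.bdd 0 (mem_univ _)
  obtain ⟨B', hB'⟩ := sw2.bdd 0 (mem_univ _)
  have hs2 : (0 : ℝ) < S / 2 := by positivity
  have hsub : Ioo (S / 2) S ⊆ Ioo 0 S := Ioo_subset_Ioo_left hs2.le
  have i1 : IntegrableOn (fun s => 2 * (d s * (2 * μ + P s ^ β))) (Ioo 0 S) :=
    ((h.memLp_d.integrable_mul sμ.memLp_const)).const_mul 2
  have i2 : IntegrableOn (fun s => 2 * (d s * (2 * μ + P s ^ β)) - P s ^ γ - P s * v s ^ 2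
        + logPrim S (fun σ => P σ * (v σ ^ 2 - w σ ^ 2)) s) (Ioo 0 S) :=
    ((i1.sub sγ.integrableOn_const).sub sv2.integrableOn_const).add
      ((memLp_logPrim hS cvw hB).integrable (by norm_num))
  have i3 : IntegrableOn (fun s => (2 * μ + P s ^ β) * d s ^ 2) (Ioo 0 S) := by
    refine (h.memLp_d.integrable_mul (memLp_mul_bdd h.memLp_d (sμ.cont 0 (mem_univ _))
      (sμ.bdd 0 (mem_univ _)).choose_spec)).congr (Eventually.of_forall fun s => ?_)
    simp only [Pi.mul_apply]; ring
  have i4 : IntegrableOn (fun s => 2 * μ + 1 + E / S + 2 * P s ^ γ + P s * v s ^ 2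
      + (2 * μ + P s ^ β) * d s ^ 2) (Ioo 0 S) :=
    (((integrable_const _).add (sγ.integrableOn_const.const_mul 2)).add
      sv2.integrableOn_const).add i3
  rw [tailMean_eq hS, ← mul_neg, ← integral_neg, ← mul_add]
  refine mul_le_mul_of_nonneg_left ?_ (by positivity)
  have hpt : ∀ s ∈ Ioo (S / 2) S, -(2 * (d s * (2 * μ + P s ^ β)) - P s ^ γ - P s * v s ^ 2
        + logPrim S (fun σ => P σ * (v σ ^ 2 - w σ ^ 2)) s)
      ≤ 2 * μ + 1 + E / S + 2 * P s ^ γ + P s * v s ^ 2 + (2 * μ + P s ^ β) * d s ^ 2 := by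
    intro s hs
    have hs0 : s ∈ Ioc 0 S := Ioo_subset_Ioc_self (hsub hs)
    have hP0 := h.nonneg s hs0
    -- The radial part of the nonlocal term has the favourable sign. The angular part is at most
    -- E/S, since s > S/2.
    have e1 : -logPrim S (fun σ => P σ * (v σ ^ 2 - w σ ^ 2)) s
        ≤ logPrim S (fun σ => P σ * w σ ^ 2) s := by
      have e2 := logPrim_const_mul (S := S) (-1) (fun σ => P σ * (v σ ^ 2 - w σ ^ 2)) s
      rw [neg_one_mul] at e2
      rw [← e2]
      refine logPrim_mono (continuousOn_const.mul cvw) cw (fun σ hσ => ?_) hs0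
      show -1 * (P σ * (v σ ^ 2 - w σ ^ 2)) ≤ P σ * w σ ^ 2
      nlinarith [mul_nonneg (h.nonneg σ hσ) (sq_nonneg (v σ))]
    have e3 := logPrim_le_of_half_le hS cw hB' (fun σ hσ => mul_nonneg (h.nonneg σ hσ) (sq_nonneg _))
      (Ioo_subset_Ico_self hs)
    have e4 : 1 / S * (∫ σ in Ioo 0 S, P σ * w σ ^ 2) ≤ E / S := by
      rw [div_mul_eq_mul_div, one_mul]; gcongr; exact h.angular_le
    have e5 := rpow_le_one_add_rpow hP0 (by linarith : 0 ≤ β) hβγ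
    have e6 : 0 ≤ P s ^ β := Real.rpow_nonneg hP0 _
    -- With a = 2μ + P^β this says -2ad ≤ a + ad². The term ad² is dissipation, and a ≤ 2μ + 1 + P^γ
    -- because β ≤ γ.
    have e7 : 0 ≤ (2 * μ + P s ^ β) * (1 + d s) ^ 2 := by positivity
    nlinarith
  have hnn : ∀ s ∈ Ioo 0 S, 0 ≤ 2 * μ + 1 + E / S + 2 * P s ^ γ + P s * v s ^ 2
      + (2 * μ + P s ^ β) * d s ^ 2 := by
    intro s hs
    have hP0 := h.nonneg s (Ioo_subset_Ioc_self hs)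
    have e6 : 0 ≤ P s ^ β := Real.rpow_nonneg hP0 _
    have e7 : 0 ≤ P s ^ γ := Real.rpow_nonneg hP0 _
    positivity
  refine (setIntegral_mono_on (i2.mono_set hsub).neg (i4.mono_set hsub) measurableSet_Ioo
    hpt).trans ?_
  refine (setIntegral_mono_set i4 (ae_restrict_of_forall_mem measurableSet_Ioo hnn)
    hsub.eventuallyLE).trans ?_
  have j1 : ∫ s in Ioo 0 S, (2 * μ + 1 + E / S + 2 * P s ^ γ + P s * v s ^ 2
      + (2 * μ + P s ^ β) * d s ^ 2)
      = S * (2 * μ + 1 + E / S) + 2 * (∫ s in Ioo 0 S, P s ^ γ)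
        + (∫ s in Ioo 0 S, P s * v s ^ 2) + diss μ β S P d := by
    have k1 : IntegrableOn (fun _ => 2 * μ + 1 + E / S) (Ioo 0 S) := integrable_const _
    have k2 : IntegrableOn (fun s => 2 * P s ^ γ) (Ioo 0 S) := sγ.integrableOn_const.const_mul 2
    have k3 : IntegrableOn (fun s => P s * v s ^ 2) (Ioo 0 S) := sv2.integrableOn_const
    rw [diss, integral_add_add_add k1 k2 k3 i3, integral_const_mul]
    simp [hS.le]
  rw [j1]
  have : S * (2 * μ + 1 + E / S) = (2 * μ + 1) * S + E := by field_simp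
  linarith [h.pressure_le, h.radial_le]

end Slice

end

/-! ### Comparison of the functional with powers of the density, and its growth -/

section

lemma one_add_add_pow_le {a b : ℝ} (ha : 0 ≤ a) (hb : 0 ≤ b) (n : ℕ) :
    (1 + a + b) ^ n ≤ 4 ^ n * (1 + a ^ n + b ^ n) := by
  have h1 := add_pow_le (by linarith : 0 ≤ 1 + a) hb n
  have h2 := add_pow_le zero_le_one ha n
  have h3 : (2 : ℝ) ^ (n - 1) ≤ 2 ^ n := pow_le_pow_right₀ one_le_two (by omega)
  have h4 : (1 : ℝ) ≤ 2 ^ n := one_le_pow₀ one_le_two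
  have ha' : 0 ≤ a ^ n := by positivity
  have hb' : 0 ≤ b ^ n := by positivity
  have e : (4 : ℝ) ^ n = 2 ^ n * 2 ^ n := by rw [← mul_pow]; norm_num
  rw [one_pow] at h2
  calc (1 + a + b) ^ n ≤ 2 ^ (n - 1) * ((1 + a) ^ n + b ^ n) := h1
    _ ≤ 2 ^ n * (2 ^ n * (1 + a ^ n) + 2 ^ n * b ^ n) := by
        gcongr
        · exact h2.trans (by gcongr)
        · exact le_mul_of_one_le_left hb' h4
    _ = _ := by rw [e]; ring

variable {S μ β γ E : ℝ}

/-- C₀ is the part of the growth rate that does not decay in time. For ρ ≥ C₀^(1/γ) the pressure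
absorbs it. For smaller ρ, θ(ρ) is at most K - 1, so a positive truncation forces ξ ≥ 1; its power m
may then be raised to 2(m + 1), the exponent from which `Slice.normPrim_pow_le` extracts the
dissipation. -/
lemma mul_cut_pow_le {C₀ ρ ξ : ℝ} (hμ : 0 < μ) (hβ : 1 ≤ β) (hγ : 1 < γ) (hC : 0 < C₀)
    (hρ : 0 ≤ ρ) {m : ℕ} (hm : 1 ≤ m) :
    ρ * cut μ β (theta μ β (C₀ ^ (1 / γ)) + 1) ρ ξ ^ m * (C₀ - ρ ^ γ)
      ≤ C₀ * C₀ ^ (1 / γ) * ξ ^ (2 * (m + 1)) := by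
  set M := C₀ ^ (1 / γ) with hM
  have hM0 : 0 < M := Real.rpow_pos_of_pos hC _
  have hMγ : M ^ γ = C₀ := by
    rw [hM, ← Real.rpow_mul hC.le, one_div_mul_cancel (by linarith), Real.rpow_one]
  have hz := cut_nonneg (μ := μ) (β := β) (K := theta μ β M + 1) ρ ξ
  have hξ : 0 ≤ ξ ^ (2 * (m + 1)) := (even_two_mul _).pow_nonneg _
  have hr : 0 ≤ C₀ * M * ξ ^ (2 * (m + 1)) := by positivity
  rcases le_or_gt M ρ with h | h
  · have : C₀ ≤ ρ ^ γ := by rw [← hMγ]; exact Real.rpow_le_rpow hM0.le h (by linarith)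
    refine le_trans ?_ hr
    exact mul_nonpos_of_nonneg_of_nonpos (by positivity) (by linarith)
  rcases hz.eq_or_lt with h0 | h0
  · rw [← h0, zero_pow (by omega)]; simpa using hr
  have hρ0 : 0 < ρ := by
    by_contra hc
    rw [cut, if_neg hc] at h0
    exact lt_irrefl _ h0
  have hzξ : cut μ β (theta μ β M + 1) ρ ξ ≤ ξ - 1 := by
    rw [cut, if_pos hρ0] at h0 ⊢
    have h1 := theta_mono (β := β) hμ hβ hρ0 h.le
    have h2 : 0 < theta μ β ρ + ξ - (theta μ β M + 1) := by
      by_contra hc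
      rw [max_eq_left (not_lt.1 hc)] at h0
      exact lt_irrefl _ h0
    rw [max_eq_right h2.le]
    linarith
  have hξ1 : 1 ≤ ξ := by linarith
  have h3 : C₀ - ρ ^ γ ≤ C₀ := by linarith [Real.rpow_nonneg hρ γ]
  calc ρ * cut μ β (theta μ β M + 1) ρ ξ ^ m * (C₀ - ρ ^ γ)
      ≤ ρ * cut μ β (theta μ β M + 1) ρ ξ ^ m * C₀ := by gcongr
    _ ≤ M * ξ ^ m * C₀ := by gcongr; linarith
    _ ≤ M * ξ ^ (2 * (m + 1)) * C₀ := by gcongr; omega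
    _ = _ := by ring

/-- For ρ ≥ 1 the logarithm in θ is nonnegative and may be dropped; for ρ ≤ 1 the left-hand side is
at most 1. -/
lemma rpow_le_cut (hμ : 0 < μ) (hβ : 1 ≤ β) (K : ℝ) {ρ : ℝ} (ξ : ℝ) (hρ : 0 ≤ ρ) :
    ρ ^ β ≤ (1 + β + β * |K|) * (1 + cut μ β K ρ ξ + |ξ|) := by
  have hz := cut_nonneg (μ := μ) (β := β) (K := K) ρ ξ
  have hβ0 : 0 < β := by linarith
  have hK := abs_nonneg K
  have hξ := abs_nonneg ξ
  have hbK : 0 ≤ β * |K| := by positivity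
  rcases le_total ρ 1 with h | h
  · have h1 := Real.rpow_le_one hρ h hβ0.le
    have h2 : 0 ≤ (β + β * |K|) * (1 + cut μ β K ρ ξ + |ξ|) := by positivity
    linarith
  · have hρ0 : 0 < ρ := by linarith
    have h1 : theta μ β ρ + ξ - K ≤ cut μ β K ρ ξ := by
      rw [cut, if_pos hρ0]; exact le_max_right _ _
    have h2 : 0 ≤ 2 * μ * Real.log ρ := by
      have := Real.log_nonneg h
      positivity
    have h3 : ρ ^ β / β ≤ cut μ β K ρ ξ + |ξ| + |K| := by
      unfold theta at h1
      linarith [neg_abs_le ξ, le_abs_self K]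
    rw [div_le_iff₀ hβ0] at h3
    have h4 : 0 ≤ (1 + β * |K|) * (cut μ β K ρ ξ + |ξ|) := by positivity
    linarith

/-- The logarithm is bounded by ρ, and ρ by 1 + ρ^β since β ≥ 1. -/
lemma cut_le_rpow (hμ : 0 < μ) (hβ : 1 ≤ β) (K : ℝ) {ρ : ℝ} (ξ : ℝ) (hρ : 0 ≤ ρ) :
    cut μ β K ρ ξ ≤ (1 + 2 * μ + |K|) * (1 + ρ ^ β + |ξ|) := by
  have hK := abs_nonneg K
  have hξ := abs_nonneg ξ
  have hρβ := Real.rpow_nonneg hρ β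
  have hr : 0 ≤ (1 + 2 * μ + |K|) * (1 + ρ ^ β + |ξ|) := by positivity
  unfold cut
  split_ifs with h
  · refine max_le hr ?_
    have h1 : Real.log ρ ≤ 1 + ρ ^ β := by
      have := Real.log_le_sub_one_of_pos h
      have := rpow_le_one_add_rpow hρ zero_le_one hβ
      rw [Real.rpow_one] at this
      linarith
    have h2 : 2 * μ * Real.log ρ ≤ 2 * μ * (1 + ρ ^ β) := by gcongr
    have h3 : ρ ^ β / β ≤ ρ ^ β := div_le_self hρβ hβ
    have h4 : 0 ≤ 2 * μ * |ξ| + |K| * (ρ ^ β + |ξ|) := by positivity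
    unfold theta
    linarith [le_abs_self ξ, neg_abs_le K]
  · exact hr

lemma rpow_one_add_mul {ρ : ℝ} (hβ : 1 ≤ β) (hρ : 0 ≤ ρ) (n : ℕ) :
    ρ ^ (1 + β * n) = ρ * (ρ ^ β) ^ n := by
  have h0 : 0 < 1 + β * n := by positivity
  rcases hρ.eq_or_lt with h | h
  · rw [← h, Real.zero_rpow h0.ne', zero_mul]
  · rw [Real.rpow_add h, Real.rpow_one, Real.rpow_mul hρ, Real.rpow_natCast]

namespace Slice

/-- The moments of the potential are small compared with the controlled power of the density. -/
lemma exists_integral_mul_abs_pow_le (hS : 0 < S) (hβ : 1 ≤ β) (hγ : 1 < γ) (hE : 0 < E) (n : ℕ)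
    {ε : ℝ} (hε : 0 < ε) :
    ∃ C : ℝ, 0 < C ∧ ∀ P v w d, Slice γ S E P v w d →
      ∫ s in Ioo 0 S, P s * |normPrim S (fun σ => P σ * v σ) s| ^ n ≤ ε * mass β n S P + C := by
  obtain ⟨C, hC, hpot⟩ := exists_integral_pot_pow_le (γ := γ) hS hE hβ n
  -- Chosen so that the coefficients of `mass` coming from P^(n+1) and from pot^(n+1) add up to ε.
  set δ := ε / ((6 * E) ^ n * (1 + C)) with hδ
  have hδ0 : 0 < δ := by positivity
  refine ⟨δ * (6 * E) ^ n * (S + C) + (S + E) / (4 * δ), by positivity, fun P v w d h => ?_⟩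
  obtain ⟨hi, -⟩ := h.integrableOn_pot_pow hS hE (N := n + 1) (by omega)
  have i1 := (h.supPow (n + 1)).integrableOn_const
  have i2 := h.supP.integrableOn_const
  have i4 : IntegrableOn (fun s => P s * |normPrim S (fun σ => P σ * v σ) s| ^ n) (Ioo 0 S) :=
    (h.supP.mul (h.supNormPrim.comp (Ψ := fun x => |x| ^ n) (by fun_prop))).integrableOn_const
  have h1 := setIntegral_mono_on i4
    (((i1.add hi).const_mul (δ * (6 * E) ^ n)).add (i2.const_mul (1 / (4 * δ))))
    measurableSet_Ioo fun s hs => by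
    have hs' := Ioo_subset_Ioc_self hs
    have hP := h.nonneg s hs'
    have hg := h.one_le_pot hS hE hs'
    have hξ := h.normPrim_sq_le hS hγ hE hs'
    set ξ := normPrim S (fun σ => P σ * v σ) s
    -- The energy bound controls ξ^(2n) by pot^n, while only ξ^n is needed; the spare half of the
    -- exponent buys the small factor δ.
    have a1 : |ξ| ^ n ≤ δ * (ξ ^ 2) ^ n + 1 / (4 * δ) := by
      have e : (ξ ^ 2) ^ n = (|ξ| ^ n) ^ 2 := by rw [← sq_abs]; ring
      rw [e]
      have : δ * (|ξ| ^ n) ^ 2 + 1 / (4 * δ) - |ξ| ^ n = δ * (|ξ| ^ n - 1 / (2 * δ)) ^ 2 := by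
        field_simp; ring
      nlinarith [mul_nonneg hδ0.le (sq_nonneg (|ξ| ^ n - 1 / (2 * δ)))]
    have a2 : (ξ ^ 2) ^ n ≤ (6 * E) ^ n * pot S E P s ^ n := by
      rw [← mul_pow]; exact pow_le_pow_left₀ (sq_nonneg _) hξ n
    have a3 := mul_pow_le_add hP (by linarith : 0 ≤ pot S E P s) n
    calc P s * |ξ| ^ n ≤ P s * (δ * ((6 * E) ^ n * pot S E P s ^ n) + 1 / (4 * δ)) := by
          gcongr; exact a1.trans (by gcongr)
      _ = δ * (6 * E) ^ n * (P s * pot S E P s ^ n) + 1 / (4 * δ) * P s := by ring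
      _ ≤ δ * (6 * E) ^ n * (P s ^ (n + 1) + pot S E P s ^ (n + 1)) + 1 / (4 * δ) * P s := by
          gcongr
  rw [integral_add' ((i1.add hi).const_mul _) (i2.const_mul _), integral_const_mul,
    integral_const_mul, integral_add' i1 hi] at h1
  have h2 := h.integral_pow_succ_le hS hβ n
  have h3 := hpot P v w d h
  have h4 := h.integral_density_le hS hγ
  have h5 : δ * (6 * E) ^ n * (1 + C) = ε := by rw [hδ]; field_simp
  have h6 : 1 / (4 * δ) * (∫ s in Ioo 0 S, P s) ≤ (S + E) / (4 * δ) := by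
    rw [div_mul_eq_mul_div, one_mul]; gcongr
  have h7 : δ * (6 * E) ^ n * ((∫ s in Ioo 0 S, P s ^ (n + 1)) + ∫ s in Ioo 0 S, pot S E P s ^ (n + 1))
      ≤ δ * (6 * E) ^ n * ((S + mass β n S P) + C * (1 + mass β n S P)) := by gcongr
  have h8 : δ * (6 * E) ^ n * ((S + mass β n S P) + C * (1 + mass β n S P))
      = δ * (6 * E) ^ n * (S + C) + ε * mass β n S P := by rw [← h5]; ring
  linarith

/-- ρ^β is bounded by the truncation plus |ξ|. The moment of |ξ| is taken with ε = 1/(2L), so that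
half of `mass` is absorbed on the left. -/
lemma exists_mass_le (hS : 0 < S) (hμ : 0 < μ) (hβ : 1 ≤ β) (hγ : 1 < γ) (hE : 0 < E) (K : ℝ)
    (n : ℕ) : ∃ C : ℝ, 0 < C ∧ ∀ P v w d, Slice γ S E P v w d →
      mass β n S P ≤ C * (1 + psi μ β K n S P v) := by
  set L := (1 + β + β * |K|) ^ n * 4 ^ n with hL
  have hL0 : 0 < L := by positivity
  obtain ⟨C, hC, hξ⟩ := exists_integral_mul_abs_pow_le hS hβ hγ hE n
    (ε := 1 / (2 * L)) (by positivity)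
  refine ⟨2 * L * (1 + S + E + C), by positivity, fun P v w d h => ?_⟩
  have i1 := h.supP.integrableOn_const
  have i2 : IntegrableOn (fun s => P s * cut μ β K (P s) (normPrim S (fun σ => P σ * v σ) s) ^ n)
    (Ioo 0 S) := (h.supP.mul (h.supCut hμ hβ K n)).integrableOn_const
  have i3 : IntegrableOn (fun s => P s * |normPrim S (fun σ => P σ * v σ) s| ^ n) (Ioo 0 S) :=
    (h.supP.mul (h.supNormPrim.comp (Ψ := fun x => |x| ^ n) (by fun_prop))).integrableOn_const
  have h1 := setIntegral_mono_on (h.integrableOn_rpow hβ n) (((i1.add i2).add i3).const_mul L)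
    measurableSet_Ioo fun s hs => by
      have hP := h.nonneg s (Ioo_subset_Ioc_self hs)
      set ξ := normPrim S (fun σ => P σ * v σ) s
      have hz := cut_nonneg (μ := μ) (β := β) (K := K) (P s) ξ
      have a1 := rpow_le_cut hμ hβ K ξ hP
      have a2 := one_add_add_pow_le hz (abs_nonneg ξ) n
      rw [rpow_one_add_mul hβ hP]
      calc P s * (P s ^ β) ^ n
          ≤ P s * ((1 + β + β * |K|) * (1 + cut μ β K (P s) ξ + |ξ|)) ^ n := by
            have := Real.rpow_nonneg hP β
            gcongr
        _ = P s * (1 + β + β * |K|) ^ n * (1 + cut μ β K (P s) ξ + |ξ|) ^ n := by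
            rw [mul_pow]; ring
        _ ≤ P s * (1 + β + β * |K|) ^ n * (4 ^ n * (1 + cut μ β K (P s) ξ ^ n + |ξ| ^ n)) := by
            gcongr
        _ = L * (P s + P s * cut μ β K (P s) ξ ^ n + P s * |ξ| ^ n) := by rw [hL]; ring
  rw [integral_const_mul, integral_add' (i1.add i2) i3, integral_add' i1 i2] at h1
  have h2 := hξ P v w d h
  have h3 := h.integral_density_le hS hγ
  have hA := h.mass_nonneg β n
  have hY := h.psi_nonneg (μ := μ) (β := β) K n
  change mass β n S P ≤ L * ((∫ s in Ioo 0 S, P s) + psi μ β K n S P v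
    + ∫ s in Ioo 0 S, P s * |normPrim S (fun σ => P σ * v σ) s| ^ n) at h1
  have h4 : L * ((∫ s in Ioo 0 S, P s) + psi μ β K n S P v
    + ∫ s in Ioo 0 S, P s * |normPrim S (fun σ => P σ * v σ) s| ^ n)
    ≤ L * ((S + E) + psi μ β K n S P v + (1 / (2 * L) * mass β n S P + C)) := by gcongr
  have h5 : L * ((S + E) + psi μ β K n S P v + (1 / (2 * L) * mass β n S P + C))
      = L * (S + E + psi μ β K n S P v + C) + mass β n S P / 2 := by field_simp; ring
  have h6 : 0 ≤ L * (1 + (S + E + C) * psi μ β K n S P v) := by positivity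
  linarith

/-- The converse comparison, which serves to bound the functional at the initial time; no absorption
is needed, so ε = 1. -/
lemma exists_psi_le (hS : 0 < S) (hμ : 0 < μ) (hβ : 1 ≤ β) (hγ : 1 < γ) (hE : 0 < E) (K : ℝ)
    (n : ℕ) : ∃ C : ℝ, 0 < C ∧ ∀ P v w d, Slice γ S E P v w d →
      psi μ β K n S P v ≤ C * (1 + mass β n S P) := by
  set L := (1 + 2 * μ + |K|) ^ n * 4 ^ n with hL
  have hL0 : 0 < L := by positivity
  obtain ⟨C, hC, hξ⟩ := exists_integral_mul_abs_pow_le hS hβ hγ hE n (ε := 1) one_pos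
  refine ⟨L * (2 + S + E + C), by positivity, fun P v w d h => ?_⟩
  have i1 := h.supP.integrableOn_const
  have i2 := h.integrableOn_rpow hβ n
  have i3 : IntegrableOn (fun s => P s * |normPrim S (fun σ => P σ * v σ) s| ^ n) (Ioo 0 S) :=
    (h.supP.mul (h.supNormPrim.comp (Ψ := fun x => |x| ^ n) (by fun_prop))).integrableOn_const
  have i4 : IntegrableOn (fun s => P s * cut μ β K (P s) (normPrim S (fun σ => P σ * v σ) s) ^ n)
    (Ioo 0 S) := (h.supP.mul (h.supCut hμ hβ K n)).integrableOn_const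
  have h1 := setIntegral_mono_on i4 (((i1.add i2).add i3).const_mul L)
    measurableSet_Ioo fun s hs => by
      have hP := h.nonneg s (Ioo_subset_Ioc_self hs)
      set ξ := normPrim S (fun σ => P σ * v σ) s
      have hz := cut_nonneg (μ := μ) (β := β) (K := K) (P s) ξ
      have hPβ := Real.rpow_nonneg hP β
      have a1 := cut_le_rpow hμ hβ K ξ hP
      have a2 := one_add_add_pow_le hPβ (abs_nonneg ξ) n
      simp only [Pi.add_apply]
      rw [rpow_one_add_mul hβ hP]
      calc P s * cut μ β K (P s) ξ ^ n
          ≤ P s * ((1 + 2 * μ + |K|) * (1 + P s ^ β + |ξ|)) ^ n := by gcongr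
        _ = P s * (1 + 2 * μ + |K|) ^ n * (1 + P s ^ β + |ξ|) ^ n := by
            rw [mul_pow]; ring
        _ ≤ P s * (1 + 2 * μ + |K|) ^ n * (4 ^ n * (1 + (P s ^ β) ^ n + |ξ| ^ n)) := by
            gcongr
        _ = L * (P s + P s * (P s ^ β) ^ n + P s * |ξ| ^ n) := by rw [hL]; ring
  rw [integral_const_mul, integral_add' (i1.add i2) i3, integral_add' i1 i2] at h1
  have h2 := hξ P v w d h
  have h3 := h.integral_density_le hS hγ
  have hA := h.mass_nonneg β n
  change psi μ β K n S P v ≤ L * ((∫ s in Ioo 0 S, P s) + mass β n S P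
    + ∫ s in Ioo 0 S, P s * |normPrim S (fun σ => P σ * v σ) s| ^ n) at h1
  have h4 : L * ((∫ s in Ioo 0 S, P s) + mass β n S P
    + ∫ s in Ioo 0 S, P s * |normPrim S (fun σ => P σ * v σ) s| ^ n)
    ≤ L * ((S + E) + mass β n S P + (1 * mass β n S P + C)) := by gcongr
  have h6 : 0 ≤ L * (2 + (S + E + C) * mass β n S P) := by positivity
  linarith

/-- The growth of the main functional is controlled by the dissipation. -/
theorem exists_growth_le (hS : 0 < S) (hμ : 0 < μ) (hβ : 1 ≤ β) (hβγ : β ≤ γ) (hγ : 1 < γ)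
    (hE : 0 < E) {n : ℕ} (hn : 2 ≤ n) :
    ∃ K C : ℝ, 0 < C ∧ ∀ P v w d, Slice γ S E P v w d →
      ∫ s in Ioo 0 S,
        P s * (n * cut μ β K (P s) (normPrim S (fun σ => P σ * v σ) s) ^ (n - 1))
          * (-P s ^ γ + logPrim S (fun σ => P σ * (v σ ^ 2 - w σ ^ 2)) s
            - tailMean S (fun s => 2 * (d s * (2 * μ + P s ^ β)) - P s ^ γ - P s * v s ^ 2
                + logPrim S (fun σ => P σ * (v σ ^ 2 - w σ ^ 2)) s))
      ≤ C * diss μ β S P d * (1 + psi μ β K n S P v + mass β n S P) := by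
  obtain ⟨m, rfl⟩ : ∃ m, n = m + 1 := ⟨n - 1, by omega⟩
  have hm : 1 ≤ m := by omega
  obtain ⟨Cg, hCg, hpot⟩ := exists_integral_pot_pow_le (γ := γ) hS hE hβ (m + 1)
  -- The constant of `neg_tailMean_le`. M is the density at which the pressure equals C₀, and K is
  -- the level required by `mul_cut_pow_le`.
  set C₀ := 2 / S * ((2 * μ + 1) * S + 4 * E) with hC₀
  have hC₀0 : 0 < C₀ := by positivity
  set M := C₀ ^ (1 / γ) with hM
  have hM0 : 0 < M := Real.rpow_pos_of_pos hC₀0 _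
  set K := theta μ β M + 1 with hK
  set N : ℝ := ((m + 1 : ℕ) : ℝ) with hN
  have hN0 : 0 ≤ N := by positivity
  refine ⟨K, N * (C₀ * M * (S * (6 * E) ^ m) / (2 * μ) * Cg + (1 / (2 * μ) + 2 / S) * (1 + S + Cg)),
    by positivity, fun P v w d h => ?_⟩
  set τ := tailMean S (fun s => 2 * (d s * (2 * μ + P s ^ β)) - P s ^ γ - P s * v s ^ 2
                + logPrim S (fun σ => P σ * (v σ ^ 2 - w σ ^ 2)) s) with hτ
  set D := diss μ β S P d with hD
  have hτD : -τ ≤ C₀ + 2 / S * D := h.neg_tailMean_le hS hμ hβ hβγ hE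
  obtain ⟨Nv, hNv⟩ := h.bddv
  set U2 := ∫ s in Ioo 0 S, d s ^ 2 with hU2
  have hv2 : ∀ s ∈ Ioc 0 S, v s ^ 2 ≤ U2 := fun s hs =>
    sq_le_integral_sq_deriv h.primV hNv h.memLp_d hs
  have hU20 : 0 ≤ U2 := integral_nonneg fun s => sq_nonneg _
  have hvU : ∀ s ∈ Ioc 0 S, |v s| ≤ √U2 := fun s hs => Real.abs_le_sqrt (hv2 s hs)
  have sμ := h.supP.comp (Ψ := fun x => 2 * μ + x ^ β)
    (continuous_const.add (Real.continuous_rpow_const (by linarith)))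
  -- The uniform shear viscosity turns the bound for v² into one by the dissipation, also in vacuum.
  have hUD : U2 ≤ D / (2 * μ) := by
    rw [le_div_iff₀ (by positivity), mul_comm, hU2, ← integral_const_mul]
    refine setIntegral_mono_on (h.memLp_d.integrable_sq.const_mul _) ?_ measurableSet_Ioo
      fun s hs => ?_
    · refine (h.memLp_d.integrable_mul (memLp_mul_bdd h.memLp_d (sμ.cont 0 (mem_univ _))
        (sμ.bdd 0 (mem_univ _)).choose_spec)).congr (Eventually.of_forall fun s => ?_)
      simp only [Pi.mul_apply]; ring
    · have := Real.rpow_nonneg (h.nonneg s (Ioo_subset_Ioc_self hs)) β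
      gcongr
      linarith
  have hD0 : 0 ≤ D := by
    by_contra hc
    have : D / (2 * μ) < 0 := div_neg_of_neg_of_pos (not_le.1 hc) (by positivity)
    linarith
  have svw := h.supP.mul ((h.supv.comp (Ψ := fun x => x ^ 2) (by fun_prop)).sub
    (h.supw.comp (Ψ := fun x => x ^ 2) (by fun_prop)))
  have cvw := svw.cont 0 (mem_univ _)
  obtain ⟨B, hB⟩ := svw.bdd 0 (mem_univ _)
  obtain ⟨hi, -⟩ := h.integrableOn_pot_pow hS hE (N := m + 1 + 1) (by omega)
  have i1 := (h.supPow (m + 1 + 1)).integrableOn_const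
  have i2 : IntegrableOn (fun s => P s * cut μ β K (P s) (normPrim S (fun σ => P σ * v σ) s)
    ^ (m + 1)) (Ioo 0 S) := (h.supP.mul (h.supCut hμ hβ K (m + 1))).integrableOn_const
  have i3 : IntegrableOn (fun s => P s * (N * cut μ β K (P s) (normPrim S (fun σ => P σ * v σ) s)
      ^ (m + 1 - 1)) * (-P s ^ γ + logPrim S (fun σ => P σ * (v σ ^ 2 - w σ ^ 2)) s - τ))
      (Ioo 0 S) := by
    refine MemLp.integrable_mul (p := 2) (q := 2)
      (h.supP.mul ((h.supCut hμ hβ K (m + 1 - 1)).const_mul N)).memLp_const ?_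
    exact memLp_sub_const τ
      (((h.supRpow (by linarith : 0 ≤ γ)).memLp_const.neg).add (memLp_logPrim hS cvw hB))
  -- c₁ arises from the nondecaying constant C₀ after it has been traded for powers of ξ, c₂ from
  -- the nonlocal term and the decaying part of the mean. Both are at most a multiple of D.
  set c₁ := C₀ * M * (S * (6 * E) ^ m) * U2 with hc₁
  set c₂ := U2 + 2 / S * D with hc₂
  have hc₂0 : 0 ≤ c₂ := by positivity
  have h1 := setIntegral_mono_on i3
    (((hi.const_mul c₁).add (((i2.add i1).add hi).const_mul c₂)).const_mul N) measurableSet_Ioo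
    fun s hs => by
      have hs' := Ioo_subset_Ioc_self hs
      have hP := h.nonneg s hs'
      have hg := h.one_le_pot hS hE hs'
      have hξ := h.normPrim_pow_le hS hγ hE hvU (n := m) hs'
      rw [Real.sq_sqrt hU20] at hξ
      set ξ := normPrim S (fun σ => P σ * v σ) s
      have hz := cut_nonneg (μ := μ) (β := β) (K := K) (P s) ξ
      -- The angular velocity enters with the favourable sign and is dropped; v² is replaced by its
      -- supremum.
      have hH : logPrim S (fun σ => P σ * (v σ ^ 2 - w σ ^ 2)) s ≤ U2 * pot S E P s := by
        have a1 : logPrim S (fun σ => P σ * (v σ ^ 2 - w σ ^ 2)) s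
            ≤ logPrim S (fun σ => U2 * P σ) s :=
          logPrim_mono cvw (continuousOn_const.mul h.contP) (fun σ hσ => by
            have := h.nonneg σ hσ
            have := hv2 σ hσ
            calc P σ * (v σ ^ 2 - w σ ^ 2) ≤ P σ * U2 := by
                  gcongr; linarith [sq_nonneg (w σ)]
              _ = U2 * P σ := mul_comm _ _) hs'
        rw [logPrim_const_mul] at a1
        refine a1.trans ?_
        gcongr
        unfold pot
        have : 0 < E / S := by positivity
        linarith
      have a2 := mul_cut_pow_le (ξ := ξ) hμ hβ hγ hC₀0 hP hm
      rw [← hM, ← hK] at a2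
      have a3 : C₀ * M * ξ ^ (2 * (m + 1)) ≤ c₁ * pot S E P s ^ (m + 2) := by
        calc C₀ * M * ξ ^ (2 * (m + 1))
            ≤ C₀ * M * (S * (6 * E) ^ m * U2 * pot S E P s ^ (m + 2)) := by gcongr
          _ = _ := by rw [hc₁]; ring
      have a4 : -P s ^ γ + logPrim S (fun σ => P σ * (v σ ^ 2 - w σ ^ 2)) s - τ
          ≤ (C₀ - P s ^ γ) + c₂ * pot S E P s := by
        have : 2 / S * D ≤ 2 / S * D * pot S E P s := le_mul_of_one_le_right (by positivity) hg
        rw [hc₂, add_mul]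
        linarith
      have a5 := mul_pow_le_add (by linarith : 0 ≤ pot S E P s) hz m
      have a6 := mul_pow_le_add hP (by linarith : 0 ≤ pot S E P s) (m + 1)
      simp only [Pi.add_apply, Nat.add_sub_cancel]
      set z := cut μ β K (P s) ξ
      set g := pot S E P s
      -- Two applications of Young's inequality separate the product into the integrand of `psi`, a
      -- power of the density and a power of the potential.
      have a7 : P s * (g * z ^ m) ≤ P s * z ^ (m + 1) + P s ^ (m + 1 + 1) + g ^ (m + 1 + 1) := by
        calc P s * (g * z ^ m) ≤ P s * (g ^ (m + 1) + z ^ (m + 1)) := by gcongr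
          _ = P s * g ^ (m + 1) + P s * z ^ (m + 1) := by ring
          _ ≤ _ := by linarith
      calc P s * (N * z ^ m) * (-P s ^ γ + logPrim S (fun σ => P σ * (v σ ^ 2 - w σ ^ 2)) s - τ)
          ≤ P s * (N * z ^ m) * ((C₀ - P s ^ γ) + c₂ * g) := by gcongr
        _ = N * (P s * z ^ m * (C₀ - P s ^ γ) + c₂ * (P s * (g * z ^ m))) := by ring
        _ ≤ N * (c₁ * g ^ (m + 1 + 1)
            + c₂ * (P s * z ^ (m + 1) + P s ^ (m + 1 + 1) + g ^ (m + 1 + 1))) := by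
            exact mul_le_mul_of_nonneg_left
              (add_le_add (a2.trans a3) (mul_le_mul_of_nonneg_left a7 hc₂0)) hN0
  rw [integral_const_mul, integral_add' (hi.const_mul c₁) (((i2.add i1).add hi).const_mul c₂),
    integral_const_mul, integral_const_mul, integral_add' (i2.add i1) hi,
    integral_add' i2 i1] at h1
  have h2 := h.integral_pow_succ_le hS hβ (m + 1)
  have h3 := hpot P v w d h
  have hA := h.mass_nonneg β (m + 1)
  have hY := h.psi_nonneg (μ := μ) (β := β) K (m + 1)
  refine h1.trans ?_
  change N * (c₁ * (∫ s in Ioo 0 S, pot S E P s ^ (m + 1 + 1)) + c₂ * (psi μ β K (m + 1) S P v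
    + (∫ s in Ioo 0 S, P s ^ (m + 1 + 1)) + ∫ s in Ioo 0 S, pot S E P s ^ (m + 1 + 1))) ≤ _
  set A := mass β (m + 1) S P
  set Y := psi μ β K (m + 1) S P v
  have hc₁D : c₁ ≤ C₀ * M * (S * (6 * E) ^ m) / (2 * μ) * D := by
    calc c₁ ≤ C₀ * M * (S * (6 * E) ^ m) * (D / (2 * μ)) := by rw [hc₁]; gcongr
      _ = _ := by ring
  have hc₂D : c₂ ≤ (1 / (2 * μ) + 2 / S) * D := by
    rw [hc₂]
    have : D / (2 * μ) = 1 / (2 * μ) * D := by ring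
    linarith
  have hc₁0 : 0 ≤ c₁ := by positivity
  have b1 : c₁ * (∫ s in Ioo 0 S, pot S E P s ^ (m + 1 + 1))
      ≤ (C₀ * M * (S * (6 * E) ^ m) / (2 * μ) * D) * (Cg * (1 + Y + A)) := by
    refine mul_le_mul hc₁D (h3.trans ?_) (integral_nonneg_of_ae ?_) (by positivity)
    · gcongr; linarith
    · exact ae_restrict_of_forall_mem measurableSet_Ioo fun s hs => by
        have := h.one_le_pot hS hE (Ioo_subset_Ioc_self hs)
        positivity
  have b2 : Y + (∫ s in Ioo 0 S, P s ^ (m + 1 + 1)) + ∫ s in Ioo 0 S, pot S E P s ^ (m + 1 + 1)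
      ≤ (1 + S + Cg) * (1 + Y + A) := by
    have : 0 ≤ 1 + S * (Y + A) + Cg * Y := by positivity
    linarith
  have b3 : c₂ * (Y + (∫ s in Ioo 0 S, P s ^ (m + 1 + 1))
      + ∫ s in Ioo 0 S, pot S E P s ^ (m + 1 + 1))
      ≤ (1 / (2 * μ) + 2 / S) * D * ((1 + S + Cg) * (1 + Y + A)) :=
    (mul_le_mul_of_nonneg_left b2 hc₂0).trans (by gcongr)
  calc _ ≤ N * ((C₀ * M * (S * (6 * E) ^ m) / (2 * μ) * D) * (Cg * (1 + Y + A))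
        + (1 / (2 * μ) + 2 / S) * D * ((1 + S + Cg) * (1 + Y + A))) := by gcongr
    _ = _ := by ring

end Slice

end

/-! ### Energy decay, Gronwall's inequality and the uniform bound -/

section

variable {S : ℝ}

lemma antitoneOn_of_hasDerivAt_nonpos {f f' : ℝ → ℝ} {a b : ℝ} (hc : ContinuousOn f (Icc a b))
    (hd : ∀ t ∈ Ioo a b, HasDerivAt f (f' t) t) (h : ∀ t ∈ Ioo a b, f' t ≤ 0) :
    AntitoneOn f (Icc a b) := by
  refine antitoneOn_of_deriv_nonpos (convex_Icc a b) hc ?_ ?_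
  · rw [interior_Icc]
    exact fun t ht => (hd t ht).differentiableAt.differentiableWithinAt
  · rw [interior_Icc]
    exact fun t ht => by rw [(hd t ht).deriv]; exact h t ht

namespace RadialFlow

variable {μ β γ T : ℝ} {P v w Q d c : ℝ → ℝ → ℝ}

section

variable (h : RadialFlow μ β γ S T P v w Q d c)

include h

lemma continuousOn_energy (hγ : 1 < γ) : ContinuousOn (energy γ S P v w) (Icc 0 T) := by
  have h1 := (h.supP.mul (h.supv.comp (Ψ := fun x => x ^ 2) (by fun_prop))).l2Cont
  have h2 := (h.supP.mul (h.supw.comp (Ψ := fun x => x ^ 2) (by fun_prop))).l2Cont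
  have h3 := (h.supP.comp (Ψ := fun x => x ^ γ)
    (Real.continuous_rpow_const (by linarith))).l2Cont
  exact (continuousOn_const.mul (h1.continuousOn_integral.add h2.continuousOn_integral)).add
    (continuousOn_const.mul h3.continuousOn_integral)

lemma diss_nonneg (hμ : 0 < μ) {t : ℝ} (ht : t ∈ Icc 0 T) :
    0 ≤ Slice.diss μ β S (P t) (d t) :=
  setIntegral_nonneg measurableSet_Ioo fun s hs => by
    have := Real.rpow_nonneg (h.nonneg t ht s (Ioo_subset_Ioc_self hs)) β
    positivity

omit h in
lemma diss_le_dissipation (hμ : 0 < μ) (t : ℝ) :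
    4 * Slice.diss μ β S (P t) (d t) ≤ dissipation μ β S P d c t := by
  have : 0 ≤ 4 * μ * ∫ s in Ioo 0 S, c t s ^ 2 :=
    mul_nonneg (by positivity) (integral_nonneg fun s => sq_nonneg _)
  unfold dissipation Slice.diss
  linarith

lemma antitoneOn_energy (hS : 0 < S) (hμ : 0 < μ) (hβ : 1 ≤ β) (hγ : 1 < γ) :
    AntitoneOn (energy γ S P v w) (Icc 0 T) := by
  refine antitoneOn_of_hasDerivAt_nonpos (h.continuousOn_energy hγ)
    (fun t ht => h.hasDerivAt_energy hS hβ hγ ht) fun t ht => ?_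
  have := h.diss_nonneg (β := β) hμ (Ioo_subset_Icc_self ht)
  have := diss_le_dissipation (μ := μ) (β := β) (S := S) (P := P) (d := d) (c := c) hμ t
  linarith

lemma kinetic_nonneg {t : ℝ} (ht : t ∈ Icc 0 T) (y : ℝ → ℝ) : 0 ≤ ∫ s in Ioo 0 S, P t s * y s ^ 2 :=
  setIntegral_nonneg measurableSet_Ioo fun s hs =>
    mul_nonneg (h.nonneg t ht s (Ioo_subset_Ioc_self hs)) (sq_nonneg _)

lemma pressure_nonneg {t : ℝ} (ht : t ∈ Icc 0 T) : 0 ≤ ∫ s in Ioo 0 S, P t s ^ γ :=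
  setIntegral_nonneg measurableSet_Ioo fun s hs =>
    Real.rpow_nonneg (h.nonneg t ht s (Ioo_subset_Ioc_self hs)) _

lemma energy_nonneg (hγ : 1 < γ) {t : ℝ} (ht : t ∈ Icc 0 T) : 0 ≤ energy γ S P v w t := by
  have h1 := h.kinetic_nonneg ht (v t)
  have h2 := h.kinetic_nonneg ht (w t)
  have h3 := h.pressure_nonneg ht
  have : 0 < γ - 1 := by linarith
  unfold energy
  positivity

/-- Twice the kinetic energy is at most 2E₀ and ∫P^γ is at most (γ - 1)E₀; γ + 1 dominates both 2
and γ - 1. -/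
lemma slice (hγ : 1 < γ) {t : ℝ} (ht : t ∈ Icc 0 T) {E₀ : ℝ} (hE : energy γ S P v w t ≤ E₀) :
    Slice γ S ((γ + 1) * E₀) (P t) (v t) (w t) (d t) := by
  have h1 := h.kinetic_nonneg ht (v t)
  have h2 := h.kinetic_nonneg ht (w t)
  have h3 := h.pressure_nonneg ht
  have hγ1 : 0 < γ - 1 := by linarith
  have h0 := h.energy_nonneg hγ ht
  have h4 : 0 ≤ 1 / (γ - 1) * ∫ s in Ioo 0 S, P t s ^ γ := by positivity
  unfold energy at hE
  have h5 : 2 * E₀ ≤ (γ + 1) * E₀ := by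
    have : 0 ≤ E₀ := h0.trans hE
    gcongr
    linarith
  refine ⟨SupCont.const (h.supP.cont t ht) (h.supP.bdd t ht),
    SupCont.const (h.supv.cont t ht) (h.supv.bdd t ht),
    SupCont.const (h.supw.cont t ht) (h.supw.bdd t ht), h.nonneg t ht, h.primV t ht,
    h.l2d.memLp t ht, ?_, by linarith, by linarith⟩
  have h6 : 1 / (γ - 1) * (∫ s in Ioo 0 S, P t s ^ γ) ≤ E₀ := by linarith
  rw [div_mul_eq_mul_div, one_mul, div_le_iff₀ hγ1] at h6
  have : 0 ≤ E₀ := h0.trans hE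
  linarith

lemma continuousOn_functional (hμ : 0 < μ) (hβ : 1 ≤ β) (K : ℝ) (n : ℕ) :
    ContinuousOn (functional μ β K n S P v) (Icc 0 T) :=
  (h.supP.mul (SupCont.comp₂ (Ψ := fun x => cut μ β K x.1 x.2 ^ n) ((continuous_cut hμ hβ).pow n)
    h.supP (h.supP.mul h.supv).normPrim)).l2Cont.continuousOn_integral

end

/-- Higher powers of the density are bounded in terms of the initial data, uniformly in time. -/
theorem exists_bound (hS : 0 < S) (hμ : 0 < μ) (hβ : 1 ≤ β) (hβγ : β ≤ γ) (hγ : 1 < γ) {E₀ : ℝ}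
    (hE : 0 < E₀) (A₀ : ℝ) {n : ℕ} (hn : 2 ≤ n) :
    ∃ C : ℝ, 0 < C ∧ ∀ (T : ℝ) (P v w Q d c : ℝ → ℝ → ℝ), 0 < T →
      RadialFlow μ β γ S T P v w Q d c → energy γ S P v w 0 ≤ E₀ →
      Slice.mass β n S (P 0) ≤ A₀ → ∀ t ∈ Icc 0 T, Slice.mass β n S (P t) ≤ C := by
  have hE' : 0 < (γ + 1) * E₀ := by positivity
  obtain ⟨K, C₁, hC₁, growth⟩ := Slice.exists_growth_le hS hμ hβ hβγ hγ hE' hn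
  obtain ⟨C₂, hC₂, hmass⟩ := Slice.exists_mass_le hS hμ hβ hγ hE' K n
  obtain ⟨C₃, hC₃, hpsi⟩ := Slice.exists_psi_le hS hμ hβ hγ hE' K n
  -- C₁(1 + C₂) is the growth constant after `mass` is replaced by C₂(1 + Y); the 4 is the factor in
  -- `diss_le_dissipation`.
  set κ := C₁ * (1 + C₂) / 4 with hκ
  refine ⟨C₂ * ((1 + C₃ * (1 + |A₀|)) * Real.exp (κ * E₀)), by positivity,
    fun T P v w Q d c hT h hE0 hA0 t ht => ?_⟩
  have h0T : (0 : ℝ) ∈ Icc 0 T := ⟨le_rfl, hT.le⟩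
  have hEt : ∀ τ ∈ Icc 0 T, energy γ S P v w τ ≤ E₀ := fun τ hτ =>
    (h.antitoneOn_energy hS hμ hβ hγ h0T hτ hτ.1).trans hE0
  have hsl := fun τ hτ => h.slice hγ hτ (hEt τ hτ)
  set Y := functional μ β K n S P v with hY
  have hY0 : ∀ τ ∈ Icc 0 T, 0 ≤ Y τ := fun τ hτ => (hsl τ hτ).psi_nonneg K n
  -- Gronwall's argument with the energy in place of time: Y' ≤ κ(1 + Y) · dissipation, and the
  -- energy decreases exactly by the dissipation, so the weight exp(κ · energy) compensates the
  -- growth and T does not appear.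
  have hanti : AntitoneOn (fun τ => (1 + Y τ) * Real.exp (κ * energy γ S P v w τ)) (Icc 0 T) := by
    refine antitoneOn_of_hasDerivAt_nonpos
      ((continuousOn_const.add (h.continuousOn_functional hμ hβ K n)).mul
        (Real.continuous_exp.comp_continuousOn
          (continuousOn_const.mul (h.continuousOn_energy hγ))))
      (fun τ hτ => ((h.hasDerivAt_functional hS hμ hβ hγ hn hτ).const_add 1).mul
        ((h.hasDerivAt_energy hS hβ hγ hτ).const_mul κ).exp) fun τ hτ => ?_
    have hτI := Ioo_subset_Icc_self hτ
    have g1 := growth _ _ _ _ (hsl τ hτI)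
    have g2 := hmass _ _ _ _ (hsl τ hτI)
    have g3 := h.diss_nonneg (β := β) hμ hτI
    have g4 := diss_le_dissipation (μ := μ) (β := β) (S := S) (P := P) (d := d) (c := c) hμ τ
    change _ ≤ C₁ * Slice.diss μ β S (P τ) (d τ) * (1 + Y τ + Slice.mass β n S (P τ)) at g1
    change Slice.mass β n S (P τ) ≤ C₂ * (1 + Y τ) at g2
    have g5 : C₁ * Slice.diss μ β S (P τ) (d τ) * (1 + Y τ + Slice.mass β n S (P τ))
        ≤ C₁ * Slice.diss μ β S (P τ) (d τ) * ((1 + C₂) * (1 + Y τ)) := by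
      gcongr; linarith
    have g6 : C₁ * Slice.diss μ β S (P τ) (d τ) * ((1 + C₂) * (1 + Y τ))
        = κ * (1 + Y τ) * (4 * Slice.diss μ β S (P τ) (d τ)) := by rw [hκ]; ring
    have g7 : κ * (1 + Y τ) * (4 * Slice.diss μ β S (P τ) (d τ))
        ≤ κ * (1 + Y τ) * dissipation μ β S P d c τ := by
      have := hY0 τ hτI
      gcongr
    have g8 := (g1.trans g5).trans (g6.le.trans g7)
    have g9 := Real.exp_pos (κ * energy γ S P v w τ)
    have g10 := mul_le_mul_of_nonneg_right g8 g9.le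
    change _ * Real.exp (κ * energy γ S P v w τ) + (1 + Y τ) *
      (Real.exp (κ * energy γ S P v w τ) * (κ * -dissipation μ β S P d c τ)) ≤ 0
    refine le_trans (add_le_add_left g10 _) (le_of_eq ?_)
    ring
  have h1 := hanti h0T ht ht.1
  have h2 : 1 + Y t ≤ (1 + Y t) * Real.exp (κ * energy γ S P v w t) := by
    have := hY0 t ht
    have := h.energy_nonneg hγ ht
    exact le_mul_of_one_le_right (by linarith) (Real.one_le_exp (by positivity))
  have h3 : Y 0 ≤ C₃ * (1 + |A₀|) := by
    refine (hpsi _ _ _ _ (hsl 0 h0T)).trans ?_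
    gcongr
    exact hA0.trans (le_abs_self _)
  have h4 : (1 + Y 0) * Real.exp (κ * energy γ S P v w 0)
      ≤ (1 + C₃ * (1 + |A₀|)) * Real.exp (κ * E₀) := by
    have := hY0 0 h0T
    gcongr
  refine (hmass _ _ _ _ (hsl t ht)).trans ?_
  gcongr
  exact h2.trans (h1.trans h4)

end RadialFlow

end

section

/-! ### Test functions and weak derivatives -/

/-- Smooth functions with compact support in `U`. -/
def IsTestOn {X : Type*} [NormedAddCommGroup X] [NormedSpace ℝ X] (U : Set X) (φ : X → ℝ) : Prop :=
  ContDiff ℝ ∞ φ ∧ HasCompactSupport φ ∧ tsupport φ ⊆ U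

lemma IsTestOn.of_eq_zero {X : Type*} [NormedAddCommGroup X] [NormedSpace ℝ X] {U K : Set X}
    {φ : X → ℝ} (hφ : ContDiff ℝ ∞ φ) (hK : IsCompact K) (hKU : K ⊆ U)
    (h : ∀ x, x ∉ K → φ x = 0) : IsTestOn U φ := by
  have hs : tsupport φ ⊆ K :=
    closure_minimal (fun x hx => by by_contra hc; exact hx (h x hc)) hK.isClosed
  exact ⟨hφ, hK.of_isClosed_subset (isClosed_tsupport φ) hs, hs.trans hKU⟩

lemma integrableOn_test_mul {X : Type*} [NormedAddCommGroup X] [NormedSpace ℝ X] [MeasureSpace X]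
    [OpensMeasurableSpace X] {U : Set X} {φ f : X → ℝ} (hφ : IsTestOn U φ)
    (hf : LocallyIntegrableOn f U) : IntegrableOn (fun x => φ x * f x) U := by
  have h1 : IntegrableOn f (tsupport φ) :=
    hf.integrableOn_compact_subset hφ.2.2 hφ.2.1.isCompact
  have h2 : IntegrableOn (fun x => φ x * f x) (tsupport φ) :=
    h1.continuousOn_mul_of_subset hφ.1.continuous.continuousOn hφ.2.1.isCompact
      (isClosed_tsupport φ).measurableSet subset_rfl
  have h3 : Integrable (fun x => φ x * f x) :=
    (integrableOn_iff_integrable_of_support_subset fun x hx =>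
      subset_tsupport φ (left_ne_zero_of_mul hx)).1 h2
  exact h3.integrableOn

lemma IsTestOn.fderiv {X : Type*} [NormedAddCommGroup X] [NormedSpace ℝ X] {U : Set X} {φ : X → ℝ}
    (hφ : IsTestOn U φ) (v : X) : IsTestOn U (fun x => fderiv ℝ φ x v) := by
  refine IsTestOn.of_eq_zero ?_ hφ.2.1.isCompact hφ.2.2 fun x hx => ?_
  · exact (hφ.1.fderiv_right (m := ∞) (by simp)).clm_apply contDiff_const
  · have : φ =ᶠ[𝓝 x] fun _ => 0 := notMem_tsupport_iff_eventuallyEq.1 hx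
    rw [this.fderiv_eq]
    simp

lemma HasWeakDeriv.integral_eq {X : Type*} [NormedAddCommGroup X] [NormedSpace ℝ X] [MeasureSpace X]
    {U : Set X} {v : X} {f g : X → ℝ} (h : HasWeakDeriv U v f g) {φ : X → ℝ} (hφ : IsTestOn U φ) :
    ∫ x in U, fderiv ℝ φ x v * f x = -∫ x in U, φ x * g x :=
  h.2.2 φ hφ.1 hφ.2.1 hφ.2.2

lemma LocallyIntegrableOn.coord {X : Type*} [TopologicalSpace X] [MeasurableSpace X] {m : Measure X}
    {U : Set X} {f : X → Plane} (hf : LocallyIntegrableOn f U m) (j : Fin 2) :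
    LocallyIntegrableOn (fun x => f x j) U m := fun x hx =>
  let ⟨t, ht, hi⟩ := hf x hx
  ⟨t, ht, (EuclideanSpace.proj (𝕜 := ℝ) j).integrable_comp hi⟩

lemma HasWeakDeriv.coord {X : Type*} [NormedAddCommGroup X] [NormedSpace ℝ X] [MeasureSpace X]
    [OpensMeasurableSpace X] {U : Set X} {v : X} {f g : X → Plane} (h : HasWeakDeriv U v f g)
    (j : Fin 2) : HasWeakDeriv U v (fun x => f x j) (fun x => g x j) := by
  refine ⟨LocallyIntegrableOn.coord h.1 j, LocallyIntegrableOn.coord h.2.1 j,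
    fun φ h1 h2 h3 => ?_⟩
  have hφ : IsTestOn U φ := ⟨h1, h2, h3⟩
  have key : ∀ {ψ : X → ℝ} {f : X → Plane}, IsTestOn U ψ → LocallyIntegrableOn f U →
      IntegrableOn (fun x => ψ x • f x) U := by
    intro ψ f hψ hf
    exact Integrable.of_eval_piLp fun i => integrableOn_test_mul hψ (LocallyIntegrableOn.coord hf i)
  have e := congrArg (EuclideanSpace.proj (𝕜 := ℝ) j) (h.2.2 φ h1 h2 h3)
  rw [map_neg, ← ContinuousLinearMap.integral_comp_comm _ (key (hφ.fderiv v) h.1),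
    ← ContinuousLinearMap.integral_comp_comm _ (key hφ h.2.1)] at e
  simpa using e

section radial

variable {R : ℝ}

lemma isTestOn_radial (hR : 0 < R) {χ : ℝ → ℝ} (hχ : IsTest 0 (R ^ 2) χ) {p : Plane → ℝ}
    (hp : ContDiff ℝ ∞ p) : IsTestOn (disk R) (fun x => χ (‖x‖ ^ 2) * p x) := by
  obtain ⟨a, b, ha, hab, hb, h0⟩ := hχ.exists_Icc (by positivity)
  refine IsTestOn.of_eq_zero (K := Metric.closedBall 0 (√b))
    ((hχ.1.comp (contDiff_norm_sq ℝ)).mul hp) (isCompact_closedBall _ _) ?_ fun x hx => ?_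
  · refine Metric.closedBall_subset_ball ?_
    rw [Real.sqrt_lt' hR]; exact hb
  · rw [h0, zero_mul]
    intro h
    refine hx ?_
    rw [mem_closedBall_zero_iff]
    exact Real.le_sqrt_of_sq_le h.2

lemma fderiv_radial {χ : ℝ → ℝ} (hχ : ContDiff ℝ ∞ χ) {p : Plane → ℝ} (hp : ContDiff ℝ ∞ p)
    (x : Plane) (i : Fin 2) :
    fderiv ℝ (fun x => χ (‖x‖ ^ 2) * p x) x (dirX i)
      = deriv χ (‖x‖ ^ 2) * (2 * x i * p x) + χ (‖x‖ ^ 2) * fderiv ℝ p x (dirX i) := by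
  have h1 : HasFDerivAt (fun x : Plane => ‖x‖ ^ 2) (2 • innerSL ℝ x) x :=
    (hasStrictFDerivAt_norm_sq x).hasFDerivAt
  have h2 := ((hχ.differentiable (by simp)).differentiableAt.hasDerivAt
    (x := ‖x‖ ^ 2)).comp_hasFDerivAt x h1
  have h3 := h2.mul (hp.differentiable (by simp)).differentiableAt.hasFDerivAt
  have h4 := h3.fderiv
  have e : fderiv ℝ (fun x => χ (‖x‖ ^ 2) * p x) x = _ := h4
  rw [e]
  simp [dirX, EuclideanSpace.inner_single_right]
  ring

end radial

/-! ### Space-time test functions -/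

lemma isTestOn_prod {R T : ℝ} (hT : 0 < T) {ψ : ℝ → ℝ} (hψ : IsTest 0 T ψ) {φ : Plane → ℝ}
    (hφ : IsTestOn (disk R) φ) : IsTestOn (cylinder R T) (fun z => ψ z.1 * φ z.2) := by
  obtain ⟨a, b, ha, hab, hb, h0⟩ := hψ.exists_Icc hT
  refine IsTestOn.of_eq_zero (K := Icc a b ×ˢ tsupport φ)
    ((hψ.1.comp contDiff_fst).mul (hφ.1.comp contDiff_snd)) (isCompact_Icc.prod hφ.2.1.isCompact)
    (prod_mono (fun x hx => ⟨ha.trans_le hx.1, hx.2.trans_lt hb⟩) hφ.2.2) fun z hz => ?_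
  by_cases h1 : z.1 ∈ Icc a b
  · rw [image_eq_zero_of_notMem_tsupport fun h2 => hz ⟨h1, h2⟩, mul_zero]
  · rw [h0 _ h1, zero_mul]

lemma fderiv_prod {ψ : ℝ → ℝ} (hψ : ContDiff ℝ ∞ ψ) {φ : Plane → ℝ} (hφ : ContDiff ℝ ∞ φ)
    (z k : ℝ × Plane) :
    fderiv ℝ (fun z : ℝ × Plane => ψ z.1 * φ z.2) z k
      = deriv ψ z.1 * k.1 * φ z.2 + ψ z.1 * fderiv ℝ φ z.2 k.2 := by
  have h1 := ((hψ.differentiable (by simp)).differentiableAt.hasDerivAt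
    (x := z.1)).comp_hasFDerivAt z (hasFDerivAt_fst (𝕜 := ℝ) (E := ℝ) (F := Plane))
  have h2 := ((hφ.differentiable (by simp)).differentiableAt.hasFDerivAt
    (x := z.2)).comp z (hasFDerivAt_snd (𝕜 := ℝ) (E := ℝ) (F := Plane))
  have h3 := (h1.mul h2).fderiv
  have e : fderiv ℝ (fun z : ℝ × Plane => ψ z.1 * φ z.2) z = _ := h3
  rw [e]
  simp
  ring

lemma integral_cylinder {R T : ℝ} (hT : 0 < T) {ψ : ℝ → ℝ} (hψ : IsTest 0 T ψ) {φ : Plane → ℝ}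
    (hφ : IsTestOn (disk R) φ) {f : ℝ × Plane → ℝ} (hf : LocallyIntegrableOn f (cylinder R T)) :
    ∫ z in cylinder R T, ψ z.1 * φ z.2 * f z
      = ∫ t in Ioo 0 T, ψ t * ∫ x in disk R, φ x * f (t, x) := by
  have h1 := integrableOn_test_mul (isTestOn_prod hT hψ hφ) hf
  rw [cylinder, Measure.volume_eq_prod] at h1 ⊢
  rw [setIntegral_prod _ h1]
  refine integral_congr_ae (Eventually.of_forall fun t => ?_)
  simp only [← integral_const_mul, mul_assoc]

/-- Both a and b are continuous, so the almost everywhere identity of du Bois-Reymond holds at every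
interior time, where the fundamental theorem of calculus applies. -/
lemma hasDerivAt_of_weak_time {T : ℝ} (hT : 0 < T) {a b : ℝ → ℝ} (ha : ContinuousOn a (Icc 0 T))
    (hb : ContinuousOn b (Icc 0 T))
    (h : ∀ ψ, IsTest 0 T ψ → ∫ t in Ioo 0 T, a t * deriv ψ t = -∫ t in Ioo 0 T, b t * ψ t) {t : ℝ}
    (ht : t ∈ Ioo 0 T) : HasDerivAt a (b t) t := by
  have hbi : IntegrableOn b (Icc 0 T) := hb.integrableOn_Icc
  obtain ⟨c, hc⟩ := ae_eq_const_add_integral hT (ha.integrableOn_Icc.mono_set Ioo_subset_Icc_self)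
    (hbi.mono_set Ioo_subset_Icc_self) h
  have hprim : ContinuousOn (fun x => c + ∫ y in 0..x, b y) (Icc 0 T) := by
    refine continuousOn_const.add ?_
    have := intervalIntegral.continuousOn_primitive_interval (μ := volume) (a := 0) (b := T) (f := b)
      (by rwa [uIcc_of_le hT.le])
    rwa [uIcc_of_le hT.le] at this
  have heq : EqOn a (fun x => c + ∫ y in 0..x, b y) (Ioo 0 T) :=
    Measure.eqOn_open_of_ae_eq ((ae_restrict_iff' measurableSet_Ioo).2 hc) isOpen_Ioo
      (ha.mono Ioo_subset_Icc_self) (hprim.mono Ioo_subset_Icc_self)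
  have hbt : ContinuousAt b t := hb.continuousAt (Icc_mem_nhds ht.1 ht.2)
  have hd : HasDerivAt (fun x => c + ∫ y in 0..x, b y) (b t) t := by
    refine (intervalIntegral.integral_hasDerivAt_right ?_ ?_ hbt).const_add c
    · rw [intervalIntegrable_iff_integrableOn_Icc_of_le ht.1.le]
      exact hbi.mono_set (Icc_subset_Icc_right ht.2.le)
    · exact ContinuousOn.stronglyMeasurableAtFilter isOpen_Ioo (hb.mono Ioo_subset_Icc_self) t ht
  exact hd.congr_of_eventuallyEq (heq.eventuallyEq_of_mem (Ioo_mem_nhds ht.1 ht.2))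

end

section

/-! ### The equations, integrated against test fields -/

/-- The integral of `φ f(t)` over the disk. -/
def pair (R : ℝ) (φ : Plane → ℝ) (f : ℝ → Plane → ℝ) (t : ℝ) : ℝ := ∫ x in disk R, φ x * f t x

/-- The derivative of `φ` in the direction `i`. -/
def pd (i : Fin 2) (φ : Plane → ℝ) (x : Plane) : ℝ := fderiv ℝ φ x (dirX i)

variable {R T : ℝ}

lemma IsTestOn.pd {U : Set Plane} {φ : Plane → ℝ} (hφ : IsTestOn U φ) (i : Fin 2) :
    IsTestOn U (pd i φ) := hφ.fderiv _

lemma integrableOn_mul_pair (hT : 0 < T) {ψ : ℝ → ℝ} (hψ : IsTest 0 T ψ) {φ : Plane → ℝ}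
    (hφ : IsTestOn (disk R) φ) {f : ℝ → Plane → ℝ}
    (hf : LocallyIntegrableOn (fun z : ℝ × Plane => f z.1 z.2) (cylinder R T)) :
    IntegrableOn (fun t => ψ t * pair R φ f t) (Ioo 0 T) := by
  have h1 := integrableOn_test_mul (isTestOn_prod hT hψ hφ) hf
  rw [cylinder, Measure.volume_eq_prod, IntegrableOn, ← Measure.prod_restrict] at h1
  refine h1.integral_prod_left.congr (Eventually.of_forall fun t => ?_)
  simp only [pair, ← integral_const_mul, mul_assoc]

/-- A weak time derivative, tested with a product. -/
lemma HasWeakDeriv.time {f : ℝ → Plane → ℝ} {g : ℝ × Plane → ℝ}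
    (h : HasWeakDeriv (cylinder R T) dirT (fun z => f z.1 z.2) g) (hT : 0 < T) {ψ : ℝ → ℝ}
    (hψ : IsTest 0 T ψ) {φ : Plane → ℝ} (hφ : IsTestOn (disk R) φ) :
    ∫ t in Ioo 0 T, deriv ψ t * pair R φ f t
      = -∫ z in cylinder R T, ψ z.1 * φ z.2 * g z := by
  have e := h.integral_eq (isTestOn_prod hT hψ hφ)
  simp only [fderiv_prod hψ.1 hφ.1, dirT, map_zero, mul_zero, add_zero, mul_one] at e
  rw [← e]
  exact (integral_cylinder hT hψ.deriv hφ h.1).symm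

/-- A weak spatial derivative, tested with a product. -/
lemma HasWeakDeriv.space {f : ℝ → Plane → ℝ} {g : ℝ × Plane → ℝ} {i : Fin 2}
    (h : HasWeakDeriv (cylinder R T) (dirTX i) (fun z => f z.1 z.2) g) (hT : 0 < T) {ψ : ℝ → ℝ}
    (hψ : IsTest 0 T ψ) {φ : Plane → ℝ} (hφ : IsTestOn (disk R) φ) :
    ∫ t in Ioo 0 T, ψ t * pair R (pd i φ) f t
      = -∫ z in cylinder R T, ψ z.1 * φ z.2 * g z := by
  have e := h.integral_eq (isTestOn_prod hT hψ hφ)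
  simp only [fderiv_prod hψ.1 hφ.1, dirTX, mul_zero, zero_mul, zero_add] at e
  rw [← e]
  exact (integral_cylinder hT hψ (hφ.pd i) h.1).symm

/-- Tested with products ψ(t)φ(x), the equation becomes by Fubini a weak identity in time alone for
each fixed φ. -/
lemma ContinuityEq.weak {ρ : ℝ → Plane → ℝ} {u : ℝ → Plane → Plane} (h : ContinuityEq R T ρ u)
    (hT : 0 < T) {φ : Plane → ℝ} (hφ : IsTestOn (disk R) φ) {ψ : ℝ → ℝ} (hψ : IsTest 0 T ψ) :
    ∫ t in Ioo 0 T, pair R φ ρ t * deriv ψ t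
      = -∫ t in Ioo 0 T, (∑ i, pair R (pd i φ) (fun t x => ρ t x * u t x i) t) * ψ t := by
  obtain ⟨ρt, c, h1, h2, h3⟩ := h
  have e1 := h1.time hT hψ hφ
  have e2 := fun i => HasWeakDeriv.space (f := fun t x => ρ t x * u t x i) (h2 i) hT hψ hφ
  have hΦ := isTestOn_prod (R := R) hT hψ hφ
  have e3 : ∫ z in cylinder R T, (ψ z.1 * φ z.2 * ρt z + ψ z.1 * φ z.2 * c 0 z
      + ψ z.1 * φ z.2 * c 1 z) = 0 := by
    refine integral_eq_zero_of_ae ?_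
    filter_upwards [h3] with z hz
    rw [Fin.sum_univ_two] at hz
    simp only [Pi.zero_apply]
    linear_combination (ψ z.1 * φ z.2) * hz
  have j0 := integrableOn_test_mul hΦ h1.2.1
  have j1 := fun i => integrableOn_test_mul hΦ (h2 i).2.1
  have j2 : IntegrableOn (fun z => ψ z.1 * φ z.2 * ρt z + ψ z.1 * φ z.2 * c 0 z) (cylinder R T) :=
    j0.add (j1 0)
  rw [integral_add j2 (j1 1), integral_add j0 (j1 0)] at e3
  have k := fun i => integrableOn_mul_pair (f := fun t x => ρ t x * u t x i) hT hψ
    (hφ.pd i) (h2 i).1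
  have e4 : ∫ t in Ioo 0 T, (∑ i, pair R (pd i φ) (fun t x => ρ t x * u t x i) t) * ψ t
      = (∫ t in Ioo 0 T, ψ t * pair R (pd 0 φ) (fun t x => ρ t x * u t x 0) t)
        + ∫ t in Ioo 0 T, ψ t * pair R (pd 1 φ) (fun t x => ρ t x * u t x 1) t := by
    rw [← integral_add (k 0) (k 1)]
    refine integral_congr_ae (Eventually.of_forall fun t => ?_)
    simp only [Fin.sum_univ_two]; ring
  rw [e4, e2 0, e2 1]
  simp only [mul_comm (pair R φ ρ _)]
  rw [e1]
  linarith

lemma integral_comb {α : Type*} [MeasurableSpace α] {m : Measure α} {f₁ f₂ f₃ f₄ f₅ f₆ : α → ℝ}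
    (h₁ : Integrable f₁ m) (h₂ : Integrable f₂ m) (h₃ : Integrable f₃ m) (h₄ : Integrable f₄ m)
    (h₅ : Integrable f₅ m) (h₆ : Integrable f₆ m) (a : ℝ) :
    Integrable (fun x => f₁ x + f₂ x + f₃ x - a * (f₄ x + f₅ x) - f₆ x) m ∧
    ∫ x, (f₁ x + f₂ x + f₃ x - a * (f₄ x + f₅ x) - f₆ x) ∂m
      = (∫ x, f₁ x ∂m) + (∫ x, f₂ x ∂m) + (∫ x, f₃ x ∂m) - a * ((∫ x, f₄ x ∂m) + ∫ x, f₅ x ∂m)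
        - ∫ x, f₆ x ∂m := by
  have i1 : Integrable (fun x => f₁ x + f₂ x) m := h₁.add h₂
  have i2 : Integrable (fun x => f₁ x + f₂ x + f₃ x) m := i1.add h₃
  have i3 : Integrable (fun x => a * (f₄ x + f₅ x)) m := (h₄.add h₅).const_mul a
  have i4 : Integrable (fun x => f₁ x + f₂ x + f₃ x - a * (f₄ x + f₅ x)) m := i2.sub i3
  refine ⟨i4.sub h₆, ?_⟩
  rw [integral_sub i4 h₆, integral_sub i2 i3, integral_add i1 h₃, integral_add h₁ h₂,
    integral_const_mul, integral_add h₄ h₅]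

/-- The momentum flux and the stresses, tested with the component `j` of a test field. -/
def momentumFlux (μ β γ R : ℝ) (ρ : ℝ → Plane → ℝ) (u : ℝ → Plane → Plane)
    (Du : Fin 2 → ℝ → Plane → Plane) (φ : Plane → ℝ) (j : Fin 2) (t : ℝ) : ℝ :=
  ∑ i, pair R (pd i φ) (fun t x => ρ t x * u t x i * u t x j) t
    + pair R (pd j φ) (fun t x => ρ t x ^ γ) t
    - μ * ∑ i, pair R (pd i φ) (fun t x => Du i t x j) t
    - pair R (pd j φ) (fun t x => (μ + ρ t x ^ β) * ∑ i, Du i t x i) t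

/-- The two integrability statements are recorded so that the components j can be added inside one
time integral. -/
lemma MomentumEq.weak {μ β γ : ℝ} {ρ : ℝ → Plane → ℝ} {u : ℝ → Plane → Plane}
    {Du : Fin 2 → ℝ → Plane → Plane} (h : MomentumEq μ β γ R T ρ u Du)
    (hT : 0 < T) {φ : Plane → ℝ} (hφ : IsTestOn (disk R) φ) {ψ : ℝ → ℝ} (hψ : IsTest 0 T ψ)
    (j : Fin 2) :
    IntegrableOn (fun t => pair R φ (fun t x => ρ t x * u t x j) t * deriv ψ t) (Ioo 0 T) ∧
    IntegrableOn (fun t => momentumFlux μ β γ R ρ u Du φ j t * ψ t) (Ioo 0 T) ∧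
    ∫ t in Ioo 0 T, pair R φ (fun t x => ρ t x * u t x j) t * deriv ψ t
      = -∫ t in Ioo 0 T, momentumFlux μ β γ R ρ u Du φ j t * ψ t := by
  obtain ⟨m, p, d, n, l, h1, h2, h3, h4, h5, h6⟩ := h j
  have e1 := HasWeakDeriv.time (f := fun t x => ρ t x * u t x j) h1 hT hψ hφ
  have e2 := fun i => HasWeakDeriv.space (f := fun t x => ρ t x * u t x i * u t x j) (h2 i) hT hψ hφ
  have e3 := HasWeakDeriv.space (f := fun t x => ρ t x ^ γ) h3 hT hψ hφ
  have e4 := fun i => HasWeakDeriv.space (f := fun t x => Du i t x j) (h4 i) hT hψ hφ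
  have e5 := HasWeakDeriv.space (f := fun t x => (μ + ρ t x ^ β) * ∑ i, Du i t x i) h5 hT hψ hφ
  have k1 := integrableOn_mul_pair (f := fun t x => ρ t x * u t x j) hT hψ.deriv hφ h1.1
  have k2 := fun i => integrableOn_mul_pair (f := fun t x => ρ t x * u t x i * u t x j) hT hψ
    (hφ.pd i) (h2 i).1
  have k3 := integrableOn_mul_pair (f := fun t x => ρ t x ^ γ) hT hψ (hφ.pd j) h3.1
  have k4 := fun i => integrableOn_mul_pair (f := fun t x => Du i t x j) hT hψ (hφ.pd i) (h4 i).1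
  have k5 := integrableOn_mul_pair (f := fun t x => (μ + ρ t x ^ β) * ∑ i, Du i t x i) hT hψ
    (hφ.pd j) h5.1
  have hΦ := isTestOn_prod (R := R) hT hψ hφ
  have j1 := integrableOn_test_mul hΦ h1.2.1
  have j2 := fun i => integrableOn_test_mul hΦ (h2 i).2.1
  have j3 := integrableOn_test_mul hΦ h3.2.1
  have j4 := fun i => integrableOn_test_mul hΦ (h4 i).2.1
  have j5 := integrableOn_test_mul hΦ h5.2.1
  have key : ∫ z in cylinder R T, ψ z.1 * φ z.2 * m z
      = -∫ z in cylinder R T, (ψ z.1 * φ z.2 * n 0 z + ψ z.1 * φ z.2 * n 1 z + ψ z.1 * φ z.2 * p z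
        - μ * (ψ z.1 * φ z.2 * l 0 z + ψ z.1 * φ z.2 * l 1 z) - ψ z.1 * φ z.2 * d z) := by
    rw [← integral_neg]
    refine integral_congr_ae ?_
    filter_upwards [h6] with z hz
    rw [Fin.sum_univ_two, Fin.sum_univ_two] at hz
    linear_combination (ψ z.1 * φ z.2) * hz
  rw [(integral_comb (j2 0) (j2 1) j3 (j4 0) (j4 1) j5 μ).2] at key
  obtain ⟨k6, k7⟩ := integral_comb (k2 0) (k2 1) k3 (k4 0) (k4 1) k5 μ
  have e6 : (fun t => ψ t * pair R (pd 0 φ) (fun t x => ρ t x * u t x 0 * u t x j) t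
      + ψ t * pair R (pd 1 φ) (fun t x => ρ t x * u t x 1 * u t x j) t
      + ψ t * pair R (pd j φ) (fun t x => ρ t x ^ γ) t
      - μ * (ψ t * pair R (pd 0 φ) (fun t x => Du 0 t x j) t
        + ψ t * pair R (pd 1 φ) (fun t x => Du 1 t x j) t)
      - ψ t * pair R (pd j φ) (fun t x => (μ + ρ t x ^ β) * ∑ i, Du i t x i) t)
      = fun t => momentumFlux μ β γ R ρ u Du φ j t * ψ t := by
    funext t
    simp only [momentumFlux, Fin.sum_univ_two (fun i => pair R (pd i φ) _ t)]
    ring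
  rw [e6] at k6 k7
  refine ⟨by simpa only [mul_comm] using k1, k6, ?_⟩
  simp only [mul_comm (pair R φ (fun t x => ρ t x * u t x j) _)]
  rw [e1, k7, e2, e2, e3, e4, e4, e5, key]
  ring

end

section

/-! ### Radial reduction of the velocity -/

/-- ζ vanishes near 0, so the division creates no singularity. It prepares the fields (ζ(s)/s) x,
whose product with u is ζ u_r/√s. -/
lemma IsTest.div_id {S : ℝ} {ζ : ℝ → ℝ} (hζ : IsTest 0 S ζ) : IsTest 0 S (fun s => ζ s / s) := by
  refine ⟨contDiff_iff_contDiffAt.2 fun s => ?_, ?_, ?_⟩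
  · by_cases hs : s = 0
    · have h0 : s ∉ tsupport ζ := fun h => absurd (hζ.2.2 h).1 (by simp [hs])
      refine (contDiffAt_const (c := (0 : ℝ))).congr_of_eventuallyEq ?_
      filter_upwards [notMem_tsupport_iff_eventuallyEq.1 h0] with y hy
      rw [hy]; simp
    · exact hζ.1.contDiffAt.div contDiffAt_id hs
  · have : (fun s => ζ s / s) = fun s => s⁻¹ * ζ s := by funext s; ring
    rw [this]; exact hζ.2.1.mul_left
  · have : (fun s => ζ s / s) = fun s => s⁻¹ * ζ s := by funext s; ring
    rw [this]; exact (tsupport_mul_subset_right).trans hζ.2.2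

/-- Continuity of V extends the almost everywhere identity to the closed interval, so that it can be
anchored at the endpoint S. -/
lemma primLoc_of_weak {S : ℝ} (hS : 0 < S) {V d : ℝ → ℝ} (hV : ContinuousOn V (Icc 0 S))
    (hd : IntegrableOn d (Ioo 0 S))
    (h : ∀ χ, IsTest 0 S χ → ∫ s in Ioo 0 S, V s * deriv χ s = -∫ s in Ioo 0 S, d s * χ s) :
    PrimLoc S V d := by
  obtain ⟨c, hc⟩ := ae_eq_const_add_integral hS (hV.integrableOn_Icc.mono_set Ioo_subset_Icc_self)
    hd h
  have hd' : IntegrableOn d (Icc 0 S) := by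
    rw [integrableOn_Icc_iff_integrableOn_Ioo]; exact hd
  have hprim : ContinuousOn (fun x => c + ∫ y in 0..x, d y) (Icc 0 S) := by
    refine continuousOn_const.add ?_
    have := intervalIntegral.continuousOn_primitive_interval (μ := volume) (a := 0) (b := S) (f := d)
      (by rwa [uIcc_of_le hS.le])
    rwa [uIcc_of_le hS.le] at this
  have heq : EqOn V (fun x => c + ∫ y in 0..x, d y) (Ioo 0 S) :=
    Measure.eqOn_open_of_ae_eq ((ae_restrict_iff' measurableSet_Ioo).2 hc) isOpen_Ioo
      (hV.mono Ioo_subset_Icc_self) (hprim.mono Ioo_subset_Icc_self)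
  have heq' : EqOn V (fun x => c + ∫ y in 0..x, d y) (Icc 0 S) :=
    heq.of_subset_closure hV hprim Ioo_subset_Icc_self (by rw [closure_Ioo hS.ne])
  have hint : ∀ a b, 0 ≤ a → a ≤ b → b ≤ S → IntervalIntegrable d volume a b :=
    fun a b ha hab hb => by
      rw [intervalIntegrable_iff_integrableOn_Icc_of_le hab]
      exact hd'.mono_set (Icc_subset_Icc ha hb)
  refine PrimLoc.of_integral (fun a ha haS => hint a S ha.le haS le_rfl) fun a ha haS => ?_
  rw [heq' ⟨ha.le, haS⟩, heq' ⟨hS.le, le_rfl⟩]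
  have := intervalIntegral.integral_add_adjacent_intervals (hint 0 a le_rfl ha.le haS)
    (hint a S ha.le haS le_rfl)
  simp only [← this]
  ring

/-- Profiles with derivatives that are continuous in time with values in `L²` are continuous in
time, uniformly in space. -/
lemma supCont_of_primLoc {S : ℝ} {I : Set ℝ} {y e : ℝ → ℝ → ℝ}
    (hc : ∀ t ∈ I, ContinuousOn (y t) (Ioc 0 S)) (hb : ∀ t ∈ I, ∃ M, ∀ s ∈ Ioc 0 S, |y t s| ≤ M)
    (he : L2Cont S I e) (hp : ∀ t ∈ I, PrimLoc S (fun s => √s * y t s) (e t)) :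
    SupCont S I y := by
  refine SupCont.of_bound hc hb
    (fun t τ => ‖toL2 (nu S) (e τ) - toL2 (nu S) (e t)‖) (fun t ht => ?_) fun t ht τ hτ s hs => ?_
  · exact tendsto_iff_norm_sub_tendsto_zero.1 (he.cont t ht)
  · obtain ⟨M, hM⟩ := hb t ht
    obtain ⟨N, hN⟩ := hb τ hτ
    have h1 : PrimLoc S (fun s => √s * (y τ s - y t s)) (fun s => e τ s - e t s) :=
      (((hp τ hτ).add ((hp t ht).const_mul (-1))).congr_deriv fun s _ => by ring).congr
        fun s _ => by ring
    have hm : MemLp (fun s => e τ s - e t s) 2 (nu S) := (he.memLp τ hτ).sub (he.memLp t ht)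
    have h2 := sq_le_integral_sq_deriv h1 (N := N + M)
      (fun s hs => (abs_sub _ _).trans (add_le_add (hN s hs) (hM s hs))) hm hs
    rw [← toL2_sub (he.memLp τ hτ) (he.memLp t ht)]
    refine abs_le_of_sq_le_sq ?_ (norm_nonneg _)
    rw [norm_toL2_sq hm]
    exact h2

variable {R T : ℝ}

lemma norm_sq_plane (x : Plane) : ‖x‖ ^ 2 = x 0 ^ 2 + x 1 ^ 2 := by
  rw [EuclideanSpace.real_norm_sq_eq, Fin.sum_univ_two]

section

variable (a b : ℝ → ℝ → ℝ) (t : ℝ) (x : Plane)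

lemma vectorField_zero :
    vectorField a b t x 0 = a t ‖x‖ * (x 0 / ‖x‖) + b t ‖x‖ * (x 1 / ‖x‖) := by
  simp [vectorField, eR, eTheta]

lemma vectorField_one :
    vectorField a b t x 1 = a t ‖x‖ * (x 1 / ‖x‖) - b t ‖x‖ * (x 0 / ‖x‖) := by
  simp [vectorField, eR, eTheta]; ring

lemma dot_vectorField :
    x 0 * vectorField a b t x 0 + x 1 * vectorField a b t x 1 = ‖x‖ * a t ‖x‖ := by
  rw [vectorField_zero, vectorField_one]
  have h := norm_sq_plane x
  by_cases hx : ‖x‖ = 0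
  · rw [hx]; simp
  · field_simp
    linear_combination (-a t ‖x‖) * h

lemma cross_vectorField :
    x 1 * vectorField a b t x 0 - x 0 * vectorField a b t x 1 = ‖x‖ * b t ‖x‖ := by
  rw [vectorField_zero, vectorField_one]
  have h := norm_sq_plane x
  by_cases hx : ‖x‖ = 0
  · rw [hx]; simp
  · field_simp
    linear_combination (-b t ‖x‖) * h

lemma normSq_vectorField (hx : x ≠ 0) :
    vectorField a b t x 0 ^ 2 + vectorField a b t x 1 ^ 2 = a t ‖x‖ ^ 2 + b t ‖x‖ ^ 2 := by
  rw [vectorField_zero, vectorField_one]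
  have h := norm_sq_plane x
  have hx : ‖x‖ ≠ 0 := norm_ne_zero_iff.2 hx
  field_simp
  linear_combination (-(a t ‖x‖ ^ 2 + b t ‖x‖ ^ 2)) * h

end

lemma pd_radial {χ : ℝ → ℝ} (hχ : ContDiff ℝ ∞ χ) {p : Plane → ℝ} (hp : ContDiff ℝ ∞ p)
    (i : Fin 2) : pd i (fun x => χ (‖x‖ ^ 2) * p x)
      = fun x => deriv χ (‖x‖ ^ 2) * (2 * x i * p x) + χ (‖x‖ ^ 2) * pd i p x :=
  funext fun x => fderiv_radial hχ hp x i

lemma ContinuousInSobolev.tendsto {F : Type*} [NormedAddCommGroup F] [NormedSpace ℝ F]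
    {p : ENNReal} {f : ℝ → Plane → F} {Df : Fin 2 → ℝ → Plane → F}
    (h : ContinuousInSobolev (disk R) p T f Df) {s : ℝ} (hs : s ∈ Icc 0 T) :
    Tendsto (fun t => eLpNorm (f t - f s) p (volume.restrict (disk R))) (𝓝[Icc 0 T] s) (𝓝 0) ∧
    ∀ i, Tendsto (fun t => eLpNorm (Df i t - Df i s) p (volume.restrict (disk R)))
      (𝓝[Icc 0 T] s) (𝓝 0) := by
  refine ⟨tendsto_of_tendsto_of_tendsto_of_le_of_le tendsto_const_nhds (h.2 s hs)
    (fun t => zero_le) fun t => le_self_add, fun i =>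
    tendsto_of_tendsto_of_tendsto_of_le_of_le tendsto_const_nhds (h.2 s hs)
    (fun t => zero_le) fun t => ?_⟩
  refine le_add_of_nonneg_of_le zero_le ?_
  exact Finset.single_le_sum (f := fun i => eLpNorm (Df i t - Df i s) p (volume.restrict (disk R)))
    (fun _ _ => zero_le) (Finset.mem_univ i)

/-- Combinations of two families that are continuous in `L^p`, with bounded coefficients. -/
lemma tendsto_eLpNorm_comb {F : Type*} [NormedAddCommGroup F] {p : ENNReal} (hp : 1 ≤ p)
    {I : Set ℝ} {f g : ℝ → Plane → F}
    (hf : ∀ t ∈ I, AEStronglyMeasurable (f t) (volume.restrict (disk R)))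
    (hg : ∀ t ∈ I, AEStronglyMeasurable (g t) (volume.restrict (disk R))) {k : ℝ → Plane → ℝ}
    (hk : ∀ t τ x, |k t x - k τ x| ≤ ‖f t x - f τ x‖ + ‖g t x - g τ x‖) {s : ℝ} (hs : s ∈ I)
    (h1 : Tendsto (fun t => eLpNorm (f t - f s) p (volume.restrict (disk R))) (𝓝[I] s) (𝓝 0))
    (h2 : Tendsto (fun t => eLpNorm (g t - g s) p (volume.restrict (disk R))) (𝓝[I] s) (𝓝 0)) :
    Tendsto (fun t => eLpNorm (k t - k s) p (volume.restrict (disk R))) (𝓝[I] s) (𝓝 0) := by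
  refine tendsto_of_tendsto_of_tendsto_of_le_of_le' tendsto_const_nhds
    (by simpa using h1.add h2) (Eventually.of_forall fun t => zero_le) ?_
  filter_upwards [self_mem_nhdsWithin] with t ht
  calc eLpNorm (k t - k s) p (volume.restrict (disk R))
      ≤ eLpNorm ((fun x => ‖(f t - f s) x‖) + fun x => ‖(g t - g s) x‖) p
        (volume.restrict (disk R)) := eLpNorm_mono_real fun x => hk t s x
    _ ≤ eLpNorm (fun x => ‖(f t - f s) x‖) p (volume.restrict (disk R))
        + eLpNorm (fun x => ‖(g t - g s) x‖) p (volume.restrict (disk R)) :=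
      eLpNorm_add_le ((hf t ht).sub (hf s hs)).norm ((hg t ht).sub (hg s hs)).norm hp
    _ = _ := by rw [eLpNorm_norm, eLpNorm_norm]

lemma abs_coord_le (x : Plane) (i : Fin 2) : |x i| ≤ ‖x‖ := by
  simpa using PiLp.norm_apply_le x i

lemma continuousOn_profile (hR : 0 < R) {y : ℝ → ℝ} (hy : ContinuousOn y (Icc 0 R)) :
    ContinuousOn (fun s => y (√s)) (Icc 0 (R ^ 2)) :=
  hy.comp Real.continuous_sqrt.continuousOn fun s hs =>
    ⟨Real.sqrt_nonneg s, (Real.sqrt_le_left hR.le).2 hs.2⟩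

lemma exists_bound_profile (hR : 0 < R) {y : ℝ → ℝ} (hy : ContinuousOn y (Icc 0 R)) :
    ∃ M, ∀ s ∈ Ioc 0 (R ^ 2), |y (√s)| ≤ M := by
  obtain ⟨M, hM⟩ := isCompact_Icc.exists_bound_of_continuousOn (continuousOn_profile hR hy)
  exact ⟨M, fun s hs => hM s (Ioc_subset_Icc_self hs)⟩

lemma aestronglyMeasurable_profile (hR : 0 < R) {y : ℝ → ℝ} (hy : ContinuousOn y (Icc 0 R))
    (g : ℝ → ℝ) (hg : Continuous g) :
    AEStronglyMeasurable (fun s => g s * y (√s)) (nu (R ^ 2)) :=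
  ((hg.continuousOn.mul (continuousOn_profile hR hy)).mono
    Ioo_subset_Icc_self).aestronglyMeasurable measurableSet_Ioo

section velocity

variable {ur uθ : ℝ → ℝ → ℝ} {Du : Fin 2 → ℝ → Plane → Plane}

/-- Half the divergence of the velocity. -/
def halfDiv (Du : Fin 2 → ℝ → Plane → Plane) (t : ℝ) (x : Plane) : ℝ :=
  1 / 2 * (Du 0 t x 0 + Du 1 t x 1)

/-- Half the curl of the velocity. -/
def halfCurl (Du : Fin 2 → ℝ → Plane → Plane) (t : ℝ) (x : Plane) : ℝ :=
  1 / 2 * (Du 1 t x 0 - Du 0 t x 1)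

variable (h : ContinuousInSobolev (disk R) 2 T (vectorField ur uθ) Du)

include h

lemma memLp_Du {t : ℝ} (ht : t ∈ Icc 0 T) (i j : Fin 2) :
    MemLp (fun x => Du i t x j) 2 (volume.restrict (disk R)) :=
  MemLp.eval_piLp ((h.1 t ht).2 i).2 j

lemma memLp_halfDiv {t : ℝ} (ht : t ∈ Icc 0 T) :
    MemLp (halfDiv Du t) 2 (volume.restrict (disk R)) :=
  ((memLp_Du h ht 0 0).add (memLp_Du h ht 1 1)).const_mul _

lemma memLp_halfCurl {t : ℝ} (ht : t ∈ Icc 0 T) :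
    MemLp (halfCurl Du t) 2 (volume.restrict (disk R)) :=
  ((memLp_Du h ht 1 0).sub (memLp_Du h ht 0 1)).const_mul _

lemma l2Cont_halfDiv (hR : 0 < R) : L2Cont (R ^ 2) (Icc 0 T) (fun t => avg hR (halfDiv Du t)) := by
  refine l2Cont_avg hR (fun t ht => memLp_halfDiv h ht) fun s hs => ?_
  refine tendsto_eLpNorm_comb (f := Du 0) (g := Du 1) one_le_two
    (fun t ht => ((h.1 t ht).2 0).2.1) (fun t ht => ((h.1 t ht).2 1).2.1) (fun t τ x => ?_) hs
    ((h.tendsto hs).2 0) ((h.tendsto hs).2 1)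
  have h1 := abs_coord_le (Du 0 t x - Du 0 τ x) 0
  have h2 := abs_coord_le (Du 1 t x - Du 1 τ x) 1
  have e : halfDiv Du t x - halfDiv Du τ x
      = 1 / 2 * (Du 0 t x - Du 0 τ x) 0 + 1 / 2 * (Du 1 t x - Du 1 τ x) 1 := by
    simp only [halfDiv, PiLp.sub_apply]; ring
  rw [e]
  refine (abs_add_le _ _).trans ?_
  rw [abs_mul, abs_mul, abs_of_pos (by norm_num : (0 : ℝ) < 1 / 2)]
  linarith [norm_nonneg (Du 0 t x - Du 0 τ x), norm_nonneg (Du 1 t x - Du 1 τ x)]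

lemma l2Cont_halfCurl (hR : 0 < R) :
    L2Cont (R ^ 2) (Icc 0 T) (fun t => avg hR (halfCurl Du t)) := by
  refine l2Cont_avg hR (fun t ht => memLp_halfCurl h ht) fun s hs => ?_
  refine tendsto_eLpNorm_comb (f := Du 0) (g := Du 1) one_le_two
    (fun t ht => ((h.1 t ht).2 0).2.1) (fun t ht => ((h.1 t ht).2 1).2.1) (fun t τ x => ?_) hs
    ((h.tendsto hs).2 0) ((h.tendsto hs).2 1)
  have h1 := abs_coord_le (Du 0 t x - Du 0 τ x) 1
  have h2 := abs_coord_le (Du 1 t x - Du 1 τ x) 0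
  have e : halfCurl Du t x - halfCurl Du τ x
      = 1 / 2 * (Du 1 t x - Du 1 τ x) 0 - 1 / 2 * (Du 0 t x - Du 0 τ x) 1 := by
    simp only [halfCurl, PiLp.sub_apply]; ring
  rw [e]
  refine (abs_sub _ _).trans ?_
  rw [abs_mul, abs_mul, abs_of_pos (by norm_num : (0 : ℝ) < 1 / 2)]
  linarith [norm_nonneg (Du 0 t x - Du 0 τ x), norm_nonneg (Du 1 t x - Du 1 τ x)]

/-- Weak derivative identities for the components of the velocity at a fixed time. -/
lemma integral_pd_mul {t : ℝ} (ht : t ∈ Icc 0 T) {φ : Plane → ℝ} (hφ : IsTestOn (disk R) φ)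
    (i j : Fin 2) :
    ∫ x in disk R, pd i φ x * vectorField ur uθ t x j = -∫ x in disk R, φ x * Du i t x j :=
  (((h.1 t ht).2 i).1.coord j).integral_eq hφ

lemma integrableOn_mul_u {t : ℝ} (ht : t ∈ Icc 0 T) {φ : Plane → ℝ} (hφ : IsTestOn (disk R) φ)
    (j : Fin 2) : IntegrableOn (fun x => φ x * vectorField ur uθ t x j) (disk R) :=
  integrableOn_test_mul hφ (((h.1 t ht).2 0).1.coord j).1

lemma integrableOn_mul_Du {t : ℝ} (ht : t ∈ Icc 0 T) {φ : Plane → ℝ} (hφ : IsTestOn (disk R) φ)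
    (i j : Fin 2) : IntegrableOn (fun x => φ x * Du i t x j) (disk R) :=
  integrableOn_test_mul hφ (((h.1 t ht).2 i).1.coord j).2.1

/-- The gradient of χ(|x|²) is 2χ'(|x|²) x, and x · u = |x| u_r. Testing the divergence with radial
functions therefore isolates the radial profile; the 2 explains the use of half the divergence. -/
lemma weak_div (hR : 0 < R) {t : ℝ} (ht : t ∈ Icc 0 T) (hc : ContinuousOn (ur t) (Icc 0 R))
    {χ : ℝ → ℝ} (hχ : IsTest 0 (R ^ 2) χ) :
    ∫ s in Ioo 0 (R ^ 2), √s * ur t (√s) * deriv χ s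
      = -∫ s in Ioo 0 (R ^ 2), avg hR (halfDiv Du t) s * χ s := by
  have hφ := isTestOn_radial hR hχ (p := fun _ => 1) contDiff_const
  have hpd : ∀ (i : Fin 2) (x : Plane), pd i (fun x : Plane => χ (‖x‖ ^ 2) * 1) x
      = deriv χ (‖x‖ ^ 2) * (2 * x i) := fun i x => by
    rw [pd_radial hχ.1 contDiff_const]; simp [pd]
  have e0 := integral_pd_mul h ht hφ 0 0
  have e1 := integral_pd_mul h ht hφ 1 1
  have e2 := integral_add (integrableOn_mul_u h ht (hφ.pd 0) 0)
    (integrableOn_mul_u h ht (hφ.pd 1) 1)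
  have e3 := integral_add (integrableOn_mul_Du h ht hφ 0 0) (integrableOn_mul_Du h ht hφ 1 1)
  have e4 := integral_radial hR (aestronglyMeasurable_profile hR hc (fun s => 2 * √s * deriv χ s)
    (by have := hχ.deriv.1.continuous; fun_prop))
  have e5 := integral_mul_avg hR (hχ.memLp) (memLp_halfDiv h ht)
  have l4 : ∀ x : Plane, pd 0 (fun x : Plane => χ (‖x‖ ^ 2) * 1) x * vectorField ur uθ t x 0
      + pd 1 (fun x : Plane => χ (‖x‖ ^ 2) * 1) x * vectorField ur uθ t x 1
      = 2 * √(‖x‖ ^ 2) * deriv χ (‖x‖ ^ 2) * ur t (√(‖x‖ ^ 2)) := fun x => by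
    rw [hpd, hpd, Real.sqrt_sq (norm_nonneg x)]
    linear_combination (2 * deriv χ (‖x‖ ^ 2)) * dot_vectorField ur uθ t x
  have l5 : ∀ x : Plane, χ (‖x‖ ^ 2) * 1 * Du 0 t x 0 + χ (‖x‖ ^ 2) * 1 * Du 1 t x 1
      = 2 * (χ (‖x‖ ^ 2) * halfDiv Du t x) := fun x => by
    simp only [halfDiv]; ring
  simp only [l4] at e2
  simp only [l5] at e3
  rw [integral_const_mul, e5] at e3
  rw [e4] at e2
  have l6 : ∫ s in Ioo 0 (R ^ 2), 2 * √s * deriv χ s * ur t (√s)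
      = 2 * ∫ s in Ioo 0 (R ^ 2), √s * ur t (√s) * deriv χ s := by
    rw [← integral_const_mul]; congr 1; funext s; ring
  have l7 : ∫ s in Ioo 0 (R ^ 2), avg hR (halfDiv Du t) s * χ s
      = ∫ s in Ioo 0 (R ^ 2), χ s * avg hR (halfDiv Du t) s := by simp only [mul_comm]
  rw [l6] at e2
  rw [l7]
  refine mul_left_cancel₀ (mul_ne_zero two_ne_zero Real.pi_ne_zero) ?_
  linear_combination e2 + e0 + e1 + e3

/-- The same with the rotated gradient: the product of u with x^⊥ is |x| u_θ. -/
lemma weak_curl (hR : 0 < R) {t : ℝ} (ht : t ∈ Icc 0 T) (hc : ContinuousOn (uθ t) (Icc 0 R))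
    {χ : ℝ → ℝ} (hχ : IsTest 0 (R ^ 2) χ) :
    ∫ s in Ioo 0 (R ^ 2), √s * uθ t (√s) * deriv χ s
      = -∫ s in Ioo 0 (R ^ 2), avg hR (halfCurl Du t) s * χ s := by
  have hφ := isTestOn_radial hR hχ (p := fun _ => 1) contDiff_const
  have hpd : ∀ (i : Fin 2) (x : Plane), pd i (fun x : Plane => χ (‖x‖ ^ 2) * 1) x
      = deriv χ (‖x‖ ^ 2) * (2 * x i) := fun i x => by
    rw [pd_radial hχ.1 contDiff_const]; simp [pd]
  have e0 := integral_pd_mul h ht hφ 1 0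
  have e1 := integral_pd_mul h ht hφ 0 1
  have e2 := integral_sub (integrableOn_mul_u h ht (hφ.pd 1) 0)
    (integrableOn_mul_u h ht (hφ.pd 0) 1)
  have e3 := integral_sub (integrableOn_mul_Du h ht hφ 1 0) (integrableOn_mul_Du h ht hφ 0 1)
  have e4 := integral_radial hR (aestronglyMeasurable_profile hR hc (fun s => 2 * √s * deriv χ s)
    (by have := hχ.deriv.1.continuous; fun_prop))
  have e5 := integral_mul_avg hR (hχ.memLp) (memLp_halfCurl h ht)
  have l4 : ∀ x : Plane, pd 1 (fun x : Plane => χ (‖x‖ ^ 2) * 1) x * vectorField ur uθ t x 0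
      - pd 0 (fun x : Plane => χ (‖x‖ ^ 2) * 1) x * vectorField ur uθ t x 1
      = 2 * √(‖x‖ ^ 2) * deriv χ (‖x‖ ^ 2) * uθ t (√(‖x‖ ^ 2)) := fun x => by
    rw [hpd, hpd, Real.sqrt_sq (norm_nonneg x)]
    linear_combination (2 * deriv χ (‖x‖ ^ 2)) * cross_vectorField ur uθ t x
  have l5 : ∀ x : Plane, χ (‖x‖ ^ 2) * 1 * Du 1 t x 0 - χ (‖x‖ ^ 2) * 1 * Du 0 t x 1
      = 2 * (χ (‖x‖ ^ 2) * halfCurl Du t x) := fun x => by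
    simp only [halfCurl]; ring
  simp only [l4] at e2
  simp only [l5] at e3
  rw [integral_const_mul, e5] at e3
  rw [e4] at e2
  have l6 : ∫ s in Ioo 0 (R ^ 2), 2 * √s * deriv χ s * uθ t (√s)
      = 2 * ∫ s in Ioo 0 (R ^ 2), √s * uθ t (√s) * deriv χ s := by
    rw [← integral_const_mul]; congr 1; funext s; ring
  have l7 : ∫ s in Ioo 0 (R ^ 2), avg hR (halfCurl Du t) s * χ s
      = ∫ s in Ioo 0 (R ^ 2), χ s * avg hR (halfCurl Du t) s := by simp only [mul_comm]
  rw [l6] at e2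
  rw [l7]
  refine mul_left_cancel₀ (mul_ne_zero two_ne_zero Real.pi_ne_zero) ?_
  linear_combination e2 + e0 - e1 + e3

lemma primLoc_ur (hR : 0 < R) {t : ℝ} (ht : t ∈ Icc 0 T) (hc : ContinuousOn (ur t) (Icc 0 R)) :
    PrimLoc (R ^ 2) (fun s => √s * ur t (√s)) (avg hR (halfDiv Du t)) :=
  primLoc_of_weak (by positivity)
    (Real.continuous_sqrt.continuousOn.mul (continuousOn_profile hR hc))
    ((memLp_avg hR _).integrable one_le_two) fun _ hχ => weak_div h hR ht hc hχ

lemma primLoc_uθ (hR : 0 < R) {t : ℝ} (ht : t ∈ Icc 0 T) (hc : ContinuousOn (uθ t) (Icc 0 R)) :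
    PrimLoc (R ^ 2) (fun s => √s * uθ t (√s)) (avg hR (halfCurl Du t)) :=
  primLoc_of_weak (by positivity)
    (Real.continuous_sqrt.continuousOn.mul (continuousOn_profile hR hc))
    ((memLp_avg hR _).integrable one_le_two) fun _ hχ => weak_curl h hR ht hc hχ

lemma supCont_ur (hR : 0 < R) (hc : ∀ t ∈ Icc 0 T, ContinuousOn (ur t) (Icc 0 R)) :
    SupCont (R ^ 2) (Icc 0 T) (fun t s => ur t (√s)) :=
  supCont_of_primLoc (fun t ht => (continuousOn_profile hR (hc t ht)).mono Ioc_subset_Icc_self)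
    (fun t ht => exists_bound_profile hR (hc t ht)) (l2Cont_halfDiv h hR)
    fun t ht => primLoc_ur h hR ht (hc t ht)

lemma supCont_uθ (hR : 0 < R) (hc : ∀ t ∈ Icc 0 T, ContinuousOn (uθ t) (Icc 0 R)) :
    SupCont (R ^ 2) (Icc 0 T) (fun t s => uθ t (√s)) :=
  supCont_of_primLoc (fun t ht => (continuousOn_profile hR (hc t ht)).mono Ioc_subset_Icc_self)
    (fun t ht => exists_bound_profile hR (hc t ht)) (l2Cont_halfCurl h hR)
    fun t ht => primLoc_uθ h hR ht (hc t ht)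

end velocity

end

section

/-! ### Radial reduction of the density -/

variable {R T : ℝ}

/-- The preimage of a null set under the square root is contained in its image under the
differentiable map r ↦ r², hence null. -/
lemma quasiMeasurePreserving_sqrt (hR : 0 < R) :
    Measure.QuasiMeasurePreserving Real.sqrt (nu (R ^ 2)) (volume.restrict (Ioo 0 R)) := by
  refine ⟨Real.continuous_sqrt.measurable, Measure.AbsolutelyContinuous.mk fun N hN h0 => ?_⟩
  rw [Measure.restrict_apply hN] at h0
  rw [Measure.map_apply Real.continuous_sqrt.measurable hN,
    Measure.restrict_apply (Real.continuous_sqrt.measurable hN)]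
  refine measure_mono_null (fun s hs => ?_)
    (addHaar_image_eq_zero_of_differentiableOn_of_addHaar_eq_zero (μ := volume)
      (f := fun r : ℝ => r ^ 2) (by fun_prop) h0)
  refine ⟨√s, ⟨hs.1, Real.sqrt_pos.2 hs.2.1, ?_⟩, Real.sq_sqrt hs.2.1.le⟩
  rw [Real.sqrt_lt' hR]; exact hs.2.2

/-- Measurability of the profile is not part of the data; polar coordinates recover it from
integrability on the disk. -/
lemma aestronglyMeasurable_profile_of_integrable (hR : 0 < R) {y : ℝ → ℝ}
    (hy : IntegrableOn (fun x : Plane => y ‖x‖) (disk R)) :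
    AEStronglyMeasurable (fun s => y (√s)) (nu (R ^ 2)) := by
  have h1 := ((integrableOn_fun_norm_addHaar volume).1 hy).aestronglyMeasurable
  have h2 : AEStronglyMeasurable (fun r : ℝ => r⁻¹) (volume.restrict (Ioo 0 R)) :=
    measurable_inv.aestronglyMeasurable
  have h3 : AEStronglyMeasurable y (volume.restrict (Ioo 0 R)) := by
    refine (h2.mul h1).congr ((ae_restrict_iff' measurableSet_Ioo).2
      (Eventually.of_forall fun r hr => ?_))
    have : r ≠ 0 := hr.1.ne'
    simp [this]
  exact h3.comp_quasiMeasurePreserving (quasiMeasurePreserving_sqrt hR)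

lemma memLp_inv_sqrt {S p : ℝ} (hS : 0 < S) (hp : 0 < p) (hp2 : p < 2) :
    MemLp (fun s => (√s)⁻¹) (ENNReal.ofReal p) (nu S) := by
  have hm : AEStronglyMeasurable (fun s : ℝ => (√s)⁻¹) (nu S) :=
    (Real.continuous_sqrt.measurable.inv).aestronglyMeasurable
  refine (integrable_norm_rpow_iff hm (by simpa using hp) ENNReal.ofReal_ne_top).1 ?_
  have h := intervalIntegral.intervalIntegrable_rpow' (a := 0) (b := S) (r := -(p / 2))
    (by linarith)
  rw [intervalIntegrable_iff_integrableOn_Ioo_of_le hS.le] at h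
  refine h.congr_fun (fun s hs => ?_) measurableSet_Ioo
  simp only [ENNReal.toReal_ofReal hp.le, norm_inv, Real.norm_of_nonneg (Real.sqrt_nonneg s)]
  rw [Real.sqrt_eq_rpow, ← Real.rpow_neg hs.1.le, ← Real.rpow_mul hs.1.le]
  congr 1; ring

/-- The weight `‖x‖⁻¹` pairs with `L^q(Ω)` for `q > 2`. -/
lemma exists_integral_inv_norm_mul_le (hR : 0 < R) {q : ℝ} (hq : 2 < q) :
    ∃ C, 0 ≤ C ∧ ∀ g : Plane → ℝ, MemLp g (ENNReal.ofReal q) (volume.restrict (disk R)) →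
      IntegrableOn (fun x => (√(‖x‖ ^ 2))⁻¹ * |g x|) (disk R) ∧
      ∫ x in disk R, (√(‖x‖ ^ 2))⁻¹ * |g x|
        ≤ C * (eLpNorm g (ENNReal.ofReal q) (volume.restrict (disk R))).toReal := by
  have hq1 : 0 < q - 1 := by linarith
  -- The exponent conjugate to q. The condition q > 2 means p < 2, which is exactly the
  -- integrability of |x|^(-p) in the plane.
  set p := q / (q - 1) with hp
  have hp0 : 0 < p := by positivity
  have hp2 : p < 2 := by rw [hp, div_lt_iff₀ hq1]; linarith
  have hH : ENNReal.HolderConjugate (ENNReal.ofReal p) (ENNReal.ofReal q) := by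
    rw [ENNReal.holderConjugate_iff, ← ENNReal.ofReal_inv_of_pos hp0,
      ← ENNReal.ofReal_inv_of_pos (by linarith), ← ENNReal.ofReal_add (by positivity)
      (by have : 0 < q := by linarith
          positivity)]
    rw [← ENNReal.ofReal_one]
    congr 1
    rw [hp]; field_simp; ring
  have hw := memLp_radial hR (memLp_inv_sqrt (S := R ^ 2) (by positivity) hp0 hp2)
  refine ⟨(eLpNorm (fun x : Plane => (√(‖x‖ ^ 2))⁻¹) (ENNReal.ofReal p)
    (volume.restrict (disk R))).toReal, ENNReal.toReal_nonneg, fun g hg => ?_⟩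
  have h1 : MemLp (fun x => (√(‖x‖ ^ 2))⁻¹ * |g x|) 1 (volume.restrict (disk R)) :=
    hg.abs.mul' hw
  refine ⟨memLp_one_iff_integrable.1 h1, ?_⟩
  have h2 : ∫ x in disk R, (√(‖x‖ ^ 2))⁻¹ * |g x|
      = (eLpNorm (fun x => (√(‖x‖ ^ 2))⁻¹ * |g x|) 1 (volume.restrict (disk R))).toReal := by
    rw [eLpNorm_one_eq_lintegral_enorm, ← integral_norm_eq_lintegral_enorm h1.1]
    congr 1; funext x
    rw [Real.norm_of_nonneg (by positivity)]
  rw [h2, ← ENNReal.toReal_mul]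
  refine ENNReal.toReal_mono (ENNReal.mul_ne_top hw.eLpNorm_ne_top hg.eLpNorm_ne_top) ?_
  have h3 := eLpNorm_smul_le_mul_eLpNorm (hpqr := hH) hg.abs.1 hw.1
  have h4 : eLpNorm (fun x => |g x|) (ENNReal.ofReal q) (volume.restrict (disk R))
      = eLpNorm g (ENNReal.ofReal q) (volume.restrict (disk R)) := by
    simpa only [Real.norm_eq_abs] using eLpNorm_norm g
  rw [← h4]
  exact h3

lemma avg_sub (hR : 0 < R) {g k : Plane → ℝ} (hg : MemLp g 2 (volume.restrict (disk R)))
    (hk : MemLp k 2 (volume.restrict (disk R))) :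
    avg hR (fun x => g x - k x) =ᵐ[nu (R ^ 2)] fun s => avg hR g s - avg hR k s := by
  have h1 : toL2 (nu (R ^ 2)) (avg hR (fun x => g x - k x))
      = toL2 (nu (R ^ 2)) (fun s => avg hR g s - avg hR k s) := by
    rw [toL2_sub (memLp_avg hR g) (memLp_avg hR k), toL2_avg, toL2_avg, toL2_avg,
      toL2_sub (memLp_muD hg) (memLp_muD hk), map_sub]
  refine (toL2_coe (memLp_avg hR _)).symm.trans ?_
  rw [h1]
  exact toL2_coe ((memLp_avg hR g).sub (memLp_avg hR k))

/-- The radial derivative of the density. -/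
def radDeriv (Dρ : Fin 2 → ℝ → Plane → ℝ) (t : ℝ) (x : Plane) : ℝ :=
  x 0 / ‖x‖ * Dρ 0 t x + x 1 / ‖x‖ * Dρ 1 t x

lemma abs_coord_div_le (x : Plane) (i : Fin 2) : |x i / ‖x‖| ≤ 1 := by
  rw [abs_div, abs_norm]
  exact div_le_one_of_le₀ (abs_coord_le x i) (norm_nonneg x)

lemma aestronglyMeasurable_coord_div (i : Fin 2) :
    AEStronglyMeasurable (fun x : Plane => x i / ‖x‖) (volume.restrict (disk R)) := by
  have : Measurable fun x : Plane => x i / ‖x‖ :=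
    Measurable.div (by fun_prop) (by fun_prop)
  exact this.aestronglyMeasurable

lemma IsTest.eq_mul_div_id {S : ℝ} {ζ : ℝ → ℝ} (hζ : IsTest 0 S ζ) (s : ℝ) :
    ζ s = s * (ζ s / s) := by
  by_cases hs : s = 0
  · rw [hs, zero_mul]
    exact image_eq_zero_of_notMem_tsupport fun h => absurd (hζ.2.2 h).1 (by simp)
  · field_simp

lemma IsTest.deriv_eq {S : ℝ} {ζ : ℝ → ℝ} (hζ : IsTest 0 S ζ) (s : ℝ) :
    _root_.deriv ζ s = ζ s / s + s * _root_.deriv (fun s => ζ s / s) s := by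
  have h1 := (hasDerivAt_id s).mul (hζ.div_id.hasDerivAt s)
  have h2 : ζ = id * fun s => ζ s / s := funext fun s => hζ.eq_mul_div_id s
  rw [← h2] at h1
  rw [h1.deriv]; simp

lemma contDiff_coord (j : Fin 2) : ContDiff ℝ ∞ (fun x : Plane => x j) :=
  (EuclideanSpace.proj (𝕜 := ℝ) j).contDiff

lemma pd_coord (i j : Fin 2) (x : Plane) :
    pd i (fun x : Plane => x j) x = if i = j then 1 else 0 := by
  have : HasFDerivAt (fun x : Plane => x j) (EuclideanSpace.proj (𝕜 := ℝ) j) x :=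
    (EuclideanSpace.proj (𝕜 := ℝ) j).hasFDerivAt
  rw [pd, this.fderiv]
  simp [dirX, eq_comm]

lemma nonneg_of_ae_nu {S : ℝ} {y : ℝ → ℝ} (hS : 0 < S) (hy : ContinuousOn y (Ioc 0 S))
    (h : ∀ᵐ s ∂(nu S), 0 ≤ y s) {s : ℝ} (hs : s ∈ Ioc 0 S) : 0 ≤ y s := by
  have hm : ContinuousOn (fun s => max (y s) 0) (Ioc 0 S) := hy.sup continuousOn_const
  have h1 : EqOn y (fun s => max (y s) 0) (Ioo 0 S) :=
    Measure.eqOn_open_of_ae_eq (h.mono fun s hs => (max_eq_left hs).symm) isOpen_Ioo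
      (hy.mono Ioo_subset_Ioc_self) (hm.mono Ioo_subset_Ioc_self)
  have h2 : EqOn y (fun s => max (y s) 0) (Ioc 0 S) := h1.of_subset_closure hy hm
    Ioo_subset_Ioc_self (by rw [closure_Ioo hS.ne]; exact Ioc_subset_Icc_self)
  rw [h2 hs]
  exact le_max_right _ _

section density

variable {q : ℝ} {ρ : ℝ → ℝ → ℝ} {Dρ : Fin 2 → ℝ → Plane → ℝ}
  (h : ContinuousInSobolev (disk R) (ENNReal.ofReal q) T (scalarField ρ) Dρ)

include h

lemma memLp_radDeriv {t : ℝ} (ht : t ∈ Icc 0 T) :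
    MemLp (radDeriv Dρ t) (ENNReal.ofReal q) (volume.restrict (disk R)) := by
  have h1 : ∀ i, MemLp (fun x : Plane => x i / ‖x‖ * Dρ i t x) (ENNReal.ofReal q)
      (volume.restrict (disk R)) := fun i => by
    have h2 := ((h.1 t ht).2 i).2
    refine h2.of_le_mul (c := 1) ((aestronglyMeasurable_coord_div i).mul h2.1)
      (Eventually.of_forall fun x => ?_)
    rw [norm_mul]
    exact mul_le_mul_of_nonneg_right (abs_coord_div_le x i) (norm_nonneg _)
  exact (h1 0).add (h1 1)

lemma tendsto_radDeriv (hq : 2 < q) {s : ℝ} (hs : s ∈ Icc 0 T) :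
    Tendsto (fun t => eLpNorm (radDeriv Dρ t - radDeriv Dρ s) (ENNReal.ofReal q)
      (volume.restrict (disk R))) (𝓝[Icc 0 T] s) (𝓝 0) := by
  refine tendsto_eLpNorm_comb (f := Dρ 0) (g := Dρ 1) (by simp; linarith)
    (fun t ht => ((h.1 t ht).2 0).2.1) (fun t ht => ((h.1 t ht).2 1).2.1) (fun t τ x => ?_) hs
    ((h.tendsto hs).2 0) ((h.tendsto hs).2 1)
  have e : radDeriv Dρ t x - radDeriv Dρ τ x
      = x 0 / ‖x‖ * (Dρ 0 t x - Dρ 0 τ x) + x 1 / ‖x‖ * (Dρ 1 t x - Dρ 1 τ x) := by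
    simp only [radDeriv]; ring
  rw [e]
  refine (abs_add_le _ _).trans ?_
  rw [abs_mul, abs_mul]
  exact add_le_add
    (mul_le_of_le_one_left (abs_nonneg _) (abs_coord_div_le x 0))
    (mul_le_of_le_one_left (abs_nonneg _) (abs_coord_div_le x 1))

lemma memLp_two_radDeriv (hq : 2 < q) {t : ℝ} (ht : t ∈ Icc 0 T) :
    MemLp (radDeriv Dρ t) 2 (volume.restrict (disk R)) :=
  (memLp_radDeriv h ht).mono_exponent (by
    rw [← ENNReal.ofReal_ofNat]; exact ENNReal.ofReal_le_ofReal hq.le)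

/-- On a bounded disk convergence in L^q with q > 2 implies convergence in L². -/
lemma l2Cont_radDeriv (hR : 0 < R) (hq : 2 < q) :
    L2Cont (R ^ 2) (Icc 0 T) (fun t => avg hR (radDeriv Dρ t)) := by
  refine l2Cont_avg hR (fun t ht => memLp_two_radDeriv h hq ht) fun s hs => ?_
  have h1 := ENNReal.Tendsto.mul_const (b := volume.restrict (disk R) univ
    ^ (1 / (2 : ENNReal).toReal - 1 / (ENNReal.ofReal q).toReal)) (tendsto_radDeriv h hq hs)
    (Or.inr ?_)
  · rw [zero_mul] at h1
    refine tendsto_of_tendsto_of_tendsto_of_le_of_le' tendsto_const_nhds h1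
      (Eventually.of_forall fun t => zero_le) ?_
    filter_upwards [self_mem_nhdsWithin] with t ht
    refine eLpNorm_le_eLpNorm_mul_rpow_measure_univ ?_
      ((memLp_radDeriv h ht).1.sub (memLp_radDeriv h hs).1)
    rw [← ENNReal.ofReal_ofNat]; exact ENNReal.ofReal_le_ofReal hq.le
  · refine ENNReal.rpow_ne_top_of_nonneg ?_ (measure_ne_top _ _)
    rw [ENNReal.toReal_ofReal (by linarith), ENNReal.toReal_ofNat, sub_nonneg]
    exact one_div_le_one_div_of_le two_pos hq.le

lemma integrableOn_profile (hR : 0 < R) (hq : 2 < q) {t : ℝ} (ht : t ∈ Icc 0 T) :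
    IntegrableOn (fun s => ρ t (√s)) (Ioo 0 (R ^ 2)) := by
  have h1 : IntegrableOn (fun x : Plane => ρ t ‖x‖) (disk R) :=
    (h.1 t ht).1.integrable (by simp; linarith)
  refine (integrable_radial_iff hR (aestronglyMeasurable_profile_of_integrable hR h1)).1 ?_
  simpa only [Real.sqrt_sq (norm_nonneg _)] using h1

/-- With χ = ζ/s the field χ(|x|²) x has divergence 2χ + 2sχ' = 2ζ', and its product with the
gradient contains only the radial derivative. -/
lemma weak_density (hR : 0 < R) (hq : 2 < q) {t : ℝ} (ht : t ∈ Icc 0 T) {ζ : ℝ → ℝ}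
    (hζ : IsTest 0 (R ^ 2) ζ) :
    ∫ s in Ioo 0 (R ^ 2), ρ t (√s) * deriv ζ s
      = -∫ s in Ioo 0 (R ^ 2), avg hR (radDeriv Dρ t) s / (2 * √s) * ζ s := by
  set χ : ℝ → ℝ := fun s => ζ s / s with hχd
  have hχ : IsTest 0 (R ^ 2) χ := hζ.div_id
  have hφ : ∀ j, IsTestOn (disk R) (fun x : Plane => χ (‖x‖ ^ 2) * x j) := fun j =>
    isTestOn_radial hR hχ (contDiff_coord j)
  have hpd : ∀ (j : Fin 2) (x : Plane), pd j (fun x : Plane => χ (‖x‖ ^ 2) * x j) x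
      = deriv χ (‖x‖ ^ 2) * (2 * x j * x j) + χ (‖x‖ ^ 2) := fun j x => by
    rw [pd_radial hχ.1 (contDiff_coord j)]; simp [pd_coord]
  have hi : ∀ j, IntegrableOn (fun x => pd j (fun x : Plane => χ (‖x‖ ^ 2) * x j) x
      * scalarField ρ t x) (disk R) := fun j =>
    integrableOn_test_mul ((hφ j).pd j) ((h.1 t ht).2 j).1.1
  have hi' : ∀ j, IntegrableOn (fun x => χ (‖x‖ ^ 2) * x j * Dρ j t x) (disk R) := fun j =>
    integrableOn_test_mul (hφ j) ((h.1 t ht).2 j).1.2.1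
  have e : ∀ j, ∫ x in disk R, pd j (fun x : Plane => χ (‖x‖ ^ 2) * x j) x * scalarField ρ t x
      = -∫ x in disk R, χ (‖x‖ ^ 2) * x j * Dρ j t x := fun j =>
    ((h.1 t ht).2 j).1.integral_eq (hφ j)
  have e2 := integral_add (hi 0) (hi 1)
  have e3 := integral_add (hi' 0) (hi' 1)
  have hm : AEStronglyMeasurable (fun s => ρ t (√s)) (nu (R ^ 2)) :=
    (integrableOn_profile h hR hq ht).aestronglyMeasurable
  have e4 := integral_radial hR (g := fun s => 2 * (ρ t (√s) * deriv ζ s))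
    ((hm.mul hζ.deriv.1.continuous.aestronglyMeasurable).const_mul 2)
  have hf : MemLp (fun s => χ s * √s) 2 (nu (R ^ 2)) := by
    obtain ⟨M, hM⟩ := exists_bound_profile (y := id) hR continuousOn_id
    exact memLp_mul_bdd hχ.memLp Real.continuous_sqrt.continuousOn hM
  have e5 := integral_mul_avg hR hf (memLp_two_radDeriv h hq ht)
  have l4 : ∀ x : Plane, pd 0 (fun x : Plane => χ (‖x‖ ^ 2) * x 0) x * scalarField ρ t x
      + pd 1 (fun x : Plane => χ (‖x‖ ^ 2) * x 1) x * scalarField ρ t x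
      = 2 * (ρ t (√(‖x‖ ^ 2)) * deriv ζ (‖x‖ ^ 2)) := fun x => by
    rw [hpd, hpd, Real.sqrt_sq (norm_nonneg x), scalarField, hζ.deriv_eq]
    change _ = 2 * (ρ t ‖x‖ * (χ (‖x‖ ^ 2) + ‖x‖ ^ 2 * deriv χ (‖x‖ ^ 2)))
    linear_combination (-2 * deriv χ (‖x‖ ^ 2) * ρ t ‖x‖) * norm_sq_plane x
  have l5 : ∀ x : Plane, χ (‖x‖ ^ 2) * x 0 * Dρ 0 t x + χ (‖x‖ ^ 2) * x 1 * Dρ 1 t x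
      = χ (‖x‖ ^ 2) * √(‖x‖ ^ 2) * radDeriv Dρ t x := fun x => by
    rw [Real.sqrt_sq (norm_nonneg x), radDeriv]
    by_cases hx : x = 0
    · simp [hx]
    · have : ‖x‖ ≠ 0 := norm_ne_zero_iff.2 hx
      field_simp
  simp only [l4] at e2
  simp only [l5] at e3
  rw [e4, integral_const_mul] at e2
  rw [e5] at e3
  have l7 : ∫ s in Ioo 0 (R ^ 2), avg hR (radDeriv Dρ t) s / (2 * √s) * ζ s
      = 1 / 2 * ∫ s in Ioo 0 (R ^ 2), χ s * √s * avg hR (radDeriv Dρ t) s := by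
    rw [← integral_const_mul]
    refine setIntegral_congr_fun measurableSet_Ioo fun s hs => ?_
    have h1 : 0 < √s := Real.sqrt_pos.2 hs.1
    simp only [hχd]
    have h3 : s ≠ 0 := hs.1.ne'
    field_simp
    rw [Real.sq_sqrt hs.1.le]
    ring
  rw [l7]
  refine mul_left_cancel₀ (mul_ne_zero two_ne_zero Real.pi_ne_zero) ?_
  linear_combination e2 + e 0 + e 1 + e3

/-- The radial derivative divided by `2√s` is integrable, uniformly in `L^q`. -/
lemma exists_integral_radDeriv_le (hR : 0 < R) (hq : 2 < q) : ∃ C, 0 ≤ C ∧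
    (∀ t ∈ Icc 0 T, IntegrableOn (fun s => avg hR (radDeriv Dρ t) s / (2 * √s)) (Ioo 0 (R ^ 2))) ∧
    ∀ t ∈ Icc 0 T, ∀ τ ∈ Icc 0 T, ∫ s in Ioo 0 (R ^ 2),
      |avg hR (radDeriv Dρ τ) s / (2 * √s) - avg hR (radDeriv Dρ t) s / (2 * √s)|
      ≤ C * (eLpNorm (radDeriv Dρ τ - radDeriv Dρ t) (ENNReal.ofReal q)
        (volume.restrict (disk R))).toReal := by
  obtain ⟨C, hC0, hC⟩ := exists_integral_inv_norm_mul_le hR hq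
  have hmeas : Measurable fun s : ℝ => (√s)⁻¹ := Real.continuous_sqrt.measurable.inv
  have h0 : ∀ s : ℝ, 0 ≤ (√s)⁻¹ := fun s => by positivity
  have hpi := Real.pi_pos
  refine ⟨C / (2 * Real.pi), by positivity, fun t ht => ?_, fun t ht τ hτ => ?_⟩
  · have h1 := (integrable_abs_avg_mul hR (memLp_two_radDeriv h hq ht) hmeas h0
      (hC _ (memLp_radDeriv h ht)).1).1
    refine (h1.const_mul (1 / 2)).mono' ?_ (Eventually.of_forall fun s => ?_)
    · exact ((memLp_avg hR _).1.mul (hmeas.const_mul (1 / 2)).aestronglyMeasurable).congr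
        (Eventually.of_forall fun s => by simp; ring)
    · rw [Real.norm_eq_abs, abs_div, abs_of_nonneg (by positivity : 0 ≤ 2 * √s)]
      refine le_of_eq ?_
      rw [div_eq_mul_inv, mul_inv]; ring
  · have hd : MemLp (fun x => radDeriv Dρ τ x - radDeriv Dρ t x) (ENNReal.ofReal q)
      (volume.restrict (disk R)) := (memLp_radDeriv h hτ).sub (memLp_radDeriv h ht)
    have h1 := integrable_abs_avg_mul hR ((memLp_two_radDeriv h hq hτ).sub
      (memLp_two_radDeriv h hq ht)) hmeas h0 (hC _ hd).1
    have h2 := h1.2.trans (hC _ hd).2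
    have h3 : ∫ s in Ioo 0 (R ^ 2),
        |avg hR (radDeriv Dρ τ) s / (2 * √s) - avg hR (radDeriv Dρ t) s / (2 * √s)|
        = 1 / 2 * ∫ s in Ioo 0 (R ^ 2), (√s)⁻¹ * |avg hR (radDeriv Dρ τ - radDeriv Dρ t) s| := by
      rw [← integral_const_mul]
      refine integral_congr_ae ?_
      filter_upwards [avg_sub hR (memLp_two_radDeriv h hq hτ) (memLp_two_radDeriv h hq ht)] with s hs
      rw [show avg hR (radDeriv Dρ τ - radDeriv Dρ t) s = _ from hs, ← sub_div, abs_div,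
        abs_of_nonneg (by positivity : 0 ≤ 2 * √s), div_eq_mul_inv, mul_inv]
      ring
    rw [h3]
    have h4 : (eLpNorm (radDeriv Dρ τ - radDeriv Dρ t) (ENNReal.ofReal q)
        (volume.restrict (disk R))).toReal = (eLpNorm (fun x => radDeriv Dρ τ x - radDeriv Dρ t x)
        (ENNReal.ofReal q) (volume.restrict (disk R))).toReal := rfl
    rw [h4, div_mul_eq_mul_div C, le_div_iff₀ (by positivity)]
    have h5 : avg hR (radDeriv Dρ τ - radDeriv Dρ t)
      = avg hR (fun x => radDeriv Dρ τ x - radDeriv Dρ t x) := rfl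
    rw [h5] at h2
    rw [h5]
    linarith

lemma exists_integral_profile_le (hR : 0 < R) (hq : 2 < q) : ∃ C, 0 ≤ C ∧
    ∀ t ∈ Icc 0 T, ∀ τ ∈ Icc 0 T, ∫ s in Ioo 0 (R ^ 2), |ρ τ (√s) - ρ t (√s)|
      ≤ C * (eLpNorm (scalarField ρ τ - scalarField ρ t) (ENNReal.ofReal q)
        (volume.restrict (disk R))).toReal := by
  obtain ⟨C, hC0, hC⟩ := exists_integral_inv_norm_mul_le hR hq
  have hpi := Real.pi_pos
  refine ⟨R * (C / Real.pi), by positivity, fun t ht τ hτ => ?_⟩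
  have hd := (h.1 τ hτ).1.sub (h.1 t ht).1
  have h1 := hC _ hd
  have hm : AEStronglyMeasurable (fun s => (√s)⁻¹ * |ρ τ (√s) - ρ t (√s)|) (nu (R ^ 2)) :=
    (Real.continuous_sqrt.measurable.inv).aestronglyMeasurable.mul
      (((integrableOn_profile h hR hq hτ).sub (integrableOn_profile h hR hq ht)).abs).1
  have e : ∀ x : Plane, (√(‖x‖ ^ 2))⁻¹ * |(scalarField ρ τ - scalarField ρ t) x|
      = (√(‖x‖ ^ 2))⁻¹ * |ρ τ (√(‖x‖ ^ 2)) - ρ t (√(‖x‖ ^ 2))| := fun x => by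
    simp [scalarField, Real.sqrt_sq (norm_nonneg x)]
  simp only [e] at h1
  rw [integral_radial hR hm] at h1
  have h2 := (integrable_radial_iff hR hm).1 h1.1
  calc ∫ s in Ioo 0 (R ^ 2), |ρ τ (√s) - ρ t (√s)|
      ≤ ∫ s in Ioo 0 (R ^ 2), R * ((√s)⁻¹ * |ρ τ (√s) - ρ t (√s)|) := by
        refine setIntegral_mono_on ((integrableOn_profile h hR hq hτ).sub
          (integrableOn_profile h hR hq ht)).abs (h2.const_mul R) measurableSet_Ioo fun s hs => ?_
        have h3 : 0 < √s := Real.sqrt_pos.2 hs.1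
        have h4 : √s ≤ R := (Real.sqrt_le_left hR.le).2 hs.2.le
        rw [← mul_assoc, ← div_eq_mul_inv]
        exact le_mul_of_one_le_left (abs_nonneg _) ((one_le_div h3).2 h4)
    _ = R * ∫ s in Ioo 0 (R ^ 2), (√s)⁻¹ * |ρ τ (√s) - ρ t (√s)| := integral_const_mul _ _
    _ ≤ R * (C * (eLpNorm (scalarField ρ τ - scalarField ρ t) (ENNReal.ofReal q)
        (volume.restrict (disk R))).toReal / Real.pi) := by
        refine mul_le_mul_of_nonneg_left ?_ hR.le
        rw [le_div_iff₀ hpi]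
        linarith [h1.2]
    _ = _ := by ring

/-- The density has a version that is continuous in `s = |x|²`, uniformly in time. -/
theorem exists_density_profile (hR : 0 < R) (hq : 2 < q) :
    ∃ P : ℝ → ℝ → ℝ, SupCont (R ^ 2) (Icc 0 T) P ∧
      (∀ t ∈ Icc 0 T, PrimLoc (R ^ 2) (P t) (fun s => avg hR (radDeriv Dρ t) s / (2 * √s))) ∧
      ∀ t ∈ Icc 0 T, (fun s => ρ t (√s)) =ᵐ[nu (R ^ 2)] P t := by
  set S := R ^ 2 with hSd
  have hS : 0 < S := by positivity
  obtain ⟨C₁, hC₁, hi, hb⟩ := exists_integral_radDeriv_le h hR hq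
  obtain ⟨C₂, hC₂, hb'⟩ := exists_integral_profile_le h hR hq
  set g : ℝ → ℝ → ℝ := fun t s => avg hR (radDeriv Dρ t) s / (2 * √s) with hg
  have hc : ∀ t, ∃ c, t ∈ Icc 0 T → ∀ᵐ s, s ∈ Ioo 0 S → ρ t (√s) = c + ∫ y in 0..s, g t y := by
    intro t
    by_cases ht : t ∈ Icc 0 T
    · obtain ⟨c, hc⟩ := ae_eq_const_add_integral hS (integrableOn_profile h hR hq ht) (hi t ht)
        fun ζ hζ => weak_density h hR hq ht hζ
      exact ⟨c, fun _ => hc⟩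
    · exact ⟨0, fun h => absurd h ht⟩
  choose c hc using hc
  set P : ℝ → ℝ → ℝ := fun t s => c t + ∫ y in 0..s, g t y with hP
  have hi' : ∀ t ∈ Icc 0 T, IntegrableOn (g t) (Icc 0 S) := fun t ht => by
    rw [integrableOn_Icc_iff_integrableOn_Ioo]; exact hi t ht
  have hint : ∀ t ∈ Icc 0 T, ∀ a b, 0 ≤ a → a ≤ b → b ≤ S → IntervalIntegrable (g t) volume a b :=
    fun t ht a b ha hab hb => by
      rw [intervalIntegrable_iff_integrableOn_Icc_of_le hab]
      exact (hi' t ht).mono_set (Icc_subset_Icc ha hb)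
  have hcont : ∀ t ∈ Icc 0 T, ContinuousOn (P t) (Icc 0 S) := fun t ht => by
    refine continuousOn_const.add ?_
    have := intervalIntegral.continuousOn_primitive_interval (μ := volume) (a := 0) (b := S)
      (f := g t) (by rw [uIcc_of_le hS.le]; exact hi' t ht)
    rwa [uIcc_of_le hS.le] at this
  have hae : ∀ t ∈ Icc 0 T, (fun s => ρ t (√s)) =ᵐ[nu S] P t := fun t ht =>
    (ae_restrict_iff' measurableSet_Ioo).2 (hc t ht)
  set N : ℝ → ℝ → ℝ := fun t τ => ∫ s in Ioo 0 S, |g τ s - g t s| with hN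
  have hprim : ∀ t ∈ Icc 0 T, ∀ τ ∈ Icc 0 T, ∀ s ∈ Icc 0 S,
      |(∫ y in 0..s, g τ y) - ∫ y in 0..s, g t y| ≤ N t τ := fun t ht τ hτ s hs => by
    rw [← intervalIntegral.integral_sub (hint τ hτ 0 s le_rfl hs.1 hs.2)
      (hint t ht 0 s le_rfl hs.1 hs.2), hN]
    refine (intervalIntegral.abs_integral_le_integral_abs hs.1).trans ?_
    rw [intervalIntegral.integral_of_le hs.1]
    simp only [← integral_Ioc_eq_integral_Ioo]
    refine setIntegral_mono_set ?_ (Eventually.of_forall fun _ => abs_nonneg _)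
      (Ioc_subset_Ioc_right hs.2).eventuallyLE
    have : IntegrableOn (fun s => |g τ s - g t s|) (Icc 0 S) := ((hi' τ hτ).sub (hi' t ht)).abs
    exact this.mono_set Ioc_subset_Icc_self
  set M : ℝ → ℝ → ℝ := fun t τ => ∫ s in Ioo 0 S, |ρ τ (√s) - ρ t (√s)| with hM
  -- The constants of integration are compared by averaging over (0, S): their increment is that of
  -- the density, small in L¹, minus that of the primitives, small uniformly.
  have hcc : ∀ t ∈ Icc 0 T, ∀ τ ∈ Icc 0 T, |c τ - c t| ≤ M t τ / S + N t τ := fun t ht τ hτ => by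
    have i1 : IntegrableOn (fun s => |ρ τ (√s) - ρ t (√s)|) (Ioo 0 S) :=
      ((integrableOn_profile h hR hq hτ).sub (integrableOn_profile h hR hq ht)).abs
    have h1 : ∫ _ in Ioo 0 S, |c τ - c t| ≤ ∫ s in Ioo 0 S, (|ρ τ (√s) - ρ t (√s)| + N t τ) := by
      refine integral_mono_ae (integrable_const _) (i1.add (integrable_const _)) ?_
      filter_upwards [hae t ht, hae τ hτ, ae_nu (S := S) fun s hs => hs] with s h1 h2 hs
      have h4 : c τ - c t = (ρ τ (√s) - ρ t (√s))
          - ((∫ y in 0..s, g τ y) - ∫ y in 0..s, g t y) := by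
        rw [h1, h2, hP]; ring
      rw [h4]
      exact (abs_sub _ _).trans (add_le_add le_rfl (hprim t ht τ hτ s (Ioo_subset_Icc_self hs)))
    rw [integral_add i1 (integrable_const _)] at h1
    simp only [integral_const, measureReal_restrict_apply_univ, Real.volume_real_Ioo_of_le hS.le,
      sub_zero, smul_eq_mul] at h1
    rw [← sub_le_iff_le_add, le_div_iff₀ hS]
    linarith
  refine ⟨P, ?_, fun t ht => ?_, hae⟩
  · refine SupCont.of_bound (fun t ht => (hcont t ht).mono Ioc_subset_Icc_self) (fun t ht => ?_)
      (fun t τ => M t τ / S + 2 * N t τ) (fun t ht => ?_) fun t ht τ hτ s hs => ?_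
    · obtain ⟨K, hK⟩ := isCompact_Icc.exists_bound_of_continuousOn (hcont t ht)
      exact ⟨K, fun s hs => hK s (Ioc_subset_Icc_self hs)⟩
    · have h1 := (ENNReal.tendsto_toReal ENNReal.zero_ne_top).comp (tendsto_radDeriv h hq ht)
      have h2 := (ENNReal.tendsto_toReal ENNReal.zero_ne_top).comp (h.tendsto ht).1
      have h3 := ((h2.const_mul C₂).div_const S).add ((h1.const_mul C₁).const_mul 2)
      simp only [ENNReal.toReal_zero, mul_zero, zero_div, add_zero] at h3
      refine squeeze_zero' (Eventually.of_forall fun τ => ?_) ?_ h3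
      · have : 0 ≤ M t τ := integral_nonneg fun _ => abs_nonneg _
        have : 0 ≤ N t τ := integral_nonneg fun _ => abs_nonneg _
        positivity
      · filter_upwards [self_mem_nhdsWithin] with τ hτ
        have h4 := hb t ht τ hτ
        have h5 := hb' t ht τ hτ
        refine add_le_add (div_le_div_of_nonneg_right h5 hS.le) ?_
        exact mul_le_mul_of_nonneg_left h4 two_pos.le
    · have h1 : P τ s - P t s = (c τ - c t) + ((∫ y in 0..s, g τ y) - ∫ y in 0..s, g t y) := by
        simp only [hP]; ring
      rw [h1]
      have := hprim t ht τ hτ s (Ioc_subset_Icc_self hs)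
      linarith [abs_add_le (c τ - c t) ((∫ y in 0..s, g τ y) - ∫ y in 0..s, g t y), hcc t ht τ hτ]
  · refine PrimLoc.of_integral (fun a ha haS => hint t ht a S ha.le haS le_rfl) fun a ha haS => ?_
    have := intervalIntegral.integral_add_adjacent_intervals (hint t ht 0 a le_rfl ha.le haS)
      (hint t ht a S ha.le haS le_rfl)
    simp only [hP, ← this]
    ring

end density

end

section

/-! ### Radial and angular test fields -/

variable {R T : ℝ}

/-- A linear form on the plane. -/
def lin (a b : ℝ) (x : Plane) : ℝ := a * x 0 + b * x 1

lemma contDiff_lin (a b : ℝ) : ContDiff ℝ ∞ (lin a b) :=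
  (contDiff_const.mul (contDiff_coord 0)).add (contDiff_const.mul (contDiff_coord 1))

lemma pd_add {φ ψ : Plane → ℝ} (hφ : ContDiff ℝ ∞ φ) (hψ : ContDiff ℝ ∞ ψ) (i : Fin 2) (x : Plane) :
    pd i (fun x => φ x + ψ x) x = pd i φ x + pd i ψ x := by
  have h1 := (hφ.differentiable (by simp)) x
  have h2 := (hψ.differentiable (by simp)) x
  simp only [pd]
  rw [fderiv_fun_add h1 h2]
  rfl

lemma pd_const_mul {φ : Plane → ℝ} (hφ : ContDiff ℝ ∞ φ) (a : ℝ) (i : Fin 2) (x : Plane) :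
    pd i (fun x => a * φ x) x = a * pd i φ x := by
  have h1 := (hφ.differentiable (by simp)) x
  simp only [pd]
  rw [fderiv_const_mul h1]
  rfl

lemma pd_const (a : ℝ) (i : Fin 2) (x : Plane) : pd i (fun _ : Plane => a) x = 0 := by
  simp [pd]

lemma pd_mul {φ ψ : Plane → ℝ} (hφ : ContDiff ℝ ∞ φ) (hψ : ContDiff ℝ ∞ ψ) (i : Fin 2) (x : Plane) :
    pd i (fun x => φ x * ψ x) x = pd i φ x * ψ x + φ x * pd i ψ x := by
  have h1 := (hφ.differentiable (by simp)) x
  have h2 := (hψ.differentiable (by simp)) x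
  simp only [pd]
  rw [fderiv_fun_mul h1 h2]
  simp; ring

lemma pd_lin (a b : ℝ) (i : Fin 2) (x : Plane) : pd i (lin a b) x = lin a b (dirX i) := by
  have h1 : lin a b = fun x : Plane => a * x 0 + b * x 1 := rfl
  rw [h1, pd_add (contDiff_const.mul (contDiff_coord 0)) (contDiff_const.mul (contDiff_coord 1)),
    pd_const_mul (contDiff_coord 0), pd_const_mul (contDiff_coord 1), pd_coord, pd_coord]
  simp [dirX, eq_comm]

lemma pd_radial_lin {χ : ℝ → ℝ} (hχ : ContDiff ℝ ∞ χ) (a b : ℝ) (i : Fin 2) :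
    pd i (fun x => χ (‖x‖ ^ 2) * lin a b x)
      = fun x => deriv χ (‖x‖ ^ 2) * (2 * x i * lin a b x)
        + χ (‖x‖ ^ 2) * lin a b (dirX i) := by
  rw [pd_radial hχ (contDiff_lin a b)]
  simp only [pd_lin]

lemma dirX_zero : dirX 0 0 = 1 ∧ dirX 0 1 = 0 ∧ dirX 1 0 = 0 ∧ dirX 1 1 = 1 := by
  simp [dirX]

/-- Linear forms l are harmonic, so Δ(χ l) = (Δχ) l + 2∇χ · ∇l, where Δχ = 4sχ'' + 4χ' and ∇χ · ∇l =
2χ' l. -/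
lemma laplacian_radial_lin {S : ℝ} {χ : ℝ → ℝ} (hχ : IsTest 0 S χ) (a b : ℝ) (x : Plane) :
    pd 0 (pd 0 (fun x => χ (‖x‖ ^ 2) * lin a b x)) x
      + pd 1 (pd 1 (fun x => χ (‖x‖ ^ 2) * lin a b x)) x
      = (4 * ‖x‖ ^ 2 * deriv (deriv χ) (‖x‖ ^ 2) + 8 * deriv χ (‖x‖ ^ 2)) * lin a b x := by
  have hl := contDiff_lin a b
  have h2 : ∀ i : Fin 2, ContDiff ℝ ∞ (fun x : Plane => 2 * x i) := fun i =>
    contDiff_const.mul (contDiff_coord i)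
  have hp : ∀ i : Fin 2, ContDiff ℝ ∞ (fun x : Plane => 2 * x i * lin a b x) := fun i =>
    (h2 i).mul hl
  have hc : ∀ {f : ℝ → ℝ}, ContDiff ℝ ∞ f → ContDiff ℝ ∞ (fun x : Plane => f (‖x‖ ^ 2)) :=
    fun hf => hf.comp (contDiff_norm_sq ℝ)
  have key : ∀ i : Fin 2, pd i (pd i (fun x => χ (‖x‖ ^ 2) * lin a b x)) x
      = deriv (deriv χ) (‖x‖ ^ 2) * (2 * x i * (2 * x i * lin a b x))
        + deriv χ (‖x‖ ^ 2) * (2 * lin a b x + 2 * x i * lin a b (dirX i))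
        + deriv χ (‖x‖ ^ 2) * (2 * x i * lin a b (dirX i)) := fun i => by
    rw [pd_radial_lin hχ.1, pd_add ((hc hχ.deriv.1).mul (hp i)) ((hc hχ.1).mul contDiff_const),
      pd_radial hχ.deriv.1 (hp i), pd_radial hχ.1 contDiff_const]
    simp only [pd_const, mul_zero, add_zero]
    rw [pd_mul (h2 i) hl, pd_const_mul (contDiff_coord i), pd_coord, pd_lin]
    simp
  rw [key, key]
  obtain ⟨d1, d2, d3, d4⟩ := dirX_zero
  simp only [lin, d1, d2, d3, d4]
  linear_combination (-4 * deriv (deriv χ) (‖x‖ ^ 2) * (a * x 0 + b * x 1)) * norm_sq_plane x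

/-- With χ = ζ/s, the factor 4sχ'' + 8χ' in the Laplacian of the test fields becomes 4ζ''. -/
lemma IsTest.deriv_deriv_eq {S : ℝ} {ζ : ℝ → ℝ} (hζ : IsTest 0 S ζ) (s : ℝ) :
    _root_.deriv (_root_.deriv ζ) s = 2 * _root_.deriv (fun s => ζ s / s) s
      + s * _root_.deriv (_root_.deriv (fun s => ζ s / s)) s := by
  have h1 := (hζ.div_id.hasDerivAt s).add ((hasDerivAt_id s).mul (hζ.div_id.deriv.hasDerivAt s))
  have h2 : _root_.deriv ζ = (fun s => ζ s / s) + id * _root_.deriv (fun s => ζ s / s) :=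
    funext fun s => hζ.deriv_eq s
  rw [h2, h1.deriv]
  simp only [id, one_mul]
  ring

lemma IsTestOn.memLp_top {φ : Plane → ℝ} (hφ : IsTestOn (disk R) φ) :
    MemLp φ ⊤ (volume.restrict (disk R)) :=
  hφ.1.continuous.memLp_top_of_hasCompactSupport hφ.2.1 _

lemma integral_eq_of_ae_radial (hR : 0 < R) {F : Plane → ℝ} {g : ℝ → ℝ}
    (hg : AEStronglyMeasurable g (nu (R ^ 2)))
    (h : F =ᵐ[volume.restrict (disk R)] fun x => g (‖x‖ ^ 2)) :
    ∫ x in disk R, F x = Real.pi * ∫ s in Ioo 0 (R ^ 2), g s := by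
  rw [integral_congr_ae h, integral_radial hR hg]

lemma ae_ne_zero : ∀ᵐ x ∂(volume.restrict (disk R)), x ≠ 0 := by
  refine ae_restrict_of_ae ?_
  rw [ae_iff]; simp

section slice

variable {ρ ur uθ P : ℝ → ℝ → ℝ} {Du : Fin 2 → ℝ → Plane → Plane} {t : ℝ}

lemma ae_density (hR : 0 < R) (hρ : (fun s => ρ t (√s)) =ᵐ[nu (R ^ 2)] P t) :
    ∀ᵐ x ∂(volume.restrict (disk R)), scalarField ρ t x = P t (‖x‖ ^ 2) := by
  filter_upwards [(quasiMeasurePreserving_normSq hR).ae hρ] with x hx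
  rw [Real.sqrt_sq (norm_nonneg x)] at hx
  exact hx

lemma memLp_top_comp_density (hR : 0 < R) (hρ : (fun s => ρ t (√s)) =ᵐ[nu (R ^ 2)] P t)
    {f : ℝ → ℝ} (hf : ContinuousOn (fun s => f (P t s)) (Ioc 0 (R ^ 2)))
    (hb : ∃ M, ∀ s ∈ Ioc 0 (R ^ 2), |f (P t s)| ≤ M) :
    MemLp (fun x => f (scalarField ρ t x)) ⊤ (volume.restrict (disk R)) := by
  obtain ⟨M, hM⟩ := hb
  have h1 := memLp_radial hR (memLp_nu_of_bound (hf.mono Ioo_subset_Ioc_self)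
    (fun s hs => hM s (Ioo_subset_Ioc_self hs)) ⊤)
  refine h1.ae_eq ?_
  filter_upwards [ae_density hR hρ] with x hx
  rw [hx]

lemma memLp_top_velocity (hur : ContinuousOn (ur t) (Icc 0 R))
    (huθ : ContinuousOn (uθ t) (Icc 0 R))
    (hm : MemLp (vectorField ur uθ t) 2 (volume.restrict (disk R))) (j : Fin 2) :
    MemLp (fun x => vectorField ur uθ t x j) ⊤ (volume.restrict (disk R)) := by
  obtain ⟨M, hM⟩ := isCompact_Icc.exists_bound_of_continuousOn hur
  obtain ⟨N, hN⟩ := isCompact_Icc.exists_bound_of_continuousOn huθ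
  refine MemLp.of_bound (MemLp.eval_piLp hm j).1 (M + N) ?_
  refine (ae_restrict_iff' measurableSet_ball).2 (Eventually.of_forall fun x hx => ?_)
  have hx' : ‖x‖ ∈ Icc 0 R := ⟨norm_nonneg x, (mem_ball_zero_iff.1 hx).le⟩
  have h1 : ∀ i : Fin 2, |ur t ‖x‖ * (x i / ‖x‖)| ≤ M := fun i => by
    rw [abs_mul]
    exact (mul_le_of_le_one_right (abs_nonneg _) (abs_coord_div_le x i)).trans (hM _ hx')
  have h2 : ∀ i : Fin 2, |uθ t ‖x‖ * (x i / ‖x‖)| ≤ N := fun i => by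
    rw [abs_mul]
    exact (mul_le_of_le_one_right (abs_nonneg _) (abs_coord_div_le x i)).trans (hN _ hx')
  fin_cases j
  · exact (congrArg _ (vectorField_zero ur uθ t x)).le.trans
      ((abs_add_le _ _).trans (add_le_add (h1 0) (h2 1)))
  · exact (congrArg _ (vectorField_one ur uθ t x)).le.trans
      ((abs_sub _ _).trans (add_le_add (h1 1) (h2 0)))

end slice

end

section

/-! ### Reduction of the equations at a fixed time -/

/-- A radially symmetric density and velocity at a fixed time, together with the profiles
`P, V = √s v, W = √s w` as functions of `s = |x|²` and their derivatives. -/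
structure RadialSlice (R : ℝ) (hR : 0 < R) (ρ ur uθ P : ℝ → ℝ → ℝ) (Du : Fin 2 → ℝ → Plane → Plane)
    (t : ℝ) : Prop where
  contP : ContinuousOn (P t) (Ioc 0 (R ^ 2))
  bddP : ∃ M, ∀ s ∈ Ioc 0 (R ^ 2), |P t s| ≤ M
  density : (fun s => ρ t (√s)) =ᵐ[nu (R ^ 2)] P t
  contR : ContinuousOn (ur t) (Icc 0 R)
  contθ : ContinuousOn (uθ t) (Icc 0 R)
  memU : MemLp (vectorField ur uθ t) 2 (volume.restrict (disk R))
  memDu : ∀ i j, MemLp (fun x => Du i t x j) 2 (volume.restrict (disk R))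
  weak : ∀ φ, IsTestOn (disk R) φ → ∀ i j,
    ∫ x in disk R, pd i φ x * vectorField ur uθ t x j = -∫ x in disk R, φ x * Du i t x j
  primV : PrimLoc (R ^ 2) (fun s => √s * ur t (√s)) (avg hR (halfDiv Du t))
  primW : PrimLoc (R ^ 2) (fun s => √s * uθ t (√s)) (avg hR (halfCurl Du t))

lemma memLp_top_mul {α : Type*} [MeasurableSpace α] {m : Measure α} {f g : α → ℝ} {p : ENNReal}
    (hf : MemLp f ⊤ m) (hg : MemLp g p m) : MemLp (fun x => f x * g x) p m := hg.mul' hf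

lemma integral_add_four {α : Type*} [MeasurableSpace α] {m : Measure α} {f₁ f₂ f₃ f₄ : α → ℝ}
    (h₁ : Integrable f₁ m) (h₂ : Integrable f₂ m) (h₃ : Integrable f₃ m) (h₄ : Integrable f₄ m) :
    ∫ x, (f₁ x + f₂ x + (f₃ x + f₄ x)) ∂m
      = (∫ x, f₁ x ∂m) + (∫ x, f₂ x ∂m) + ((∫ x, f₃ x ∂m) + ∫ x, f₄ x ∂m) := by
  have i1 : Integrable (fun x => f₁ x + f₂ x) m := h₁.add h₂
  have i2 : Integrable (fun x => f₃ x + f₄ x) m := h₃.add h₄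
  rw [integral_add i1 i2, integral_add h₁ h₂, integral_add h₃ h₄]

namespace RadialSlice

variable {R : ℝ} {hR : 0 < R} {ρ ur uθ P : ℝ → ℝ → ℝ} {Du : Fin 2 → ℝ → Plane → Plane} {t : ℝ}
  (h : RadialSlice R hR ρ ur uθ P Du t)

include h

lemma contV : ContinuousOn (fun s => ur t (√s)) (Ioo 0 (R ^ 2)) :=
  (continuousOn_profile hR h.contR).mono Ioo_subset_Icc_self

lemma contW : ContinuousOn (fun s => uθ t (√s)) (Ioo 0 (R ^ 2)) :=
  (continuousOn_profile hR h.contθ).mono Ioo_subset_Icc_self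

lemma contP' : ContinuousOn (P t) (Ioo 0 (R ^ 2)) := h.contP.mono Ioo_subset_Ioc_self

lemma memLp_rho {f : ℝ → ℝ} (hf : Continuous f) :
    MemLp (fun x => f (scalarField ρ t x)) ⊤ (volume.restrict (disk R)) := by
  refine memLp_top_comp_density hR h.density (hf.comp_continuousOn h.contP) ?_
  obtain ⟨M, hM⟩ := h.bddP
  obtain ⟨K, hK⟩ := (isCompact_Icc (a := -M) (b := M)).exists_bound_of_continuousOn hf.continuousOn
  exact ⟨K, fun s hs => hK _ (abs_le.1 (hM s hs))⟩

lemma memLp_u (j : Fin 2) :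
    MemLp (fun x => vectorField ur uθ t x j) ⊤ (volume.restrict (disk R)) :=
  memLp_top_velocity h.contR h.contθ h.memU j

lemma pair_density {χ : ℝ → ℝ} (hχ : IsTest 0 (R ^ 2) χ) :
    pair R (fun x => χ (‖x‖ ^ 2) * 1) (scalarField ρ) t
      = Real.pi * ∫ s in Ioo 0 (R ^ 2), P t s * χ s := by
  refine integral_eq_of_ae_radial hR
    ((h.contP'.mul hχ.1.continuous.continuousOn).aestronglyMeasurable measurableSet_Ioo) ?_
  filter_upwards [ae_density hR h.density] with x hx
  rw [hx]; ring

lemma flux_density {χ : ℝ → ℝ} (hχ : IsTest 0 (R ^ 2) χ) :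
    ∑ i, pair R (pd i (fun x => χ (‖x‖ ^ 2) * 1))
      (fun t x => scalarField ρ t x * vectorField ur uθ t x i) t
      = Real.pi * (2 * ∫ s in Ioo 0 (R ^ 2), P t s * (√s * ur t (√s)) * deriv χ s) := by
  have hφ := isTestOn_radial hR hχ (p := fun _ => 1) contDiff_const
  have hi : ∀ i, Integrable (fun x => pd i (fun x => χ (‖x‖ ^ 2) * 1) x
      * (scalarField ρ t x * vectorField ur uθ t x i)) (volume.restrict (disk R)) := fun i =>
    (memLp_top_mul (hφ.pd i).memLp_top (memLp_top_mul (h.memLp_rho continuous_id)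
      (h.memLp_u i))).integrable le_top
  rw [Fin.sum_univ_two, pair, pair, ← integral_add (hi 0) (hi 1), ← integral_const_mul]
  have hc := h.contP'
  have hv := h.contV
  have hχ' := hχ.deriv.1.continuous.continuousOn (s := Ioo 0 (R ^ 2))
  refine integral_eq_of_ae_radial hR (ContinuousOn.aestronglyMeasurable (continuousOn_const.mul
    ((hc.mul (Real.continuous_sqrt.continuousOn.mul hv)).mul hχ')) measurableSet_Ioo) ?_
  filter_upwards [ae_density hR h.density] with x hx
  rw [hx, pd_radial hχ.1 contDiff_const, pd_radial hχ.1 contDiff_const,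
    Real.sqrt_sq (norm_nonneg x)]
  simp only [pd_const]
  linear_combination (2 * deriv χ (‖x‖ ^ 2) * P t (‖x‖ ^ 2)) * dot_vectorField ur uθ t x

end RadialSlice

section testfield

/-- The components of the test field `χ(|x|²) (a x + b x^⊥)`. -/
def testField (χ : ℝ → ℝ) (a b : ℝ) (j : Fin 2) (x : Plane) : ℝ :=
  χ (‖x‖ ^ 2) * if j = 0 then lin a b x else lin (-b) a x

variable (χ : ℝ → ℝ) (a b : ℝ)

lemma testField_zero : testField χ a b 0 = fun x => χ (‖x‖ ^ 2) * lin a b x := by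
  funext x; simp [testField]

lemma testField_one : testField χ a b 1 = fun x => χ (‖x‖ ^ 2) * lin (-b) a x := by
  funext x; simp [testField]

variable {χ} {R : ℝ}

lemma isTestOn_testField (hR : 0 < R) (hχ : IsTest 0 (R ^ 2) χ) (j : Fin 2) :
    IsTestOn (disk R) (testField χ a b j) := by
  fin_cases j
  · exact (testField_zero χ a b).symm ▸ isTestOn_radial hR hχ (contDiff_lin a b)
  · exact (testField_one χ a b).symm ▸ isTestOn_radial hR hχ (contDiff_lin (-b) a)

lemma pd_testField_zero (hχ : ContDiff ℝ ∞ χ) (i : Fin 2) (x : Plane) :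
    pd i (testField χ a b 0) x = deriv χ (‖x‖ ^ 2) * (2 * x i * lin a b x)
        + χ (‖x‖ ^ 2) * lin a b (dirX i) := by
  rw [testField_zero, pd_radial_lin hχ]

lemma pd_testField_one (hχ : ContDiff ℝ ∞ χ) (i : Fin 2) (x : Plane) :
    pd i (testField χ a b 1) x = deriv χ (‖x‖ ^ 2) * (2 * x i * lin (-b) a x)
        + χ (‖x‖ ^ 2) * lin (-b) a (dirX i) := by
  rw [testField_one, pd_radial_lin hχ]

lemma laplacian_testField_zero {S : ℝ} (hχ : IsTest 0 S χ) (x : Plane) :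
    pd 0 (pd 0 (testField χ a b 0)) x + pd 1 (pd 1 (testField χ a b 0)) x
      = (4 * ‖x‖ ^ 2 * deriv (deriv χ) (‖x‖ ^ 2) + 8 * deriv χ (‖x‖ ^ 2)) * lin a b x := by
  rw [testField_zero, laplacian_radial_lin hχ]

lemma laplacian_testField_one {S : ℝ} (hχ : IsTest 0 S χ) (x : Plane) :
    pd 0 (pd 0 (testField χ a b 1)) x + pd 1 (pd 1 (testField χ a b 1)) x
      = (4 * ‖x‖ ^ 2 * deriv (deriv χ) (‖x‖ ^ 2) + 8 * deriv χ (‖x‖ ^ 2)) * lin (-b) a x := by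
  rw [testField_one, laplacian_radial_lin hχ]

/-- The swirl part χ x^⊥ is divergence free, so b is absent. Hence neither the pressure nor the bulk
viscosity acts on the angular momentum. -/
lemma div_testField {ζ : ℝ → ℝ} {S : ℝ} (hζ : IsTest 0 S ζ) (x : Plane) :
    pd 0 (testField (fun s => ζ s / s) a b 0) x + pd 1 (testField (fun s => ζ s / s) a b 1) x
      = 2 * a * deriv ζ (‖x‖ ^ 2) := by
  rw [pd_testField_zero a b hζ.div_id.1, pd_testField_one a b hζ.div_id.1, hζ.deriv_eq]
  obtain ⟨d1, d2, d3, d4⟩ := dirX_zero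
  simp only [lin, d1, d2, d3, d4]
  linear_combination (-2 * a * deriv (fun s => ζ s / s) (‖x‖ ^ 2)) * norm_sq_plane x

end testfield

namespace RadialSlice

variable {R : ℝ} {hR : 0 < R} {ρ ur uθ P : ℝ → ℝ → ℝ} {Du : Fin 2 → ℝ → Plane → Plane} {t : ℝ}
  (h : RadialSlice R hR ρ ur uθ P Du t) (a b : ℝ) {ζ : ℝ → ℝ} (hζ : IsTest 0 (R ^ 2) ζ)

include h hζ

lemma pair_momentum :
    ∑ j, pair R (testField (fun s => ζ s / s) a b j)
      (fun t x => scalarField ρ t x * vectorField ur uθ t x j) t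
      = Real.pi * ∫ s in Ioo 0 (R ^ 2), P t s * (a * ur t (√s) + b * uθ t (√s)) / √s * ζ s := by
  have hχ := hζ.div_id
  have hi : ∀ j, Integrable (fun x => testField (fun s => ζ s / s) a b j x
      * (scalarField ρ t x * vectorField ur uθ t x j)) (volume.restrict (disk R)) := fun j =>
    (memLp_top_mul (isTestOn_testField a b hR hχ j).memLp_top
      (memLp_top_mul (h.memLp_rho continuous_id) (h.memLp_u j))).integrable le_top
  rw [Fin.sum_univ_two, pair, pair, ← integral_add (hi 0) (hi 1)]
  have hc := h.contP'
  have hv := h.contV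
  have hw := h.contW
  have hz := hζ.1.continuous
  refine integral_eq_of_ae_radial hR (ContinuousOn.aestronglyMeasurable (ContinuousOn.mul
    (ContinuousOn.div (hc.mul ((continuousOn_const.mul hv).add (continuousOn_const.mul hw)))
      (by fun_prop) fun s hs => (Real.sqrt_pos.2 hs.1).ne') (by fun_prop)) measurableSet_Ioo) ?_
  filter_upwards [ae_density hR h.density, ae_ne_zero] with x hx h0
  have h1 : ‖x‖ ≠ 0 := norm_ne_zero_iff.2 h0
  rw [hx, testField_zero, testField_one, Real.sqrt_sq (norm_nonneg x)]
  simp only [lin]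
  have e1 := dot_vectorField ur uθ t x
  have e2 := cross_vectorField ur uθ t x
  field_simp
  linear_combination (ζ (‖x‖ ^ 2) * P t (‖x‖ ^ 2) * a) * e1 + (ζ (‖x‖ ^ 2) * P t (‖x‖ ^ 2) * b) * e2

/-- Differentiating χ gives 2χ'(x · u)(a x · u + b x^⊥ · u), and differentiating the linear field
gives χ a |u|², the rotation being antisymmetric. Replacing sχ' by ζ' - χ produces the centrifugal
and Coriolis terms. -/
lemma flux_convection :
    ∑ j, ∑ i, pair R (pd i (testField (fun s => ζ s / s) a b j))
      (fun t x => scalarField ρ t x * vectorField ur uθ t x i * vectorField ur uθ t x j) t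
      = Real.pi * ∫ s in Ioo 0 (R ^ 2),
        (2 * (P t s * ur t (√s) * (a * ur t (√s) + b * uθ t (√s))) * deriv ζ s
        - P t s * (a * (ur t (√s) ^ 2 - uθ t (√s) ^ 2) + 2 * b * (ur t (√s) * uθ t (√s)))
          / s * ζ s) := by
  have hχ := hζ.div_id
  have hi : ∀ j i, Integrable (fun x => pd i (testField (fun s => ζ s / s) a b j) x
      * (scalarField ρ t x * vectorField ur uθ t x i * vectorField ur uθ t x j))
      (volume.restrict (disk R)) := fun j i =>
    (memLp_top_mul ((isTestOn_testField a b hR hχ j).pd i).memLp_top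
      (memLp_top_mul (memLp_top_mul (h.memLp_rho continuous_id) (h.memLp_u i))
        (h.memLp_u j))).integrable le_top
  simp only [Fin.sum_univ_two, pair]
  rw [← integral_add_four (hi 0 0) (hi 0 1) (hi 1 0) (hi 1 1)]
  have hc := h.contP'
  have hv := h.contV
  have hw := h.contW
  have hz := hζ.1.continuous
  have hz' := hζ.deriv.1.continuous
  refine integral_eq_of_ae_radial hR (ContinuousOn.aestronglyMeasurable (ContinuousOn.sub
    ((continuousOn_const.mul ((hc.mul hv).mul
      ((continuousOn_const.mul hv).add (continuousOn_const.mul hw)))).mul hz'.continuousOn)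
    (ContinuousOn.mul (ContinuousOn.div (hc.mul ((continuousOn_const.mul
      ((hv.pow 2).sub (hw.pow 2))).add (continuousOn_const.mul (hv.mul hw)))) (by fun_prop)
      fun s hs => hs.1.ne') hz.continuousOn)) measurableSet_Ioo) ?_
  filter_upwards [ae_density hR h.density, ae_ne_zero] with x hx h0
  have h1 : ‖x‖ ≠ 0 := norm_ne_zero_iff.2 h0
  rw [hx]
  simp only [pd_testField_zero a b hχ.1, pd_testField_one a b hχ.1, hζ.deriv_eq,
    Real.sqrt_sq (norm_nonneg x)]
  obtain ⟨d1, d2, d3, d4⟩ := dirX_zero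
  simp only [lin, d1, d2, d3, d4]
  have e1 := dot_vectorField ur uθ t x
  have e2 := cross_vectorField ur uθ t x
  have e3 := normSq_vectorField ur uθ t x h0
  set u0 := vectorField ur uθ t x 0
  set u1 := vectorField ur uθ t x 1
  set D := deriv (fun s => ζ s / s) (‖x‖ ^ 2)
  have e4 : ζ (‖x‖ ^ 2) = ‖x‖ ^ 2 * (ζ (‖x‖ ^ 2) / ‖x‖ ^ 2) := by field_simp
  set X := ζ (‖x‖ ^ 2) / ‖x‖ ^ 2
  have e5 : P t (‖x‖ ^ 2) * (a * (ur t ‖x‖ ^ 2 - uθ t ‖x‖ ^ 2) + 2 * b * (ur t ‖x‖ * uθ t ‖x‖))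
      / ‖x‖ ^ 2 * ζ (‖x‖ ^ 2) = P t (‖x‖ ^ 2) * (a * (ur t ‖x‖ ^ 2 - uθ t ‖x‖ ^ 2)
        + 2 * b * (ur t ‖x‖ * uθ t ‖x‖)) * X := by
    rw [div_mul_eq_mul_div, mul_div_assoc]
  rw [e5]
  set Q := P t (‖x‖ ^ 2)
  linear_combination (2 * D * Q * (a * (x 0 * u0 + x 1 * u1) + b * (x 1 * u0 - x 0 * u1))) * e1
    + (2 * D * Q * (‖x‖ * ur t ‖x‖) * a) * e1 + (2 * D * Q * (‖x‖ * ur t ‖x‖) * b) * e2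
    + (X * Q * a) * e3

lemma flux_pressure {γ : ℝ} (hγ : 0 ≤ γ) :
    ∑ j, pair R (pd j (testField (fun s => ζ s / s) a b j)) (fun t x => scalarField ρ t x ^ γ) t
      = Real.pi * ∫ s in Ioo 0 (R ^ 2), 2 * a * P t s ^ γ * deriv ζ s := by
  have hχ := hζ.div_id
  have hi : ∀ j, Integrable (fun x => pd j (testField (fun s => ζ s / s) a b j) x
      * scalarField ρ t x ^ γ) (volume.restrict (disk R)) := fun j =>
    (memLp_top_mul ((isTestOn_testField a b hR hχ j).pd j).memLp_top
      (h.memLp_rho (Real.continuous_rpow_const hγ))).integrable le_top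
  rw [Fin.sum_univ_two, pair, pair, ← integral_add (hi 0) (hi 1)]
  have hc : ContinuousOn (fun s => P t s ^ γ) (Ioo 0 (R ^ 2)) :=
    (Real.continuous_rpow_const hγ).comp_continuousOn h.contP'
  have hz' := hζ.deriv.1.continuous
  refine integral_eq_of_ae_radial hR (ContinuousOn.aestronglyMeasurable (by fun_prop)
    measurableSet_Ioo) ?_
  filter_upwards [ae_density hR h.density] with x hx
  rw [hx]
  linear_combination (P t (‖x‖ ^ 2) ^ γ) * div_testField a b hζ x

lemma flux_bulk {β μ : ℝ} (hβ : 0 ≤ β) :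
    ∑ j, pair R (pd j (testField (fun s => ζ s / s) a b j))
      (fun t x => (μ + scalarField ρ t x ^ β) * ∑ i, Du i t x i) t
      = Real.pi * ∫ s in Ioo 0 (R ^ 2),
        4 * a * (μ + P t s ^ β) * avg hR (halfDiv Du t) s * deriv ζ s := by
  have hχ := hζ.div_id
  have hm : MemLp (halfDiv Du t) 2 (volume.restrict (disk R)) :=
    ((h.memDu 0 0).add (h.memDu 1 1)).const_mul _
  have hD : ∀ t x, ∑ i, Du i t x i = 2 * halfDiv Du t x := fun t x => by
    simp only [Fin.sum_univ_two, halfDiv]; ring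
  simp only [hD]
  have hi : ∀ j, Integrable (fun x => pd j (testField (fun s => ζ s / s) a b j) x
      * ((μ + scalarField ρ t x ^ β) * (2 * halfDiv Du t x))) (volume.restrict (disk R)) := fun j =>
    (memLp_top_mul ((isTestOn_testField a b hR hχ j).pd j).memLp_top
      (memLp_top_mul (h.memLp_rho (continuous_const.add (Real.continuous_rpow_const hβ)))
        (hm.const_mul 2))).integrable one_le_two
  rw [Fin.sum_univ_two, pair, pair, ← integral_add (hi 0) (hi 1)]
  have hc : ContinuousOn (fun s => 4 * a * (μ + P t s ^ β)) (Ioc 0 (R ^ 2)) :=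
    continuousOn_const.mul (continuousOn_const.add
      ((Real.continuous_rpow_const hβ).comp_continuousOn h.contP))
  have hb : ∃ M, ∀ s ∈ Ioc 0 (R ^ 2), |4 * a * (μ + P t s ^ β)| ≤ M := by
    obtain ⟨M, hM⟩ := h.bddP
    have hf : Continuous fun p : ℝ => 4 * a * (μ + p ^ β) :=
      continuous_const.mul (continuous_const.add (Real.continuous_rpow_const hβ))
    obtain ⟨K, hK⟩ := (isCompact_Icc (a := -M) (b := M)).exists_bound_of_continuousOn
      hf.continuousOn
    exact ⟨K, fun s hs => hK _ (abs_le.1 (hM s hs))⟩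
  obtain ⟨M, hM⟩ := hb
  have h2 := integral_mul_avg hR (memLp_mul_bdd hζ.deriv.memLp hc hM) hm
  have h3 : ∫ s in Ioo 0 (R ^ 2), 4 * a * (μ + P t s ^ β) * avg hR (halfDiv Du t) s * deriv ζ s
      = ∫ s in Ioo 0 (R ^ 2), deriv ζ s * (4 * a * (μ + P t s ^ β)) * avg hR (halfDiv Du t) s := by
    congr 1; funext s; ring
  rw [h3, ← h2]
  refine integral_congr_ae ?_
  filter_upwards [ae_density hR h.density] with x hx
  rw [hx]
  linear_combination ((μ + P t (‖x‖ ^ 2) ^ β) * (2 * halfDiv Du t x)) * div_testField a b hζ x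

/-- The circular means of single derivatives of u are avoided: the derivative is moved to the test
field, whose Laplacian is again radial or swirling with factor 4ζ'', and then moved back in one
dimension onto √s u_r and √s u_θ. -/
lemma flux_shear :
    ∑ j, ∑ i, pair R (pd i (testField (fun s => ζ s / s) a b j)) (fun t x => Du i t x j) t
      = Real.pi * ∫ s in Ioo 0 (R ^ 2),
        4 * (a * avg hR (halfDiv Du t) s + b * avg hR (halfCurl Du t) s) * deriv ζ s := by
  have hχ := hζ.div_id
  have hφ := fun j i => (isTestOn_testField a b hR hχ j).pd i
  have hi : ∀ j i, Integrable (fun x => pd i (pd i (testField (fun s => ζ s / s) a b j)) x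
      * vectorField ur uθ t x j) (volume.restrict (disk R)) := fun j i =>
    (memLp_top_mul ((hφ j i).pd i).memLp_top (h.memLp_u j)).integrable le_top
  have e : ∀ j i, pair R (pd i (testField (fun s => ζ s / s) a b j)) (fun t x => Du i t x j) t
      = -∫ x in disk R, pd i (pd i (testField (fun s => ζ s / s) a b j)) x
        * vectorField ur uθ t x j := fun j i => by
    rw [h.weak _ (hφ j i) i j, neg_neg, pair]
  have hv := h.contV
  have hw := h.contW
  have hz2 := hζ.deriv.deriv.1.continuous
  have e1 : ∫ x in disk R, (pd 0 (pd 0 (testField (fun s => ζ s / s) a b 0)) x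
        * vectorField ur uθ t x 0 + pd 1 (pd 1 (testField (fun s => ζ s / s) a b 0)) x
        * vectorField ur uθ t x 0 + (pd 0 (pd 0 (testField (fun s => ζ s / s) a b 1)) x
        * vectorField ur uθ t x 1 + pd 1 (pd 1 (testField (fun s => ζ s / s) a b 1)) x
        * vectorField ur uθ t x 1))
      = Real.pi * ∫ s in Ioo 0 (R ^ 2),
        (4 * a * (√s * ur t (√s) * deriv (deriv ζ) s)
          + 4 * b * (√s * uθ t (√s) * deriv (deriv ζ) s)) := by
    have hs := Real.continuous_sqrt.continuousOn (s := Ioo 0 (R ^ 2))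
    refine integral_eq_of_ae_radial hR (ContinuousOn.aestronglyMeasurable
      ((continuousOn_const.mul ((hs.mul hv).mul hz2.continuousOn)).add
        (continuousOn_const.mul ((hs.mul hw).mul hz2.continuousOn)))
      measurableSet_Ioo) (Eventually.of_forall fun x => ?_)
    have l0 := laplacian_testField_zero a b hχ x
    have l1 := laplacian_testField_one a b hχ x
    simp only [hζ.deriv_deriv_eq, Real.sqrt_sq (norm_nonneg x)]
    simp only [lin] at l0 l1
    set D := deriv (fun s => ζ s / s) (‖x‖ ^ 2)
    set E := deriv (deriv (fun s => ζ s / s)) (‖x‖ ^ 2)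
    linear_combination vectorField ur uθ t x 0 * l0 + vectorField ur uθ t x 1 * l1
      + (4 * ‖x‖ ^ 2 * E + 8 * D) * (a * dot_vectorField ur uθ t x
        + b * cross_vectorField ur uθ t x)
  have e2 := h.primV.integral_mul_deriv_test (by positivity) hζ.deriv
  have e3 := h.primW.integral_mul_deriv_test (by positivity) hζ.deriv
  have iV := hζ.deriv.deriv.integrableOn_mul_left (by positivity) fun a b ha _ hb =>
    h.primV.integrableOn_Icc ha hb
  have iW := hζ.deriv.deriv.integrableOn_mul_left (by positivity) fun a b ha _ hb =>
    h.primW.integrableOn_Icc ha hb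
  have id' := hζ.deriv.integrableOn_mul_left (by positivity) fun a b ha hab hb =>
    h.primV.integrableOn_Icc_deriv ha hab hb
  have ic := hζ.deriv.integrableOn_mul_left (by positivity) fun a b ha hab hb =>
    h.primW.integrableOn_Icc_deriv ha hab hb
  rw [integral_add_four (hi 0 0) (hi 0 1) (hi 1 0) (hi 1 1), integral_add (iV.const_mul _) (iW.const_mul _),
    integral_const_mul, integral_const_mul, e2, e3] at e1
  have e4 : ∫ s in Ioo 0 (R ^ 2),
        4 * (a * avg hR (halfDiv Du t) s + b * avg hR (halfCurl Du t) s) * deriv ζ s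
      = 4 * a * (∫ s in Ioo 0 (R ^ 2), avg hR (halfDiv Du t) s * deriv ζ s)
        + 4 * b * ∫ s in Ioo 0 (R ^ 2), avg hR (halfCurl Du t) s * deriv ζ s := by
    rw [← integral_const_mul, ← integral_const_mul,
      ← integral_add (id'.const_mul _) (ic.const_mul _)]
    congr 1; funext s; ring
  rw [e4]
  simp only [Fin.sum_univ_two, e]
  linear_combination -e1

end RadialSlice

end

section

/-! ### From strong solutions to radial flows -/

lemma L2Cont.of_eq {S : ℝ} {I : Set ℝ} {f g : ℝ → ℝ → ℝ} (h : L2Cont S I f)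
    (e : ∀ t s, g t s = f t s) : L2Cont S I g := by
  have : g = f := by funext t s; exact e t s
  rwa [this]

lemma IsTest.supCont {S : ℝ} {I : Set ℝ} {χ : ℝ → ℝ} (hχ : IsTest 0 S χ) :
    SupCont S I (fun _ => χ) :=
  SupCont.const hχ.1.continuous.continuousOn
    (let ⟨M, hM⟩ := hχ.exists_bound; ⟨M, fun s _ => hM s⟩)

lemma IsTest.supCont_div_sqrt {S : ℝ} {I : Set ℝ} {χ : ℝ → ℝ} (hχ : IsTest 0 S χ) :
    SupCont S I (fun _ s => χ s / √s) := by
  obtain ⟨M, hM⟩ := hχ.div_id.exists_bound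
  refine SupCont.const (hχ.1.continuous.continuousOn.div (by fun_prop)
    fun s hs => (Real.sqrt_pos.2 hs.1).ne') ⟨√S * M, fun s hs => ?_⟩
  have h1 : 0 < √s := Real.sqrt_pos.2 hs.1
  have h2 : χ s / √s = √s * (χ s / s) := by
    have : s ≠ 0 := hs.1.ne'
    field_simp
    rw [Real.sq_sqrt hs.1.le]
  rw [h2, abs_mul, abs_of_pos h1]
  exact mul_le_mul (Real.sqrt_le_sqrt hs.2) (hM s) (abs_nonneg _) (Real.sqrt_nonneg _)

lemma supCont_sqrt {S : ℝ} {I : Set ℝ} : SupCont S I (fun _ s => √s) :=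
  SupCont.const Real.continuous_sqrt.continuousOn ⟨√S, fun s hs => by
    rw [abs_of_nonneg (Real.sqrt_nonneg s)]; exact Real.sqrt_le_sqrt hs.2⟩

/-- Division of a weak time derivative by `π`. -/
lemma hasDerivAt_of_weak_time_mul {T : ℝ} (hT : 0 < T) {a b A B : ℝ → ℝ}
    (ha : ContinuousOn a (Icc 0 T)) (hb : ContinuousOn b (Icc 0 T))
    (hA : ∀ t ∈ Icc 0 T, A t = Real.pi * a t) (hB : ∀ t ∈ Icc 0 T, B t = Real.pi * b t)
    (h : ∀ ψ, IsTest 0 T ψ → ∫ t in Ioo 0 T, A t * deriv ψ t = -∫ t in Ioo 0 T, B t * ψ t) {t : ℝ}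
    (ht : t ∈ Ioo 0 T) : HasDerivAt a (b t) t := by
  refine hasDerivAt_of_weak_time hT ha hb (fun ψ hψ => ?_) ht
  have h1 : ∫ t in Ioo 0 T, A t * deriv ψ t = Real.pi * ∫ t in Ioo 0 T, a t * deriv ψ t := by
    rw [← integral_const_mul]
    refine setIntegral_congr_fun measurableSet_Ioo fun t ht => ?_
    rw [hA t (Ioo_subset_Icc_self ht)]; ring
  have h2 : ∫ t in Ioo 0 T, B t * ψ t = Real.pi * ∫ t in Ioo 0 T, b t * ψ t := by
    rw [← integral_const_mul]
    refine setIntegral_congr_fun measurableSet_Ioo fun t ht => ?_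
    rw [hB t (Ioo_subset_Icc_self ht)]; ring
  have h3 := h ψ hψ
  rw [h1, h2] at h3
  exact mul_left_cancel₀ Real.pi_ne_zero (by linarith)

section flow

variable {μ β γ R T : ℝ} {hR : 0 < R} {ρ ur uθ P : ℝ → ℝ → ℝ} {Du : Fin 2 → ℝ → Plane → Plane}

lemma hasDerivAt_mass (hT : 0 < T) (hP : SupCont (R ^ 2) (Icc 0 T) P)
    (hv : SupCont (R ^ 2) (Icc 0 T) (fun t s => ur t (√s)))
    (hs : ∀ t ∈ Icc 0 T, RadialSlice R hR ρ ur uθ P Du t)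
    (hc : ContinuityEq R T (scalarField ρ) (vectorField ur uθ)) {χ : ℝ → ℝ}
    (hχ : IsTest 0 (R ^ 2) χ) {t : ℝ} (ht : t ∈ Ioo 0 T) :
    HasDerivAt (fun τ => ∫ s in Ioo 0 (R ^ 2), P τ s * χ s)
      (2 * ∫ s in Ioo 0 (R ^ 2), P t s * (√s * ur t (√s)) * deriv χ s) t :=
  hasDerivAt_of_weak_time_mul hT
    (b := fun t => 2 * ∫ s in Ioo 0 (R ^ 2), P t s * (√s * ur t (√s)) * deriv χ s)
    (hP.mul hχ.supCont).l2Cont.continuousOn_integral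
    (continuousOn_const.mul ((hP.mul (supCont_sqrt.mul hv)).mul
      hχ.deriv.supCont).l2Cont.continuousOn_integral)
    (fun t ht => (hs t ht).pair_density hχ) (fun t ht => (hs t ht).flux_density hχ)
    (fun _ hψ => hc.weak hT (isTestOn_radial hR hχ contDiff_const) hψ) ht

/-- A single family of test fields treats both components: (a, b) = (1, 0) gives the radial and (0,
1) the angular equation. -/
lemma hasDerivAt_momentum (hT : 0 < T) (hβ : 0 ≤ β) (hγ : 0 ≤ γ)
    (hP : SupCont (R ^ 2) (Icc 0 T) P) (hv : SupCont (R ^ 2) (Icc 0 T) (fun t s => ur t (√s)))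
    (hw : SupCont (R ^ 2) (Icc 0 T) (fun t s => uθ t (√s)))
    (hd : L2Cont (R ^ 2) (Icc 0 T) (fun t => avg hR (halfDiv Du t)))
    (hc : L2Cont (R ^ 2) (Icc 0 T) (fun t => avg hR (halfCurl Du t)))
    (hs : ∀ t ∈ Icc 0 T, RadialSlice R hR ρ ur uθ P Du t)
    (hm : MomentumEq μ β γ R T (scalarField ρ) (vectorField ur uθ) Du) (a b : ℝ) {ζ : ℝ → ℝ}
    (hζ : IsTest 0 (R ^ 2) ζ) {t : ℝ} (ht : t ∈ Ioo 0 T) :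
    HasDerivAt (fun τ => ∫ s in Ioo 0 (R ^ 2),
        P τ s * (a * ur τ (√s) + b * uθ τ (√s)) / √s * ζ s)
      (∫ s in Ioo 0 (R ^ 2),
        ((2 * (P t s * ur t (√s) * (a * ur t (√s) + b * uθ t (√s))) * deriv ζ s
        - P t s * (a * (ur t (√s) ^ 2 - uθ t (√s) ^ 2) + 2 * b * (ur t (√s) * uθ t (√s)))
          / s * ζ s) + 2 * a * P t s ^ γ * deriv ζ s
        - μ * (4 * (a * avg hR (halfDiv Du t) s + b * avg hR (halfCurl Du t) s) * deriv ζ s)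
        - 4 * a * (μ + P t s ^ β) * avg hR (halfDiv Du t) s * deriv ζ s)) t := by
  have hz' : SupCont (R ^ 2) (Icc 0 T) (fun _ => deriv ζ) := hζ.deriv.supCont
  have hzs : SupCont (R ^ 2) (Icc 0 T) (fun _ s => ζ s / s) := hζ.div_id.supCont
  have hX : SupCont (R ^ 2) (Icc 0 T) (fun t s => a * ur t (√s) + b * uθ t (√s)) :=
    (hv.const_mul a).add (hw.const_mul b)
  have hY : SupCont (R ^ 2) (Icc 0 T) (fun t s => a * (ur t (√s) ^ 2 - uθ t (√s) ^ 2)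
      + 2 * b * (ur t (√s) * uθ t (√s))) :=
    (((hv.comp (continuous_pow 2)).sub (hw.comp (continuous_pow 2))).const_mul a).add
      ((hv.mul hw).const_mul (2 * b))
  have l1 : L2Cont (R ^ 2) (Icc 0 T) (fun t s =>
      2 * (P t s * ur t (√s) * (a * ur t (√s) + b * uθ t (√s))) * deriv ζ s
        - P t s * (a * (ur t (√s) ^ 2 - uθ t (√s) ^ 2) + 2 * b * (ur t (√s) * uθ t (√s)))
          / s * ζ s) :=
    (((((hP.mul hv).mul hX).const_mul 2).mul hz').sub ((hP.mul hY).mul hzs)).l2Cont.of_eq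
      fun t s => by ring
  have l2 : L2Cont (R ^ 2) (Icc 0 T) (fun t s => 2 * a * P t s ^ γ * deriv ζ s) :=
    (((hP.comp (Real.continuous_rpow_const hγ)).const_mul (2 * a)).mul hz').l2Cont
  have l3 : L2Cont (R ^ 2) (Icc 0 T) (fun t s =>
      4 * (a * avg hR (halfDiv Du t) s + b * avg hR (halfCurl Du t) s) * deriv ζ s) :=
    (((hd.const_mul a).add (hc.const_mul b)).const_mul 4).mul hz'
  have l4 : L2Cont (R ^ 2) (Icc 0 T) (fun t s =>
      4 * a * (μ + P t s ^ β) * avg hR (halfDiv Du t) s * deriv ζ s) :=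
    (hd.mul (((hP.comp (Ψ := fun p => μ + p ^ β)
      (continuous_const.add (Real.continuous_rpow_const hβ))).const_mul (4 * a)).mul hz')).of_eq
      fun t s => by ring
  have lA : L2Cont (R ^ 2) (Icc 0 T) (fun t s =>
      P t s * (a * ur t (√s) + b * uθ t (√s)) / √s * ζ s) :=
    ((hP.mul hX).mul hζ.supCont_div_sqrt).l2Cont.of_eq fun t s => by ring
  refine hasDerivAt_of_weak_time_mul hT lA.continuousOn_integral
    (((l1.add l2).sub (l3.const_mul μ)).sub l4).continuousOn_integral
    (fun t ht => (hs t ht).pair_momentum a b hζ)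
    (B := fun t => ∑ j, momentumFlux μ β γ R (scalarField ρ) (vectorField ur uθ) Du
      (testField (fun s => ζ s / s) a b j) j t) (fun t ht => ?_) (fun ψ hψ => ?_) ht
  · have i1 := l1.integrableOn ht
    have i2 := l2.integrableOn ht
    have i3 := (l3.const_mul μ).integrableOn ht
    have i12 := (l1.add l2).integrableOn ht
    have i123 := ((l1.add l2).sub (l3.const_mul μ)).integrableOn ht
    have i4 := l4.integrableOn ht
    have h := hs t ht
    have e1 := h.flux_convection a b hζ
    have e2 := h.flux_pressure a b hζ hγ
    have e3 := h.flux_shear a b hζ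
    have e4 := h.flux_bulk a b hζ (μ := μ) hβ
    rw [integral_sub i123 i4, integral_sub i12 i3, integral_add i1 i2,
      integral_const_mul μ]
    -- The sum over components is distributed over the four kinds of flux, each of which has been
    -- reduced separately.
    simp only [momentumFlux, Finset.sum_sub_distrib, Finset.sum_add_distrib, ← Finset.mul_sum]
    rw [e1, e2, e3, e4]
    ring
  · have hφ := isTestOn_testField a b hR hζ.div_id
    have w0 := hm.weak hT (hφ 0) hψ 0
    have w1 := hm.weak hT (hφ 1) hψ 1
    simp only [Fin.sum_univ_two, add_mul]
    rw [integral_add w0.1 w1.1, integral_add w0.2.1 w1.2.1, w0.2.2, w1.2.2]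
    ring

/-- The density is replaced by its version that is continuous in s, and d, c, Q are circular means
of half the divergence, half the curl and the radial derivative of the density. -/
theorem IsStrongSolutionWith.exists_radialFlow {q : ℝ} {Dρ : Fin 2 → ℝ → Plane → ℝ}
    {ut : ℝ → Plane → Plane} (H : IsStrongSolutionWith μ β γ R T q ρ ur uθ Dρ Du ut) (hR : 0 < R)
    (hT : 0 < T) (hq : 2 < q) (hβ : 0 ≤ β) (hγ : 0 ≤ γ) :
    ∃ P Q d c, RadialFlow μ β γ (R ^ 2) T P (fun t s => ur t (√s)) (fun t s => uθ t (√s)) Q d c ∧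
      ∀ t ∈ Icc 0 T, (fun s => ρ t (√s)) =ᵐ[nu (R ^ 2)] P t := by
  have hS : 0 < R ^ 2 := by positivity
  obtain ⟨P, hP, hprim, hae⟩ := exists_density_profile H.density_sobolev hR hq
  have hu := H.velocity_sobolev
  have hcr := fun t ht => (H.profile_continuous t ht).1
  have hcθ := fun t ht => (H.profile_continuous t ht).2
  have hv := supCont_ur hu hR hcr
  have hw := supCont_uθ hu hR hcθ
  have hd := l2Cont_halfDiv hu hR
  have hc := l2Cont_halfCurl hu hR
  have hs : ∀ t ∈ Icc 0 T, RadialSlice R hR ρ ur uθ P Du t := fun t ht =>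
    { contP := hP.cont t ht
      bddP := hP.bdd t ht
      density := hae t ht
      contR := hcr t ht
      contθ := hcθ t ht
      memU := (hu.1 t ht).1
      memDu := fun i j => memLp_Du hu ht i j
      weak := fun _ hφ i j => integral_pd_mul hu ht hφ i j
      primV := primLoc_ur hu hR ht (hcr t ht)
      primW := primLoc_uθ hu hR ht (hcθ t ht) }
  refine ⟨P, fun t => avg hR (radDeriv Dρ t), fun t => avg hR (halfDiv Du t),
    fun t => avg hR (halfCurl Du t), ?_, hae⟩
  exact
    { supP := hP
      supv := hv
      supw := hw
      l2Q := l2Cont_radDeriv H.density_sobolev hR hq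
      l2d := hd
      l2c := hc
      nonneg := fun t ht s hs => by
        refine nonneg_of_ae_nu hS (hP.cont t ht) ?_ hs
        filter_upwards [hae t ht,
          (quasiMeasurePreserving_sqrt hR).ae (H.density_nonneg t ht)] with s h1 h2
        rw [← h1]; exact h2
      primP := hprim
      primV := fun t ht => (hs t ht).primV
      primW := fun t ht => (hs t ht).primW
      v_end := fun t ht => by
        simp only [Real.sqrt_sq hR.le]; exact (H.boundary t ht).2.1
      w_end := fun t ht => by
        simp only [Real.sqrt_sq hR.le]; exact (H.boundary t ht).2.2.2
      continuity := fun χ hχ t ht => hasDerivAt_mass hT hP hv hs H.continuity hχ ht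
      radial := fun ζ hζ t ht => by
        have h := hasDerivAt_momentum hT hβ hγ hP hv hw hd hc hs H.momentum 1 0 hζ ht
        simp only [one_mul, zero_mul, mul_zero, add_zero, mul_one] at h
        refine h.congr_deriv ?_
        congr 1; funext s; ring
      angular := fun ζ hζ t ht => by
        have h := hasDerivAt_momentum hT hβ hγ hP hv hw hd hc hs H.momentum 0 1 hζ ht
        simp only [one_mul, zero_mul, mul_zero, zero_add, mul_one, add_zero, sub_zero] at h
        refine h.congr_deriv ?_
        congr 1; funext s; ring }

/-- The powers of the density in terms of its profile. -/
lemma integral_density_rpow_le (hR : 0 < R) {t : ℝ} (hc : ContinuousOn (P t) (Ioc 0 (R ^ 2)))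
    (hb : ∃ M, ∀ s ∈ Ioc 0 (R ^ 2), |P t s| ≤ M) (h0 : ∀ s ∈ Ioc 0 (R ^ 2), 0 ≤ P t s)
    (hρ : (fun s => ρ t (√s)) =ᵐ[nu (R ^ 2)] P t) {p : ℝ} {n : ℕ} (hβ : 0 ≤ β) (hp : 0 ≤ p)
    (hpn : p ≤ 1 + β * n) :
    IntegrableOn (fun x => scalarField ρ t x ^ p) (disk R) ∧
      ∫ x in disk R, scalarField ρ t x ^ p ≤ Real.pi * (R ^ 2 + Slice.mass β n (R ^ 2) (P t)) := by
  have hS : 0 < R ^ 2 := by positivity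
  have hcp : ∀ {r : ℝ}, 0 ≤ r → ContinuousOn (fun s => P t s ^ r) (Ioc 0 (R ^ 2)) := fun hr =>
    (Real.continuous_rpow_const hr).comp_continuousOn hc
  have hbp : ∀ {r : ℝ}, 0 ≤ r → ∃ M, ∀ s ∈ Ioc 0 (R ^ 2), |P t s ^ r| ≤ M := fun {r} hr => by
    obtain ⟨M, hM⟩ := hb
    refine ⟨M ^ r, fun s hs => ?_⟩
    rw [abs_of_nonneg (Real.rpow_nonneg (h0 s hs) r)]
    exact Real.rpow_le_rpow (h0 s hs) ((le_abs_self _).trans (hM s hs)) hr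
  have hi : ∀ {r : ℝ}, 0 ≤ r → IntegrableOn (fun s => P t s ^ r) (Ioo 0 (R ^ 2)) := fun hr => by
    obtain ⟨M, hM⟩ := hbp hr
    exact (memLp_nu_of_bound ((hcp hr).mono Ioo_subset_Ioc_self)
      (fun s hs => hM s (Ioo_subset_Ioc_self hs)) 1).integrable le_rfl
  have hn : 0 ≤ 1 + β * n := by positivity
  refine ⟨(memLp_top_comp_density (f := fun y => y ^ p) hR hρ (hcp hp) (hbp hp)).integrable le_top, ?_⟩
  have h1 : ∫ x in disk R, scalarField ρ t x ^ p
      = Real.pi * ∫ s in Ioo 0 (R ^ 2), P t s ^ p := by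
    refine integral_eq_of_ae_radial hR (hi hp).aestronglyMeasurable ?_
    filter_upwards [ae_density hR hρ] with x hx
    rw [hx]
  rw [h1]
  refine mul_le_mul_of_nonneg_left ?_ Real.pi_pos.le
  have h2 : ∫ s in Ioo 0 (R ^ 2), P t s ^ p
      ≤ ∫ s in Ioo 0 (R ^ 2), (1 + P t s ^ (1 + β * n)) :=
    setIntegral_mono_on (hi hp) ((integrable_const 1).add (hi hn)) measurableSet_Ioo fun s hs =>
      rpow_le_one_add_rpow (h0 s (Ioo_subset_Ioc_self hs)) hp hpn
  rw [integral_add (integrable_const 1) (hi hn)] at h2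
  simpa [hS.le, Slice.mass] using h2

end flow

end

end RadialNS

end

/-! ### The time-independent bound -/

theorem mainTheorem4 (μ β γ R k : ℝ) (hμ : 0 < μ) (hγ : 1 < γ) (hβ : 1 ≤ β) (hβγ : β ≤ γ)
    (hR : 0 < R) (hk : 1 ≤ k) (ρ₀ ur₀ uθ₀ : ℝ → ℝ) :
    ∃ C : ℝ, 0 < C ∧
      ∀ (T q : ℝ), 0 < T → 2 < q →
        ∀ ρ ur uθ : ℝ → ℝ → ℝ,
          RadialNS.IsStrongSolution μ β γ R T q ρ ur uθ →
          RadialNS.HasInitialData R ρ ur uθ ρ₀ ur₀ uθ₀ →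
          ∀ t ∈ Set.Icc 0 T,
            MeasureTheory.IntegrableOn
              (fun x => RadialNS.scalarField ρ t x ^ (k * β * γ + 1)) (RadialNS.disk R) ∧
            ∫ x in RadialNS.disk R, RadialNS.scalarField ρ t x ^ (k * β * γ + 1) ≤ C := by
  have hS : 0 < R ^ 2 := by positivity
  have hpi := Real.pi_pos
  -- n ≥ kγ gives kβγ + 1 ≤ 1 + βn, and n ≥ 2 makes the truncated power continuously differentiable.
  set n : ℕ := max 2 ⌈k * γ⌉₊ with hn
  have hkn : k * γ ≤ n := (Nat.le_ceil _).trans (by rw [hn]; exact_mod_cast le_max_right _ _)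
  set P₀ : ℝ → ℝ := fun s => ρ₀ (√s)
  set v₀ : ℝ → ℝ := fun s => ur₀ (√s)
  set w₀ : ℝ → ℝ := fun s => uθ₀ (√s)
  -- The bounds for energy and mass are computed from the data alone, before any solution is chosen;
  -- the absolute value plus 1 makes the energy bound positive.
  obtain ⟨C, hC, hbound⟩ := RadialNS.RadialFlow.exists_bound hS hμ hβ hβγ hγ
    (E₀ := |RadialNS.RadialFlow.energy γ (R ^ 2) (fun _ => P₀) (fun _ => v₀) (fun _ => w₀) 0| + 1)
    (by positivity) (RadialNS.Slice.mass β n (R ^ 2) P₀) (le_max_left _ _ : 2 ≤ n)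
  refine ⟨Real.pi * (R ^ 2 + C), by positivity, fun T q hT hq ρ ur uθ hsol hinit t ht => ?_⟩
  obtain ⟨Dρ, Du, ut, H⟩ := hsol
  obtain ⟨P, Q, d, c, hflow, hae⟩ := H.exists_radialFlow hR hT hq (by linarith) (by linarith)
  have h0T : (0 : ℝ) ∈ Set.Icc 0 T := ⟨le_rfl, hT.le⟩
  -- The data are attained only almost everywhere, which suffices because energy and mass are
  -- integrals.
  have hdata : ∀ᵐ s ∂(RadialNS.nu (R ^ 2)), P 0 s = P₀ s ∧ ur 0 (√s) = v₀ s ∧ uθ 0 (√s) = w₀ s := by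
    filter_upwards [hae 0 h0T, (RadialNS.quasiMeasurePreserving_sqrt hR).ae hinit] with s h1 h2
    exact ⟨h1.symm.trans h2.1, h2.2⟩
  have hE : RadialNS.RadialFlow.energy γ (R ^ 2) P (fun t s => ur t (√s)) (fun t s => uθ t (√s)) 0
      = RadialNS.RadialFlow.energy γ (R ^ 2) (fun _ => P₀) (fun _ => v₀) (fun _ => w₀) 0 := by
    have e1 : ∫ s in Ioo 0 (R ^ 2), P 0 s * ur 0 (√s) ^ 2 = ∫ s in Ioo 0 (R ^ 2), P₀ s * v₀ s ^ 2 :=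
      integral_congr_ae (hdata.mono fun s hs => by simp only [hs.1, hs.2.1])
    have e2 : ∫ s in Ioo 0 (R ^ 2), P 0 s * uθ 0 (√s) ^ 2 = ∫ s in Ioo 0 (R ^ 2), P₀ s * w₀ s ^ 2 :=
      integral_congr_ae (hdata.mono fun s hs => by simp only [hs.1, hs.2.2])
    have e3 : ∫ s in Ioo 0 (R ^ 2), P 0 s ^ γ = ∫ s in Ioo 0 (R ^ 2), P₀ s ^ γ :=
      integral_congr_ae (hdata.mono fun s hs => by simp only [hs.1])
    simp only [RadialNS.RadialFlow.energy, e1, e2, e3]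
  have hM : RadialNS.Slice.mass β n (R ^ 2) (P 0) = RadialNS.Slice.mass β n (R ^ 2) P₀ :=
    integral_congr_ae (hdata.mono fun s hs => by simp only [hs.1])
  have hmass := hbound T P _ _ Q d c hT hflow
    (by rw [hE]; exact (le_abs_self _).trans (le_add_of_nonneg_right zero_le_one)) hM.le t ht
  have hp : k * β * γ + 1 ≤ 1 + β * n := by nlinarith
  have hfin := RadialNS.integral_density_rpow_le hR (hflow.supP.cont t ht) (hflow.supP.bdd t ht)
    (hflow.nonneg t ht) (hae t ht) (p := k * β * γ + 1) (n := n) (by linarith) (by positivity) hp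
  exact ⟨hfin.1, hfin.2.trans (mul_le_mul_of_nonneg_left (by linarith) hpi.le)⟩
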